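/- Let $n\ge 2$, let $(M,\Omega)$ be a symplectic manifold of dimension $2n$, and let $L\subset M$ be a (properly embedded, i.e. closed as a subset) Lagrangian submanifold that is monotone with monotonicity constant $\lambda>0$, that is, $\mu_L(u)=\lambda\int_D u^*\Omega$ for every smooth disc $u:(D,\partial D)\to(M,L)$, where $\mu_L$ denotes the Maslov index. Let $\rho>0$ be given by $\rho^2=\frac{2(n-1)}{\lambda\pi}$, and let $\iota$ be a symplectic embedding into $(M,\Omega)$ of an open ball of radius $R>\rho$ around the origin of $(\mathbb{C}^n,\omega_0)$ such that $L$ is disjoint from the image $\iota(B^{2n}(\rho))$ of the closed ball of radius $\rho$. Then $L$ is disjoint from $\iota(\operatorname{int}B^{2n}(r))$ for some $r\in(\rho,R]$. For every such $r$, let $\pi:\widetilde M\to M$ be the blow-up of $M$ at $\iota(0)$ (constructed with the complex structure of the ball), with exceptional divisor $E=\pi^{-1}(\iota(0))\cong\mathbb{C}P^{n-1}$, and let $\widetilde\Omega_\rho$ be a blow-up form of weight $\rho$ supported by the ball of radius $r$: it is the pullback of $\Omega$ under the map $\widetilde M\setminus E\to M$ that is $z\mapsto\beta(|z|)\,z/|z|$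 in $\iota(\operatorname{int}B^{2n}(r))\setminus\{\iota(0)\}$ and the identity elsewhere, and it equals $\Phi^*\omega_0+\rho^2\,pr^*\omega_{FS}$ along $E$, where $\Phi$ and $pr$ are the blow-down map and the bundle projection of the blow-up $\widetilde{\mathbb{C}^n}\subset\mathbb{C}^n\times\mathbb{C}P^{n-1}$ of $\mathbb{C}^n$ at the origin, the Fubini--Study form $\omega_{FS}$ gives lines the area $\pi$, and, for some $\delta>0$, $\beta:[0,r]\to\mathbb{R}$ is a smooth function with $\beta(s)=\sqrt{\rho^2+s^2}$ for $0\le s\le\delta$, $\beta(s)=s$ for $r-\delta\le s\le r$ and $0<\beta'(s)\le1$ for $0<s\le r-\delta$. Then $(\widetilde M,\widetilde\Omega_\rho)$ is a symplectic manifold, and the proper transform $\widetilde L=\pi^{-1}(L)$ is a monotone Lagrangian submanifold of it with the same monotonicity constant $\lambda$. -/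

import Mathlib

open Set Filter Topology MeasureTheory
open scoped Manifold ContDiff

noncomputable section

/-- The Euclidean space `ℂⁿ`, used as the model space of real `2n`-dimensional manifolds. -/
abbrev Cn (n : ℕ) : Type := EuclideanSpace ℂ (Fin n)

/-- The standard symplectic form `ω₀ = ∑ dxₖ ∧ dyₖ` on `ℂⁿ`. -/
def stdForm (n : ℕ) : Cn n [⋀^Fin 2]→L[ℝ] ℝ where
  toFun v := ∑ k, ((v 0 k).re * (v 1 k).im - (v 0 k).im * (v 1 k).re)
  map_update_add' := by
    intro inst v i x y
    obtain rfl : inst = instDecidableEqFin 2 := Subsingleton.elim _ _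
    fin_cases i <;> simp [add_mul, mul_add, Finset.sum_add_distrib] <;> ring
  map_update_smul' := by
    intro inst v i c x
    obtain rfl : inst = instDecidableEqFin 2 := Subsingleton.elim _ _
    fin_cases i <;> simp [mul_assoc, mul_left_comm, ← Finset.mul_sum, mul_sub]
  map_eq_zero_of_eq' := by
    intro v i j hv hij
    have h : v 0 = v 1 := by
      fin_cases i <;> fin_cases j <;> simp_all
    simp only [h]
    exact Finset.sum_eq_zero fun k _ => by ring
  cont := by fun_prop

/-! ### Symplectic forms, Lagrangian submanifolds, monotonicity -/

section Symplectic

variable {n : ℕ} {M : Type*} [TopologicalSpace M] [ChartedSpace (Cn n) M]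

/-- A (not necessarily smooth) differential 2-form on a real `2n`-dimensional manifold `M`. -/
abbrev TwoForm (n : ℕ) (M : Type*) [TopologicalSpace M] [ChartedSpace (Cn n) M] :=
  ∀ x : M, TangentSpace 𝓘(ℝ, Cn n) x [⋀^Fin 2]→L[ℝ] ℝ

/-- The coordinate expression `(φ⁻¹)^* Ω` of a 2-form in a chart `φ`. -/
def TwoForm.inChart (Ω : TwoForm n M) (φ : OpenPartialHomeomorph M (Cn n)) (y : Cn n) :
    Cn n [⋀^Fin 2]→L[ℝ] ℝ :=
  (Ω (φ.symm y)).compContinuousLinearMap (mfderiv 𝓘(ℝ, Cn n) 𝓘(ℝ, Cn n) φ.symm y)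

/-- Symplectic forms: smooth, closed, nondegenerate 2-forms. -/
structure IsSymplecticForm (Ω : TwoForm n M) : Prop where
  smooth : ∀ φ ∈ atlas (Cn n) M, ContDiffOn ℝ ∞ (Ω.inChart φ) φ.target
  closed : ∀ φ ∈ atlas (Cn n) M, ∀ y ∈ φ.target, extDeriv (Ω.inChart φ) y = 0
  nondegenerate : ∀ (x : M) (a : TangentSpace 𝓘(ℝ, Cn n) x), a ≠ 0 →
    ∃ b : TangentSpace 𝓘(ℝ, Cn n) x, Ω x ![a, b] ≠ 0

variable [IsManifold 𝓘(ℝ, Cn n) ∞ M]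

/-- The vectors at `x` that are tangent to `L`: velocities at time `0` of smooth curves in `L`
through `x`. -/
def tangentVectors (n : ℕ) {M : Type*} [TopologicalSpace M] [ChartedSpace (Cn n) M]
    (L : Set M) (x : M) : Set (TangentSpace 𝓘(ℝ, Cn n) x) :=
  {v | ∃ γ : ℝ → M, ContMDiffAt 𝓘(ℝ, ℝ) 𝓘(ℝ, Cn n) ∞ γ 0 ∧ (∀ᶠ t in 𝓝 0, γ t ∈ L) ∧
    (⟨γ 0, mfderiv 𝓘(ℝ, ℝ) 𝓘(ℝ, Cn n) γ 0 (1 : ℝ)⟩ : TangentBundle 𝓘(ℝ, Cn n) M) = ⟨x, v⟩}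

/-- `L` is a Lagrangian submanifold of `(M, Ω)`: a closed subset which is an embedded smooth
submanifold of dimension `n` (in suitable smooth charts it is the slice `ℝⁿ ⊂ ℂⁿ`) and on whose
tangent spaces `Ω` vanishes. -/
structure IsLagrangian (Ω : TwoForm n M) (L : Set M) : Prop where
  isClosed : IsClosed L
  slice : ∀ x ∈ L, ∃ φ ∈ IsManifold.maximalAtlas 𝓘(ℝ, Cn n) ∞ M, x ∈ φ.source ∧
    ∀ y ∈ φ.source, (y ∈ L ↔ ∀ k, (φ y k).im = 0)
  isotropic : ∀ x ∈ L, ∀ a ∈ tangentVectors n L x, ∀ b ∈ tangentVectors n L x, Ω x ![a, b] = 0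

/-- Smooth maps `u : (D, ∂D) → (M, L)` of the closed unit disc `D ⊂ ℂ`; the values of `u` outside
`D` are irrelevant. -/
structure IsSmoothDisc (n : ℕ) {M : Type*} [TopologicalSpace M] [ChartedSpace (Cn n) M]
    (L : Set M) (u : ℂ → M) : Prop where
  smooth : ContMDiffOn 𝓘(ℝ, ℂ) 𝓘(ℝ, Cn n) ∞ u (Metric.closedBall 0 1)
  boundary : ∀ z ∈ Metric.sphere (0 : ℂ) 1, u z ∈ L

/-- The symplectic area `∫_D u^*Ω` of a disc. -/
def symplecticArea (Ω : TwoForm n M) (u : ℂ → M) : ℝ :=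
  ∫ z in Metric.closedBall (0 : ℂ) 1,
    Ω (u z) ![mfderivWithin 𝓘(ℝ, ℂ) 𝓘(ℝ, Cn n) u (Metric.closedBall 0 1) z (1 : ℂ),
      mfderivWithin 𝓘(ℝ, ℂ) 𝓘(ℝ, Cn n) u (Metric.closedBall 0 1) z Complex.I]

/-- `k` is the Maslov index of the disc `u : (D, ∂D) → (M, L)`: with respect to a symplectic
trivialization `Φ` of `u^*TM` over `D`, the loop `Λ_θ = Φ⁻¹ T_{u(e^{iθ})}L` of Lagrangian subspaces
of `ℂⁿ` has Maslov index `k`, that is, `det²(Λ_θ) = det(v)² / |det v|²` (`v` any real basis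
of `Λ_θ`) has the continuous argument `φ`, which increases by `2πk` around the circle. -/
def HasMaslovIndex (Ω : TwoForm n M) (L : Set M) (u : ℂ → M) (k : ℤ) : Prop :=
  ∃ (Φ : ∀ z : ℂ, Cn n ≃L[ℝ] TangentSpace 𝓘(ℝ, Cn n) (u z)) (φ : ℝ → ℝ),
    ContinuousOn (fun p : ℂ × Cn n => (⟨u p.1, Φ p.1 p.2⟩ : TangentBundle 𝓘(ℝ, Cn n) M))
      (Metric.closedBall 0 1 ×ˢ univ) ∧
    (∀ z ∈ Metric.closedBall (0 : ℂ) 1, ∀ a b : Cn n,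
      Ω (u z) ![Φ z a, Φ z b] = stdForm n ![a, b]) ∧
    Continuous φ ∧
    (∀ (θ : ℝ) (v : Fin n → Cn n), LinearIndependent ℝ v →
      (∀ i, Φ (Complex.exp (θ * Complex.I)) (v i) ∈
        tangentVectors n L (u (Complex.exp (θ * Complex.I)))) →
      (Matrix.of fun i k => v i k).det ^ 2 =
        (‖(Matrix.of fun i k => v i k).det‖ : ℂ) ^ 2 * Complex.exp (φ θ * Complex.I)) ∧
    φ (2 * Real.pi) = φ 0 + 2 * Real.pi * k

/-- The Maslov index `μ_L(u)` of a disc `u : (D, ∂D) → (M, L)`. -/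
def maslovIndex (Ω : TwoForm n M) (L : Set M) (u : ℂ → M) : ℤ :=
  Classical.epsilon (HasMaslovIndex Ω L u)

/-- `L` is monotone with monotonicity constant `lam > 0`: Maslov index and symplectic area satisfy
`μ_L = lam · Ω` on all classes of discs `u : (D, ∂D) → (M, L)`. -/
def IsMonotone (Ω : TwoForm n M) (L : Set M) (lam : ℝ) : Prop :=
  0 < lam ∧ ∀ u : ℂ → M, IsSmoothDisc n L u →
    (maslovIndex Ω L u : ℝ) = lam * symplecticArea Ω u

/-- `L` is a monotone Lagrangian submanifold with monotonicity constant `lam`. -/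
def IsMonotoneLagrangian (Ω : TwoForm n M) (L : Set M) (lam : ℝ) : Prop :=
  IsLagrangian Ω L ∧ IsMonotone Ω L lam

end Symplectic

/-! ### The affine charts of the blow-up of `ℂⁿ` at the origin -/

section Affine

variable {n : ℕ}

/-- The vector with the coordinates of `w`, except that the `j`-th coordinate is `1`. -/
def hat (j : Fin n) (w : Cn n) : Cn n := WithLp.toLp 2 fun i => if i = j then 1 else w i

/-- The blow-down map `Φ : \tilde ℂⁿ → ℂⁿ` in the `j`-th affine chart, where `w` stands for the
point `(w_j · hat j w, [hat j w])` of `\tilde ℂⁿ ⊂ ℂⁿ × ℂPⁿ⁻¹`. -/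
def affineBlowDown (j : Fin n) (w : Cn n) : Cn n := w j • hat j w

/-- The coordinates in the `j`-th affine chart of the point `(s v, [v])` of `\tilde ℂⁿ`. -/
def affineCoord (j : Fin n) (s : ℂ) (v : Cn n) : Cn n :=
  WithLp.toLp 2 fun i => if i = j then s * v j else v i / v j

lemma hat_same (j : Fin n) (w : Cn n) : hat j w j = 1 := by simp [hat]

lemma hat_ne_zero (j : Fin n) (w : Cn n) : hat j w ≠ 0 := by
  intro h
  have := hat_same j w
  simp [h] at this

lemma affineBlowDown_same (j : Fin n) (w : Cn n) : affineBlowDown j w j = w j := by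
  simp [affineBlowDown, hat_same]

lemma affineBlowDown_eq_zero {j : Fin n} {w : Cn n} : affineBlowDown j w = 0 ↔ w j = 0 := by
  simp [affineBlowDown, hat_ne_zero]

lemma affineCoord_same (j : Fin n) (s : ℂ) (v : Cn n) : affineCoord j s v j = s * v j := by
  simp [affineCoord]

lemma hat_affineCoord (j : Fin n) (s : ℂ) {v : Cn n} (hv : v j ≠ 0) :
    hat j (affineCoord j s v) = (v j)⁻¹ • v := by
  ext i
  by_cases h : i = j
  · subst h; simp [hat, hv]
  · simp [hat, affineCoord, h]; field_simp

lemma affineBlowDown_affineCoord (j : Fin n) (s : ℂ) {v : Cn n} (hv : v j ≠ 0) :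
    affineBlowDown j (affineCoord j s v) = s • v := by
  rw [affineBlowDown, hat_affineCoord j s hv, affineCoord_same, smul_smul]
  congr 1
  field_simp

lemma affineCoord_hat (j : Fin n) (w : Cn n) : affineCoord j (w j) (hat j w) = w := by
  ext i
  by_cases h : i = j
  · subst h; simp [affineCoord, hat]
  · simp [affineCoord, hat, h]

lemma affineCoord_smul (j : Fin n) (s c : ℂ) (hc : c ≠ 0) (v : Cn n) :
    affineCoord j s (c • v) = affineCoord j (s * c) v := by
  ext i
  by_cases h : i = j
  · subst h; simp [affineCoord, mul_assoc]
  · simp [affineCoord, h, mul_div_mul_left _ _ hc]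

lemma contDiff_hat (j : Fin n) : ContDiff ℝ ∞ (hat j : Cn n → Cn n) := by
  rw [contDiff_piLp]
  intro i
  by_cases h : i = j
  · simp only [hat, h, if_true]; exact contDiff_const
  · simp only [hat, h, if_false]; fun_prop

lemma contDiff_affineBlowDown (j : Fin n) :
    ContDiff ℝ ∞ (affineBlowDown j : Cn n → Cn n) := by
  rw [contDiff_piLp]
  intro i
  have h1 : ContDiff ℝ ∞ fun w : Cn n => hat j w i :=
    (contDiff_piLp_apply (p := 2) (i := i)).comp (contDiff_hat j)
  have h2 : ContDiff ℝ ∞ fun w : Cn n => w j := contDiff_piLp_apply 2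
  exact h2.mul h1

lemma contDiffOn_affineCoord (j : Fin n) {X : Type*} [NormedAddCommGroup X] [NormedSpace ℝ X]
    {s : X → ℂ} {v : X → Cn n} {S : Set X} (hs : ContDiffOn ℝ ∞ s S) (hv : ContDiffOn ℝ ∞ v S)
    (h0 : ∀ x ∈ S, v x j ≠ 0) : ContDiffOn ℝ ∞ (fun x => affineCoord j (s x) (v x)) S := by
  rw [contDiffOn_piLp] at hv ⊢
  intro i
  by_cases h : i = j
  · simp only [affineCoord, h, if_true]; exact hs.mul (hv j)
  · simp only [affineCoord, h, if_false]; 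
    have hi : ContDiffOn ℝ ∞ (fun x => v x i) S := hv i
    have hj : ContDiffOn ℝ ∞ (fun x => v x j) S := hv j
    have hd : ContDiffOn ℝ ∞ (fun x => v x i * (v x j)⁻¹) S := hi.mul (hj.inv h0)
    exact hd.congr fun x _ => div_eq_mul_inv _ _

end Affine

/-! ### Embedded balls and the blow-up manifold -/

/-- A smooth embedding `ι` of the open ball of some radius `R > 0` around `0 ∈ ℂⁿ` onto an open
subset of `M`. -/
structure SmoothBall (n : ℕ) (M : Type*) [TopologicalSpace M] [ChartedSpace (Cn n) M] where
  /-- the radius -/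
  radius : ℝ
  radius_pos : 0 < radius
  /-- the embedding, with its inverse -/
  ι : OpenPartialHomeomorph (Cn n) M
  source_eq : ι.source = Metric.ball 0 radius
  smooth : ContMDiffOn 𝓘(ℝ, Cn n) 𝓘(ℝ, Cn n) ∞ ι ι.source
  smooth_symm : ContMDiffOn 𝓘(ℝ, Cn n) 𝓘(ℝ, Cn n) ∞ ι.symm ι.target

namespace SmoothBall

variable {n : ℕ} {M : Type*} [TopologicalSpace M] [ChartedSpace (Cn n) M]

/-- The point `x₀ = ι(0)` to be blown up. -/
def center (B : SmoothBall n M) : M := B.ι 0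

/-- The embedding of the ball is symplectic: `ι^*Ω = ω₀`. -/
def IsSymplectic (B : SmoothBall n M) (Ω : TwoForm n M) : Prop :=
  ∀ z ∈ B.ι.source, ∀ a b : TangentSpace 𝓘(ℝ, Cn n) z,
    Ω (B.ι z) ![mfderiv 𝓘(ℝ, Cn n) 𝓘(ℝ, Cn n) B.ι z a, mfderiv 𝓘(ℝ, Cn n) 𝓘(ℝ, Cn n) B.ι z b] =
      stdForm n ![a, b]

lemma zero_mem (B : SmoothBall n M) : (0 : Cn n) ∈ B.ι.source := by
  rw [B.source_eq]; exact Metric.mem_ball_self B.radius_pos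

lemma symm_eq_zero_iff (B : SmoothBall n M) {x : M} (hx : x ∈ B.ι.target) :
    B.ι.symm x = 0 ↔ x = B.center := by
  constructor
  · intro h; rw [center, ← h, B.ι.right_inv hx]
  · rintro rfl; exact B.ι.left_inv B.zero_mem

lemma apply_eq_center_iff (B : SmoothBall n M) {z : Cn n} (hz : z ∈ B.ι.source) :
    B.ι z = B.center ↔ z = 0 := by
  rw [← B.symm_eq_zero_iff (B.ι.map_source hz), B.ι.left_inv hz]

end SmoothBall

/-- The underlying set of the blow-up of `M` at the center `x₀` of an embedded ball: the disjoint
union of `M ∖ {x₀}` and the exceptional divisor `E = ℂPⁿ⁻¹`. -/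
inductive BlowUp {n : ℕ} {M : Type*} [TopologicalSpace M] [ChartedSpace (Cn n) M]
    (B : SmoothBall n M) : Type _
  /-- a point of `M ∖ {x₀}` -/
  | off (x : M) (hx : x ≠ B.center) : BlowUp B
  /-- a point of the exceptional divisor -/
  | exc (l : Projectivization ℂ (Cn n)) : BlowUp B

namespace BlowUp

variable {n : ℕ} {M : Type*} [TopologicalSpace M] [ChartedSpace (Cn n) M] (B : SmoothBall n M)

/-- The blow-down map `π`. -/
def proj : BlowUp B → M
  | off x _ => x
  | exc _ => B.center

open Classical in
/-- The point of the blow-up over `s v` in the line `[v]`: it is the image of the point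
`(s v, [v])` of the blow-up of the ball. -/
def ofLine (s : ℂ) (v : Cn n) (hv : v ≠ 0) : BlowUp B :=
  if h : B.ι (s • v) = B.center then exc (Projectivization.mk ℂ v hv)
  else off (B.ι (s • v)) h

/-- The `j`-th affine chart of the blow-up of the ball `ι(B)`. -/
def affineChart (j : Fin n) : PartialEquiv (BlowUp B) (Cn n) where
  toFun
    | off x _ => affineCoord j 1 (B.ι.symm x)
    | exc l => affineCoord j 0 l.rep
  invFun w := ofLine B (w j) (hat j w) (hat_ne_zero j w)
  source := {p | match p with
    | off x _ => x ∈ B.ι.target ∧ B.ι.symm x j ≠ 0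
    | exc l => l.rep j ≠ 0}
  target := {w | affineBlowDown j w ∈ B.ι.source}
  map_source' := by
    rintro (⟨x, hx⟩ | l) h
    · simpa [affineBlowDown_affineCoord j 1 h.2] using B.ι.map_target h.1
    · simpa [affineBlowDown_affineCoord j 0 h] using B.zero_mem
  map_target' := by
    intro w hw
    have hw' : w j • hat j w ∈ B.ι.source := hw
    by_cases h : B.ι (w j • hat j w) = B.center
    · simp only [ofLine, h, dif_pos, mem_ofPred_eq]
      obtain ⟨a, ha⟩ := (Projectivization.mk_eq_mk_iff' ℂ _ _
        (Projectivization.rep_nonzero (Projectivization.mk ℂ (hat j w) (hat_ne_zero j w)))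
        (hat_ne_zero j w)).1 (Projectivization.mk_rep _)
      intro h0
      have hj := congrArg (fun v : Cn n => v j) ha
      simp only [PiLp.smul_apply, hat_same, smul_eq_mul, mul_one] at hj
      rw [h0] at hj
      rw [hj, zero_smul] at ha
      exact Projectivization.rep_nonzero _ ha.symm
    · simp only [ofLine, h, dif_neg, not_false_eq_true, mem_ofPred_eq]
      refine ⟨B.ι.map_source hw', ?_⟩
      rw [B.ι.left_inv hw']
      intro h0
      apply h
      rw [B.apply_eq_center_iff hw']
      have : w j = 0 := by simpa [hat_same] using h0
      simp [this]
  left_inv' := by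
    rintro (⟨x, hx⟩ | l) h
    · have h1 : affineCoord j 1 (B.ι.symm x) j • hat j (affineCoord j 1 (B.ι.symm x)) =
          B.ι.symm x := by
        simpa [affineBlowDown] using affineBlowDown_affineCoord j 1 h.2
      have h2 : B.ι (B.ι.symm x) = x := B.ι.right_inv h.1
      simp only [ofLine, h1, h2, hx, dif_neg, not_false_eq_true]
    · have h1 : affineCoord j 0 l.rep j = 0 := by simp [affineCoord]
      have h2 : B.ι (0 : Cn n) = B.center := rfl
      simp only [ofLine, h1, zero_smul, h2, dif_pos]
      congr 1
      conv_rhs => rw [← Projectivization.mk_rep l]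
      rw [Projectivization.mk_eq_mk_iff']
      exact ⟨(l.rep j)⁻¹, (hat_affineCoord j 0 h).symm⟩
  right_inv' := by
    intro w hw
    have hw' : w j • hat j w ∈ B.ι.source := hw
    by_cases h : B.ι (w j • hat j w) = B.center
    · simp only [ofLine, h, dif_pos]
      obtain ⟨a, ha⟩ := (Projectivization.mk_eq_mk_iff' ℂ _ _
        (Projectivization.rep_nonzero (Projectivization.mk ℂ (hat j w) (hat_ne_zero j w)))
        (hat_ne_zero j w)).1 (Projectivization.mk_rep _)
      have ha0 : a ≠ 0 := by
        rintro rfl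
        rw [zero_smul] at ha
        exact Projectivization.rep_nonzero _ ha.symm
      have hj : w j = 0 := by
        have := (B.apply_eq_center_iff hw').1 h
        exact affineBlowDown_eq_zero.1 this
      rw [← ha, affineCoord_smul j 0 a ha0, zero_mul]
      conv_rhs => rw [← affineCoord_hat j w, hj]
    · simp only [ofLine, h, dif_neg, not_false_eq_true]
      rw [B.ι.left_inv hw']
      have hj : w j ≠ 0 := by
        intro h0
        apply h
        rw [h0, zero_smul]; rfl
      rw [affineCoord_smul j 1 _ hj, one_mul, affineCoord_hat]

open Classical in
/-- The chart of `M ∖ {x₀}` given by a chart of `M`. -/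
def offChart [NeZero n] (φ : OpenPartialHomeomorph M (Cn n)) :
    PartialEquiv (BlowUp B) (Cn n) where
  toFun p := φ (proj B p)
  invFun y := if h : φ.symm y = B.center
    then exc (Projectivization.mk ℂ (hat 0 0) (hat_ne_zero 0 0)) else off (φ.symm y) h
  source := {p | match p with
    | off x _ => x ∈ φ.source
    | exc _ => False}
  target := {y | y ∈ φ.target ∧ φ.symm y ≠ B.center}
  map_source' := by
    rintro (⟨x, hx⟩ | l) h
    · exact ⟨φ.map_source h, by simpa [proj, φ.left_inv h] using hx⟩
    · exact h.elim
  map_target' := by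
    rintro y ⟨hy, hc⟩
    simp only [hc, dif_neg, not_false_eq_true, mem_ofPred_eq]
    exact φ.map_target hy
  left_inv' := by
    rintro (⟨x, hx⟩ | l) h
    · have : φ.symm (φ x) = x := φ.left_inv h
      simp only [proj, this, hx, dif_neg, not_false_eq_true]
    · exact h.elim
  right_inv' := by
    rintro y ⟨hy, hc⟩
    simp only [hc, dif_neg, not_false_eq_true, proj]
    exact φ.right_inv hy

/-- An index of a nonvanishing homogeneous coordinate. -/
lemma exists_rep_ne_zero (l : Projectivization ℂ (Cn n)) : ∃ j, l.rep j ≠ 0 := by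
  by_contra! h
  exact Projectivization.rep_nonzero l (by ext j; simpa using h j)

/-- A choice of an affine chart around a given point of the exceptional divisor. -/
def lineIndex (l : Projectivization ℂ (Cn n)) : Fin n := (exists_rep_ne_zero l).choose

/-- The atlas of the blow-up: the charts of `M ∖ {x₀}` and the affine charts. -/
def charts [NeZero n] : Set (PartialEquiv (BlowUp B) (Cn n)) :=
  {e | (∃ φ ∈ atlas (Cn n) M, e = offChart B φ) ∨ ∃ j, e = affineChart B j}

section Transition

variable [NeZero n] [IsManifold 𝓘(ℝ, Cn n) ∞ M]

lemma transition_off_off [T2Space M] {φ ψ : OpenPartialHomeomorph M (Cn n)}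
    (hφ : φ ∈ atlas (Cn n) M) (hψ : ψ ∈ atlas (Cn n) M) :
    IsOpen ((offChart B φ).symm.trans (offChart B ψ)).source ∧
    ContDiffOn ℝ ∞ ((offChart B φ).symm.trans (offChart B ψ))
      ((offChart B φ).symm.trans (offChart B ψ)).source := by
  have hs : ((offChart B φ).symm.trans (offChart B ψ)).source =
      (φ.symm.trans ψ).source ∩ (φ.target ∩ φ.symm ⁻¹' {B.center}ᶜ) := by
    ext y
    by_cases h : φ.symm y = B.center
    · simp [PartialEquiv.trans_source, offChart, h]
    · simp [PartialEquiv.trans_source, offChart, h]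
      tauto
  rw [hs]
  refine ⟨(φ.symm.trans ψ).open_source.inter
    (φ.isOpen_inter_preimage_symm isOpen_compl_singleton), ?_⟩
  have hc := (contDiffGroupoid ∞ 𝓘(ℝ, Cn n)).compatible hφ hψ
  rw [contDiffGroupoid, mem_groupoid_of_pregroupoid] at hc
  have hc1 : ContDiffOn ℝ ∞ (φ.symm.trans ψ) (φ.symm.trans ψ).source := by
    simpa [contDiffPregroupoid] using hc.1
  refine (hc1.mono inter_subset_left).congr ?_
  rintro y ⟨-, -, hy⟩
  have hy : φ.symm y ≠ B.center := hy
  simp [offChart, hy, proj]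

lemma transition_off_affine {φ : OpenPartialHomeomorph M (Cn n)}
    (hφ : φ ∈ atlas (Cn n) M) (j : Fin n) :
    IsOpen ((offChart B φ).symm.trans (affineChart B j)).source ∧
    ContDiffOn ℝ ∞ ((offChart B φ).symm.trans (affineChart B j))
      ((offChart B φ).symm.trans (affineChart B j)).source := by
  have hs : ((offChart B φ).symm.trans (affineChart B j)).source =
      (φ.symm.trans B.ι.symm).source ∩ (φ.symm.trans B.ι.symm) ⁻¹' {z | z j ≠ 0} := by
    ext y
    by_cases h : φ.symm y = B.center
    · have h' : B.ι.symm B.center = 0 := B.ι.left_inv B.zero_mem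
      simp [PartialEquiv.trans_source, offChart, h, h']
    · simp [PartialEquiv.trans_source, offChart, affineChart, h]
      tauto
  have ho : IsOpen {z : Cn n | z j ≠ 0} :=
    isOpen_ne_fun (by fun_prop) continuous_const
  rw [hs]
  refine ⟨(φ.symm.trans B.ι.symm).isOpen_inter_preimage ho, ?_⟩
  have h1 : ContDiffOn ℝ ∞ (φ.symm.trans B.ι.symm) (φ.symm.trans B.ι.symm).source := by
    rw [← contMDiffOn_iff_contDiffOn]
    have h2 : ContMDiffOn 𝓘(ℝ, Cn n) 𝓘(ℝ, Cn n) ∞ φ.symm φ.target :=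
      contMDiffOn_symm_of_mem_maximalAtlas (IsManifold.subset_maximalAtlas hφ)
    refine B.smooth_symm.comp (h2.mono ?_) ?_
    · intro y hy; exact hy.1
    · intro y hy; exact hy.2
  refine (contDiffOn_affineCoord j (s := fun _ => 1) contDiffOn_const
    (h1.mono inter_subset_left) ?_).congr ?_
  · rintro y ⟨-, hy⟩; exact hy
  · rintro y ⟨-, hy⟩
    have h : φ.symm y ≠ B.center := by
      intro h
      have h' : B.ι.symm B.center = 0 := B.ι.left_inv B.zero_mem
      apply hy
      simp [h, h']
    simp [offChart, affineChart, h]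

lemma transition_affine_off {φ : OpenPartialHomeomorph M (Cn n)}
    (hφ : φ ∈ atlas (Cn n) M) (j : Fin n) :
    IsOpen ((affineChart B j).symm.trans (offChart B φ)).source ∧
    ContDiffOn ℝ ∞ ((affineChart B j).symm.trans (offChart B φ))
      ((affineChart B j).symm.trans (offChart B φ)).source := by
  have hs : ((affineChart B j).symm.trans (offChart B φ)).source =
      affineBlowDown j ⁻¹' (B.ι.trans φ).source ∩ {w | w j ≠ 0} := by
    ext w
    by_cases h : w j = 0
    · have h' : B.ι 0 = B.center := rfl
      simp [PartialEquiv.trans_source, affineChart, offChart, ofLine, h, h']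
    · by_cases hw : affineBlowDown j w ∈ B.ι.source
      · have h0 : B.ι (w j • hat j w) ≠ B.center := by
          rw [Ne, show w j • hat j w = affineBlowDown j w from rfl, B.apply_eq_center_iff hw]
          exact fun hh => h (affineBlowDown_eq_zero.1 hh)
        simp [PartialEquiv.trans_source, affineChart, offChart, ofLine, h, h0, hw]
        rfl
      · simp [PartialEquiv.trans_source, affineChart, hw]
  have ho : IsOpen {w : Cn n | w j ≠ 0} :=
    isOpen_ne_fun (by fun_prop) continuous_const
  rw [hs]
  refine ⟨((B.ι.trans φ).open_source.preimage (contDiff_affineBlowDown j).continuous).inter ho, ?_⟩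
  have h1 : ContDiffOn ℝ ∞ (B.ι.trans φ) (B.ι.trans φ).source := by
    rw [← contMDiffOn_iff_contDiffOn]
    have h2 : ContMDiffOn 𝓘(ℝ, Cn n) 𝓘(ℝ, Cn n) ∞ φ φ.source :=
      contMDiffOn_of_mem_maximalAtlas (IsManifold.subset_maximalAtlas hφ)
    refine h2.comp (B.smooth.mono ?_) ?_
    · intro y hy; exact hy.1
    · intro y hy; exact hy.2
  refine ((h1.comp (contDiff_affineBlowDown j).contDiffOn
    (fun w hw => hw)).mono inter_subset_left).congr ?_
  rintro w ⟨hw, h⟩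
  have h0 : B.ι (w j • hat j w) ≠ B.center := by
    rw [Ne, show w j • hat j w = affineBlowDown j w from rfl, B.apply_eq_center_iff hw.1]
    exact fun hh => h (affineBlowDown_eq_zero.1 hh)
  simp [affineChart, offChart, ofLine, h0, proj]
  rfl

lemma transition_affine_affine (i j : Fin n) :
    IsOpen ((affineChart B i).symm.trans (affineChart B j)).source ∧
    ContDiffOn ℝ ∞ ((affineChart B i).symm.trans (affineChart B j))
      ((affineChart B i).symm.trans (affineChart B j)).source := by
  have key : ∀ w, affineBlowDown i w ∈ B.ι.source →
      ((affineChart B i).symm w ∈ (affineChart B j).source ↔ hat i w j ≠ 0) ∧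
      (affineChart B j) ((affineChart B i).symm w) = affineCoord j (w i) (hat i w) := by
    intro w hw
    have hw' : w i • hat i w ∈ B.ι.source := hw
    by_cases h : B.ι (w i • hat i w) = B.center
    · have hi : w i = 0 := affineBlowDown_eq_zero.1 ((B.apply_eq_center_iff hw').1 h)
      obtain ⟨a, ha⟩ := (Projectivization.mk_eq_mk_iff' ℂ _ _
        (Projectivization.rep_nonzero (Projectivization.mk ℂ (hat i w) (hat_ne_zero i w)))
        (hat_ne_zero i w)).1 (Projectivization.mk_rep _)
      have ha0 : a ≠ 0 := by
        rintro rfl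
        rw [zero_smul] at ha
        exact Projectivization.rep_nonzero _ ha.symm
      have e : (affineChart B i).symm w = exc (Projectivization.mk ℂ (hat i w) (hat_ne_zero i w)) := by
        change ofLine B (w i) (hat i w) _ = _
        simp only [ofLine, h, dif_pos]
      rw [e]
      simp only [affineChart, mem_ofPred_eq]
      rw [← ha, affineCoord_smul j 0 a ha0, zero_mul, hi]
      simp [ha0]
    · have hi : w i ≠ 0 := by
        intro h0
        apply h
        rw [h0, zero_smul]; rfl
      have e : (affineChart B i).symm w = off (B.ι (w i • hat i w)) h := by
        change ofLine B (w i) (hat i w) _ = _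
        simp only [ofLine, h, dif_neg, not_false_eq_true]
      rw [e]
      simp only [affineChart, mem_ofPred_eq]
      rw [B.ι.left_inv hw', affineCoord_smul j 1 _ hi, one_mul]
      simp [hi, B.ι.map_source hw']
  have hs : ((affineChart B i).symm.trans (affineChart B j)).source =
      affineBlowDown i ⁻¹' B.ι.source ∩ {w | hat i w j ≠ 0} := by
    ext w
    rw [PartialEquiv.trans_source]
    constructor
    · rintro ⟨h1, h2⟩
      exact ⟨h1, (key w h1).1.1 h2⟩
    · rintro ⟨h1, h2⟩
      exact ⟨h1, (key w h1).1.2 h2⟩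
  rw [hs]
  refine ⟨(B.ι.open_source.preimage (contDiff_affineBlowDown i).continuous).inter
    (isOpen_ne_fun ?_ continuous_const), ?_⟩
  · exact (contDiff_piLp_apply (𝕜 := ℝ) (n := ∞) (p := 2) (i := j)).continuous.comp
      (contDiff_hat i).continuous
  · refine (contDiffOn_affineCoord j (s := fun w : Cn n => w i) (v := hat i)
      (contDiff_piLp_apply 2).contDiffOn (contDiff_hat i).contDiffOn ?_).congr ?_
    · rintro w ⟨-, hw⟩; exact hw
    · rintro w ⟨hw, -⟩
      exact (key w hw).2

end Transition

section Manifold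

variable [NeZero n] [T2Space M] [IsManifold 𝓘(ℝ, Cn n) ∞ M]

lemma transition {e e' : PartialEquiv (BlowUp B) (Cn n)} (he : e ∈ charts B)
    (he' : e' ∈ charts B) :
    IsOpen (e.symm.trans e').source ∧ ContDiffOn ℝ ∞ (e.symm.trans e') (e.symm.trans e').source := by
  obtain ⟨φ, hφ, rfl⟩ | ⟨i, rfl⟩ := he <;> obtain ⟨ψ, hψ, rfl⟩ | ⟨j, rfl⟩ := he'
  · exact transition_off_off B hφ hψ
  · exact transition_off_affine B hφ j
  · exact transition_affine_off B hψ i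
  · exact transition_affine_affine B i j

/-- The blow-up as a space glued from its charts; it is covered by the open subset `M ∖ {x₀}` and
the blow-up of the ball, glued along `ι(B) ∖ {x₀}`. -/
def core : ChartedSpaceCore (Cn n) (BlowUp B) where
  atlas := charts B
  chartAt
    | off x _ => offChart B (chartAt (Cn n) x)
    | exc l => affineChart B (lineIndex l)
  mem_chart_source := by
    rintro (⟨x, hx⟩ | l)
    · exact mem_chart_source (Cn n) x
    · exact (exists_rep_ne_zero l).choose_spec
  chart_mem_atlas := by
    rintro (⟨x, hx⟩ | l)
    · exact Or.inl ⟨_, chart_mem_atlas (Cn n) x, rfl⟩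
    · exact Or.inr ⟨_, rfl⟩
  open_source _ _ he he' := (transition B he he').1
  continuousOn_toFun _ _ he he' := (transition B he he').2.continuousOn

instance : TopologicalSpace (BlowUp B) := (core B).toTopologicalSpace

instance : ChartedSpace (Cn n) (BlowUp B) := (core B).toChartedSpace

instance : IsManifold 𝓘(ℝ, Cn n) ∞ (BlowUp B) := by
  refine isManifold_of_contDiffOn _ _ _ ?_
  intro e e' he he'
  replace he : e ∈ ⋃ (f : PartialEquiv (BlowUp B) (Cn n)) (hf : f ∈ (core B).atlas),
    {(core B).openPartialHomeomorph f hf} := he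
  replace he' : e' ∈ ⋃ (f : PartialEquiv (BlowUp B) (Cn n)) (hf : f ∈ (core B).atlas),
    {(core B).openPartialHomeomorph f hf} := he'
  simp only [mem_iUnion, mem_singleton_iff] at he he'
  obtain ⟨f, hf, rfl⟩ := he
  obtain ⟨f', hf', rfl⟩ := he'
  have h := (transition B hf hf').2
  simp only [modelWithCornersSelf_coe, modelWithCornersSelf_coe_symm, range_id, inter_univ,
    Function.id_comp, Function.comp_id, preimage_id]
  exact h

end Manifold

/-! ### The symplectic form on the blow-up -/

/-- The pullback to `ℂⁿ ∖ {0}` of the Fubini-Study form of `ℂPⁿ⁻¹`, normalised so that lines have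
area `π`: at `z` it is `|z|⁻²` times the pullback of `ω₀` by the orthogonal projection to the
complement of the line `ℂ z`. -/
def fubiniStudy (n : ℕ) (z : Cn n) : Cn n [⋀^Fin 2]→L[ℝ] ℝ :=
  (‖z‖ ^ 2)⁻¹ • (stdForm n).compContinuousLinearMap
    ((Submodule.span ℂ {z})ᗮ.starProjection.restrictScalars ℝ)

/-- The form `ω(ρ) = Φ^*ω₀ + ρ² pr^*ω_FS` on `\tilde ℂⁿ` in the `j`-th affine chart. -/
def modelForm (ρ : ℝ) (j : Fin n) (w : Cn n) : Cn n [⋀^Fin 2]→L[ℝ] ℝ :=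
  (stdForm n).compContinuousLinearMap (fderiv ℝ (affineBlowDown j) w) +
    ρ ^ 2 • (fubiniStudy n (hat j w)).compContinuousLinearMap (fderiv ℝ (hat j) w)

/-- The radial profiles `β` used in the blow-up of weight `ρ` of a ball of radius `r > ρ`. -/
structure IsProfile (ρ r δ : ℝ) (β : ℝ → ℝ) : Prop where
  lt : ρ < r
  pos : 0 < δ
  smooth : ContDiffOn ℝ ∞ β (Icc 0 r)
  inner : ∀ s ∈ Icc 0 δ, β s = Real.sqrt (ρ ^ 2 + s ^ 2)
  outer : ∀ s ∈ Icc (r - δ) r, β s = s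
  deriv_mem : ∀ s ∈ Ioc 0 (r - δ), 0 < deriv β s ∧ deriv β s ≤ 1

open Classical in
/-- The map `M̃ ∖ E → M` which is `z ↦ β(|z|) z / |z|` in the ball of radius `r` and the identity
outside of it (its values on `E` are irrelevant). -/
def stretch (r : ℝ) (β : ℝ → ℝ) (p : BlowUp B) : M :=
  if proj B p ∈ B.ι '' Metric.ball 0 r then
    B.ι ((β ‖B.ι.symm (proj B p)‖ / ‖B.ι.symm (proj B p)‖) • B.ι.symm (proj B p))
  else proj B p

variable [NeZero n] [T2Space M] [IsManifold 𝓘(ℝ, Cn n) ∞ M]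

/-- The blow-up form of weight `ρ`: the pullback of the symplectic form of `M` by `stretch` off the
exceptional divisor (so that it is `π^*Ω` outside of the ball), and `ω(ρ)` at the points of `E`. -/
def form (Ω : TwoForm n M) (ρ r : ℝ) (β : ℝ → ℝ) : TwoForm n (BlowUp B)
  | off x hx => (Ω (stretch B r β (off x hx))).compContinuousLinearMap
      (mfderiv 𝓘(ℝ, Cn n) 𝓘(ℝ, Cn n) (stretch B r β) (off x hx))
  | exc l => (modelForm ρ (lineIndex l) (affineChart B (lineIndex l) (exc l))).compContinuousLinearMap
      (mfderiv 𝓘(ℝ, Cn n) 𝓘(ℝ, Cn n) (affineChart B (lineIndex l)) (exc l))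

end BlowUp

/-! Let `u` be a disc in the blow-up with boundary on the proper transform, and let `v = π ∘ u`. For
a disc meeting `E` in isolated points, both sides of the monotonicity equation change by multiples
of the intersection number: the area of `u` is that of `v` minus `πρ² (u·E)`, and the Maslov index
of `u` is that of `v` minus `2(n-1) (u·E)`. The choice of `ρ` says exactly that `λπρ² = 2(n-1)`, so
the equation for `v` gives the one for `u`.

The argument never counts intersections, since `u` may meet `E` in an arbitrary closed set away from
the boundary circle. Instead, both changes are expressed by one real number `a`: the variation along
the boundary circle of the argument of the complex determinant of `dπ`, read in symplectic frames
along `u` and along `v`. It plays the role of `2π(n-1) (u·E)`.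

Index: near the boundary `π` is symplectic, so `dπ` is a loop of linear symplectomorphisms carrying
one Lagrangian loop to the other. By `IsLagrangianLoop.phase_comparison` the phase of `det²` changes
by `2a`. `HasMaslovIndex.unique` makes the index independent of the frames.

Area: off `E` the blow-up form minus `π^*Ω` is the exterior derivative of `½((β(|p|)/|p|)² - 1)
Im⟨p, dp⟩`, where `p` is the coordinate in the ball; this form vanishes near the edge of the ball
and is singular along `E`. If `F` is a function on the disc that vanishes on `E` like the power
`n-1` of a local equation, then subtracting `ρ²/(2(n-1)) d arg F` cancels the singularity
(`connForm_sub_argForm_eq`), and Green's theorem (`green_disc`) leaves only the boundary integral of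
`d arg F` (`BlowUp.symplecticArea_form`).

The link between the two is that `F` can be taken to have the argument variation `a`
(`BlowUp.IsFramedDisc.exists_isDivisorFunction`). In an affine chart the blow-down map has complex
Jacobian `w_j^(n-1)`, which gives the order of vanishing. Two obstacles remain. Complex-linear parts
of real-linear maps are not multiplicative; this is repaired by deforming away antilinear parts,
where `IsSympl.eq_zero_of_linPart_eq` and tameness prevent new zeros. The frames are only
continuous; multiplying by a function with positive real part (`exists_smoothing_factor`) makes the
result smooth without changing its winding.

The blow-up form is symplectic because it is locally a pullback of a closed form, and because it
tames multiplication by `i` inside the ball, including along `E`, while outside it is `π^*Ω`. -/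

set_option linter.unusedSectionVars false

/-! ### Complex-linear and antilinear parts of real-linear maps -/

/-! ### Arithmetic of 2-forms on pairs of vectors. -/

section AlternatingForms

variable {E : Type*} [NormedAddCommGroup E] [NormedSpace ℝ E] (τ : E [⋀^Fin 2]→L[ℝ] ℝ)

lemma update_pair_zero {α : Type*} (a b c : α) : Function.update ![a, b] 0 c = ![c, b] := by
  ext i; fin_cases i <;> rfl

lemma update_pair_one {α : Type*} (a b c : α) : Function.update ![a, b] 1 c = ![a, c] := by
  ext i; fin_cases i <;> rfl

lemma form_add_left (a a' b : E) : τ ![a + a', b] = τ ![a, b] + τ ![a', b] := by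
  simpa only [update_pair_zero] using τ.map_update_add ![a, b] 0 a a'

lemma form_add_right (a b b' : E) : τ ![a, b + b'] = τ ![a, b] + τ ![a, b'] := by
  simpa only [update_pair_one] using τ.map_update_add ![a, b] 1 b b'

lemma form_smul_left (c : ℝ) (a b : E) : τ ![c • a, b] = c * τ ![a, b] := by
  simpa only [update_pair_zero, smul_eq_mul] using τ.map_update_smul ![a, b] 0 c a

lemma form_smul_right (c : ℝ) (a b : E) : τ ![a, c • b] = c * τ ![a, b] := by
  simpa only [update_pair_one, smul_eq_mul] using τ.map_update_smul ![a, b] 1 c b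

lemma form_neg_left (a b : E) : τ ![-a, b] = -τ ![a, b] := by
  simpa using form_smul_left τ (-1) a b

lemma form_neg_right (a b : E) : τ ![a, -b] = -τ ![a, b] := by
  simpa using form_smul_right τ (-1) a b

lemma form_self (a : E) : τ ![a, a] = 0 :=
  τ.map_eq_zero_of_eq ![a, a] (i := 0) (j := 1) rfl (by decide)

lemma form_swap (a b : E) : τ ![a, b] = -τ ![b, a] := by
  have h := form_self τ (a + b)
  rw [form_add_left, form_add_right, form_add_right, form_self, form_self] at h
  linarith

end AlternatingForms

/-! ### Splitting real-linear maps of `ℂⁿ`, and linear symplectomorphisms. -/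

section LinearAlgebra

variable {n : ℕ}

lemma stdForm_apply (a b : Cn n) : stdForm n ![a, b] = (inner ℂ a b).im := by
  change ∑ k, ((a k).re * (b k).im - (a k).im * (b k).re) = _
  rw [PiLp.inner_apply, Complex.im_sum]
  refine Finset.sum_congr rfl fun k _ => ?_
  simp [Complex.mul_im]
  ring

lemma stdForm_self_I_smul (v : Cn n) : stdForm n ![v, Complex.I • v] = ‖v‖ ^ 2 := by
  rw [stdForm_apply, inner_smul_right, inner_self_eq_norm_sq_to_K]
  simp [Complex.mul_im, ← Complex.ofReal_pow]

lemma stdForm_I_smul_left (a b : Cn n) :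
    stdForm n ![Complex.I • a, b] = -stdForm n ![a, Complex.I • b] := by
  rw [stdForm_apply, stdForm_apply, inner_smul_left, inner_smul_right]
  simp

lemma I_smul_I_smul (v : Cn n) : Complex.I • Complex.I • v = -v := by
  rw [smul_smul, Complex.I_mul_I, neg_one_smul]

/-- The complex-linear part of a real-linear endomorphism of `ℂⁿ`. -/
def linPart : (Cn n →L[ℝ] Cn n) →ₗ[ℝ] (Cn n →L[ℂ] Cn n) where
  toFun A := LinearMap.toContinuousLinearMap
    { toFun := fun v => (2⁻¹ : ℝ) • (A v - Complex.I • A (Complex.I • v))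
      map_add' := by
        intro v w
        simp only [smul_add, map_add]
        module
      map_smul' := by
        intro c v
        have h : ∀ w : Cn n, c • w = c.re • w + c.im • Complex.I • w := by
          intro w
          conv_lhs => rw [← Complex.re_add_im c]
          rw [add_smul, mul_smul, Complex.coe_smul, Complex.coe_smul]
        have h2 : Complex.I • c • v = c.re • Complex.I • v - c.im • v := by
          rw [h, smul_add, smul_comm Complex.I c.im (Complex.I • v), smul_smul Complex.I Complex.I,
            Complex.I_mul_I, neg_one_smul, smul_neg, ← sub_eq_add_neg, smul_comm]
        simp only [RingHom.id_apply]
        rw [h2, h v, h]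
        simp only [map_add, map_sub, map_smul, smul_add, smul_sub, smul_comm Complex.I (_ : ℝ),
          smul_smul Complex.I Complex.I, Complex.I_mul_I, neg_one_smul]
        module }
  map_add' A B := by ext1 v; simp [smul_add]; module
  map_smul' c A := by
    ext1 v
    simp [smul_comm Complex.I c, smul_comm (2⁻¹ : ℝ) c, ← smul_sub]

lemma linPart_apply (A : Cn n →L[ℝ] Cn n) (v : Cn n) :
    linPart A v = (2⁻¹ : ℝ) • (A v - Complex.I • A (Complex.I • v)) := rfl

/-- The complex-antilinear part of a real-linear endomorphism of `ℂⁿ`. -/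
def antiPart (A : Cn n →L[ℝ] Cn n) : Cn n →L[ℝ] Cn n :=
  A - (linPart A).restrictScalars ℝ

lemma linPart_add_antiPart (A : Cn n →L[ℝ] Cn n) (v : Cn n) :
    linPart A v + antiPart A v = A v := by simp [antiPart]

lemma antiPart_apply (A : Cn n →L[ℝ] Cn n) (v : Cn n) :
    antiPart A v = (2⁻¹ : ℝ) • (A v + Complex.I • A (Complex.I • v)) := by
  simp only [antiPart, sub_apply, ContinuousLinearMap.coe_restrictScalars',
    linPart_apply]
  module

lemma antiPart_I_smul (A : Cn n →L[ℝ] Cn n) (v : Cn n) :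
    antiPart A (Complex.I • v) = -(Complex.I • antiPart A v) := by
  rw [antiPart_apply, antiPart_apply, smul_smul, Complex.I_mul_I, neg_one_smul, map_neg,
    smul_comm Complex.I (2⁻¹ : ℝ), smul_add Complex.I, smul_smul Complex.I Complex.I,
    Complex.I_mul_I, neg_one_smul, ← smul_neg]
  congr 1
  module

lemma continuous_linPart : Continuous (linPart : (Cn n →L[ℝ] Cn n) → (Cn n →L[ℂ] Cn n)) :=
  LinearMap.continuous_of_finiteDimensional linPart

lemma continuous_antiPart : Continuous (antiPart : (Cn n →L[ℝ] Cn n) → (Cn n →L[ℝ] Cn n)) :=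
  continuous_id.sub ((ContinuousLinearMap.restrictScalarsL ℂ (Cn n) (Cn n) ℝ ℝ).continuous.comp
    continuous_linPart)

lemma linPart_restrictScalars_comp (X : Cn n →L[ℂ] Cn n) (A : Cn n →L[ℝ] Cn n) :
    linPart ((X.restrictScalars ℝ).comp A) = X.comp (linPart A) := by
  ext1 v
  simp only [linPart_apply, ContinuousLinearMap.comp_apply,
    ContinuousLinearMap.coe_restrictScalars']
  rw [← map_smul X Complex.I, ← map_sub]
  exact ((X.restrictScalars ℝ).map_smul _ _).symm

/-- The determinant of the complex-linear part. -/
def cdet (A : Cn n →L[ℝ] Cn n) : ℂ := (linPart A).det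

lemma continuous_cdet : Continuous (cdet : (Cn n →L[ℝ] Cn n) → ℂ) :=
  ContinuousLinearMap.continuous_det.comp continuous_linPart

/-- Multiplicativity fails for two general real-linear maps, because a product of antilinear parts
is again complex-linear. A complex-linear left factor has no antilinear part. -/
lemma cdet_restrictScalars_comp (X : Cn n →L[ℂ] Cn n) (A : Cn n →L[ℝ] Cn n) :
    cdet ((X.restrictScalars ℝ).comp A) = X.det * cdet A := by
  rw [cdet, linPart_restrictScalars_comp]
  exact LinearMap.det_comp _ _

lemma cdet_ne_zero {A : Cn n →L[ℝ] Cn n} (h : ∀ v, linPart A v = 0 → v = 0) : cdet A ≠ 0 := by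
  intro h0
  obtain ⟨v, hv, hv0⟩ := (LinearMap.bot_lt_ker_of_det_eq_zero h0).ne_bot
    |> Submodule.exists_mem_ne_zero_of_ne_bot
  exact hv0 (h v hv)

/-- A real-linear endomorphism of `ℂⁿ` pulling back a form that tames the complex structure to the
standard form has an invertible complex-linear part. -/
lemma cdet_ne_zero_of_tame {A : Cn n →L[ℝ] Cn n} {τ : Cn n [⋀^Fin 2]→L[ℝ] ℝ}
    (hA : ∀ v, τ ![A v, A (Complex.I • v)] = stdForm n ![v, Complex.I • v])
    (hτ : ∀ v, 0 ≤ τ ![v, Complex.I • v]) : cdet A ≠ 0 := by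
  refine cdet_ne_zero fun v hv => ?_
  -- On the kernel of the linear part `A` anticommutes with `i`, so taming makes `τ(Av, A(iv))`
  -- nonpositive, while it equals `|v|²`.
  have h1 : A (Complex.I • v) = -(Complex.I • A v) := by
    rw [← linPart_add_antiPart A v, ← linPart_add_antiPart A (Complex.I • v), map_smul, hv,
      antiPart_I_smul]
    simp
  have h2 := hA v
  rw [h1, stdForm_self_I_smul, form_neg_right] at h2
  have h4 := hτ (A v)
  have h5 : ‖v‖ ^ 2 ≤ 0 := by linarith
  have : ‖v‖ = 0 := by nlinarith [norm_nonneg v]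
  simpa using this

/-- Linear symplectomorphisms of `ℂⁿ`. -/
def IsSympl (A : Cn n →L[ℝ] Cn n) : Prop := ∀ a b, stdForm n ![A a, A b] = stdForm n ![a, b]

namespace IsSympl

lemma comp {A B : Cn n →L[ℝ] Cn n} (hA : IsSympl A) (hB : IsSympl B) : IsSympl (A.comp B) :=
  fun a b => (hA _ _).trans (hB a b)

/-- Evaluate invariance on the pair `v`, `iv`. The linear part contributes its squared norm with a
plus sign, the antilinear part with a minus sign, and the mixed terms cancel. Thus the linear part
is injective and dominates the antilinear one. -/
lemma norm_linPart_sq {A : Cn n →L[ℝ] Cn n} (hA : IsSympl A) (v : Cn n) :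
    ‖linPart A v‖ ^ 2 = ‖antiPart A v‖ ^ 2 + ‖v‖ ^ 2 := by
  have h := hA v (Complex.I • v)
  rw [stdForm_self_I_smul, ← linPart_add_antiPart A v, ← linPart_add_antiPart A (Complex.I • v),
    map_smul, antiPart_I_smul, stdForm_apply, ← smul_neg, ← smul_add, inner_smul_right,
    inner_add_left, inner_add_right, inner_add_right, inner_neg_right, inner_neg_right,
    inner_self_eq_norm_sq_to_K, inner_self_eq_norm_sq_to_K,
    ← inner_conj_symm (antiPart A v) (linPart A v)] at h
  simp only [Complex.mul_im, Complex.I_re, Complex.I_im, Complex.coe_algebraMap, ← Complex.ofReal_pow,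
    Complex.add_re, Complex.neg_re, Complex.ofReal_re, Complex.conj_re] at h
  linarith

lemma cdet_ne_zero {A : Cn n →L[ℝ] Cn n} (hA : IsSympl A) : cdet A ≠ 0 := by
  refine _root_.cdet_ne_zero fun v hv => ?_
  have h := hA.norm_linPart_sq v
  rw [hv, norm_zero] at h
  have : ‖v‖ = 0 := by nlinarith [norm_nonneg v, sq_nonneg ‖antiPart A v‖]
  simpa using this

lemma injective {A : Cn n →L[ℝ] Cn n} (hA : IsSympl A) : Function.Injective A := by
  rw [injective_iff_map_eq_zero]
  intro v hv
  have h := hA v (Complex.I • v)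
  rw [stdForm_self_I_smul, hv, stdForm_apply, inner_zero_left] at h
  have : ‖v‖ = 0 := by
    have : ‖v‖ ^ 2 = 0 := by simpa using h.symm
    simpa using this
  simpa using this

lemma symm {P : Cn n ≃L[ℝ] Cn n} (hP : IsSympl (P : Cn n →L[ℝ] Cn n)) :
    IsSympl (P.symm : Cn n →L[ℝ] Cn n) := by
  intro a b
  have := hP (P.symm a) (P.symm b)
  simpa using this.symm

/-- This is the contraction property behind all nonvanishing results: for symplectic `P`, the
inverse of the linear part followed after the antilinear part strictly decreases norms. With `Q =
P⁻¹`, the linear and antilinear parts of `Q` are the symplectic adjoints of those of `P`. If `a` is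
the linear part of `Q` at `v`, then `|a|² ≤ |antiPart Q v| |b| ≤ |antiPart Q v| |a|`, whereas `|a|²
= |antiPart Q v|² + |v|²`; hence `v = 0`. -/
lemma eq_zero_of_linPart_eq {P : Cn n →L[ℝ] Cn n} (hP : IsSympl P) {a b : Cn n} {s : ℝ}
    (hs0 : 0 ≤ s) (hs : s ≤ 1) (hab : ‖b‖ ≤ ‖a‖) (h : linPart P a = -(s • antiPart P b)) :
    a = 0 := by
  let e : Cn n ≃L[ℝ] Cn n :=
    (LinearEquiv.ofInjectiveEndo (P : Cn n →ₗ[ℝ] Cn n) hP.injective).toContinuousLinearEquiv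
  have he : ∀ v, e v = P v := fun v => rfl
  let Q : Cn n →L[ℝ] Cn n := (e.symm : Cn n →L[ℝ] Cn n)
  have hQe : ∀ v, P (Q v) = v := fun v => e.apply_symm_apply v
  have hQs : IsSympl Q := by
    intro x y
    rw [← hP, hQe, hQe]
  have adj : ∀ v w, stdForm n ![Q v, w] = stdForm n ![v, P w] := by
    intro v w
    rw [← hP, hQe]
  have lin : ∀ v w, stdForm n ![linPart Q v, w] = stdForm n ![v, linPart P w] := by
    intro v w
    rw [linPart_apply, linPart_apply, form_smul_left, form_smul_right, sub_eq_add_neg,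
      sub_eq_add_neg, form_add_left, form_add_right, form_neg_left, form_neg_right,
      stdForm_I_smul_left, adj, adj, stdForm_I_smul_left]
    ring
  have anti : ∀ v w, stdForm n ![antiPart Q v, w] = stdForm n ![v, antiPart P w] := by
    intro v w
    have h1 := adj v w
    rw [← linPart_add_antiPart Q v, ← linPart_add_antiPart P w, form_add_left, form_add_right,
      lin] at h1
    linarith
  obtain ⟨v, hv⟩ : ∃ v, linPart Q v = a := by
    have hinj : Function.Injective (linPart Q) := by
      rw [injective_iff_map_eq_zero]
      intro v hv
      have h := hQs.norm_linPart_sq v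
      rw [hv, norm_zero] at h
      have : ‖v‖ = 0 := by nlinarith [norm_nonneg v, sq_nonneg ‖antiPart Q v‖]
      simpa using this
    exact (LinearMap.injective_iff_surjective (f := (linPart Q : Cn n →ₗ[ℂ] Cn n))).1 hinj a
  have h1 : ‖a‖ ^ 2 = s * stdForm n ![antiPart Q (Complex.I • v), b] := by
    rw [← stdForm_self_I_smul]
    nth_rewrite 1 [← hv]
    rw [lin, map_smul, h, smul_neg, form_neg_right, ← stdForm_I_smul_left, form_smul_right, anti]
  have h2 : stdForm n ![antiPart Q (Complex.I • v), b] ≤ ‖antiPart Q v‖ * ‖b‖ := by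
    rw [antiPart_I_smul, stdForm_apply]
    refine (Complex.abs_im_le_norm _).trans' (le_abs_self _) |>.trans ?_
    refine (norm_inner_le_norm _ _).trans ?_
    rw [norm_neg, norm_smul, Complex.norm_I, one_mul]
  have h3 := hQs.norm_linPart_sq v
  rw [hv] at h3
  by_contra ha
  have ha' : 0 < ‖a‖ := norm_pos_iff.2 ha
  have h4 : ‖a‖ ^ 2 ≤ ‖antiPart Q v‖ * ‖a‖ := by
    have h5 : ‖antiPart Q v‖ * ‖b‖ ≤ ‖antiPart Q v‖ * ‖a‖ := by gcongr
    have h6 : 0 ≤ ‖antiPart Q v‖ * ‖a‖ := by positivity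
    nlinarith
  have h5 : ‖a‖ ≤ ‖antiPart Q v‖ := by nlinarith
  have h6 : ‖v‖ = 0 := by nlinarith [norm_nonneg v]
  rw [norm_eq_zero] at h6
  rw [← hv, h6, map_zero] at ha
  exact ha rfl

end IsSympl

end LinearAlgebra

/-! ### Variation of the argument along loops -/

section ArgVariation

open Complex

/-- The plane is simply connected, so the map lifts through the covering `exp : ℂ → ℂ ∖ {0}`. -/
lemma exists_continuous_log {F : ℂ → ℂ} (hF : Continuous F) (h0 : ∀ z, F z ≠ 0) :
    ∃ G : ℂ → ℂ, Continuous G ∧ ∀ z, exp (G z) = F z := by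
  let f : C(ℂ, {z : ℂ // z ≠ 0}) := ⟨fun z => ⟨F z, h0 z⟩, by fun_prop⟩
  obtain ⟨G, ⟨-, hG⟩, -⟩ := isCoveringMap_exp.existsUnique_continuousMap_lifts f 0 (log (F 0))
    (Subtype.ext (exp_log (h0 0)))
  refine ⟨G, G.continuous, fun z => ?_⟩
  exact congrArg Subtype.val (congrFun hG z)

lemma exists_continuous_arg {c : ℝ → ℂ} (hc : Continuous c) (h0 : ∀ θ, c θ ≠ 0) :
    ∃ ψ : ℝ → ℝ, Continuous ψ ∧ ∀ θ, c θ = ‖c θ‖ * exp (ψ θ * I) := by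
  obtain ⟨G, hG, h⟩ := exists_continuous_log (F := fun z => c z.re)
    (hc.comp continuous_re) (fun z => h0 _)
  refine ⟨fun θ => (G θ).im, by fun_prop, fun θ => ?_⟩
  have h1 : exp (G θ) = c θ := by simpa using h θ
  rw [← h1, norm_exp, ofReal_exp, ← exp_add, re_add_im]

/-- The values lie in the discrete set `2πℤ`. This is obtained from uniqueness of lifts through the
covering of the circle by the line. -/
lemma eq_of_exp_mul_I_eq_one {X : Type*} [TopologicalSpace X] [PreconnectedSpace X] {f : X → ℝ}
    (hf : Continuous f) (h : ∀ x, exp (f x * I) = 1) (x y : X) : f x = f y := by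
  have key := Circle.isCoveringMap_exp.eq_of_comp_eq hf (continuous_const (y := f y)) ?_ y rfl
  · exact congrFun key x
  · funext z
    simp only [Function.comp_apply]
    ext
    rw [Circle.coe_exp, Circle.coe_exp, h, h]

/-- The argument of the path `c` in `ℂ ∖ {0}` increases by `v` on `[0, 2π]`. -/
def HasArgVar (c : ℝ → ℂ) (v : ℝ) : Prop :=
  ∃ ψ : ℝ → ℝ, Continuous ψ ∧ (∀ θ, c θ = ‖c θ‖ * exp (ψ θ * I)) ∧ ψ (2 * Real.pi) - ψ 0 = v

lemma exists_hasArgVar {c : ℝ → ℂ} (hc : Continuous c) (h0 : ∀ θ, c θ ≠ 0) :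
    ∃ v, HasArgVar c v :=
  let ⟨ψ, h1, h2⟩ := exists_continuous_arg hc h0
  ⟨_, ψ, h1, h2, rfl⟩

namespace HasArgVar

lemma unique {c : ℝ → ℂ} {v v' : ℝ} (h0 : ∀ θ, c θ ≠ 0) (h : HasArgVar c v)
    (h' : HasArgVar c v') : v = v' := by
  obtain ⟨ψ, h1, h2, rfl⟩ := h
  obtain ⟨ψ', h1', h2', rfl⟩ := h'
  have := eq_of_exp_mul_I_eq_one (h1.sub h1') (fun θ => ?_) 0 (2 * Real.pi)
  · simp only [Pi.sub_apply] at this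
    linarith
  · have h3 : (‖c θ‖ : ℂ) ≠ 0 := by simpa using h0 θ
    have h4 := mul_left_cancel₀ h3 ((h2 θ).symm.trans (h2' θ))
    rw [Pi.sub_apply, ofReal_sub, sub_mul, exp_sub, h4, div_self (exp_ne_zero _)]

lemma mul {c c' : ℝ → ℂ} {v v' : ℝ} (h : HasArgVar c v) (h' : HasArgVar c' v') :
    HasArgVar (fun θ => c θ * c' θ) (v + v') := by
  obtain ⟨ψ, h1, h2, rfl⟩ := h
  obtain ⟨ψ', h1', h2', rfl⟩ := h'
  refine ⟨fun θ => ψ θ + ψ' θ, by fun_prop, fun θ => ?_, by ring⟩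
  rw [norm_mul, ofReal_mul, ofReal_add, add_mul, exp_add]
  conv_lhs => beta_reduce; rw [h2, h2']
  ring

lemma congr {c c' : ℝ → ℂ} {v : ℝ} (h : HasArgVar c v) (hc : ∀ θ, c θ = c' θ) :
    HasArgVar c' v := by
  rwa [← funext hc]

lemma of_re_pos {c : ℝ → ℂ} (hc : Continuous c) (h : ∀ θ, 0 < (c θ).re)
    (hp : c (2 * Real.pi) = c 0) : HasArgVar c 0 := by
  refine ⟨fun θ => arg (c θ), ?_, fun θ => ?_, by simp [hp]⟩
  · exact continuous_iff_continuousAt.2 fun θ =>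
      (continuousAt_arg (Or.inl (h θ))).comp hc.continuousAt
  · exact (norm_mul_exp_arg_mul_I _).symm

/-- The quotient stays in the right half-plane, where the principal argument is continuous, so the
closed path it traces does not wind. -/
lemma of_re_div_pos {c c' : ℝ → ℂ} {v : ℝ} (hv : HasArgVar c v) (hc : Continuous c)
    (hc' : Continuous c') (h0 : ∀ θ, c θ ≠ 0)
    (h : ∀ θ, 0 < (c' θ / c θ).re) (hp : c (2 * Real.pi) = c 0) (hp' : c' (2 * Real.pi) = c' 0) :
    HasArgVar c' v := by
  have h1 := hv.mul (of_re_pos (hc'.div hc h0) h (by rw [Pi.div_apply, Pi.div_apply, hp, hp']))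
  rw [add_zero] at h1
  exact h1.congr fun θ => mul_div_cancel₀ _ (h0 θ)

/-- Clamping the homotopy parameter to `[0, 1]` extends `H` to the whole plane, where a single
continuous logarithm exists. The increase of its imaginary part over a period lies in `2πℤ`, because
each stage is a loop, and depends continuously on the parameter. -/
lemma of_homotopy {H : ℝ → ℝ → ℂ} {v : ℝ}
    (hH : ContinuousOn (fun p : ℝ × ℝ => H p.1 p.2) (Icc 0 1 ×ˢ univ))
    (h0 : ∀ s ∈ Icc (0 : ℝ) 1, ∀ θ, H s θ ≠ 0)
    (hp : ∀ s ∈ Icc (0 : ℝ) 1, H s (2 * Real.pi) = H s 0) (hv : HasArgVar (H 0) v) :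
    HasArgVar (H 1) v := by
  let pr : ℝ → ℝ := fun s => projIcc (0 : ℝ) 1 zero_le_one s
  have hpr : ∀ s, pr s ∈ Icc (0 : ℝ) 1 := fun s => (projIcc (0 : ℝ) 1 zero_le_one s).2
  have hprc : Continuous pr := continuous_subtype_val.comp continuous_projIcc
  obtain ⟨G, hG, h⟩ := exists_continuous_log (F := fun z => H (pr z.re) z.im)
    (hH.comp_continuous (f := fun z : ℂ => (pr z.re, z.im)) (by fun_prop)
      (fun z => ⟨hpr _, mem_univ _⟩))
    (fun z => h0 _ (hpr _) _)
  have h3 : ∀ s ∈ Icc (0 : ℝ) 1, ∀ θ : ℝ, exp (G (s + θ * I)) = H s θ := by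
    intro s hs θ
    have := h (s + θ * I)
    simpa [pr, projIcc_of_mem zero_le_one hs] using this
  have h4 : ∀ s ∈ Icc (0 : ℝ) 1, ∀ θ : ℝ,
      H s θ = ‖H s θ‖ * exp ((G (s + θ * I)).im * I) := by
    intro s hs θ
    rw [← h3 s hs, norm_exp, ofReal_exp, ← exp_add, re_add_im]
  have hv0 : HasArgVar (H 0) _ := ⟨fun θ => (G ((0 : ℝ) + θ * I)).im, by fun_prop,
    h4 0 (by simp), rfl⟩
  have hv1 : HasArgVar (H 1) _ := ⟨fun θ => (G ((1 : ℝ) + θ * I)).im, by fun_prop,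
    h4 1 (by simp), rfl⟩
  convert hv1 using 1
  rw [hv.unique (h0 0 (by simp)) hv0]
  have key := eq_of_exp_mul_I_eq_one (X := ℝ)
    (f := fun s => (G ((pr s : ℝ) + (2 * Real.pi : ℝ) * I)).im - (G ((pr s : ℝ) + (0 : ℝ) * I)).im)
    (by fun_prop) (fun s => ?_) 0 1
  · simpa [pr] using key
  · have e1 := h4 _ (hpr s) (2 * Real.pi)
    have e2 := h4 _ (hpr s) 0
    have h5 : (‖H (pr s) 0‖ : ℂ) ≠ 0 := by simpa using h0 _ (hpr s) 0
    rw [hp _ (hpr s), e2] at e1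
    have h6 := mul_left_cancel₀ h5 (by simpa using e1)
    rw [ofReal_sub, sub_mul, exp_sub]
    simp only [ofReal_mul, ofReal_ofNat, ofReal_zero, zero_mul, add_zero] at h6 ⊢
    rw [← h6, div_self (exp_ne_zero _)]

/-- Shrinking the circle radially to the centre deforms the loop to a constant without meeting a
zero. -/
lemma of_disc {F : ℂ → ℂ} (hF : ContinuousOn F (Metric.closedBall 0 1))
    (h0 : ∀ z ∈ Metric.closedBall (0 : ℂ) 1, F z ≠ 0) :
    HasArgVar (fun θ => F (exp (θ * I))) 0 := by
  have hm : ∀ s ∈ Icc (0 : ℝ) 1, ∀ θ : ℝ, (s : ℂ) * exp (θ * I) ∈ Metric.closedBall (0 : ℂ) 1 := by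
    intro s hs θ
    rw [mem_closedBall_zero_iff, norm_mul, norm_exp_ofReal_mul_I, mul_one, norm_real,
      Real.norm_of_nonneg hs.1]
    exact hs.2
  have := of_homotopy (H := fun s θ => F (s * exp (θ * I))) (v := 0) ?_ ?_ ?_ ?_
  · simpa using this
  · refine hF.comp (by fun_prop) ?_
    rintro ⟨s, θ⟩ ⟨hs, -⟩
    exact hm s hs θ
  · exact fun s hs θ => h0 _ (hm s hs θ)
  · intro s hs
    simp
  · refine ⟨fun _ => arg (F 0), continuous_const, fun θ => ?_, by simp⟩
    simp only [ofReal_zero, zero_mul]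
    exact (norm_mul_exp_arg_mul_I _).symm

/-- The integral `g` of `c'/c` is a logarithm of `c` up to a constant, since `c exp(-g)` has
derivative zero. -/
lemma of_hasDerivAt {c c' : ℝ → ℂ} (hc : ∀ θ, HasDerivAt c (c' θ) θ) (hc' : Continuous c')
    (h0 : ∀ θ, c θ ≠ 0) :
    HasArgVar c (∫ θ in (0 : ℝ)..2 * Real.pi, (c' θ / c θ).im) := by
  have hcc : Continuous c := continuous_iff_continuousAt.2 fun θ => (hc θ).continuousAt
  have hq : Continuous fun θ => c' θ / c θ := hc'.div hcc h0
  let g : ℝ → ℂ := fun θ => ∫ t in (0 : ℝ)..θ, c' t / c t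
  have hg : ∀ θ, HasDerivAt g (c' θ / c θ) θ := fun θ =>
    intervalIntegral.integral_hasDerivAt_right (hq.intervalIntegrable _ _)
      (hq.stronglyMeasurableAtFilter _ _) hq.continuousAt
  have hk : ∀ θ, c θ * exp (-g θ) = c 0 := by
    have hd : ∀ θ, HasDerivAt (fun θ => c θ * exp (-g θ)) 0 θ := by
      intro θ
      refine ((hc θ).mul ((hg θ).neg.cexp)).congr_deriv ?_
      have h1 : c θ * (c' θ / c θ) = c' θ := mul_div_cancel₀ _ (h0 θ)
      linear_combination -Complex.exp ((-g) θ) * h1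
    intro θ
    have := is_const_of_deriv_eq_zero (fun θ => (hd θ).differentiableAt) (fun θ => (hd θ).deriv) θ 0
    simpa [g] using this
  have hgc : Continuous g := continuous_iff_continuousAt.2 fun θ => (hg θ).continuousAt
  refine ⟨fun θ => arg (c 0) + (g θ).im, by fun_prop, fun θ => ?_, ?_⟩
  · have h1 : c θ = c 0 * exp (g θ) := by
      rw [← hk θ, mul_assoc, ← exp_add, neg_add_cancel, exp_zero, mul_one]
    rw [h1, norm_mul, norm_exp, ofReal_mul, ofReal_exp, ofReal_add, add_mul, exp_add]
    conv_lhs => rw [← norm_mul_exp_arg_mul_I (c 0), ← re_add_im (g θ), exp_add]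
    ring
  · have h1 : (g (2 * Real.pi)).im = ∫ θ in (0 : ℝ)..2 * Real.pi, (c' θ / c θ).im := by
      have := (Complex.imCLM.intervalIntegral_comp_comm (μ := volume) (hq.intervalIntegrable 0 (2 * Real.pi)))
      simpa [g] using this.symm
    have h2 : g 0 = 0 := by simp [g]
    rw [← h1]
    simp [h2]

end HasArgVar

end ArgVariation

/-! ### Symplectic bases, and their continuous dependence on the form -/

section Darboux

/-- A nondegenerate alternating form on a finite-dimensional real vector space is isomorphic to the
standard one. -/
lemma exists_symplectic_basis {V : Type*} [AddCommGroup V] [Module ℝ V] [FiniteDimensional ℝ V]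
    (B : V →ₗ[ℝ] V →ₗ[ℝ] ℝ) (hB : ∀ x, B x x = 0) (hnd : ∀ x, x ≠ 0 → ∃ y, B x y ≠ 0) :
    ∃ (m : ℕ) (φ : Cn m ≃ₗ[ℝ] V), ∀ a b, B (φ a) (φ b) = stdForm m ![a, b] := by
  induction h : Module.finrank ℝ V using Nat.strong_induction_on generalizing V with
  | _ d ih =>
    subst h
    have hswap : ∀ x y, B x y = -B y x := by
      intro x y
      have := hB (x + y)
      simp only [map_add, LinearMap.add_apply, hB] at this
      linarith
    by_cases hV : ∀ x : V, x = 0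
    · have : Subsingleton V := ⟨fun x y => (hV x).trans (hV y).symm⟩
      refine ⟨0, LinearEquiv.ofSubsingleton _ _, fun a b => ?_⟩
      rw [hV (LinearEquiv.ofSubsingleton _ _ a), Subsingleton.elim a 0, stdForm_apply]
      simp
    push Not at hV
    obtain ⟨e, he⟩ := hV
    obtain ⟨f', hf'⟩ := hnd e he
    obtain ⟨f, hf⟩ : ∃ f, B e f = 1 := ⟨(B e f')⁻¹ • f', by simp [hf']⟩
    have hfe : B f e = -1 := by rw [hswap, hf]
    -- `e` and `f` span a hyperbolic plane; the induction runs on its orthogonal complement.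
    let U : Submodule ℝ V := LinearMap.ker (B e) ⊓ LinearMap.ker (B f)
    have hU : ∀ x : U, B e x = 0 ∧ B f x = 0 := fun x => x.2
    have hU' : ∀ x : U, B x e = 0 ∧ B x f = 0 := fun x => by
      rw [hswap, (hU x).1, hswap _ f, (hU x).2]; simp
    have hdec : ∀ x : V, x - B x f • e - B e x • f ∈ U := by
      intro x
      constructor
      · change B e _ = 0
        simp [hB, hf]
      · change B f _ = 0
        simp [hB, hfe, hswap f x]
    have hlt : Module.finrank ℝ U < Module.finrank ℝ V := by
      refine Submodule.finrank_lt (fun htop => ?_)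
      have : f ∈ U := htop ▸ Submodule.mem_top
      have : B e f = 0 := this.1
      rw [hf] at this
      exact one_ne_zero this
    obtain ⟨m, φ, hφ⟩ := ih _ hlt (B.domRestrict₁₂ U U) (fun x => hB x) (by
      intro x hx
      obtain ⟨y, hy⟩ := hnd x (by simpa using hx)
      refine ⟨⟨_, hdec y⟩, ?_⟩
      have h2 := hU' x
      rw [LinearMap.domRestrict₁₂_apply]
      simpa [h2.1, h2.2] using hy) rfl
    let ψ : Cn (m + 1) →ₗ[ℝ] V :=
      { toFun := fun a => (a 0).re • e + (a 0).im • f + φ (WithLp.toLp 2 fun i => a i.succ)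
        map_add' := by
          intro a b
          have : (WithLp.toLp 2 fun i : Fin m => (a + b) i.succ : Cn m) =
            WithLp.toLp 2 (fun i => a i.succ) + WithLp.toLp 2 (fun i => b i.succ) := rfl
          rw [this, map_add]
          simp only [PiLp.add_apply, Complex.add_re, Complex.add_im, Submodule.coe_add]
          module
        map_smul' := by
          intro c a
          have : (WithLp.toLp 2 fun i : Fin m => (c • a) i.succ : Cn m) =
            c • WithLp.toLp 2 (fun i => a i.succ) := rfl
          rw [this, map_smul]
          simp only [PiLp.smul_apply, Complex.real_smul, Complex.re_ofReal_mul,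
            Complex.im_ofReal_mul, Submodule.coe_smul, RingHom.id_apply]
          module }
    have hψ : ∀ a b, B (ψ a) (ψ b) = stdForm (m + 1) ![a, b] := by
      intro a b
      have h2 := hφ (WithLp.toLp 2 fun i => a i.succ) (WithLp.toLp 2 fun i => b i.succ)
      have h3 : stdForm (m + 1) ![a, b] = ((a 0).re * (b 0).im - (a 0).im * (b 0).re) +
          stdForm m ![WithLp.toLp 2 fun i => a i.succ, WithLp.toLp 2 fun i => b i.succ] :=
        Fin.sum_univ_succ _
      rw [h3, ← h2]
      simp only [ψ, LinearMap.coe_mk, AddHom.coe_mk, map_add, LinearMap.add_apply, map_smul,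
        LinearMap.smul_apply, hB, hf, hfe, hU, hU', smul_eq_mul, LinearMap.domRestrict₁₂_apply]
      ring
    have hinj : Function.Injective ψ := by
      rw [injective_iff_map_eq_zero]
      intro a ha
      have := hψ a (Complex.I • a)
      rw [ha, stdForm_self_I_smul] at this
      simpa using this.symm
    have hsurj : Function.Surjective ψ := by
      intro x
      obtain ⟨a, ha⟩ := φ.surjective ⟨_, hdec x⟩
      refine ⟨WithLp.toLp 2 (Fin.cons ⟨B x f, B e x⟩ a), ?_⟩
      have : (WithLp.toLp 2 fun i : Fin m => a i : Cn m) = a := rfl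
      simp [ψ, this, ha]
    exact ⟨m + 1, LinearEquiv.ofBijective ψ ⟨hinj, hsurj⟩, hψ⟩

variable {n : ℕ}

/-- A 2-form as a bilinear map. -/
def formBilin {E : Type*} [NormedAddCommGroup E] [NormedSpace ℝ E] (τ : E [⋀^Fin 2]→L[ℝ] ℝ) :
    E →ₗ[ℝ] E →ₗ[ℝ] ℝ :=
  LinearMap.mk₂ ℝ (fun a b => τ ![a, b]) (form_add_left τ) (form_smul_left τ)
    (form_add_right τ) (form_smul_right τ)

lemma exists_symplectic_equiv (τ : Cn n [⋀^Fin 2]→L[ℝ] ℝ)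
    (h : ∀ a, a ≠ 0 → ∃ b, τ ![a, b] ≠ 0) :
    ∃ S : Cn n ≃L[ℝ] Cn n, ∀ a b, τ ![S a, S b] = stdForm n ![a, b] := by
  obtain ⟨m, φ, hφ⟩ := exists_symplectic_basis (formBilin τ) (form_self τ) h
  have hd : ∀ k, Module.finrank ℝ (Cn k) = 2 * k := by
    intro k
    rw [← Module.finrank_mul_finrank ℝ ℂ (Cn k), Complex.finrank_real_complex,
      finrank_euclideanSpace_fin]
  have hmn : m = n := by
    have := φ.finrank_eq
    rw [hd, hd] at this
    omega
  subst hmn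
  exact ⟨φ.toContinuousLinearEquiv, hφ⟩

/-- A continuous local square root near the identity compatible with an anti-automorphism. -/
lemma exists_local_sqrt {A : Type*} [NormedRing A] [NormedAlgebra ℝ A] [CompleteSpace A]
    (d : A → A) (hd : Continuous d) (hd1 : d 1 = 1) (hmul : ∀ x y, d (x * y) = d y * d x) :
    ∃ (U : Set A) (S : A → A), IsOpen U ∧ 1 ∈ U ∧ ContinuousOn S U ∧
      ∀ K ∈ U, S K * S K = K ∧ (d K = K → d (S K) = S K) := by
  -- Squaring has the invertible derivative `2` at `1`, so the inverse function theorem provides the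
  -- root.
  have hf : HasStrictFDerivAt (fun x : A => x * x)
      ((ContinuousLinearEquiv.smulLeft (Units.mk0 (2 : ℝ) two_ne_zero) : A ≃L[ℝ] A) :
        A →L[ℝ] A) 1 := by
    have := (hasStrictFDerivAt_id (𝕜 := ℝ) (1 : A)).mul' (hasStrictFDerivAt_id (𝕜 := ℝ) (1 : A))
    refine this.congr_fderiv ?_
    ext x
    simp [two_smul, Units.smul_def]
  let e := hf.toOpenPartialHomeomorph _
  have he : ∀ x, e x = x * x := fun x => rfl
  have h1 : (1 : A) ∈ e.source := hf.mem_toOpenPartialHomeomorph_source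
  have h1t : (1 : A) ∈ e.target := by simpa [he] using e.map_source h1
  have hs1 : e.symm 1 = 1 := by
    have := e.left_inv h1
    rwa [he, mul_one] at this
  have hc : ContinuousOn (fun K => d (e.symm K)) e.target :=
    hd.comp_continuousOn e.continuousOn_symm
  -- Shrinking the domain so that `d` of the root stays where squaring is injective: if `d K = K`,
  -- then `d` of the root is another root of `K` there, hence the same one.
  refine ⟨e.target ∩ (fun K => d (e.symm K)) ⁻¹' e.source, e.symm,
    hc.isOpen_inter_preimage e.open_target e.open_source, ⟨h1t, ?_⟩,
    e.continuousOn_symm.mono inter_subset_left, ?_⟩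
  · simpa [hs1, hd1] using h1
  · rintro K ⟨hK, hK'⟩
    have h2 : e.symm K * e.symm K = K := by
      rw [← he, e.right_inv hK]
    refine ⟨h2, fun hdK => e.injOn hK' (e.map_target hK) ?_⟩
    rw [he, he, h2, ← hmul, h2, hdK]

/-- Multiplication by `i`. -/
def mulI (n : ℕ) : Cn n →L[ℝ] Cn n := (Complex.I • ContinuousLinearMap.id ℂ (Cn n)).restrictScalars ℝ

lemma mulI_apply (v : Cn n) : mulI n v = Complex.I • v := rfl

lemma stdForm_eq_inner (a b : Cn n) : stdForm n ![a, b] = -inner ℝ a (mulI n b) := by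
  rw [stdForm_apply, mulI_apply, PiLp.inner_apply, PiLp.inner_apply, Complex.im_sum,
    ← Finset.sum_neg_distrib]
  refine Finset.sum_congr rfl fun k _ => ?_
  simp [Complex.inner]

/-- The adjoint with respect to the standard symplectic form. -/
def symplAdjoint (X : Cn n →L[ℝ] Cn n) : Cn n →L[ℝ] Cn n :=
  -(mulI n * ContinuousLinearMap.adjoint X * mulI n)

lemma stdForm_symplAdjoint (X : Cn n →L[ℝ] Cn n) (a b : Cn n) :
    stdForm n ![X a, b] = stdForm n ![a, symplAdjoint X b] := by
  have h : mulI n (symplAdjoint X b) = ContinuousLinearMap.adjoint X (mulI n b) := by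
    have := I_smul_I_smul (ContinuousLinearMap.adjoint X (mulI n b))
    rw [← mulI_apply, ← mulI_apply] at this
    simp only [symplAdjoint, neg_apply, mul_apply_eq_comp, map_neg, this, neg_neg]
  rw [stdForm_eq_inner, stdForm_eq_inner, h, ContinuousLinearMap.adjoint_inner_right]

lemma stdForm_ext {a a' : Cn n} (h : ∀ b, stdForm n ![a, b] = stdForm n ![a', b]) : a = a' := by
  have h2 := h (Complex.I • (a - a'))
  have h3 : stdForm n ![a - a', Complex.I • (a - a')] = 0 := by
    rw [sub_eq_add_neg a a', form_add_left, form_neg_left, ← sub_eq_add_neg a a', h2]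
    ring
  rw [stdForm_self_I_smul] at h3
  have : ‖a - a'‖ = 0 := by simpa using h3
  exact sub_eq_zero.1 (norm_eq_zero.1 this)

/-- A 2-form as an endomorphism, by means of the standard form. -/
def formOp (τ : Cn n [⋀^Fin 2]→L[ℝ] ℝ) : Cn n →L[ℝ] Cn n :=
  -(mulI n * ∑ k, (LinearMap.toContinuousLinearMap
    ((formBilin τ).flip (stdOrthonormalBasis ℝ (Cn n) k))).smulRight
      (stdOrthonormalBasis ℝ (Cn n) k))

lemma stdForm_formOp (τ : Cn n [⋀^Fin 2]→L[ℝ] ℝ) (a b : Cn n) :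
    stdForm n ![formOp τ a, b] = τ ![a, b] := by
  have h : stdForm n ![formOp τ a, b] =
      inner ℝ (∑ k, τ ![a, stdOrthonormalBasis ℝ (Cn n) k] • stdOrthonormalBasis ℝ (Cn n) k) b := by
    have h1 : formOp τ a = -(Complex.I •
        ∑ k, τ ![a, stdOrthonormalBasis ℝ (Cn n) k] • stdOrthonormalBasis ℝ (Cn n) k) := by
      simp [formOp, mulI_apply, formBilin, Finset.smul_sum, smul_comm Complex.I (_ : ℝ)]
    rw [h1, form_neg_left, stdForm_I_smul_left, stdForm_eq_inner, mulI_apply, I_smul_I_smul,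
      inner_neg_right]
    simp
  rw [h, sum_inner]
  simp only [real_inner_smul_left]
  have h2 : τ ![a, b] = formBilin τ a b := rfl
  rw [h2]
  conv_rhs => rw [← (stdOrthonormalBasis ℝ (Cn n)).sum_repr' b, map_sum]
  refine Finset.sum_congr rfl fun k _ => ?_
  rw [map_smul, smul_eq_mul, mul_comm]
  rfl

lemma continuousOn_formOp {X : Type*} [TopologicalSpace X] {τ : X → Cn n [⋀^Fin 2]→L[ℝ] ℝ}
    {U : Set X} (h : ∀ a b, ContinuousOn (fun x => τ x ![a, b]) U) :
    ContinuousOn (fun x => formOp (τ x)) U := by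
  rw [continuousOn_clm_apply]
  intro a
  simp only [formOp, formBilin, neg_apply, mul_apply_eq_comp,
    sum_apply, ContinuousLinearMap.smulRight_apply,
    LinearMap.coe_toContinuousLinearMap', LinearMap.flip_apply, LinearMap.mk₂_apply]
  refine ((mulI n).continuous.comp_continuousOn (continuousOn_finsetSum _ fun k _ => ?_)).neg
  exact (h a _).smul continuousOn_const

open Classical in
-- A linear version of Moser's argument. After normalising `τ` at `x₀` by `S`, write it as
-- `ω₀(K(x)·, ·)` with `K(x₀) = 1`. Antisymmetry of the form makes `K` self-adjoint for `ω₀`, hence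
-- so is its root `Q` near the identity, and `τ(Sa, Sb) = ω₀(Qa, Qb)`. Therefore `S Q⁻¹` is a
-- symplectic frame, and it is continuous because the root is.
lemma exists_local_symplectic_frame {X : Type*} [TopologicalSpace X]
    {τ : X → Cn n [⋀^Fin 2]→L[ℝ] ℝ} {U : Set X} (hU : IsOpen U)
    (h : ∀ a b, ContinuousOn (fun x => τ x ![a, b]) U) {x₀ : X} (hx₀ : x₀ ∈ U)
    (hnd : ∀ a, a ≠ 0 → ∃ b, τ x₀ ![a, b] ≠ 0) :
    ∃ (V : Set X) (Θ : X → Cn n ≃L[ℝ] Cn n), IsOpen V ∧ x₀ ∈ V ∧ V ⊆ U ∧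
      ContinuousOn (fun x => (Θ x : Cn n →L[ℝ] Cn n)) V ∧
      ∀ x ∈ V, ∀ a b, τ x ![Θ x a, Θ x b] = stdForm n ![a, b] := by
  obtain ⟨S, hS⟩ := exists_symplectic_equiv (τ x₀) hnd
  have hd : Continuous (symplAdjoint : (Cn n →L[ℝ] Cn n) → _) :=
    ((continuous_const.mul (LinearIsometryEquiv.continuous _)).mul continuous_const).neg
  have hmul : ∀ x y : Cn n →L[ℝ] Cn n, symplAdjoint (x * y) = symplAdjoint y * symplAdjoint x := by
    intro x y
    ext1 v
    refine (stdForm_ext fun b => ?_)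
    rw [form_swap, ← stdForm_symplAdjoint, mul_apply_eq_comp,
      mul_apply_eq_comp, stdForm_symplAdjoint, stdForm_symplAdjoint, ← form_swap]
  have h1 : symplAdjoint (1 : Cn n →L[ℝ] Cn n) = 1 := by
    ext1 v
    refine (stdForm_ext fun b => ?_)
    rw [form_swap, ← stdForm_symplAdjoint, ← form_swap]
    rfl
  obtain ⟨W, R, hW, hW1, hR, hRK⟩ := exists_local_sqrt symplAdjoint hd h1 hmul
  let σ : X → Cn n [⋀^Fin 2]→L[ℝ] ℝ := fun x => (τ x).compContinuousLinearMap (S : Cn n →L[ℝ] Cn n)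
  have hσ : ∀ x a b, σ x ![a, b] = τ x ![S a, S b] := by
    intro x a b
    change τ x _ = _
    congr 1
    ext i; fin_cases i <;> rfl
  let K : X → Cn n →L[ℝ] Cn n := fun x => formOp (σ x)
  have hKc : ContinuousOn K U := continuousOn_formOp fun a b => by
    simp only [hσ]
    exact h _ _
  have hK0 : K x₀ = 1 := by
    ext1 v
    refine stdForm_ext fun b => ?_
    rw [stdForm_formOp, hσ, hS]
    rfl
  have hKd : ∀ x, symplAdjoint (K x) = K x := by
    intro x
    ext1 v
    refine stdForm_ext fun b => ?_
    rw [form_swap, ← stdForm_symplAdjoint, stdForm_formOp, stdForm_formOp, ← form_swap]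
  let Q : X → Cn n →L[ℝ] Cn n := fun x => R (K x)
  let V₁ := U ∩ K ⁻¹' W
  have hV₁ : IsOpen V₁ := hKc.isOpen_inter_preimage hU hW
  have hQc : ContinuousOn Q V₁ := hR.comp (hKc.mono inter_subset_left) fun x hx => hx.2
  let V := V₁ ∩ K ⁻¹' {k | IsUnit k}
  have hV : IsOpen V := (hKc.mono inter_subset_left).isOpen_inter_preimage hV₁ Units.isOpen
  have hQu : ∀ x ∈ V, IsUnit (Q x) := by
    intro x hx
    have h2 : IsUnit (Q x * Q x) := by
      rw [(hRK _ hx.1.2).1]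
      exact hx.2
    exact isUnit_pow_iff (n := 2) two_ne_zero |>.1 (by rwa [pow_two])
  have key : ∀ x ∈ V, ∀ a b, τ x ![S (Ring.inverse (Q x) a), S (Ring.inverse (Q x) b)] =
      stdForm n ![a, b] := by
    intro x hx a b
    have h3 : ∀ v, Q x (Ring.inverse (Q x) v) = v := fun v => by
      rw [← mul_apply_eq_comp, Ring.mul_inverse_cancel _ (hQu x hx)]
      rfl
    have h4 : K x (Ring.inverse (Q x) a) = Q x a := by
      rw [← (hRK _ hx.1.2).1, mul_apply_eq_comp]
      exact congrArg (Q x) (h3 a)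
    rw [← hσ, ← stdForm_formOp]
    change stdForm n ![K x _, _] = _
    rw [h4, stdForm_symplAdjoint, (hRK _ hx.1.2).2 (hKd x)]
    exact congrArg (fun v => stdForm n ![a, v]) (h3 b)
  -- Outside `V` the value is irrelevant; on `V` the first branch always applies.
  refine ⟨V, fun x => if hx : IsUnit (Ring.inverse (Q x)) then
    (ContinuousLinearEquiv.ofUnit hx.unit).trans S else S, hV, ⟨⟨hx₀, ?_⟩, ?_⟩, fun x hx => hx.1.1,
    ?_, ?_⟩
  · simpa [hK0] using hW1
  · simp [hK0]
  · have : ContinuousOn (fun x => (S : Cn n →L[ℝ] Cn n).comp (Ring.inverse (Q x))) V := by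
      refine continuousOn_const.clm_comp fun x hx => ?_
      obtain ⟨q, hq⟩ := hQu x hx
      have := NormedRing.inverse_continuousAt q
      rw [hq] at this
      exact this.comp_continuousWithinAt ((hQc.mono inter_subset_left) x hx)
    refine this.congr fun x hx => ?_
    have h2 : IsUnit (Ring.inverse (Q x)) := (hQu x hx).ringInverse
    simp only [h2, ↓reduceDIte]
    rfl
  · intro x hx a b
    have h2 : IsUnit (Ring.inverse (Q x)) := (hQu x hx).ringInverse
    simp only [h2, ↓reduceDIte]
    exact key x hx a b

end Darboux

/-! ### Symplectic frames along discs -/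

section Frames

lemma form_comp_pair {E F : Type*} [AddCommGroup E] [Module ℝ E] [TopologicalSpace E]
    [AddCommGroup F] [Module ℝ F] [TopologicalSpace F] (τ : F [⋀^Fin 2]→L[ℝ] ℝ) (f : E →L[ℝ] F)
    (a b : E) : τ.compContinuousLinearMap f ![a, b] = τ ![f a, f b] := by
  change τ _ = _
  congr 1
  ext i; fin_cases i <;> rfl

variable {n : ℕ} {M : Type*} [TopologicalSpace M] [ChartedSpace (Cn n) M]
  [IsManifold 𝓘(ℝ, Cn n) ∞ M]

variable {X : Type*} [TopologicalSpace X]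

/-- The family `Φ` of linear isomorphisms `ℂⁿ → T_{w(x)} M` is continuous on `S`. -/
def IsFrameOn (w : X → M) (Φ : ∀ x, Cn n ≃L[ℝ] TangentSpace 𝓘(ℝ, Cn n) (w x)) (S : Set X) : Prop :=
  ∀ v : Cn n, ContinuousOn (fun x => (⟨w x, Φ x v⟩ : TangentBundle 𝓘(ℝ, Cn n) M)) S

/-- The coordinates on the tangent spaces given by the preferred chart at `p`. -/
def tcoord (n : ℕ) {M : Type*} [TopologicalSpace M] [ChartedSpace (Cn n) M]
    [IsManifold 𝓘(ℝ, Cn n) ∞ M] (p q : M) : TangentSpace 𝓘(ℝ, Cn n) q →L[ℝ] Cn n :=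
  (trivializationAt (Cn n) (TangentSpace 𝓘(ℝ, Cn n)) p).continuousLinearMapAt ℝ q

lemma tcoord_eq_snd {p q : M} (h : q ∈ (chartAt (Cn n) p).source)
    (v : TangentSpace 𝓘(ℝ, Cn n) q) :
    tcoord n p q v = (trivializationAt (Cn n) (TangentSpace 𝓘(ℝ, Cn n)) p ⟨q, v⟩).2 := by
  rw [tcoord, Bundle.Trivialization.continuousLinearMapAt_apply,
    Bundle.Trivialization.coe_linearMapAt_of_mem _ (by simpa using h)]

lemma isInvertible_tcoord {p q : M} (h : q ∈ (chartAt (Cn n) p).source) :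
    (tcoord n p q).IsInvertible :=
  ⟨(trivializationAt (Cn n) (TangentSpace 𝓘(ℝ, Cn n)) p).continuousLinearEquivAt ℝ q
    (by simpa using h), by
    ext1 v
    rw [tcoord_eq_snd h]
    rfl⟩

/-- Continuity into the tangent bundle of a vector field along `w` can thus be tested in one fixed
chart around the point. -/
lemma continuousWithinAt_tcoord_iff {w : X → M} {V : ∀ x, TangentSpace 𝓘(ℝ, Cn n) (w x)}
    {S : Set X} {x₀ : X} {p : M} (hw : ContinuousWithinAt w S x₀)
    (hp : w x₀ ∈ (chartAt (Cn n) p).source) :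
    ContinuousWithinAt (fun x => (⟨w x, V x⟩ : TangentBundle 𝓘(ℝ, Cn n) M)) S x₀ ↔
      ContinuousWithinAt (fun x => tcoord n p (w x) (V x)) S x₀ := by
  have h1 : (⟨w x₀, V x₀⟩ : TangentBundle 𝓘(ℝ, Cn n) M) ∈
      (trivializationAt (Cn n) (TangentSpace 𝓘(ℝ, Cn n)) p).source := by
    rw [Bundle.Trivialization.mem_source]
    simpa using hp
  rw [ContinuousWithinAt,
    (trivializationAt (Cn n) (TangentSpace 𝓘(ℝ, Cn n)) p).tendsto_nhds_iff h1]
  have h2 : ∀ᶠ x in 𝓝[S] x₀, w x ∈ (chartAt (Cn n) p).source :=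
    hw.eventually_mem ((chartAt (Cn n) p).open_source.mem_nhds hp)
  have h3 : Tendsto (fun x => (trivializationAt (Cn n) (TangentSpace 𝓘(ℝ, Cn n)) p
        (⟨w x, V x⟩ : TangentBundle 𝓘(ℝ, Cn n) M)).2) (𝓝[S] x₀)
        (𝓝 (trivializationAt (Cn n) (TangentSpace 𝓘(ℝ, Cn n)) p
        (⟨w x₀, V x₀⟩ : TangentBundle 𝓘(ℝ, Cn n) M)).2) ↔
      ContinuousWithinAt (fun x => tcoord n p (w x) (V x)) S x₀ := by
    rw [ContinuousWithinAt, tcoord_eq_snd hp]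
    exact tendsto_congr' (h2.mono fun x hx => (tcoord_eq_snd hx _).symm)
  rw [h3]
  exact ⟨fun h => h.2, fun h => ⟨hw, h⟩⟩

lemma continuousWithinAt_inverse {E F : Type*} [NormedAddCommGroup E] [NormedSpace ℝ E]
    [CompleteSpace E] [NormedAddCommGroup F] [NormedSpace ℝ F] {f : X → E →L[ℝ] F} {S : Set X}
    {x₀ : X} (hf : ContinuousWithinAt f S x₀) (h : (f x₀).IsInvertible) :
    ContinuousWithinAt (fun x => (f x).inverse) S x₀ := by
  obtain ⟨e, he⟩ := h
  have := (contDiffAt_map_inverse (𝕜 := ℝ) (n := 0) e).continuousAt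
  rw [he] at this
  exact this.comp_continuousWithinAt hf

namespace IsFrameOn

variable {w : X → M} {Φ Φ' : ∀ x, Cn n ≃L[ℝ] TangentSpace 𝓘(ℝ, Cn n) (w x)} {S S' : Set X}

lemma mono (h : IsFrameOn w Φ S) (hS : S' ⊆ S) : IsFrameOn w Φ S' := fun v => (h v).mono hS

lemma coord (h : IsFrameOn w Φ S) (hw : ContinuousOn w S) {x₀ : X} (hx₀ : x₀ ∈ S) {p : M}
    (hp : w x₀ ∈ (chartAt (Cn n) p).source) :
    ContinuousWithinAt (fun x => (tcoord n p (w x)).comp (Φ x : Cn n →L[ℝ] _)) S x₀ := by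
  rw [continuousWithinAt_clm_apply]
  intro v
  exact (continuousWithinAt_tcoord_iff (hw x₀ hx₀) hp).1 (h v x₀ hx₀)

/-- The change of frames. -/
lemma trans_continuousOn (h : IsFrameOn w Φ S) (h' : IsFrameOn w Φ' S) (hw : ContinuousOn w S) :
    ContinuousOn (fun x => (((Φ x).trans (Φ' x).symm : Cn n ≃L[ℝ] Cn n) : Cn n →L[ℝ] Cn n)) S := by
  intro x₀ hx₀
  have hp := mem_chart_source (Cn n) (w x₀)
  have h1 := h.coord hw hx₀ hp
  have h2 := h'.coord hw hx₀ hp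
  have hinv : ∀ x, w x ∈ (chartAt (Cn n) (w x₀)).source →
      ((tcoord n (w x₀) (w x)).comp (Φ' x : Cn n →L[ℝ] _)).IsInvertible := by
    intro x hx
    exact (isInvertible_tcoord hx).comp ⟨Φ' x, rfl⟩
  have h3 := (continuousWithinAt_inverse h2 (hinv x₀ hp)).clm_comp h1
  have key : ∀ x, w x ∈ (chartAt (Cn n) (w x₀)).source →
      (((Φ x).trans (Φ' x).symm : Cn n ≃L[ℝ] Cn n) : Cn n →L[ℝ] Cn n) =
      ((tcoord n (w x₀) (w x)).comp (Φ' x : Cn n →L[ℝ] _)).inverse.comp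
        ((tcoord n (w x₀) (w x)).comp (Φ x : Cn n →L[ℝ] _)) := by
    intro x hx
    obtain ⟨e, he⟩ := isInvertible_tcoord hx
    rw [← he]
    have : ((e : TangentSpace 𝓘(ℝ, Cn n) (w x) →L[ℝ] Cn n).comp (Φ' x : Cn n →L[ℝ] _)).inverse =
        ((Φ' x).trans e).symm := ContinuousLinearMap.inverse_equiv ((Φ' x).trans e)
    rw [this]
    ext1 v
    simp
  refine h3.congr_of_eventuallyEq ?_ (key x₀ hp)
  have h4 : ∀ᶠ x in 𝓝[S] x₀, w x ∈ (chartAt (Cn n) (w x₀)).source :=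
    (hw x₀ hx₀).eventually_mem ((chartAt (Cn n) _).open_source.mem_nhds hp)
  exact h4.mono fun x hx => key x hx

lemma continuousOn_apply (h : IsFrameOn w Φ S) (hw : ContinuousOn w S) {Y : Type*}
    [TopologicalSpace Y] {f : Y → X} {g : Y → Cn n} {T : Set Y} (hf : ContinuousOn f T)
    (hfS : MapsTo f T S) (hg : ContinuousOn g T) :
    ContinuousOn (fun y => (⟨w (f y), Φ (f y) (g y)⟩ : TangentBundle 𝓘(ℝ, Cn n) M)) T := by
  intro y₀ hy₀
  have hp := mem_chart_source (Cn n) (w (f y₀))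
  have h1 := (h.coord hw (hfS hy₀) hp).comp (hf y₀ hy₀) hfS
  rw [continuousWithinAt_tcoord_iff (w := fun y => w (f y)) (V := fun y => Φ (f y) (g y))
    ((hw.comp hf hfS) y₀ hy₀) hp]
  exact h1.clm_apply (hg y₀ hy₀)

end IsFrameOn

/-- Symplectic frames on `S`. -/
structure IsSymplecticFrameOn (Ω : TwoForm n M) (w : X → M)
    (Φ : ∀ x, Cn n ≃L[ℝ] TangentSpace 𝓘(ℝ, Cn n) (w x)) (S : Set X) : Prop where
  isFrameOn : IsFrameOn w Φ S
  form_eq : ∀ x ∈ S, ∀ a b, Ω (w x) ![Φ x a, Φ x b] = stdForm n ![a, b]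

lemma IsSymplecticFrameOn.mono {Ω : TwoForm n M} {w : X → M}
    {Φ : ∀ x, Cn n ≃L[ℝ] TangentSpace 𝓘(ℝ, Cn n) (w x)} {S S' : Set X}
    (h : IsSymplecticFrameOn Ω w Φ S) (hS : S' ⊆ S) : IsSymplecticFrameOn Ω w Φ S' :=
  ⟨h.1.mono hS, fun x hx => h.2 x (hS hx)⟩

open Classical in
-- The frame `Φ₂` is corrected by the transition `Φ₂⁻¹ Φ₁` evaluated at `r x`. This transition is a
-- linear symplectomorphism of `ℂⁿ`, defined on all of `S₂` since `r` maps into the overlap, and on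
-- the overlap the corrected frame is `Φ₁` because `r` fixes it.
lemma IsSymplecticFrameOn.glue {Ω : TwoForm n M} {w : X → M} (hw : Continuous w)
    {Φ₁ Φ₂ : ∀ x, Cn n ≃L[ℝ] TangentSpace 𝓘(ℝ, Cn n) (w x)} {S₁ S₂ : Set X}
    (h₁ : IsSymplecticFrameOn Ω w Φ₁ S₁) (h₂ : IsSymplecticFrameOn Ω w Φ₂ S₂)
    (hS₁ : IsClosed S₁) (hS₂ : IsClosed S₂) (r : X → X) (hr : Continuous r)
    (hr₂ : MapsTo r S₂ (S₁ ∩ S₂)) (hr₁ : ∀ x ∈ S₁ ∩ S₂, r x = x) :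
    ∃ Φ, IsSymplecticFrameOn Ω w Φ (S₁ ∪ S₂) := by
  let Ψ : ∀ x, Cn n ≃L[ℝ] TangentSpace 𝓘(ℝ, Cn n) (w x) := fun x =>
    ((Φ₁ (r x)).trans (Φ₂ (r x)).symm).trans (Φ₂ x)
  have hΨ : ∀ x ∈ S₁ ∩ S₂, Ψ x = Φ₁ x := by
    intro x hx
    refine ContinuousLinearEquiv.ext (funext fun v => ?_)
    have : ∀ y, y = x → Φ₂ x ((Φ₂ y).symm (Φ₁ y v)) = Φ₁ x v := by
      rintro _ rfl
      simp
    exact this _ (hr₁ x hx)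
  have hg : ContinuousOn (fun x => (((Φ₁ (r x)).trans (Φ₂ (r x)).symm : Cn n ≃L[ℝ] Cn n) :
      Cn n →L[ℝ] Cn n)) S₂ :=
    (IsFrameOn.trans_continuousOn (h₁.1.mono inter_subset_left) (h₂.1.mono inter_subset_right)
      hw.continuousOn).comp hr.continuousOn hr₂
  have hΨc : IsFrameOn w Ψ S₂ := by
    intro v
    exact h₂.1.continuousOn_apply hw.continuousOn continuousOn_id (mapsTo_id _)
      (hg.clm_apply (continuousOn_const (c := v)))
  refine ⟨fun x => if x ∈ S₁ then Φ₁ x else Ψ x, fun v => ?_, ?_⟩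
  · refine ContinuousOn.union_of_isClosed ?_ ?_ hS₁ hS₂
    · refine (h₁.1 v).congr fun x hx => ?_
      simp only [hx, if_true]
    · refine (hΨc v).congr fun x hx => ?_
      by_cases h : x ∈ S₁
      · simp only [h, if_true]
        rw [hΨ x ⟨h, hx⟩]
      · simp only [h, if_false]
  · intro x hx a b
    by_cases h : x ∈ S₁
    · simp only [h, if_true]
      exact h₁.2 x h a b
    · simp only [h, if_false]
      have hx₂ : x ∈ S₂ := hx.resolve_left h
      have h3 := h₂.2 x hx₂ ((Φ₂ (r x)).symm (Φ₁ (r x) a)) ((Φ₂ (r x)).symm (Φ₁ (r x) b))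
      have h4 := h₂.2 _ (hr₂ hx₂).2 ((Φ₂ (r x)).symm (Φ₁ (r x) a)) ((Φ₂ (r x)).symm (Φ₁ (r x) b))
      simp only [ContinuousLinearEquiv.apply_symm_apply] at h4
      exact (h3.trans h4.symm).trans (h₁.2 _ (hr₂ hx₂).1 a b)

/-- Symplectic frames exist locally. -/
lemma exists_isSymplecticFrameOn_nhds {Ω : TwoForm n M} (hΩ : IsSymplecticForm Ω) {w : X → M}
    (hw : Continuous w) (x₀ : X) :
    ∃ V : Set X, IsOpen V ∧ x₀ ∈ V ∧ ∃ Φ, IsSymplecticFrameOn Ω w Φ V := by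
  set φ := chartAt (Cn n) (w x₀) with hφ
  let e : ∀ q : M, Cn n →L[ℝ] TangentSpace 𝓘(ℝ, Cn n) q := fun q =>
    (trivializationAt (Cn n) (TangentSpace 𝓘(ℝ, Cn n)) (w x₀)).symmL ℝ q
  have he : ∀ q ∈ φ.source, e q = mfderiv 𝓘(ℝ, Cn n) 𝓘(ℝ, Cn n) φ.symm (φ q) := by
    intro q hq
    have := TangentBundle.symmL_trivializationAt (I := 𝓘(ℝ, Cn n)) hq
    simpa [mfderivWithin_univ] using this
  let τ : X → Cn n [⋀^Fin 2]→L[ℝ] ℝ := fun x => (Ω (w x)).compContinuousLinearMap (e (w x))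
  let U := w ⁻¹' φ.source
  have hU : IsOpen U := φ.open_source.preimage hw
  have hτc : ContinuousOn τ U := by
    have h1 : ContinuousOn (fun x => Ω.inChart φ (φ (w x))) U :=
      (hΩ.smooth φ (chart_mem_atlas _ _)).continuousOn.comp
        (φ.continuousOn.comp hw.continuousOn (mapsTo_preimage _ _))
        (fun x hx => φ.map_source hx)
    refine h1.congr fun x hx => ?_
    simp only [τ, TwoForm.inChart]
    rw [he _ hx, φ.left_inv hx]
  -- Outside the chart domain some isomorphism must still be named; the identity of `ℂⁿ` serves.
  have hei : ∀ q, ∃ E : Cn n ≃L[ℝ] TangentSpace 𝓘(ℝ, Cn n) q, q ∈ φ.source →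
      (E : Cn n →L[ℝ] TangentSpace 𝓘(ℝ, Cn n) q) = e q ∧ ∀ v, tcoord n (w x₀) q (E v) = v := by
    intro q
    by_cases hq : q ∈ φ.source
    swap
    · exact ⟨ContinuousLinearEquiv.refl ℝ (Cn n), fun h => absurd h hq⟩
    have hb : q ∈ (trivializationAt (Cn n) (TangentSpace 𝓘(ℝ, Cn n)) (w x₀)).baseSet := by
      simpa using hq
    refine ⟨((trivializationAt (Cn n) (TangentSpace 𝓘(ℝ, Cn n)) (w x₀)).continuousLinearEquivAt
      ℝ q hb).symm, fun _ => ⟨?_, fun v => ?_⟩⟩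
    · ext1 v
      exact congrFun (Bundle.Trivialization.symm_continuousLinearEquivAt_eq _ hb) v
    · have h2 := congrFun (Bundle.Trivialization.symm_continuousLinearEquivAt_eq (R := ℝ)
        (trivializationAt (Cn n) (TangentSpace 𝓘(ℝ, Cn n)) (w x₀)) hb) v
      rw [h2]
      exact Bundle.Trivialization.continuousLinearMapAt_symmL _ hb v
  choose E hEE using hei
  have hE := fun q hq => (hEE q hq).1
  have hE' := fun q hq => (hEE q hq).2
  obtain ⟨V, Θ, hV, hx₀V, hVU, hΘ, hΘτ⟩ := exists_local_symplectic_frame hU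
    (fun a b => (continuous_eval_const ![a, b]).comp_continuousOn hτc)
    (mem_chart_source (Cn n) (w x₀)) (fun a ha => by
      have hx := mem_chart_source (Cn n) (w x₀)
      obtain ⟨b, hb⟩ := hΩ.nondegenerate (w x₀) (E (w x₀) a) (by simpa using ha)
      refine ⟨(E (w x₀)).symm b, ?_⟩
      rw [form_comp_pair, ← hE _ hx]
      simpa using hb)
  refine ⟨V, hV, hx₀V, fun x => (Θ x).trans (E (w x)), fun v x hx => ?_, fun x hx a b => ?_⟩
  · rw [continuousWithinAt_tcoord_iff hw.continuousWithinAt (hVU hx)]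
    refine ((hΘ.clm_apply (continuousOn_const (c := v))) x hx).congr (fun y hy => ?_) ?_
    · exact hE' _ (hVU hy) _
    · exact hE' _ (hVU hx) _
  · have h1 := hΘτ x hx a b
    rw [form_comp_pair, ← hE _ (hVU hx)] at h1
    exact h1

open unitInterval in
/-- Symplectic frames exist on squares. -/
lemma exists_isSymplecticFrameOn_square {Ω : TwoForm n M} (hΩ : IsSymplecticForm Ω)
    {w : I × I → M} (hw : Continuous w) : ∃ Φ, IsSymplecticFrameOn Ω w Φ univ := by
  choose V hV hxV Φ hΦ using exists_isSymplecticFrameOn_nhds hΩ hw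
  -- A Lebesgue number subdivision: each cell of the grid lies in the domain of one local frame, and
  -- the grid points are `1` from the index `N` on.
  obtain ⟨t, ht0, htm, ⟨N, hN⟩, hcell⟩ := exists_monotone_Icc_subset_open_cover_unitInterval_prod_self
    hV (fun x _ => mem_iUnion.2 ⟨x, hxV x⟩)
  have hcell' : ∀ k m, ∃ Φ, IsSymplecticFrameOn Ω w Φ
      (Icc (t k) (t (k + 1)) ×ˢ Icc (t m) (t (m + 1))) := by
    intro k m
    obtain ⟨i, hi⟩ := hcell k m
    exact ⟨_, (hΦ i).mono hi⟩
  -- Cells are glued into rows and then rows into the square; each new piece is retracted onto the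
  -- edge it shares with the old ones.
  have hrow : ∀ m k, ∃ Φ, IsSymplecticFrameOn Ω w Φ (Icc 0 (t k) ×ˢ Icc (t m) (t (m + 1))) := by
    intro m k
    induction k with
    | zero =>
      obtain ⟨Φ, h⟩ := hcell' 0 m
      refine ⟨Φ, h.mono (prod_mono ?_ subset_rfl)⟩
      rw [ht0]
      exact Icc_subset_Icc le_rfl nonneg'
    | succ k ih =>
      obtain ⟨Φ₁, h₁⟩ := ih
      obtain ⟨Φ₂, h₂⟩ := hcell' k m
      obtain ⟨Φ, h⟩ := h₁.glue hw h₂ (isClosed_Icc.prod isClosed_Icc)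
        (isClosed_Icc.prod isClosed_Icc) (fun x => (t k, x.2)) (by fun_prop)
        (by
          rintro ⟨x, y⟩ ⟨hx, hy⟩
          exact ⟨⟨⟨nonneg', le_rfl⟩, hy⟩, ⟨⟨le_rfl, htm k.le_succ⟩, hy⟩⟩)
        (by
          rintro ⟨x, y⟩ ⟨⟨hx, -⟩, ⟨hx', -⟩⟩
          exact Prod.ext (le_antisymm hx'.1 hx.2) rfl)
      rw [← union_prod, Icc_union_Icc_eq_Icc nonneg' (htm k.le_succ)] at h
      exact ⟨Φ, h⟩
  have hall : ∀ m, ∃ Φ, IsSymplecticFrameOn Ω w Φ (univ ×ˢ Icc 0 (t m)) := by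
    intro m
    have huniv : Icc 0 (t N) = univ := by
      rw [hN N le_rfl]
      exact eq_univ_of_forall fun x => ⟨nonneg', le_one'⟩
    induction m with
    | zero =>
      obtain ⟨Φ, h⟩ := hrow 0 N
      refine ⟨Φ, h.mono (prod_mono huniv.ge ?_)⟩
      rw [ht0]
      exact Icc_subset_Icc le_rfl nonneg'
    | succ m ih =>
      obtain ⟨Φ₁, h₁⟩ := ih
      obtain ⟨Φ₂, h₂⟩ := hrow m N
      rw [huniv] at h₂
      obtain ⟨Φ, h⟩ := h₁.glue hw h₂ (isClosed_univ.prod isClosed_Icc)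
        (isClosed_univ.prod isClosed_Icc) (fun x => (x.1, t m)) (by fun_prop)
        (by
          rintro ⟨x, y⟩ ⟨hx, hy⟩
          exact ⟨⟨mem_univ _, ⟨nonneg', le_rfl⟩⟩, ⟨mem_univ _, ⟨le_rfl, htm m.le_succ⟩⟩⟩)
        (by
          rintro ⟨x, y⟩ ⟨⟨-, hx⟩, ⟨-, hx'⟩⟩
          exact Prod.ext rfl (le_antisymm hx'.1 hx.2))
      rw [← prod_union, Icc_union_Icc_eq_Icc nonneg' (htm m.le_succ)] at h
      exact ⟨Φ, h⟩
  obtain ⟨Φ, h⟩ := hall N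
  refine ⟨Φ, h.mono fun x _ => ⟨mem_univ _, nonneg', ?_⟩⟩
  rw [hN N le_rfl]
  exact le_one'

/-- Symplectic frames exist along discs. -/
lemma exists_isSymplecticFrameOn_disc {Ω : TwoForm n M} (hΩ : IsSymplecticForm Ω) {u : ℂ → M}
    (hu : ContinuousOn u (Metric.closedBall 0 1)) :
    ∃ Φ, IsSymplecticFrameOn Ω u Φ (Metric.closedBall 0 1) := by
  -- The disc sits in the square `[-1, 1]²`, and `ret` pushes the plane back to the disc. So `u`
  -- extends to a continuous map of the square, whose frame restricts to the disc.
  let ret : ℂ → ℂ := fun z => (max 1 ‖z‖ : ℝ)⁻¹ • z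
  have hpos : ∀ z : ℂ, 0 < max 1 ‖z‖ := fun z => lt_max_of_lt_left one_pos
  have hret : Continuous ret := by
    refine Continuous.smul (Continuous.inv₀ (by fun_prop) fun z => (hpos z).ne') continuous_id
  have hretm : ∀ z, ret z ∈ Metric.closedBall (0 : ℂ) 1 := by
    intro z
    rw [mem_closedBall_zero_iff, norm_smul, norm_inv, Real.norm_of_nonneg (hpos z).le,
      inv_mul_le_iff₀ (hpos z), mul_one]
    exact le_max_right _ _
  have hrete : ∀ z ∈ Metric.closedBall (0 : ℂ) 1, ret z = z := by
    intro z hz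
    rw [mem_closedBall_zero_iff] at hz
    simp [ret, max_eq_left hz]
  let sq : unitInterval × unitInterval → ℂ := fun p => ⟨2 * p.1 - 1, 2 * p.2 - 1⟩
  have hsq : Continuous sq :=
    Complex.equivRealProdCLM.symm.continuous.comp
      (f := fun p : unitInterval × unitInterval => ((2 * p.1 - 1 : ℝ), (2 * p.2 - 1 : ℝ)))
      (by fun_prop)
  let σ : ℂ → unitInterval × unitInterval := fun z =>
    (projIcc 0 1 zero_le_one ((z.re + 1) / 2), projIcc 0 1 zero_le_one ((z.im + 1) / 2))
  have hσ : Continuous σ := (continuous_projIcc.comp (by fun_prop)).prodMk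
    (continuous_projIcc.comp (by fun_prop))
  have hsσ : ∀ z ∈ Metric.closedBall (0 : ℂ) 1, sq (σ z) = z := by
    intro z hz
    rw [mem_closedBall_zero_iff] at hz
    have h1 := abs_le.1 ((Complex.abs_re_le_norm z).trans hz)
    have h2 := abs_le.1 ((Complex.abs_im_le_norm z).trans hz)
    have e1 : (z.re + 1) / 2 ∈ Icc (0 : ℝ) 1 := ⟨by linarith, by linarith⟩
    have e2 : (z.im + 1) / 2 ∈ Icc (0 : ℝ) 1 := ⟨by linarith, by linarith⟩
    simp only [sq, σ, projIcc_of_mem zero_le_one e1, projIcc_of_mem zero_le_one e2]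
    apply Complex.ext
    · change 2 * ((z.re + 1) / 2) - 1 = z.re
      ring
    · change 2 * ((z.im + 1) / 2) - 1 = z.im
      ring
  let w : unitInterval × unitInterval → M := fun p => u (ret (sq p))
  have hw : Continuous w := hu.comp_continuous (hret.comp hsq) fun p => hretm _
  obtain ⟨Φ, hΦ⟩ := exists_isSymplecticFrameOn_square hΩ hw
  have hwσ : ∀ z ∈ Metric.closedBall (0 : ℂ) 1, w (σ z) = u z := by
    intro z hz
    simp only [w, hsσ z hz, hrete z hz]
  have key : ∀ (p q : M), p = q → ∀ v : Cn n, (⟨p, v⟩ : TangentBundle 𝓘(ℝ, Cn n) M) = ⟨q, v⟩ := by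
    rintro p _ rfl v
    rfl
  have key2 : ∀ (p q : M), p = q → ∀ a b : Cn n, Ω p ![a, b] = Ω q ![a, b] := by
    rintro p _ rfl a b
    rfl
  -- All tangent spaces are by definition `Cn n`, so the frame at `w (σ z)` can be reused at the
  -- equal point `u z`.
  refine ⟨fun z => (Φ (σ z) : Cn n ≃L[ℝ] Cn n), fun v => ?_, fun z hz a b => ?_⟩
  · refine ((hΦ.1 v).comp hσ.continuousOn (mapsTo_univ σ (Metric.closedBall 0 1))).congr
      fun z hz => ?_
    exact (key _ _ (hwσ z hz) _).symm
  · exact (key2 _ _ (hwσ z hz) _ _).symm.trans (hΦ.2 (σ z) (mem_univ _) a b)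

end Frames

/-! ### Loops of Lagrangian subspaces -/

section LagrangianLoops

variable {n : ℕ}

/-- The matrix with the rows `v i`. -/
def rowMatrix (v : Fin n → Cn n) : Matrix (Fin n) (Fin n) ℂ := Matrix.of fun i k => v i k

lemma continuous_rowMatrix : Continuous (rowMatrix : (Fin n → Cn n) → _) := by
  refine continuous_matrix fun i k => ?_
  exact ((EuclideanSpace.proj k : Cn n →L[ℂ] ℂ).continuous).comp (continuous_apply i)

lemma sum_coe_smul (g : Fin n → ℝ) (v : Fin n → Cn n) (k : Fin n) :
    (∑ j, g j • v j) k = ∑ j, (g j : ℂ) * v j k := by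
  simp

/-- A change of real basis commutes with every real-linear map, so it multiplies all these
determinants by the same real factor. Hence their ratios depend only on the spanned subspace. -/
lemma rowMatrix_map (g : Matrix (Fin n) (Fin n) ℝ) {v v' : Fin n → Cn n}
    (h : ∀ i, v' i = ∑ j, g i j • v j) (A : Cn n →L[ℝ] Cn n) :
    (rowMatrix fun i => A (v' i)).det = (g.map Complex.ofReal).det *
      (rowMatrix fun i => A (v i)).det := by
  rw [← Matrix.det_mul]
  congr 1
  ext i k
  simp only [rowMatrix, Matrix.of_apply, Matrix.mul_apply, Matrix.map_apply, h, map_sum, map_smul]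
  exact sum_coe_smul _ _ _

lemma det_linPart_eq (X : Cn n →L[ℂ] Cn n) (v : Fin n → Cn n) :
    (rowMatrix fun i => X (v i)).det = X.det * (rowMatrix v).det := by
  have h1 : X.det = (LinearMap.toMatrix (EuclideanSpace.basisFun (Fin n) ℂ).toBasis
      (EuclideanSpace.basisFun (Fin n) ℂ).toBasis (X : Cn n →ₗ[ℂ] Cn n)).det :=
    (LinearMap.det_toMatrix _ _).symm
  rw [h1, ← Matrix.det_transpose, ← Matrix.det_transpose (rowMatrix v), ← Matrix.det_mul]
  congr 1
  ext k i
  have h2 := congrFun (LinearMap.toMatrix_mulVec_repr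
    (EuclideanSpace.basisFun (Fin n) ℂ).toBasis (EuclideanSpace.basisFun (Fin n) ℂ).toBasis
    (X : Cn n →ₗ[ℂ] Cn n) (v i)) k
  simpa [rowMatrix, Matrix.mul_apply, Matrix.mulVec, dotProduct] using h2.symm

/-- The homotopy from the complex-linear part of `A` to `A`. -/
def partialAnti (A : Cn n →L[ℝ] Cn n) (s : ℝ) : Cn n →L[ℝ] Cn n :=
  (linPart A).restrictScalars ℝ + s • antiPart A

lemma partialAnti_apply (A : Cn n →L[ℝ] Cn n) (s : ℝ) (v : Cn n) :
    partialAnti A s v = linPart A v + s • antiPart A v := rfl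

lemma partialAnti_one (A : Cn n →L[ℝ] Cn n) : partialAnti A 1 = A := by
  ext1 v
  rw [partialAnti_apply, one_smul, linPart_add_antiPart]

lemma continuous_partialAnti :
    Continuous fun p : (Cn n →L[ℝ] Cn n) × ℝ => partialAnti p.1 p.2 :=
  (((ContinuousLinearMap.restrictScalarsL ℂ (Cn n) (Cn n) ℝ ℝ).continuous.comp
    continuous_linPart).comp continuous_fst).add
    (continuous_snd.smul (continuous_antiPart.comp continuous_fst))

lemma complex_smul_eq (c : ℂ) (w : Cn n) : c • w = c.re • w + c.im • Complex.I • w := by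
  conv_lhs => rw [← Complex.re_add_im c]
  rw [add_smul, mul_smul, Complex.coe_smul, Complex.coe_smul]

lemma antiPart_smul (A : Cn n →L[ℝ] Cn n) (c : ℂ) (w : Cn n) :
    antiPart A (c • w) = (starRingEnd ℂ c) • antiPart A w := by
  rw [complex_smul_eq, complex_smul_eq (starRingEnd ℂ c), map_add, map_smul, map_smul,
    antiPart_I_smul]
  simp

lemma norm_sq_add_I_smul (p q : Cn n) :
    ‖p + Complex.I • q‖ ^ 2 = ‖p‖ ^ 2 + ‖q‖ ^ 2 - 2 * stdForm n ![p, q] := by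
  rw [@norm_add_sq ℂ, norm_smul, Complex.norm_I, one_mul, inner_smul_right, stdForm_apply]
  simp
  ring

/-- A complex relation with coefficients `c i` among the image vectors says that the linear part of
`A` at `a = ∑ c i v i` is `-s` times the antilinear part at `b`, the same sum with conjugated
coefficients. Writing `a = p + iq` and `b = p - iq`, isotropy of the span gives `|a| = |b|`. The
contraction property forces `a = 0`, then `p = q = 0`, and real independence kills the coefficients.
-/
lemma IsSympl.det_partialAnti_ne_zero {A : Cn n →L[ℝ] Cn n} (hA : IsSympl A) {v : Fin n → Cn n}
    (hv : LinearIndependent ℝ v) (hiso : ∀ i j, stdForm n ![v i, v j] = 0) {s : ℝ}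
    (hs : s ∈ Icc (0 : ℝ) 1) : (rowMatrix fun i => partialAnti A s (v i)).det ≠ 0 := by
  intro h0
  obtain ⟨c, hc, hcM⟩ := Matrix.exists_vecMul_eq_zero_iff.2 h0
  let p := ∑ i, (c i).re • v i
  let q := ∑ i, (c i).im • v i
  have hpq : stdForm n ![p, q] = 0 := by
    have : formBilin (stdForm n) p q = 0 := by
      simp only [p, q, map_sum, LinearMap.sum_apply, map_smul, LinearMap.smul_apply]
      refine Finset.sum_eq_zero fun i _ => ?_
      rw [Finset.sum_eq_zero, smul_zero]
      intro j _
      rw [show formBilin (stdForm n) (v j) (v i) = 0 from hiso _ _]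
      simp
    exact this
  have ha : ∑ i, c i • v i = p + Complex.I • q := by
    simp only [p, q, Finset.smul_sum, ← Finset.sum_add_distrib]
    refine Finset.sum_congr rfl fun i _ => ?_
    rw [complex_smul_eq, smul_comm]
  have hb : ∑ i, (starRingEnd ℂ (c i)) • v i = p + Complex.I • (-q) := by
    simp only [p, q, smul_neg, Finset.smul_sum, ← sub_eq_add_neg, ← Finset.sum_sub_distrib]
    refine Finset.sum_congr rfl fun i _ => ?_
    rw [complex_smul_eq, smul_comm]
    simp [sub_eq_add_neg]
  have hna := norm_sq_add_I_smul p q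
  have hnb := norm_sq_add_I_smul p (-q)
  rw [form_neg_right, norm_neg] at hnb
  rw [hpq] at hna hnb
  have hzero : ∑ i, c i • partialAnti A s (v i) = 0 := by
    ext k
    have := congrFun hcM k
    simpa [Matrix.vecMul, dotProduct, rowMatrix] using this
  have h1 : linPart A (p + Complex.I • q) = -(s • antiPart A (p + Complex.I • (-q))) := by
    rw [← ha, ← hb, map_sum, map_sum, eq_neg_iff_add_eq_zero, Finset.smul_sum,
      ← Finset.sum_add_distrib, ← hzero]
    refine Finset.sum_congr rfl fun i _ => ?_
    rw [partialAnti_apply, map_smul, antiPart_smul, Complex.conj_conj, smul_add, smul_comm s]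
  have h2 := hA.eq_zero_of_linPart_eq hs.1 hs.2 (a := p + Complex.I • q)
    (b := p + Complex.I • (-q)) (by
      refine le_of_sq_le_sq ?_ (norm_nonneg _)
      rw [hna, hnb]
      simp) h1
  rw [h2, norm_zero] at hna
  have hp : p = 0 := by
    have : ‖p‖ = 0 := by nlinarith [norm_nonneg p, norm_nonneg q]
    simpa using this
  have hq : q = 0 := by
    have : ‖q‖ = 0 := by nlinarith [norm_nonneg p, norm_nonneg q]
    simpa using this
  rw [Fintype.linearIndependent_iff] at hv
  exact hc (funext fun i => Complex.ext (hv _ hp i) (hv _ hq i))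

lemma isSympl_id : IsSympl (ContinuousLinearMap.id ℝ (Cn n)) := fun _ _ => rfl

lemma det_rowMatrix_ne_zero {v : Fin n → Cn n}
    (hv : LinearIndependent ℝ v) (hiso : ∀ i j, stdForm n ![v i, v j] = 0) :
    (rowMatrix v).det ≠ 0 := by
  have := isSympl_id.det_partialAnti_ne_zero hv hiso (s := 1) (by simp)
  rwa [partialAnti_one] at this

/-- Continuous loops of Lagrangian subspaces of `ℂⁿ`. -/
structure IsLagrangianLoop (Λ : ℝ → Set (Cn n)) : Prop where
  frame : ∀ θ₀, ∃ v : ℝ → Fin n → Cn n, ContinuousAt v θ₀ ∧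
    ∀ᶠ θ in 𝓝 θ₀, LinearIndependent ℝ (v θ) ∧ Λ θ = Submodule.span ℝ (range (v θ))
  isotropic : ∀ θ, ∀ a ∈ Λ θ, ∀ b ∈ Λ θ, stdForm n ![a, b] = 0
  periodic : Λ (2 * Real.pi) = Λ 0

/-- `φ` is a continuous argument of `det²` along the path `Λ` of Lagrangian subspaces. -/
def HasPhase (Λ : ℝ → Set (Cn n)) (φ : ℝ → ℝ) : Prop :=
  Continuous φ ∧ ∀ (θ : ℝ) (v : Fin n → Cn n), LinearIndependent ℝ v → (∀ i, v i ∈ Λ θ) →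
    (rowMatrix v).det ^ 2 = (‖(rowMatrix v).det‖ : ℂ) ^ 2 * Complex.exp (φ θ * Complex.I)

namespace IsLagrangianLoop

variable {Λ : ℝ → Set (Cn n)}

lemma exists_frame (hΛ : IsLagrangianLoop Λ) (θ : ℝ) :
    ∃ v : Fin n → Cn n, LinearIndependent ℝ v ∧ Λ θ = Submodule.span ℝ (range v) := by
  obtain ⟨v, -, h⟩ := hΛ.frame θ
  exact ⟨v θ, h.self_of_nhds⟩

lemma det_ne_zero (hΛ : IsLagrangianLoop Λ) {θ : ℝ} {v : Fin n → Cn n}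
    (hv : LinearIndependent ℝ v) (hvΛ : ∀ i, v i ∈ Λ θ) : (rowMatrix v).det ≠ 0 :=
  det_rowMatrix_ne_zero hv fun i j => hΛ.isotropic θ _ (hvΛ i) _ (hvΛ j)

lemma mem_of_span {v : Fin n → Cn n} {θ : ℝ} (h : Λ θ = Submodule.span ℝ (range v)) (i : Fin n) :
    v i ∈ Λ θ := by
  rw [h]
  exact Submodule.subset_span (mem_range_self i)

lemma exists_matrix {v v' : Fin n → Cn n} {θ : ℝ} (h : Λ θ = Submodule.span ℝ (range v))
    (hv' : ∀ i, v' i ∈ Λ θ) : ∃ g : Matrix (Fin n) (Fin n) ℝ, ∀ i, v' i = ∑ j, g i j • v j := by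
  have : ∀ i, ∃ c : Fin n → ℝ, ∑ j, c j • v j = v' i := by
    intro i
    have := hv' i
    rw [h] at this
    exact (Submodule.mem_span_range_iff_exists_fun ℝ).1 this
  choose g hg using this
  exact ⟨g, fun i => (hg i).symm⟩

/-- The ratio of the determinants of `A v` and `v`, where `v` is a basis of `Λ θ`. -/
def ratio (hΛ : IsLagrangianLoop Λ) (A : Cn n →L[ℝ] Cn n) (θ : ℝ) : ℂ :=
  (rowMatrix fun i => A ((hΛ.exists_frame θ).choose i)).det /
    (rowMatrix (hΛ.exists_frame θ).choose).det

lemma ratio_eq (hΛ : IsLagrangianLoop Λ) (A : Cn n →L[ℝ] Cn n) {θ : ℝ} {v : Fin n → Cn n}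
    (hv : LinearIndependent ℝ v) (hvΛ : ∀ i, v i ∈ Λ θ) :
    hΛ.ratio A θ = (rowMatrix fun i => A (v i)).det / (rowMatrix v).det := by
  obtain ⟨h1, h2⟩ := (hΛ.exists_frame θ).choose_spec
  obtain ⟨g, hg⟩ := exists_matrix h2 hvΛ
  have h3 := rowMatrix_map g hg A
  have h4 := rowMatrix_map g hg (ContinuousLinearMap.id ℝ (Cn n))
  simp only [ContinuousLinearMap.id_apply] at h4
  have h5 := hΛ.det_ne_zero hv hvΛ
  change (rowMatrix v).det = _ * (rowMatrix (hΛ.exists_frame θ).choose).det at h4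
  have h6 : (g.map Complex.ofReal).det ≠ 0 := by
    intro h
    rw [h, zero_mul] at h4
    exact h5 h4
  rw [h3, h4, mul_div_mul_left _ _ h6, ratio]

lemma exists_hasPhase (hΛ : IsLagrangianLoop Λ) :
    ∃ (φ : ℝ → ℝ) (k : ℤ), HasPhase Λ φ ∧ φ (2 * Real.pi) = φ 0 + 2 * Real.pi * k := by
  -- A real change of basis multiplies the determinant by a real number `g`, and `g² = |g|²`, so `D`
  -- depends only on the subspace.
  let D : (Fin n → Cn n) → ℂ := fun v => (rowMatrix v).det ^ 2 / (‖(rowMatrix v).det‖ : ℂ) ^ 2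
  have hDc : ∀ v, (rowMatrix v).det ≠ 0 → ContinuousAt D v := by
    intro v hv
    have h1 : Continuous fun v : Fin n → Cn n => (rowMatrix v).det := continuous_rowMatrix.matrix_det
    refine ContinuousAt.div (h1.pow 2).continuousAt
      ((Complex.continuous_ofReal.comp h1.norm).pow 2).continuousAt ?_
    simpa using hv
  have hDeq : ∀ {θ v v'}, Λ θ = Submodule.span ℝ (range v) → LinearIndependent ℝ v' →
      (∀ i, v' i ∈ Λ θ) → D v' = D v := by
    intro θ v v' h hv' hv'Λ
    obtain ⟨g, hg⟩ := exists_matrix h hv'Λ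
    have h4 : (rowMatrix v').det = _ * (rowMatrix v).det :=
      rowMatrix_map g hg (ContinuousLinearMap.id ℝ (Cn n))
    have h5 := hΛ.det_ne_zero hv' hv'Λ
    have h6 : (g.map Complex.ofReal).det ≠ 0 := by
      intro h
      rw [h, zero_mul] at h4
      exact h5 h4
    have h7 : (g.map Complex.ofReal).det = (g.det : ℂ) := by
      exact (RingHom.map_det Complex.ofRealHom g).symm
    have h8 : ((‖(g.det : ℂ)‖ : ℝ) : ℂ) ^ 2 = (g.det : ℂ) ^ 2 := by
      rw [Complex.norm_real, Real.norm_eq_abs, ← Complex.ofReal_pow, sq_abs, Complex.ofReal_pow]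
    simp only [D]
    rw [h4, h7, norm_mul, Complex.ofReal_mul, mul_pow, mul_pow, h8]
    rw [h7] at h6
    exact mul_div_mul_left _ _ (pow_ne_zero 2 h6)
  choose f hf1 hf2 using hΛ.exists_frame
  have hfm := fun θ i => mem_of_span (hf2 θ) i
  have hDnorm : ∀ θ, ‖D (f θ)‖ = 1 := by
    intro θ
    have := hΛ.det_ne_zero (hf1 θ) (hfm θ)
    simp only [D, norm_div, norm_pow, Complex.norm_real, norm_norm]
    exact div_self (pow_ne_zero 2 (norm_ne_zero_iff.2 this))
  have hc : Continuous fun θ => D (f θ) := by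
    rw [continuous_iff_continuousAt]
    intro θ₀
    obtain ⟨v, hv, hev⟩ := hΛ.frame θ₀
    have h0 := hev.self_of_nhds
    have h1 : ContinuousAt (fun θ => D (v θ)) θ₀ :=
      ContinuousAt.comp (f := v) (hDc _ (hΛ.det_ne_zero h0.1 (mem_of_span h0.2))) hv
    refine h1.congr (hev.mono fun θ hθ => ?_)
    exact hDeq (hf2 θ) hθ.1 (mem_of_span hθ.2)
  obtain ⟨φ, hφ, hφD⟩ := exists_continuous_arg hc (fun θ h => by
    have := hDnorm θ
    rw [h, norm_zero] at this
    exact zero_ne_one this)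
  replace hφD : ∀ θ, D (f θ) = Complex.exp (φ θ * Complex.I) := fun θ => by
    have h := hφD θ
    rwa [hDnorm, Complex.ofReal_one, one_mul] at h
  have hper : D (f (2 * Real.pi)) = D (f 0) :=
    hDeq (θ := 0) (hf2 0) (hf1 _) fun i => hΛ.periodic ▸ hfm _ i
  have hk : ∃ k : ℤ, φ (2 * Real.pi) = φ 0 + 2 * Real.pi * k := by
    have h1 := hφD (2 * Real.pi)
    rw [hper, hφD 0] at h1
    obtain ⟨k, hk⟩ := Complex.exp_eq_exp_iff_exists_int.1 h1.symm
    refine ⟨k, ?_⟩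
    have h2 := congrArg Complex.im hk
    simp at h2
    linarith
  obtain ⟨k, hk⟩ := hk
  refine ⟨φ, k, ⟨hφ, fun θ v hv hvΛ => ?_⟩, hk⟩
  have h1 := hDeq (hf2 θ) hv hvΛ
  rw [hφD] at h1
  have h2 : ((‖(rowMatrix v).det‖ : ℝ) : ℂ) ^ 2 ≠ 0 := by
    simpa using hΛ.det_ne_zero hv hvΛ
  rw [← h1]
  exact (mul_div_cancel₀ _ h2).symm

/-- The phase of a loop of Lagrangian subspaces after a change of symplectic frames. -/
lemma phase_comparison (hΛ : IsLagrangianLoop Λ) {Λ' : ℝ → Set (Cn n)} {A : ℝ → Cn n →L[ℝ] Cn n}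
    (hA : Continuous A) (hAs : ∀ θ, IsSympl (A θ)) (hAp : A (2 * Real.pi) = A 0)
    (hAΛ : ∀ θ, ∀ v ∈ Λ θ, A θ v ∈ Λ' θ) {φ φ' : ℝ → ℝ} (hφ : HasPhase Λ φ)
    (hφ' : HasPhase Λ' φ') {a : ℝ} (ha : HasArgVar (fun θ => cdet (A θ)) a) :
    φ' (2 * Real.pi) - φ' 0 = φ (2 * Real.pi) - φ 0 + 2 * a := by
  -- At `s = 0` this is the complex determinant of `A θ`, and at `s = 1` it is the quotient of the
  -- determinants of a basis of `Λ θ` after and before applying `A θ`.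
  let H : ℝ → ℝ → ℂ := fun s θ => hΛ.ratio (partialAnti (A θ) s) θ
  have hH0 : ∀ s ∈ Icc (0 : ℝ) 1, ∀ θ, H s θ ≠ 0 := by
    intro s hs θ
    obtain ⟨v, hv, hvΛ⟩ := hΛ.exists_frame θ
    have hm := mem_of_span hvΛ
    simp only [H]
    rw [hΛ.ratio_eq _ hv hm]
    exact div_ne_zero ((hAs θ).det_partialAnti_ne_zero hv
      (fun i j => hΛ.isotropic θ _ (hm i) _ (hm j)) hs) (hΛ.det_ne_zero hv hm)
  have hHc : ContinuousOn (fun p : ℝ × ℝ => H p.1 p.2) (Icc 0 1 ×ˢ univ) := by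
    rintro ⟨s₀, θ₀⟩ -
    refine ContinuousAt.continuousWithinAt ?_
    obtain ⟨v, hv, hev⟩ := hΛ.frame θ₀
    have h0 := hev.self_of_nhds
    have h1 : ContinuousAt (fun p : ℝ × ℝ =>
        (rowMatrix fun i => partialAnti (A p.2) p.1 (v p.2 i)).det / (rowMatrix (v p.2)).det)
        (s₀, θ₀) := by
      have hdet : Continuous fun v : Fin n → Cn n => (rowMatrix v).det :=
        continuous_rowMatrix.matrix_det
      have hv2 : ContinuousAt (fun p : ℝ × ℝ => v p.2) (s₀, θ₀) :=
        ContinuousAt.comp (f := Prod.snd) (g := v) (x := ((s₀, θ₀) : ℝ × ℝ)) hv continuousAt_snd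
      refine ContinuousAt.div ?_ ?_ (hΛ.det_ne_zero h0.1 (mem_of_span h0.2))
      · refine ContinuousAt.comp (g := fun v : Fin n → Cn n => (rowMatrix v).det)
          (f := fun p : ℝ × ℝ => fun i => partialAnti (A p.2) p.1 (v p.2 i)) hdet.continuousAt ?_
        refine continuousAt_pi.2 fun i => ContinuousAt.clm_apply ?_ ?_
        · exact (continuous_partialAnti.comp
            ((hA.comp continuous_snd).prodMk continuous_fst)).continuousAt
        · exact continuousAt_pi.1 hv2 i
      · exact ContinuousAt.comp (g := fun v : Fin n → Cn n => (rowMatrix v).det)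
          (f := fun p : ℝ × ℝ => v p.2) hdet.continuousAt hv2
    refine h1.congr ?_
    have hev2 : ∀ᶠ p : ℝ × ℝ in 𝓝 (s₀, θ₀), LinearIndependent ℝ (v p.2) ∧
        Λ p.2 = Submodule.span ℝ (range (v p.2)) := (continuous_snd.tendsto (s₀, θ₀)).eventually hev
    exact hev2.mono fun p hp => (hΛ.ratio_eq _ hp.1 (mem_of_span hp.2)).symm
  have hHp : ∀ s ∈ Icc (0 : ℝ) 1, H s (2 * Real.pi) = H s 0 := by
    intro s _
    obtain ⟨v, hv, hvΛ⟩ := hΛ.exists_frame 0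
    have hm := mem_of_span hvΛ
    simp only [H]
    rw [hΛ.ratio_eq _ hv hm, hΛ.ratio_eq _ hv (fun i => hΛ.periodic.symm ▸ hm i), hAp]
  have ha0 : HasArgVar (H 0) a := ha.congr fun θ => by
    obtain ⟨v, hv, hvΛ⟩ := hΛ.exists_frame θ
    have hm := mem_of_span hvΛ
    simp only [H]
    rw [hΛ.ratio_eq _ hv hm]
    simp only [partialAnti_apply, zero_smul, add_zero]
    rw [det_linPart_eq, cdet, mul_div_cancel_right₀ _ (hΛ.det_ne_zero hv hm)]
  obtain ⟨ψ, hψ, hψH, rfl⟩ := HasArgVar.of_homotopy hHc hH0 hHp ha0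
  -- The squared phase of `A θ (Λ θ)` is that of `Λ θ` times the square of the phase of `H 1 θ`, so
  -- this combination takes values in `2πℤ`.
  have key := eq_of_exp_mul_I_eq_one (f := fun θ => φ' θ - φ θ - 2 * ψ θ)
    ((hφ'.1.sub hφ.1).sub (continuous_const.mul hψ)) (fun θ => ?_) (2 * Real.pi) 0
  · linarith
  · obtain ⟨v, hv, hvΛ⟩ := hΛ.exists_frame θ
    have hm := mem_of_span hvΛ
    have hne := hΛ.det_ne_zero hv hm
    have hAv : LinearIndependent ℝ fun i => A θ (v i) :=
      hv.map' (A θ : Cn n →ₗ[ℝ] Cn n) (LinearMap.ker_eq_bot.2 (hAs θ).injective)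
    have e1 := hφ.2 θ v hv hm
    have e2 := hφ'.2 θ _ hAv (fun i => hAΛ θ _ (hm i))
    have e3 := hψH θ
    have e4 := hH0 1 (by simp) θ
    have e5 : H 1 θ * (rowMatrix v).det = (rowMatrix fun i => A θ (v i)).det := by
      simp only [H]
      rw [hΛ.ratio_eq _ hv hm, partialAnti_one, div_mul_cancel₀ _ hne]
    rw [← e5, norm_mul, mul_pow, e1, Complex.ofReal_mul, mul_pow] at e2
    have e6 : H 1 θ ^ 2 = (‖H 1 θ‖ : ℂ) ^ 2 * Complex.exp (2 * ψ θ * Complex.I) := by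
      conv_lhs => rw [e3]
      rw [mul_pow, ← Complex.exp_nat_mul]
      congr 2
      push_cast
      ring
    rw [e6] at e2
    have n1 : (‖H 1 θ‖ : ℂ) ^ 2 ≠ 0 := by simpa using e4
    have n2 : ((‖(rowMatrix v).det‖ : ℝ) : ℂ) ^ 2 ≠ 0 := by simpa using hne
    have e7 : Complex.exp (2 * ψ θ * Complex.I) * Complex.exp (φ θ * Complex.I) =
        Complex.exp (φ' θ * Complex.I) :=
      mul_left_cancel₀ (mul_ne_zero n1 n2) (by linear_combination e2)
    push_cast
    rw [sub_mul, sub_mul, Complex.exp_sub, Complex.exp_sub, ← e7]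
    field_simp

end IsLagrangianLoop

end LagrangianLoops

/-! ### Existence, uniqueness and comparison of Maslov indices -/

section Maslov

variable {n : ℕ} {M : Type*} [TopologicalSpace M] [ChartedSpace (Cn n) M]
  [IsManifold 𝓘(ℝ, Cn n) ∞ M] {N : Type*} [TopologicalSpace N] [ChartedSpace (Cn n) N]
  [IsManifold 𝓘(ℝ, Cn n) ∞ N]

variable {X : Type*} [TopologicalSpace X]

lemma continuousWithinAt_tangent_map {f : M → N} {U : Set M} (hU : IsOpen U)
    (hf : ContMDiffOn 𝓘(ℝ, Cn n) 𝓘(ℝ, Cn n) ∞ f U) {w : X → M}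
    {V : ∀ x, TangentSpace 𝓘(ℝ, Cn n) (w x)} {S : Set X} {x₀ : X}
    (h : ContinuousWithinAt (fun x => (⟨w x, V x⟩ : TangentBundle 𝓘(ℝ, Cn n) M)) S x₀)
    (hw : ContinuousWithinAt w S x₀) (h0 : w x₀ ∈ U) :
    ContinuousWithinAt (fun x => (⟨f (w x), mfderiv 𝓘(ℝ, Cn n) 𝓘(ℝ, Cn n) f (w x) (V x)⟩ :
      TangentBundle 𝓘(ℝ, Cn n) N)) S x₀ := by
  have h1 := hf.continuousOn_tangentMapWithin (by simp) hU.uniqueMDiffOn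
  have h2 : ContinuousAt (tangentMapWithin 𝓘(ℝ, Cn n) 𝓘(ℝ, Cn n) f U)
      (⟨w x₀, V x₀⟩ : TangentBundle 𝓘(ℝ, Cn n) M) :=
    h1.continuousAt ((hU.preimage (FiberBundle.continuous_proj (Cn n) _)).mem_nhds h0)
  refine (ContinuousAt.comp_continuousWithinAt
    (f := fun x => (⟨w x, V x⟩ : TangentBundle 𝓘(ℝ, Cn n) M)) h2 h).congr_of_eventuallyEq ?_ ?_
  · filter_upwards [hw.eventually_mem (hU.mem_nhds h0)] with x hx
    simp only [Function.comp_apply, tangentMapWithin, mfderivWithin_of_isOpen hU hx]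
  · simp only [Function.comp_apply, tangentMapWithin, mfderivWithin_of_isOpen hU h0]

/-- The derivative of a map to `ℂⁿ`, with values in `ℂⁿ`. -/
def mfd (f : M → Cn n) (x : M) : TangentSpace 𝓘(ℝ, Cn n) x →L[ℝ] Cn n :=
  mfderiv 𝓘(ℝ, Cn n) 𝓘(ℝ, Cn n) f x

lemma continuousWithinAt_mfd_apply {f : M → Cn n} {U : Set M} (hU : IsOpen U)
    (hf : ContMDiffOn 𝓘(ℝ, Cn n) 𝓘(ℝ, Cn n) ∞ f U) {w : X → M}
    {V : ∀ x, TangentSpace 𝓘(ℝ, Cn n) (w x)} {S : Set X} {x₀ : X}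
    (h : ContinuousWithinAt (fun x => (⟨w x, V x⟩ : TangentBundle 𝓘(ℝ, Cn n) M)) S x₀)
    (hw : ContinuousWithinAt w S x₀) (h0 : w x₀ ∈ U) :
    ContinuousWithinAt (fun x => mfd f (w x) (V x)) S x₀ := by
  have h1 := continuousWithinAt_tangent_map hU hf h hw h0
  have h2 : ContinuousWithinAt (fun x => f (w x)) S x₀ :=
    (hf.continuousOn.continuousAt (hU.mem_nhds h0)).comp_continuousWithinAt hw
  rw [continuousWithinAt_tcoord_iff (w := fun x => f (w x)) (p := f (w x₀)) h2
    (mem_chart_source (Cn n) (f (w x₀)))] at h1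
  simp only [tcoord, TangentBundle.continuousLinearMapAt_model_space] at h1
  exact h1

lemma OpenPartialHomeomorph.mdifferentiable_of_mem_maximalAtlas
    {φ : OpenPartialHomeomorph M (Cn n)} (h : φ ∈ IsManifold.maximalAtlas 𝓘(ℝ, Cn n) ∞ M) :
    φ.MDifferentiable 𝓘(ℝ, Cn n) 𝓘(ℝ, Cn n) :=
  ⟨(contMDiffOn_of_mem_maximalAtlas h).mdifferentiableOn (by simp),
    (contMDiffOn_symm_of_mem_maximalAtlas h).mdifferentiableOn (by simp)⟩

/-- In a slice chart the imaginary coordinates of a curve in `L` vanish, and so do their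
derivatives. Conversely, a vector with real coordinates is the velocity of a straight segment in the
slice. -/
lemma mem_tangentVectors_iff {L : Set M} {φ : OpenPartialHomeomorph M (Cn n)}
    (hφ : φ ∈ IsManifold.maximalAtlas 𝓘(ℝ, Cn n) ∞ M)
    (hL : ∀ y ∈ φ.source, (y ∈ L ↔ ∀ k, (φ y k).im = 0)) {x : M} (hx : x ∈ φ.source) (hxL : x ∈ L)
    (v : TangentSpace 𝓘(ℝ, Cn n) x) :
    v ∈ tangentVectors n L x ↔
      ∀ k, (mfd φ x v k).im = 0 := by
  have hmd := OpenPartialHomeomorph.mdifferentiable_of_mem_maximalAtlas hφ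
  constructor
  · rintro ⟨γ, hγ, hγL, h⟩ k
    obtain rfl : γ 0 = x := congrArg Bundle.TotalSpace.proj h
    have hv : mfderiv 𝓘(ℝ, ℝ) 𝓘(ℝ, Cn n) γ 0 (1 : ℝ) = v := by simpa using h
    have hγd : MDifferentiableAt 𝓘(ℝ, ℝ) 𝓘(ℝ, Cn n) γ 0 := hγ.mdifferentiableAt (by simp)
    have h1 := mfderiv_comp (I := 𝓘(ℝ, ℝ)) (I' := 𝓘(ℝ, Cn n)) (I'' := 𝓘(ℝ, Cn n)) (0 : ℝ)
      (hmd.mdifferentiableAt hx) hγd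
    have h2 : MDifferentiableAt 𝓘(ℝ, ℝ) 𝓘(ℝ, Cn n) (φ ∘ γ) 0 :=
      (hmd.mdifferentiableAt hx).comp (0 : ℝ) hγd
    have h3 : HasFDerivAt (φ ∘ γ) (fderiv ℝ (φ ∘ γ) 0) 0 :=
      (mdifferentiableAt_iff_differentiableAt.1 h2).hasFDerivAt
    let ℓ : Cn n →L[ℝ] ℝ := Complex.imCLM.comp ((EuclideanSpace.proj k : Cn n →L[ℂ] ℂ).restrictScalars ℝ)
    have h4 := ℓ.hasFDerivAt.comp (0 : ℝ) h3
    have h5 : (ℓ ∘ (φ ∘ γ)) =ᶠ[𝓝 0] fun _ => 0 := by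
      filter_upwards [hγL, hγ.continuousAt.eventually_mem (φ.open_source.mem_nhds hx)] with t ht ht'
      exact (hL _ ht').1 ht k
    have h6 := h4.unique ((hasFDerivAt_const (0 : ℝ) (0 : ℝ)).congr_of_eventuallyEq h5)
    have h7 : ℓ (fderiv ℝ (φ ∘ γ) 0 1) = 0 := DFunLike.congr_fun h6 (1 : ℝ)
    rw [← mfderiv_eq_fderiv, h1] at h7
    rw [← hv]
    exact h7
  · intro hv
    set a : Cn n := mfd φ x v with ha
    let c : ℝ → Cn n := fun t => φ x + t • a
    have hc0 : c 0 = φ x := by simp [c]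
    have hcs : ContDiff ℝ ∞ c := by fun_prop
    have hcd : HasFDerivAt c (ContinuousLinearMap.toSpanSingleton ℝ a) 0 :=
      ((hasDerivAt_id (0 : ℝ)).smul_const a).const_add (φ x) |>.hasFDerivAt.congr_fderiv
        (by ext1; simp)
    have hs : ContMDiffAt 𝓘(ℝ, Cn n) 𝓘(ℝ, Cn n) ∞ φ.symm (c 0) := by
      rw [hc0]
      exact (contMDiffOn_symm_of_mem_maximalAtlas hφ).contMDiffAt
        (φ.open_target.mem_nhds (φ.map_source hx))
    have hγ0 : φ.symm (c 0) = x := by rw [hc0, φ.left_inv hx]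
    refine ⟨fun t => φ.symm (c t), hs.comp (0 : ℝ) hcs.contMDiff.contMDiffAt, ?_, ?_⟩
    · have hev : ∀ᶠ t in 𝓝 0, c t ∈ φ.target :=
        hcs.continuous.continuousAt.eventually_mem (φ.open_target.mem_nhds (by
          rw [hc0]; exact φ.map_source hx))
      filter_upwards [hev] with t ht
      refine (hL _ (φ.map_target ht)).2 fun k => ?_
      rw [φ.right_inv ht]
      have h1 := (hL x hx).1 hxL k
      have h2 := hv k
      simp [c, h1, h2]
    · have h1 : mfderiv 𝓘(ℝ, ℝ) 𝓘(ℝ, Cn n) (fun t => φ.symm (c t)) 0 =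
          (mfderiv 𝓘(ℝ, Cn n) 𝓘(ℝ, Cn n) φ.symm (c 0)).comp (mfderiv 𝓘(ℝ, ℝ) 𝓘(ℝ, Cn n) c 0) :=
        mfderiv_comp (I := 𝓘(ℝ, ℝ)) (I' := 𝓘(ℝ, Cn n)) (I'' := 𝓘(ℝ, Cn n)) (0 : ℝ)
          (hs.mdifferentiableAt (by simp)) (hcs.contMDiff.contMDiffAt.mdifferentiableAt (by simp))
      have h2 : mfderiv 𝓘(ℝ, ℝ) 𝓘(ℝ, Cn n) c 0 (1 : ℝ) = a := by
        rw [mfderiv_eq_fderiv, hcd.fderiv]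
        exact one_smul ℝ a
      have h3 : ∀ y : Cn n, y = φ x → ∀ b : Cn n, b = a →
          (⟨φ.symm y, mfderiv 𝓘(ℝ, Cn n) 𝓘(ℝ, Cn n) φ.symm y b⟩ :
            TangentBundle 𝓘(ℝ, Cn n) M) = ⟨x, v⟩ := by
        rintro _ rfl _ rfl
        have h4 : mfderiv 𝓘(ℝ, Cn n) 𝓘(ℝ, Cn n) φ.symm (φ x) a = v :=
          DFunLike.congr_fun (hmd.symm_comp_deriv hx) v
        have h5 : ∀ y : M, y = x → ∀ b : Cn n, b = (v : Cn n) →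
            (⟨y, b⟩ : TangentBundle 𝓘(ℝ, Cn n) M) = ⟨x, v⟩ := by
          rintro _ rfl _ rfl
          rfl
        exact h5 _ (φ.left_inv hx) _ h4
      refine Eq.trans ?_ (h3 (c 0) hc0 _ h2)
      rw [h1]
      rfl

variable {L : Set M} {u : ℂ → M} {Ω : TwoForm n M}

/-- The loop of Lagrangian subspaces along the boundary of a disc. -/
def boundaryLoop (L : Set M) (u : ℂ → M) (Φ : ∀ z, Cn n ≃L[ℝ] TangentSpace 𝓘(ℝ, Cn n) (u z))
    (θ : ℝ) : Set (Cn n) :=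
  {v | Φ (Complex.exp (θ * Complex.I)) v ∈ tangentVectors n L (u (Complex.exp (θ * Complex.I)))}

lemma exp_mem_closedBall (θ : ℝ) : Complex.exp (θ * Complex.I) ∈ Metric.closedBall (0 : ℂ) 1 := by
  rw [mem_closedBall_zero_iff, Complex.norm_exp_ofReal_mul_I]

lemma exp_mem_sphere (θ : ℝ) : Complex.exp (θ * Complex.I) ∈ Metric.sphere (0 : ℂ) 1 := by
  rw [mem_sphere_zero_iff_norm, Complex.norm_exp_ofReal_mul_I]

/-- The standard real basis of `ℝⁿ ⊂ ℂⁿ`. -/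
def realBasis (n : ℕ) (i : Fin n) : Cn n := EuclideanSpace.single i 1

lemma mem_span_realBasis (v : Cn n) :
    v ∈ Submodule.span ℝ (range (realBasis n)) ↔ ∀ k, (v k).im = 0 := by
  rw [Submodule.mem_span_range_iff_exists_fun]
  have hsum : ∀ (c : Fin n → ℝ) k, (∑ i, c i • realBasis n i) k = c k := by
    intro c k
    rw [sum_coe_smul]
    simp [realBasis, PiLp.single_apply]
  constructor
  · rintro ⟨c, rfl⟩ k
    rw [hsum]
    simp
  · intro h
    refine ⟨fun k => (v k).re, ?_⟩
    ext k
    rw [hsum]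
    exact Complex.ext (by simp) (by simp [h k])

lemma linearIndependent_realBasis : LinearIndependent ℝ (realBasis n) := by
  rw [Fintype.linearIndependent_iff]
  intro c hc k
  have := congrArg (fun v : Cn n => v k) hc
  simp only [sum_coe_smul] at this
  simpa [realBasis, PiLp.single_apply] using this

lemma isLagrangianLoop_boundaryLoop (hL : IsLagrangian Ω L)
    (hu : ContinuousOn u (Metric.closedBall 0 1)) (hub : ∀ z ∈ Metric.sphere (0 : ℂ) 1, u z ∈ L)
    {Φ : ∀ z, Cn n ≃L[ℝ] TangentSpace 𝓘(ℝ, Cn n) (u z)}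
    (hΦ : IsSymplecticFrameOn Ω u Φ (Metric.closedBall 0 1)) :
    IsLagrangianLoop (boundaryLoop L u Φ) := by
  let e : ℝ → ℂ := fun θ => Complex.exp (θ * Complex.I)
  have he : Continuous e := by fun_prop
  have heD : ∀ θ, e θ ∈ Metric.closedBall (0 : ℂ) 1 := exp_mem_closedBall
  have huL : ∀ θ, u (e θ) ∈ L := fun θ => hub _ (exp_mem_sphere θ)
  refine ⟨fun θ₀ => ?_, fun θ a ha b hb => ?_, ?_⟩
  · obtain ⟨φ, hφ, hxφ, hφL⟩ := hL.slice _ (huL θ₀)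
    have hmd := OpenPartialHomeomorph.mdifferentiable_of_mem_maximalAtlas hφ
    -- `T` reads the frame in a slice chart, where the tangent space of `L` is `ℝⁿ`. Pulling the
    -- standard real basis back by `T` gives a continuous basis of the loop.
    let T : ℝ → Cn n →L[ℝ] Cn n := fun θ =>
      (mfd φ (u (e θ))).comp
        (Φ (e θ) : Cn n →L[ℝ] TangentSpace 𝓘(ℝ, Cn n) (u (e θ)))
    have huc : Continuous fun θ => u (e θ) := hu.comp_continuous he heD
    have hTc : ContinuousAt T θ₀ := by
      rw [← continuousWithinAt_univ, continuousWithinAt_clm_apply]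
      intro v
      refine continuousWithinAt_mfd_apply (w := fun θ => u (e θ))
        (V := fun θ => Φ (e θ) v) φ.open_source (contMDiffOn_of_mem_maximalAtlas hφ) ?_
        huc.continuousWithinAt hxφ
      exact ((hΦ.1 v).comp_continuous he heD).continuousWithinAt
    have hTi : ∀ θ, u (e θ) ∈ φ.source → ∃ E : Cn n ≃L[ℝ] Cn n, (E : Cn n →L[ℝ] Cn n) = T θ :=
      fun θ hθ => ⟨(Φ (e θ)).trans (hmd.mfderiv hθ), rfl⟩
    refine ⟨fun θ i => (T θ).inverse (realBasis n i), ?_, ?_⟩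
    · refine continuousAt_pi.2 fun i => ContinuousAt.clm_apply ?_ continuousAt_const
      have h1 := continuousWithinAt_inverse (S := univ) hTc.continuousWithinAt (hTi θ₀ hxφ)
      rwa [continuousWithinAt_univ] at h1
    · filter_upwards [huc.continuousAt.eventually_mem (φ.open_source.mem_nhds hxφ)] with θ hθ
      obtain ⟨E, hE⟩ := hTi θ hθ
      have h1 : (fun i => (T θ).inverse (realBasis n i)) = fun i => E.symm (realBasis n i) := by
        rw [← hE, ContinuousLinearMap.inverse_equiv]
        rfl
      rw [h1]
      refine ⟨linearIndependent_realBasis.map' (E.symm : Cn n →ₗ[ℝ] Cn n)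
        (LinearMap.ker_eq_bot.2 E.symm.injective), ?_⟩
      ext v
      have h2 : v ∈ boundaryLoop L u Φ θ ↔ ∀ k, (E v k).im = 0 := by
        change Φ (e θ) v ∈ tangentVectors n L (u (e θ)) ↔ _
        rw [mem_tangentVectors_iff hφ hφL hθ (huL θ)]
        have h3 : E v = T θ v := DFunLike.congr_fun hE v
        rw [h3]
        rfl
      rw [h2, ← mem_span_realBasis, SetLike.mem_coe]
      have h4 : range (fun i => E.symm (realBasis n i)) =
          (E.symm : Cn n →ₗ[ℝ] Cn n) '' range (realBasis n) := (range_comp _ _)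
      rw [h4, ← Submodule.map_span, Submodule.mem_map]
      constructor
      · intro h
        exact ⟨E v, h, E.symm_apply_apply v⟩
      · rintro ⟨y, hy, rfl⟩
        have : E (E.symm y) = y := E.apply_symm_apply y
        exact this.symm ▸ hy
  · rw [← hΦ.form_eq _ (heD θ)]
    exact hL.isotropic _ (huL θ) _ ha _ hb
  · refine congrArg (fun z => {v | Φ z v ∈ tangentVectors n L (u z)}) (?_ : e _ = e _)
    simp [e]

lemma hasMaslovIndex_iff {k : ℤ} : HasMaslovIndex Ω L u k ↔
    ∃ (Φ : ∀ z : ℂ, Cn n ≃L[ℝ] TangentSpace 𝓘(ℝ, Cn n) (u z)) (φ : ℝ → ℝ),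
      ContinuousOn (fun p : ℂ × Cn n => (⟨u p.1, Φ p.1 p.2⟩ : TangentBundle 𝓘(ℝ, Cn n) M))
        (Metric.closedBall 0 1 ×ˢ univ) ∧
      (∀ z ∈ Metric.closedBall (0 : ℂ) 1, ∀ a b : Cn n,
        Ω (u z) ![Φ z a, Φ z b] = stdForm n ![a, b]) ∧
      HasPhase (boundaryLoop L u Φ) φ ∧ φ (2 * Real.pi) = φ 0 + 2 * Real.pi * k := by
  refine exists_congr fun Φ => exists_congr fun φ => ?_
  constructor
  · rintro ⟨h1, h2, h3, h4, h5⟩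
    exact ⟨h1, h2, ⟨h3, h4⟩, h5⟩
  · rintro ⟨h1, h2, ⟨h3, h4⟩, h5⟩
    exact ⟨h1, h2, h3, h4, h5⟩

lemma IsSymplecticFrameOn.of_prod {Φ : ∀ z, Cn n ≃L[ℝ] TangentSpace 𝓘(ℝ, Cn n) (u z)}
    (h : ContinuousOn (fun p : ℂ × Cn n => (⟨u p.1, Φ p.1 p.2⟩ : TangentBundle 𝓘(ℝ, Cn n) M))
      (Metric.closedBall 0 1 ×ˢ univ))
    (h2 : ∀ z ∈ Metric.closedBall (0 : ℂ) 1, ∀ a b : Cn n,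
      Ω (u z) ![Φ z a, Φ z b] = stdForm n ![a, b]) :
    IsSymplecticFrameOn Ω u Φ (Metric.closedBall 0 1) :=
  ⟨fun v => h.comp (f := fun z : ℂ => (z, v)) (by fun_prop) fun z hz => ⟨hz, mem_univ _⟩, h2⟩

/-- The Maslov index exists; it can be computed in any symplectic frame. -/
lemma exists_hasMaslovIndex_of_frame (hL : IsLagrangian Ω L)
    (hu : ContinuousOn u (Metric.closedBall 0 1)) (hub : ∀ z ∈ Metric.sphere (0 : ℂ) 1, u z ∈ L)
    {Φ : ∀ z, Cn n ≃L[ℝ] TangentSpace 𝓘(ℝ, Cn n) (u z)}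
    (hΦ : IsSymplecticFrameOn Ω u Φ (Metric.closedBall 0 1)) :
    ∃ (φ : ℝ → ℝ) (k : ℤ), HasPhase (boundaryLoop L u Φ) φ ∧
      φ (2 * Real.pi) = φ 0 + 2 * Real.pi * k ∧ HasMaslovIndex Ω L u k := by
  obtain ⟨φ, k, h1, h2⟩ := (isLagrangianLoop_boundaryLoop hL hu hub hΦ).exists_hasPhase
  refine ⟨φ, k, h1, h2, hasMaslovIndex_iff.2 ⟨Φ, φ, ?_, hΦ.2, h1, h2⟩⟩
  exact hΦ.1.continuousOn_apply hu continuousOn_fst (fun p hp => hp.1) continuousOn_snd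

/-- The change between two symplectic frames is symplectic over the whole disc, so its complex
determinant has no zero there and does not wind along the boundary. -/
lemma HasMaslovIndex.unique (hL : IsLagrangian Ω L)
    (hu : ContinuousOn u (Metric.closedBall 0 1)) (hub : ∀ z ∈ Metric.sphere (0 : ℂ) 1, u z ∈ L)
    {k k' : ℤ} (h : HasMaslovIndex Ω L u k) (h' : HasMaslovIndex Ω L u k') : k = k' := by
  obtain ⟨Φ, φ, h1, h2, h3, h4⟩ := hasMaslovIndex_iff.1 h
  obtain ⟨Φ', φ', h1', h2', h3', h4'⟩ := hasMaslovIndex_iff.1 h'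
  have hΦ := IsSymplecticFrameOn.of_prod h1 h2
  have hΦ' := IsSymplecticFrameOn.of_prod h1' h2'
  let A : ℂ → Cn n →L[ℝ] Cn n := fun z => ((Φ z).trans (Φ' z).symm : Cn n ≃L[ℝ] Cn n)
  have hA : ContinuousOn A (Metric.closedBall 0 1) := hΦ.1.trans_continuousOn hΦ'.1 hu
  have hAs : ∀ z ∈ Metric.closedBall (0 : ℂ) 1, IsSympl (A z) := by
    intro z hz a b
    rw [← h2' z hz, ← h2 z hz]
    simp [A]
  have hvar : HasArgVar (fun θ => cdet (A (Complex.exp (θ * Complex.I)))) 0 :=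
    HasArgVar.of_disc (F := fun z => cdet (A z)) (continuous_cdet.comp_continuousOn hA)
      fun z hz => (hAs z hz).cdet_ne_zero
  have key := (isLagrangianLoop_boundaryLoop hL hu hub hΦ).phase_comparison
    (A := fun θ => A (Complex.exp (θ * Complex.I)))
    (hA.comp_continuous (by fun_prop) exp_mem_closedBall) (fun θ => hAs _ (exp_mem_closedBall θ))
    (by simp) (fun θ v hv => by
      change Φ' (Complex.exp (θ * Complex.I)) _ ∈ tangentVectors n L _
      simpa [A] using! hv) h3 h3' hvar
  rw [h4, h4'] at key
  have : (k : ℝ) = k' := by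
    have := Real.pi_pos
    nlinarith
  exact_mod_cast this

lemma HasMaslovIndex.maslovIndex_eq (hL : IsLagrangian Ω L)
    (hu : ContinuousOn u (Metric.closedBall 0 1)) (hub : ∀ z ∈ Metric.sphere (0 : ℂ) 1, u z ∈ L)
    {k : ℤ} (h : HasMaslovIndex Ω L u k) : maslovIndex Ω L u = k :=
  HasMaslovIndex.unique hL hu hub (Classical.epsilon_spec (p := HasMaslovIndex Ω L u) ⟨k, h⟩) h

end Maslov

/-! ### Differential forms on `ℂⁿ`: radial forms and the model form -/

section FormCalculus

variable {E : Type*} [NormedAddCommGroup E] [NormedSpace ℝ E]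

lemma form_ext {τ σ : E [⋀^Fin 2]→L[ℝ] ℝ} (h : ∀ a b, τ ![a, b] = σ ![a, b]) : τ = σ := by
  ext v
  have hv : v = ![v 0, v 1] := by ext i; fin_cases i <;> rfl
  rw [hv]
  exact h _ _

lemma form_zero_left (τ : E [⋀^Fin 2]→L[ℝ] ℝ) (b : E) : τ ![0, b] = 0 := by
  simpa using form_smul_left τ 0 0 b

/-- The matrix of a 2-form with respect to a basis. -/
def formMatrix {ι : Type*} (e : ι → E) : (E [⋀^Fin 2]→L[ℝ] ℝ) →ₗ[ℝ] ι → ι → ℝ where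
  toFun τ i j := τ ![e i, e j]
  map_add' _ _ := rfl
  map_smul' _ _ := rfl

lemma formMatrix_injective {ι : Type*} [Fintype ι] (e : Module.Basis ι ℝ E) :
    Function.Injective (formMatrix e) := by
  rw [injective_iff_map_eq_zero]
  intro τ hτ
  have h : ∀ i j, τ ![e i, e j] = 0 := fun i j => congrFun (congrFun hτ i) j
  refine form_ext fun a b => ?_
  let L : E →ₗ[ℝ] E →ₗ[ℝ] ℝ := LinearMap.mk₂ ℝ (fun a b => τ ![a, b]) (form_add_left τ)
    (form_smul_left τ) (form_add_right τ) (fun c a b => form_smul_right τ c a b)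
  have hL : L = 0 := e.ext fun i => e.ext fun j => by simpa [L] using h i j
  exact congrArg (fun f : E →ₗ[ℝ] E →ₗ[ℝ] ℝ => f a b) hL

/-- In finite dimensions a form is recovered linearly from its finitely many coefficients in a
basis. -/
lemma contDiffWithinAt_form [FiniteDimensional ℝ E] {X : Type*} [NormedAddCommGroup X]
    [NormedSpace ℝ X] {f : X → E [⋀^Fin 2]→L[ℝ] ℝ} {S : Set X} {x : X} {k : WithTop ℕ∞}
    (h : ∀ a b, ContDiffWithinAt ℝ k (fun x => f x ![a, b]) S x) : ContDiffWithinAt ℝ k f S x := by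
  let e := Module.finBasis ℝ E
  obtain ⟨g, hg⟩ := (formMatrix e).exists_leftInverse_of_injective
    (LinearMap.ker_eq_bot.2 (formMatrix_injective e))
  have h1 : f = fun x => LinearMap.toContinuousLinearMap g (formMatrix e (f x)) := by
    ext1 x
    exact (LinearMap.congr_fun hg (f x)).symm
  rw [h1]
  refine (LinearMap.toContinuousLinearMap g).contDiff.contDiffAt.comp_contDiffWithinAt x ?_
  rw [contDiffWithinAt_pi]
  intro i
  rw [contDiffWithinAt_pi]
  exact fun j => h _ _

lemma contDiffAt_form_apply {X : Type*} [NormedAddCommGroup X]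
    [NormedSpace ℝ X] {f : X → E [⋀^Fin 2]→L[ℝ] ℝ} {x : X} {k : WithTop ℕ∞}
    (h : ContDiffAt ℝ k f x) (v : Fin 2 → E) : ContDiffAt ℝ k (fun x => f x v) x :=
  (ContinuousAlternatingMap.apply ℝ E ℝ v).contDiff.contDiffAt.comp x h

/-- A form with smooth coefficients, applied to smooth vector fields. -/
lemma ContDiffAt.form_pair [FiniteDimensional ℝ E] {X : Type*} [NormedAddCommGroup X]
    [NormedSpace ℝ X] {f : X → E [⋀^Fin 2]→L[ℝ] ℝ} {a b : X → E} {x : X} {k : WithTop ℕ∞}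
    (h : ContDiffAt ℝ k f x) (ha : ContDiffAt ℝ k a x) (hb : ContDiffAt ℝ k b x) :
    ContDiffAt ℝ k (fun x => f x ![a x, b x]) x := by
  let e := Module.finBasis ℝ E
  have h1 : ∀ τ : E [⋀^Fin 2]→L[ℝ] ℝ, ∀ a b : E, τ ![a, b] =
      ∑ i, ∑ j, LinearMap.toContinuousLinearMap (e.coord i) a *
        (LinearMap.toContinuousLinearMap (e.coord j) b * τ ![e i, e j]) := by
    intro τ a b
    let L : E →ₗ[ℝ] E →ₗ[ℝ] ℝ := LinearMap.mk₂ ℝ (fun a b => τ ![a, b]) (form_add_left τ)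
      (form_smul_left τ) (form_add_right τ) (fun c a b => form_smul_right τ c a b)
    change L a b = _
    conv_lhs => rw [← e.sum_repr a, ← e.sum_repr b]
    simp only [map_sum, map_smul, LinearMap.sum_apply, LinearMap.smul_apply, smul_eq_mul,
      Finset.mul_sum]
    rw [Finset.sum_comm]
    refine Finset.sum_congr rfl fun i _ => Finset.sum_congr rfl fun j _ => ?_
    simp [L]
    ring
  have h2 : (fun x => f x ![a x, b x]) = fun x => ∑ i, ∑ j,
      LinearMap.toContinuousLinearMap (e.coord i) (a x) *
        (LinearMap.toContinuousLinearMap (e.coord j) (b x) * f x ![e i, e j]) :=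
    funext fun x => h1 _ _ _
  rw [h2]
  refine ContDiffAt.sum fun i _ => ContDiffAt.sum fun j _ => ?_
  exact ((LinearMap.toContinuousLinearMap (e.coord i)).contDiff.contDiffAt.comp x ha).mul
    (((LinearMap.toContinuousLinearMap (e.coord j)).contDiff.contDiffAt.comp x hb).mul
      (contDiffAt_form_apply h _))

variable {F : Type*} [NormedAddCommGroup F] [NormedSpace ℝ F]

/-- Pullbacks of smooth forms are smooth. -/
lemma contDiffAt_pullback [FiniteDimensional ℝ E] [FiniteDimensional ℝ F]
    {τ : F → F [⋀^Fin 2]→L[ℝ] ℝ} {f : E → F} {x : E} (hτ : ContDiffAt ℝ ∞ τ (f x))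
    (hf : ContDiffAt ℝ ∞ f x) :
    ContDiffAt ℝ ∞ (fun x => (τ (f x)).compContinuousLinearMap (fderiv ℝ f x)) x := by
  rw [← contDiffWithinAt_univ]
  refine contDiffWithinAt_form fun a b => ?_
  rw [contDiffWithinAt_univ]
  have h1 : ContDiffAt ℝ ∞ (fderiv ℝ f) x := hf.fderiv_right (m := ∞) (by simp)
  simp only [form_comp_pair]
  exact (hτ.comp x hf).form_pair (h1.clm_apply contDiffAt_const) (h1.clm_apply contDiffAt_const)

lemma extDeriv_pullback_eq_zero {τ : F → F [⋀^Fin 2]→L[ℝ] ℝ} {f : E → F} {x : E}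
    (hτ : ContDiffAt ℝ ∞ τ (f x)) (hf : ContDiffAt ℝ ∞ f x) (h : extDeriv τ (f x) = 0) :
    extDeriv (fun x => (τ (f x)).compContinuousLinearMap (fderiv ℝ f x)) x = 0 := by
  rw [extDeriv_pullback (hτ.differentiableAt (by simp)) hf
    (by simpa using (WithTop.coe_le_coe.2 le_top : (2 : WithTop ℕ∞) ≤ ∞)), h]
  ext v
  rfl

lemma extDeriv_const_form (τ : F [⋀^Fin 2]→L[ℝ] ℝ) (x : F) :
    extDeriv (fun _ => τ) x = 0 := by
  ext v
  rw [extDeriv_apply (differentiableAt_const _)]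
  simp

end FormCalculus

/-! ### Radial pullbacks, the Fubini-Study form and the model form. -/

section RadialForms

variable {n : ℕ}

lemma norm_sq_eq_inner (z : Cn n) : inner ℂ z z = ((‖z‖ ^ 2 : ℝ) : ℂ) := by
  rw [inner_self_eq_norm_sq_to_K]; simp

lemma real_inner_eq_re (z a : Cn n) : inner ℝ z a = (inner ℂ z a).re := by
  rw [PiLp.inner_apply, PiLp.inner_apply, Complex.re_sum]
  rfl

/-- The imaginary part of the Hermitian form `⟨z, a⟩⁻ ⟨z, b⟩`. -/
def radialPart (z a b : Cn n) : ℝ := (starRingEnd ℂ (inner ℂ z a) * inner ℂ z b).im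

lemma radialPart_eq (z a b : Cn n) : radialPart z a b =
    (inner ℂ z a).re * (inner ℂ z b).im - (inner ℂ z a).im * (inner ℂ z b).re := by
  rw [radialPart, Complex.mul_im, Complex.conj_re, Complex.conj_im]
  ring

/-- The derivative of a radial map `z ↦ g(|z|) z`. -/
lemma hasFDerivAt_radial {g : ℝ → ℝ} {g' : ℝ} {z : Cn n} (hz : z ≠ 0)
    (hg : HasDerivAt g g' ‖z‖) :
    HasFDerivAt (fun z : Cn n => g ‖z‖ • z) (g ‖z‖ • ContinuousLinearMap.id ℝ (Cn n) +
      ((g' / ‖z‖) • innerSL ℝ z).smulRight z) z := by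
  have h0 : ‖z‖ ≠ 0 := norm_ne_zero_iff.2 hz
  have h1 : HasFDerivAt (fun z : Cn n => ‖z‖) ((1 / ‖z‖) • innerSL ℝ z) z := by
    have h2 := (hasStrictFDerivAt_norm_sq z).hasFDerivAt.sqrt (by positivity)
    have h3 : (fun z : Cn n => Real.sqrt (‖z‖ ^ 2)) = fun z => ‖z‖ :=
      funext fun z => Real.sqrt_sq (norm_nonneg z)
    rw [h3, Real.sqrt_sq (norm_nonneg z)] at h2
    refine h2.congr_fderiv ?_
    ext v
    simp
    field_simp
  have h2 : HasFDerivAt (fun z : Cn n => g ‖z‖) (g' • (1 / ‖z‖) • innerSL ℝ z) z :=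
    hg.comp_hasFDerivAt z h1
  refine (h2.smul (hasFDerivAt_id z)).congr_fderiv ?_
  ext v
  simp [smul_smul, div_eq_mul_inv, mul_assoc]

/-- The derivative of a radial map has this shape. The term quadratic in `h` drops out because both
of its vectors are multiples of `z`, and the two mixed terms combine to the imaginary part in
`radialPart`. -/
lemma stdForm_radial (z a b : Cn n) (g h : ℝ) :
    stdForm n ![g • a + (h * inner ℝ z a) • z, g • b + (h * inner ℝ z b) • z] =
      g ^ 2 * stdForm n ![a, b] + g * h * radialPart z a b := by
  rw [form_add_left, form_add_right, form_add_right, form_smul_left, form_smul_left,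
    form_smul_left, form_smul_left, form_smul_right, form_smul_right, form_smul_right,
    form_smul_right, form_self, form_swap _ a z, stdForm_apply z, stdForm_apply z,
    real_inner_eq_re, real_inner_eq_re, radialPart_eq]
  ring

lemma radialPart_self_I_smul (z a : Cn n) :
    radialPart z a (Complex.I • a) = ‖(inner ℂ z a : ℂ)‖ ^ 2 := by
  rw [radialPart, inner_smul_right, ← mul_assoc, mul_comm _ Complex.I, mul_assoc,
    ← Complex.normSq_eq_conj_mul_self, Complex.normSq_eq_norm_sq]
  simp [-Complex.ofReal_pow]

/-- The projection to the complement of `ℂz` subtracts `⟨z, a⟩ z / |z|²`, which removes exactly the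
product of the two `z`-components from the Hermitian product. This explicit form gives smoothness
and the comparison with radial pullbacks. -/
lemma fubiniStudy_apply {z : Cn n} (hz : z ≠ 0) (a b : Cn n) : BlowUp.fubiniStudy n z ![a, b] =
    (‖z‖ ^ 2)⁻¹ * stdForm n ![a, b] - ((‖z‖ ^ 2) ^ 2)⁻¹ * radialPart z a b := by
  have h0 : ‖z‖ ≠ 0 := norm_ne_zero_iff.2 hz
  have hp : ∀ a, (Submodule.span ℂ {z})ᗮ.starProjection a =
      a - (inner ℂ z a / ((‖z‖ ^ 2 : ℝ) : ℂ)) • z := by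
    intro a
    rw [Submodule.starProjection_orthogonal', sub_apply,
      Submodule.starProjection_singleton]
    simp
  have h1 : BlowUp.fubiniStudy n z ![a, b] = (‖z‖ ^ 2)⁻¹ *
      stdForm n ![(Submodule.span ℂ {z})ᗮ.starProjection a,
        (Submodule.span ℂ {z})ᗮ.starProjection b] := by
    change (‖z‖ ^ 2)⁻¹ • (stdForm n).compContinuousLinearMap _ ![a, b] = _
    rw [form_comp_pair]
    rfl
  rw [h1, hp, hp, stdForm_apply, stdForm_apply]
  have h2 : (inner ℂ (a - (inner ℂ z a / ((‖z‖ ^ 2 : ℝ) : ℂ)) • z)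
      (b - (inner ℂ z b / ((‖z‖ ^ 2 : ℝ) : ℂ)) • z) : ℂ) =
      inner ℂ a b - ((‖z‖ ^ 2)⁻¹ : ℝ) * (starRingEnd ℂ (inner ℂ z a) * inner ℂ z b) := by
    simp only [inner_sub_left, inner_sub_right, inner_smul_left, inner_smul_right,
      norm_sq_eq_inner, ← inner_conj_symm a z]
    have h3 : ((‖z‖ ^ 2 : ℝ) : ℂ) ≠ 0 := by exact_mod_cast pow_ne_zero 2 h0
    rw [map_div₀, Complex.conj_ofReal, Complex.ofReal_inv]
    field_simp
    ring
  rw [h2, Complex.sub_im, Complex.im_ofReal_mul, ← radialPart]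
  field_simp

lemma fubiniStudy_tame (z a : Cn n) : 0 ≤ BlowUp.fubiniStudy n z ![a, Complex.I • a] := by
  change 0 ≤ (‖z‖ ^ 2)⁻¹ • (stdForm n).compContinuousLinearMap _ ![a, Complex.I • a]
  rw [form_comp_pair]
  simp only [ContinuousLinearMap.coe_restrictScalars', map_smul]
  rw [stdForm_self_I_smul, smul_eq_mul]
  positivity

/-- If the Fubini-Study form vanishes on `(a, i a)` then `a` is tangent to the line of `z`. -/
lemma mem_span_of_fubiniStudy_eq_zero {z a : Cn n} (hz : z ≠ 0)
    (h : BlowUp.fubiniStudy n z ![a, Complex.I • a] = 0) : a ∈ Submodule.span ℂ {z} := by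
  have h0 : ‖z‖ ≠ 0 := norm_ne_zero_iff.2 hz
  change (‖z‖ ^ 2)⁻¹ • (stdForm n).compContinuousLinearMap _ ![a, Complex.I • a] = 0 at h
  rw [form_comp_pair] at h
  simp only [ContinuousLinearMap.coe_restrictScalars', map_smul] at h
  rw [stdForm_self_I_smul, smul_eq_mul, mul_eq_zero] at h
  have h1 : (Submodule.span ℂ {z})ᗮ.starProjection a = 0 := by
    rcases h with h | h
    · exact absurd h (by positivity)
    · simpa using h
  rw [Submodule.starProjection_orthogonal', sub_apply, sub_eq_zero] at h1
  rw [← Submodule.starProjection_eq_self_iff]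
  exact h1.symm

/-- The Fubini-Study form is the pullback of a form on projective space. -/
lemma fubiniStudy_smul {c : ℂ} (hc : c ≠ 0) {z : Cn n} (hz : z ≠ 0) (a b : Cn n) (x y : ℂ) :
    BlowUp.fubiniStudy n (c • z) ![x • z + c • a, y • z + c • b] =
      BlowUp.fubiniStudy n z ![a, b] := by
  have h0 : ‖z‖ ≠ 0 := norm_ne_zero_iff.2 hz
  have h1 : ‖c‖ ≠ 0 := norm_ne_zero_iff.2 hc
  change (‖c • z‖ ^ 2)⁻¹ • (stdForm n).compContinuousLinearMap _ ![_, _] =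
    (‖z‖ ^ 2)⁻¹ • (stdForm n).compContinuousLinearMap _ ![_, _]
  rw [form_comp_pair, form_comp_pair]
  have h2 : Submodule.span ℂ {c • z} = Submodule.span ℂ {z} :=
    Submodule.span_singleton_smul_eq (IsUnit.mk0 c hc) z
  have h3 : (Submodule.span ℂ {z})ᗮ.starProjection z = 0 := by
    rw [Submodule.starProjection_orthogonal', sub_apply, sub_eq_zero]
    exact (Submodule.starProjection_eq_self_iff.2 (Submodule.mem_span_singleton_self z)).symm
  simp only [h2, ContinuousLinearMap.coe_restrictScalars', map_smul, map_add, h3, smul_zero,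
    zero_add]
  rw [stdForm_apply, stdForm_apply, inner_smul_left, inner_smul_right, ← mul_assoc,
    ← Complex.normSq_eq_conj_mul_self, Complex.normSq_eq_norm_sq, Complex.im_ofReal_mul, norm_smul]
  simp only [smul_eq_mul]
  field_simp

/-- Smoothness of the Fubini-Study form. -/
lemma contDiffAt_fubiniStudy {z : Cn n} (hz : z ≠ 0) :
    ContDiffAt ℝ ∞ (BlowUp.fubiniStudy n) z := by
  rw [← contDiffWithinAt_univ]
  refine contDiffWithinAt_form fun a b => ?_
  rw [contDiffWithinAt_univ]
  have h : (fun z => BlowUp.fubiniStudy n z ![a, b]) =ᶠ[𝓝 z] fun z =>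
      (‖z‖ ^ 2)⁻¹ * stdForm n ![a, b] - ((‖z‖ ^ 2) ^ 2)⁻¹ * radialPart z a b := by
    filter_upwards [isOpen_ne.mem_nhds hz] with y hy using fubiniStudy_apply hy a b
  refine ContDiffAt.congr_of_eventuallyEq ?_ h
  have h0 : ‖z‖ ≠ 0 := norm_ne_zero_iff.2 hz
  have h1 : ContDiffAt ℝ ∞ (fun z : Cn n => ‖z‖ ^ 2) z := (contDiff_norm_sq ℝ).contDiffAt
  have h2 : ∀ a, ContDiff ℝ ∞ (fun z : Cn n => (inner ℂ z a : ℂ)) := fun a =>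
    contDiff_id.inner ℂ contDiff_const
  have h3 : ContDiffAt ℝ ∞ (fun z : Cn n => radialPart z a b) z := by
    simp only [radialPart_eq]
    exact (((Complex.reCLM.contDiff.comp (h2 a)).mul (Complex.imCLM.contDiff.comp (h2 b))).sub
      ((Complex.imCLM.contDiff.comp (h2 a)).mul (Complex.reCLM.contDiff.comp (h2 b)))).contDiffAt
  exact ((h1.inv (pow_ne_zero 2 h0)).mul contDiffAt_const).sub
    (((h1.pow 2).inv (pow_ne_zero 2 (pow_ne_zero 2 h0))).mul h3)

/-- The derivative of the profile `s ↦ √(ρ² + s²) / s`. -/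
lemma hasDerivAt_sqrt_div {ρ s : ℝ} (hs : 0 < s) :
    HasDerivAt (fun s => Real.sqrt (ρ ^ 2 + s ^ 2) / s)
      (-(ρ ^ 2) / (Real.sqrt (ρ ^ 2 + s ^ 2) * s ^ 2)) s := by
  have h0 : 0 < ρ ^ 2 + s ^ 2 := by positivity
  have h1 : HasDerivAt (fun s : ℝ => ρ ^ 2 + s ^ 2) (2 * s) s := by
    simpa using (hasDerivAt_pow 2 s).const_add (ρ ^ 2)
  have h2 := (h1.sqrt h0.ne').div (hasDerivAt_id s) hs.ne'
  refine h2.congr_deriv ?_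
  have h3 := Real.sq_sqrt h0.le
  have h4 : 0 < Real.sqrt (ρ ^ 2 + s ^ 2) := Real.sqrt_pos.2 h0
  simp only [id]
  field_simp
  rw [h3]
  ring

/-- The form `ω₀ + ρ² ω_FS` is the pullback of `ω₀` by `z ↦ √(ρ² + |z|²) z / |z|`. -/
lemma stdForm_add_fubiniStudy {ρ : ℝ} {z : Cn n} (hz : z ≠ 0) :
    (stdForm n).compContinuousLinearMap
      (fderiv ℝ (fun z : Cn n => (Real.sqrt (ρ ^ 2 + ‖z‖ ^ 2) / ‖z‖) • z) z) =
    stdForm n + ρ ^ 2 • BlowUp.fubiniStudy n z := by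
  have h0 : 0 < ‖z‖ := norm_pos_iff.2 hz
  refine form_ext fun a b => ?_
  rw [form_comp_pair, (hasFDerivAt_radial hz (hasDerivAt_sqrt_div (ρ := ρ) h0)).fderiv]
  have h2 : (stdForm n + ρ ^ 2 • BlowUp.fubiniStudy n z) ![a, b] =
    stdForm n ![a, b] + ρ ^ 2 * BlowUp.fubiniStudy n z ![a, b] := rfl
  rw [h2, fubiniStudy_apply hz]
  simp only [add_apply, ContinuousLinearMap.smulRight_apply, smul_apply,
    ContinuousLinearMap.id_apply, innerSL_apply_apply, smul_eq_mul]
  rw [stdForm_radial]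
  have h1 : 0 < ρ ^ 2 + ‖z‖ ^ 2 := by positivity
  have h3 := Real.sq_sqrt h1.le
  have h4 : 0 < Real.sqrt (ρ ^ 2 + ‖z‖ ^ 2) := Real.sqrt_pos.2 h1
  rw [div_pow, h3]
  field_simp
  ring

/-- For weight `1`, the sum `ω₀ + ω_FS` is a pullback of the constant form `ω₀` and therefore
closed; subtracting `ω₀` leaves the claim. -/
lemma extDeriv_fubiniStudy {z : Cn n} (hz : z ≠ 0) : extDeriv (BlowUp.fubiniStudy n) z = 0 := by
  have h0 : 0 < ‖z‖ := norm_pos_iff.2 hz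
  have h1 : ContDiffAt ℝ ∞ (fun z : Cn n => (Real.sqrt (1 ^ 2 + ‖z‖ ^ 2) / ‖z‖) • z) z := by
    have h2 : ContDiffAt ℝ ∞ (fun z : Cn n => ‖z‖) z := contDiffAt_norm ℝ hz
    refine ContDiffAt.smul (ContDiffAt.div ?_ h2 h0.ne') contDiffAt_id
    exact (contDiffAt_const.add (h2.pow 2)).sqrt (by positivity)
  have h2 := extDeriv_pullback_eq_zero (τ := fun _ : Cn n => stdForm n) contDiffAt_const h1
    (extDeriv_const_form _ _)
  have h3 : (fun z : Cn n => (stdForm n).compContinuousLinearMap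
      (fderiv ℝ (fun z : Cn n => (Real.sqrt (1 ^ 2 + ‖z‖ ^ 2) / ‖z‖) • z) z)) =ᶠ[𝓝 z]
      fun z => stdForm n + BlowUp.fubiniStudy n z := by
    filter_upwards [isOpen_ne.mem_nhds hz] with y hy
    simpa using stdForm_add_fubiniStudy (ρ := 1) hy
  rw [h3.extDeriv_eq, extDeriv_fun_add (differentiableAt_const _)
    ((contDiffAt_fubiniStudy hz).differentiableAt (by simp)), extDeriv_const_form, zero_add] at h2
  exact h2

/-- The derivative of `hat j`. -/
def hatDeriv (j : Fin n) : Cn n →L[ℂ] Cn n :=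
  ContinuousLinearMap.id ℂ (Cn n) -
    (EuclideanSpace.proj j).smulRight (EuclideanSpace.single j (1 : ℂ))

lemma hatDeriv_apply (j : Fin n) (a : Cn n) (i : Fin n) :
    hatDeriv j a i = if i = j then 0 else a i := by
  by_cases h : i = j
  · subst h; simp [hatDeriv]
  · simp [hatDeriv, h]

lemma hasFDerivAt_hat (j : Fin n) (w : Cn n) :
    HasFDerivAt (hat j) ((hatDeriv j).restrictScalars ℝ) w := by
  have h : (hat j : Cn n → Cn n) = fun w => hatDeriv j w + EuclideanSpace.single j 1 := by
    ext w i
    by_cases h : i = j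
    · subst h; simp [hat, hatDeriv]
    · simp [hat, hatDeriv, h]
  rw [h]
  exact ((hatDeriv j).restrictScalars ℝ).hasFDerivAt.add_const _

/-- The derivative of the blow-down map in an affine chart. -/
def blowDownDeriv (j : Fin n) (w : Cn n) : Cn n →L[ℂ] Cn n :=
  w j • hatDeriv j + (EuclideanSpace.proj j).smulRight (hat j w)

lemma blowDownDeriv_apply (j : Fin n) (w a : Cn n) :
    blowDownDeriv j w a = a j • hat j w + w j • hatDeriv j a := by
  simp [blowDownDeriv, add_comm]

lemma hasFDerivAt_affineBlowDown (j : Fin n) (w : Cn n) :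
    HasFDerivAt (affineBlowDown j) ((blowDownDeriv j w).restrictScalars ℝ) w := by
  have h1 : HasFDerivAt (fun w : Cn n => w j)
      ((EuclideanSpace.proj j : Cn n →L[ℂ] ℂ).restrictScalars ℝ) w :=
    ((EuclideanSpace.proj j : Cn n →L[ℂ] ℂ).restrictScalars ℝ).hasFDerivAt
  refine (h1.smul (hasFDerivAt_hat j w)).congr_fderiv ?_
  ext v
  simp [blowDownDeriv]

lemma modelForm_apply (ρ : ℝ) (j : Fin n) (w a b : Cn n) : BlowUp.modelForm ρ j w ![a, b] =
    stdForm n ![blowDownDeriv j w a, blowDownDeriv j w b] +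
      ρ ^ 2 * BlowUp.fubiniStudy n (hat j w) ![hatDeriv j a, hatDeriv j b] := by
  change ((stdForm n).compContinuousLinearMap _ ![a, b] +
    ρ ^ 2 • (BlowUp.fubiniStudy n (hat j w)).compContinuousLinearMap _ ![a, b]) = _
  rw [form_comp_pair, form_comp_pair, (hasFDerivAt_hat j w).fderiv,
    (hasFDerivAt_affineBlowDown j w).fderiv]
  rfl

lemma modelForm_tame (ρ : ℝ) (j : Fin n) (w a : Cn n) :
    0 ≤ BlowUp.modelForm ρ j w ![a, Complex.I • a] := by
  rw [modelForm_apply, map_smul, map_smul, stdForm_self_I_smul]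
  have := fubiniStudy_tame (hat j w) (hatDeriv j a)
  positivity

/-- Both summands are nonnegative, so both vanish. The Fubini-Study part makes `hatDeriv j a` a
multiple of `hat j w`; their `j`-th coordinates are `0` and `1`, so the multiple is zero and only `a
j` can survive. Then the blow-down part is `a j • hat j w`, which kills `a j` as well. The
Fubini-Study part thus supplies the nondegeneracy which the blow-down map loses on `E`. -/
lemma eq_zero_of_modelForm_eq_zero {ρ : ℝ} (hρ : ρ ≠ 0) {j : Fin n} {w a : Cn n}
    (h : BlowUp.modelForm ρ j w ![a, Complex.I • a] = 0) : a = 0 := by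
  rw [modelForm_apply, map_smul, map_smul, stdForm_self_I_smul] at h
  have h1 := fubiniStudy_tame (hat j w) (hatDeriv j a)
  have h2 : 0 ≤ ‖blowDownDeriv j w a‖ ^ 2 := by positivity
  have h3 : 0 ≤ ρ ^ 2 * BlowUp.fubiniStudy n (hat j w) ![hatDeriv j a, Complex.I • hatDeriv j a] := by
    positivity
  have h4 : ‖blowDownDeriv j w a‖ ^ 2 = 0 := by linarith
  have h5 : blowDownDeriv j w a = 0 := by simpa using h4
  have h6 : BlowUp.fubiniStudy n (hat j w) ![hatDeriv j a, Complex.I • hatDeriv j a] = 0 := by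
    have : ρ ^ 2 * BlowUp.fubiniStudy n (hat j w) ![hatDeriv j a, Complex.I • hatDeriv j a] = 0 := by
      linarith
    simpa [hρ] using this
  obtain ⟨c, hc⟩ := Submodule.mem_span_singleton.1
    (mem_span_of_fubiniStudy_eq_zero (hat_ne_zero j w) h6)
  have hc0 : c = 0 := by
    have := congrArg (fun v : Cn n => v j) hc
    simpa [hat_same, hatDeriv_apply] using this
  rw [hc0, zero_smul] at hc
  rw [blowDownDeriv_apply, ← hc, smul_zero, add_zero] at h5
  have h7 : a j = 0 := by
    have := congrArg (fun v : Cn n => v j) h5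
    simpa [hat_same] using this
  ext i
  by_cases hi : i = j
  · subst hi; exact h7
  · have := congrArg (fun v : Cn n => v i) hc
    simpa [hatDeriv_apply, hi] using this.symm

lemma contDiffAt_modelForm (ρ : ℝ) (j : Fin n) (w : Cn n) :
    ContDiffAt ℝ ∞ (BlowUp.modelForm ρ j) w :=
  (contDiffAt_pullback (τ := fun _ => stdForm n) contDiffAt_const
    (contDiff_affineBlowDown j).contDiffAt).add
  ((contDiffAt_pullback (contDiffAt_fubiniStudy (hat_ne_zero j w))
    (contDiff_hat j).contDiffAt).const_smul _)

lemma extDeriv_modelForm (ρ : ℝ) (j : Fin n) (w : Cn n) :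
    extDeriv (BlowUp.modelForm ρ j) w = 0 := by
  have h1 := contDiffAt_pullback (τ := fun _ : Cn n => stdForm n) contDiffAt_const
    (contDiff_affineBlowDown j).contDiffAt (x := w)
  have h2 := contDiffAt_pullback (contDiffAt_fubiniStudy (hat_ne_zero j w))
    (contDiff_hat j).contDiffAt (x := w)
  have h3 := extDeriv_pullback_eq_zero (τ := fun _ : Cn n => stdForm n) contDiffAt_const
    (contDiff_affineBlowDown j).contDiffAt (x := w) (extDeriv_const_form _ _)
  have h4 := extDeriv_pullback_eq_zero (contDiffAt_fubiniStudy (hat_ne_zero j w))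
    (contDiff_hat j).contDiffAt (x := w) (extDeriv_fubiniStudy (hat_ne_zero j w))
  have h5 := extDeriv_fun_add (h1.differentiableAt (by simp))
    ((h2.const_smul (ρ ^ 2)).differentiableAt (by simp))
  refine h5.trans ?_
  rw [h3, zero_add]
  refine (extDeriv_fun_smul (ρ ^ 2) _).trans ?_
  rw [h4, smul_zero]

/-- Off the exceptional divisor, the model form is the pullback of `ω₀ + ρ² ω_FS` by the
blow-down map. -/
lemma modelForm_eq_of_ne {ρ : ℝ} {j : Fin n} {w : Cn n} (hw : w j ≠ 0) (a b : Cn n) :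
    BlowUp.modelForm ρ j w ![a, b] = (stdForm n + ρ ^ 2 • BlowUp.fubiniStudy n (affineBlowDown j w))
      ![blowDownDeriv j w a, blowDownDeriv j w b] := by
  rw [modelForm_apply]
  change _ = stdForm n ![_, _] + ρ ^ 2 * BlowUp.fubiniStudy n _ ![_, _]
  rw [blowDownDeriv_apply, blowDownDeriv_apply, affineBlowDown,
    fubiniStudy_smul hw (hat_ne_zero j w)]

/-- The model form does not depend on the affine chart. -/
lemma modelForm_transition {ρ : ℝ} {i j : Fin n} {T : Cn n → Cn n} {T' : Cn n →L[ℝ] Cn n}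
    {w : Cn n} (hT : HasFDerivAt T T' w) {c : Cn n → ℂ} {c' : Cn n →L[ℝ] ℂ}
    (hc : HasFDerivAt c c' w) (hc0 : c w ≠ 0)
    (h1 : ∀ᶠ w in 𝓝 w, affineBlowDown j (T w) = affineBlowDown i w)
    (h2 : ∀ᶠ w in 𝓝 w, hat j (T w) = c w • hat i w) (a b : Cn n) :
    BlowUp.modelForm ρ j (T w) ![T' a, T' b] = BlowUp.modelForm ρ i w ![a, b] := by
  have e1 : ∀ a, blowDownDeriv j (T w) (T' a) = blowDownDeriv i w a := by
    have := (((hasFDerivAt_affineBlowDown j (T w)).comp w hT).congr_of_eventuallyEq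
      (h1.mono fun w hw => hw.symm)).unique (hasFDerivAt_affineBlowDown i w)
    exact fun a => congrArg (fun A : Cn n →L[ℝ] Cn n => A a) this
  have e2 : ∀ a, hatDeriv j (T' a) = c' a • hat i w + c w • hatDeriv i a := by
    have := (((hasFDerivAt_hat j (T w)).comp w hT).congr_of_eventuallyEq
      (h2.mono fun w hw => hw.symm)).unique (hc.smul (hasFDerivAt_hat i w))
    intro a
    have := congrArg (fun A : Cn n →L[ℝ] Cn n => A a) this
    simpa [add_comm] using this
  rw [modelForm_apply, modelForm_apply, e1, e1, e2, e2, h2.self_of_nhds,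
    fubiniStudy_smul hc0 (hat_ne_zero i w)]

end RadialForms

/-! ### Smoothness and closedness of 2-forms on manifolds -/

section FormsOnManifolds

variable {n : ℕ} {N : Type*} [TopologicalSpace N] [ChartedSpace (Cn n) N]
  [IsManifold 𝓘(ℝ, Cn n) ∞ N]

/-- A form which is near `x` the pullback of a smooth closed form on `ℂⁿ` is smooth and closed
in all charts at `x`. -/
lemma smooth_closed_of_pullback {Θ : TwoForm n N} {f : N → Cn n}
    {τ : Cn n → Cn n [⋀^Fin 2]→L[ℝ] ℝ} {x : N} (hf : ContMDiffAt 𝓘(ℝ, Cn n) 𝓘(ℝ, Cn n) ∞ f x)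
    (hτ : ContDiffAt ℝ ∞ τ (f x)) (hτc : extDeriv τ (f x) = 0)
    (h : ∀ᶠ y in 𝓝 x, ∀ a b, Θ y ![a, b] = τ (f y) ![mfd f y a, mfd f y b])
    {φ : OpenPartialHomeomorph N (Cn n)} (hφ : φ ∈ IsManifold.maximalAtlas 𝓘(ℝ, Cn n) ∞ N)
    (hx : x ∈ φ.source) :
    ContDiffAt ℝ ∞ (Θ.inChart φ) (φ x) ∧ extDeriv (Θ.inChart φ) (φ x) = 0 := by
  have hxt := φ.map_source hx
  have hs : ContMDiffAt 𝓘(ℝ, Cn n) 𝓘(ℝ, Cn n) ∞ φ.symm (φ x) :=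
    contMDiffAt_symm_of_mem_maximalAtlas hφ hxt
  have hg : ContDiffAt ℝ ∞ (f ∘ φ.symm) (φ x) := by
    rw [← contMDiffAt_iff_contDiffAt]
    refine ContMDiffAt.comp (φ x) ?_ hs
    rwa [φ.left_inv hx]
  have hfx : (f ∘ φ.symm) (φ x) = f x := by simp [φ.left_inv hx]
  have hcont : ContinuousAt φ.symm (φ x) := hs.continuousAt
  have hev : Θ.inChart φ =ᶠ[𝓝 (φ x)] fun y =>
      (τ ((f ∘ φ.symm) y)).compContinuousLinearMap (fderiv ℝ (f ∘ φ.symm) y) := by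
    let P : N → Prop := fun y => ∀ a b, Θ y ![a, b] = τ (f y) ![mfd f y a, mfd f y b]
    have h1 : ∀ᶠ y in 𝓝 (φ x), P (φ.symm y) := by
      refine hcont.eventually (p := P) ?_
      rwa [φ.left_inv hx]
    have h2 : ∀ᶠ y in 𝓝 x, MDifferentiableAt 𝓘(ℝ, Cn n) 𝓘(ℝ, Cn n) f y := by
      have h2 : ContMDiffAt 𝓘(ℝ, Cn n) 𝓘(ℝ, Cn n) 1 f x := hf.of_le (by simp)
      filter_upwards [(contMDiffAt_iff_contMDiffAt_nhds (by simp)).1 h2] with y hy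
      exact hy.mdifferentiableAt (by simp)
    have h3 : ∀ᶠ y in 𝓝 (φ x), MDifferentiableAt 𝓘(ℝ, Cn n) 𝓘(ℝ, Cn n) f (φ.symm y) := by
      refine hcont.eventually ?_
      rwa [φ.left_inv hx]
    filter_upwards [h1, h3, φ.open_target.mem_nhds hxt] with y hy1 hy3 hy2
    refine form_ext fun a b => ?_
    rw [form_comp_pair, TwoForm.inChart]
    erw [form_comp_pair]
    rw [hy1]
    have hd : MDifferentiableAt 𝓘(ℝ, Cn n) 𝓘(ℝ, Cn n) φ.symm y :=
      (contMDiffAt_symm_of_mem_maximalAtlas hφ hy2).mdifferentiableAt (by simp)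
    have h4 := mfderiv_comp y hy3 hd
    rw [mfderiv_eq_fderiv] at h4
    rw [h4]
    rfl
  refine ⟨ContDiffAt.congr_of_eventuallyEq (contDiffAt_pullback (by rwa [hfx]) hg) hev, ?_⟩
  rw [hev.extDeriv_eq]
  exact extDeriv_pullback_eq_zero (by rwa [hfx]) hg (by rwa [hfx])

/-- A 2-form expressed by its coordinate expression. -/
lemma TwoForm.eq_inChart (Ω : TwoForm n N) {φ : OpenPartialHomeomorph N (Cn n)}
    (hφ : φ ∈ IsManifold.maximalAtlas 𝓘(ℝ, Cn n) ∞ N) {x : N} (hx : x ∈ φ.source)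
    (a b : TangentSpace 𝓘(ℝ, Cn n) x) :
    Ω x ![a, b] = Ω.inChart φ (φ x) ![mfd φ x a, mfd φ x b] := by
  have hmd := OpenPartialHomeomorph.mdifferentiable_of_mem_maximalAtlas hφ
  rw [TwoForm.inChart]
  erw [form_comp_pair]
  have h1 : ∀ a, mfderiv 𝓘(ℝ, Cn n) 𝓘(ℝ, Cn n) φ.symm (φ x) (mfd φ x a) = a := fun a =>
    DFunLike.congr_fun (hmd.symm_comp_deriv hx) a
  erw [h1, h1]
  have h2 : ∀ y : N, y = x → ∀ a b : Cn n, Ω x ![(a : TangentSpace 𝓘(ℝ, Cn n) x), b] =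
      Ω y ![(a : TangentSpace 𝓘(ℝ, Cn n) y), b] := by
    rintro _ rfl a b; rfl
  exact h2 _ (φ.left_inv hx) a b

/-- Local criterion: pullbacks of symplectic forms are smooth and closed. -/
lemma smooth_closed_of_pullback_symplectic {M : Type*} [TopologicalSpace M]
    [ChartedSpace (Cn n) M] [IsManifold 𝓘(ℝ, Cn n) ∞ M] {Ω : TwoForm n M}
    (hΩ : IsSymplecticForm Ω) {Θ : TwoForm n N} {f : N → M} {x : N}
    (hf : ContMDiffAt 𝓘(ℝ, Cn n) 𝓘(ℝ, Cn n) ∞ f x)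
    (h : ∀ᶠ y in 𝓝 x, ∀ a b, Θ y ![a, b] =
      Ω (f y) ![mfderiv 𝓘(ℝ, Cn n) 𝓘(ℝ, Cn n) f y a, mfderiv 𝓘(ℝ, Cn n) 𝓘(ℝ, Cn n) f y b])
    {φ : OpenPartialHomeomorph N (Cn n)} (hφ : φ ∈ IsManifold.maximalAtlas 𝓘(ℝ, Cn n) ∞ N)
    (hx : x ∈ φ.source) :
    ContDiffAt ℝ ∞ (Θ.inChart φ) (φ x) ∧ extDeriv (Θ.inChart φ) (φ x) = 0 := by
  set ψ := chartAt (Cn n) (f x) with hψ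
  have hψm : ψ ∈ IsManifold.maximalAtlas 𝓘(ℝ, Cn n) ∞ M := IsManifold.chart_mem_maximalAtlas _
  have hfx : f x ∈ ψ.source := mem_chart_source _ _
  have hψs : ContMDiffAt 𝓘(ℝ, Cn n) 𝓘(ℝ, Cn n) ∞ ψ (f x) :=
    contMDiffAt_of_mem_maximalAtlas hψm hfx
  refine smooth_closed_of_pullback (f := ψ ∘ f) (τ := Ω.inChart ψ) (hψs.comp x hf)
    ((hΩ.smooth ψ (chart_mem_atlas _ _)).contDiffAt (ψ.open_target.mem_nhds (ψ.map_source hfx)))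
    (hΩ.closed ψ (chart_mem_atlas _ _) _ (ψ.map_source hfx)) ?_ hφ hx
  have h2 : ∀ᶠ y in 𝓝 x, MDifferentiableAt 𝓘(ℝ, Cn n) 𝓘(ℝ, Cn n) f y := by
    have h2 : ContMDiffAt 𝓘(ℝ, Cn n) 𝓘(ℝ, Cn n) 1 f x := hf.of_le (by simp)
    filter_upwards [(contMDiffAt_iff_contMDiffAt_nhds (by simp)).1 h2] with y hy
    exact hy.mdifferentiableAt (by simp)
  filter_upwards [h, h2, hf.continuousAt.eventually_mem (ψ.open_source.mem_nhds hfx)]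
    with y hy hyd hys a b
  rw [hy, Ω.eq_inChart hψm hys]
  have h3 := mfderiv_comp y
    ((contMDiffAt_of_mem_maximalAtlas hψm hys).mdifferentiableAt (by simp)) hyd
  have h4 : ∀ a, mfd (ψ ∘ f) y a = mfd ψ (f y) (mfderiv 𝓘(ℝ, Cn n) 𝓘(ℝ, Cn n) f y a) :=
    fun a => DFunLike.congr_fun h3 a
  rw [h4, h4]
  rfl

end FormsOnManifolds

/-! ### The blow-down map as a smooth map -/

lemma SmoothBall.symm_mem_maximalAtlas {n : ℕ} {M : Type*} [TopologicalSpace M]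
    [ChartedSpace (Cn n) M] [IsManifold 𝓘(ℝ, Cn n) ∞ M] (B : SmoothBall n M) :
    B.ι.symm ∈ IsManifold.maximalAtlas 𝓘(ℝ, Cn n) ∞ M :=
  B.ι.symm.mem_maximalAtlas_of_contMDiffOn B.smooth_symm (by simpa using B.smooth)

namespace BlowUp

variable {n : ℕ} {M : Type*} [TopologicalSpace M] [ChartedSpace (Cn n) M] (B : SmoothBall n M)

lemma proj_ofLine (s : ℂ) (v : Cn n) (hv : v ≠ 0) : proj B (ofLine B s v hv) = B.ι (s • v) := by
  by_cases h : B.ι (s • v) = B.center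
  · simp [ofLine, h, proj]
  · simp [ofLine, h, proj]

lemma proj_ne_center_iff {p : BlowUp B} :
    proj B p ≠ B.center ↔ ∃ (x : M) (hx : x ≠ B.center), p = off x hx := by
  cases p with
  | off x hx => exact ⟨fun _ => ⟨x, hx, rfl⟩, fun _ => hx⟩
  | exc l => exact ⟨fun h => absurd rfl h, fun ⟨_, _, h⟩ => by cases h⟩

/-- The coordinate in the ball. -/
def ballCoord (p : BlowUp B) : Cn n := B.ι.symm (proj B p)

lemma affineBlowDown_affineChart {j : Fin n} {p : BlowUp B} (hp : p ∈ (affineChart B j).source) :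
    proj B p ∈ B.ι.target ∧ affineBlowDown j (affineChart B j p) = ballCoord B p := by
  have h1 : affineBlowDown j (affineChart B j p) ∈ B.ι.source := (affineChart B j).map_source hp
  have h2 : proj B p = B.ι (affineBlowDown j (affineChart B j p)) := by
    conv_lhs => rw [← (affineChart B j).left_inv hp]
    exact proj_ofLine B _ _ _
  rw [ballCoord, h2, B.ι.left_inv h1]
  exact ⟨B.ι.map_source h1, rfl⟩

lemma ballCoord_eq_zero_iff {p : BlowUp B} (hp : proj B p ∈ B.ι.target) :
    ballCoord B p = 0 ↔ proj B p = B.center := B.symm_eq_zero_iff hp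

lemma exists_mem_affineChart_source {p : BlowUp B} (hp : proj B p ∈ B.ι.target) :
    ∃ j, p ∈ (affineChart B j).source := by
  cases p with
  | off x hx =>
    have h0 : B.ι.symm x ≠ 0 := fun h => hx ((B.symm_eq_zero_iff hp).1 h)
    by_contra! h
    refine h0 ?_
    ext j
    by_contra hj
    exact h j ⟨hp, hj⟩
  | exc l => exact ⟨lineIndex l, (exists_rep_ne_zero l).choose_spec⟩

variable [NeZero n]

open Classical in
/-- The inverse of the blow-down map off the center. -/
def lift (x : M) : BlowUp B :=
  -- The value at the centre is arbitrary; the map is used only off it.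
  if h : x = B.center then exc (Projectivization.mk ℂ (hat 0 0) (hat_ne_zero 0 0)) else off x h

lemma proj_lift (x : M) : proj B (lift B x) = x := by
  by_cases h : x = B.center
  · simp [lift, h, proj]
  · simp [lift, h, proj]

lemma lift_proj {p : BlowUp B} (hp : proj B p ≠ B.center) : lift B (proj B p) = p := by
  obtain ⟨x, hx, rfl⟩ := (proj_ne_center_iff B).1 hp
  simp [lift, proj, hx]

variable [T2Space M] [IsManifold 𝓘(ℝ, Cn n) ∞ M]

/-- The affine charts as charts of the manifold. -/
def affineHomeo (j : Fin n) : OpenPartialHomeomorph (BlowUp B) (Cn n) :=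
  (core B).openPartialHomeomorph (affineChart B j) (Or.inr ⟨j, rfl⟩)

/-- The charts of `M ∖ {x₀}` as charts of the manifold. -/
def offHomeo {φ : OpenPartialHomeomorph M (Cn n)} (hφ : φ ∈ atlas (Cn n) M) :
    OpenPartialHomeomorph (BlowUp B) (Cn n) :=
  (core B).openPartialHomeomorph (offChart B φ) (Or.inl ⟨φ, hφ, rfl⟩)

lemma mem_atlas_of_mem_charts {e : PartialEquiv (BlowUp B) (Cn n)} (he : e ∈ (core B).atlas) :
    (core B).openPartialHomeomorph e he ∈ atlas (Cn n) (BlowUp B) := by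
  change _ ∈ ⋃ (f : PartialEquiv (BlowUp B) (Cn n)) (hf : f ∈ (core B).atlas),
    {(core B).openPartialHomeomorph f hf}
  simp only [mem_iUnion, mem_singleton_iff]
  exact ⟨e, he, rfl⟩

lemma affineHomeo_mem (j : Fin n) :
    affineHomeo B j ∈ IsManifold.maximalAtlas 𝓘(ℝ, Cn n) ∞ (BlowUp B) :=
  IsManifold.subset_maximalAtlas (mem_atlas_of_mem_charts B _)

lemma offHomeo_mem {φ : OpenPartialHomeomorph M (Cn n)} (hφ : φ ∈ atlas (Cn n) M) :
    offHomeo B hφ ∈ IsManifold.maximalAtlas 𝓘(ℝ, Cn n) ∞ (BlowUp B) :=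
  IsManifold.subset_maximalAtlas (mem_atlas_of_mem_charts B _)

/-- Over the centre `π` is the polynomial map `affineBlowDown` in an affine chart, followed by `ι`.
Elsewhere it is the identity in charts of `M`. -/
lemma contMDiff_proj : ContMDiff 𝓘(ℝ, Cn n) 𝓘(ℝ, Cn n) ∞ (proj B) := by
  intro p
  by_cases hp : proj B p = B.center
  · have hpt : proj B p ∈ B.ι.target := hp ▸ B.ι.map_source B.zero_mem
    obtain ⟨j, hj⟩ := exists_mem_affineChart_source B hpt
    have hj' : p ∈ (affineHomeo B j).source := hj
    have h1 : proj B =ᶠ[𝓝 p] fun q => B.ι (affineBlowDown j (affineHomeo B j q)) := by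
      filter_upwards [(affineHomeo B j).open_source.mem_nhds hj'] with q hq
      have h2 := affineBlowDown_affineChart B hq
      change _ = B.ι (affineBlowDown j (affineChart B j q))
      rw [h2.2, ballCoord, B.ι.right_inv h2.1]
    refine ContMDiffAt.congr_of_eventuallyEq ?_ h1
    have h3 : affineBlowDown j (affineHomeo B j p) ∈ B.ι.source :=
      (affineChart B j).map_source hj
    exact (B.smooth.contMDiffAt (B.ι.open_source.mem_nhds h3)).comp p
      ((contDiff_affineBlowDown j).contMDiff.contMDiffAt.comp p
        (contMDiffAt_of_mem_maximalAtlas (affineHomeo_mem B j) hj'))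
  · obtain ⟨x, hx, rfl⟩ := (proj_ne_center_iff B).1 hp
    set φ := chartAt (Cn n) x
    have hφ : φ ∈ atlas (Cn n) M := chart_mem_atlas _ _
    have hps : (off x hx : BlowUp B) ∈ (offHomeo B hφ).source := mem_chart_source (Cn n) x
    have h1 : proj B =ᶠ[𝓝 (off x hx)] fun q => φ.symm (offHomeo B hφ q) := by
      filter_upwards [(offHomeo B hφ).open_source.mem_nhds hps] with q hq
      cases q with
      | off y hy => exact (φ.left_inv hq).symm
      | exc l => exact hq.elim
    refine ContMDiffAt.congr_of_eventuallyEq ?_ h1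
    exact (contMDiffAt_symm_of_mem_maximalAtlas (IsManifold.subset_maximalAtlas hφ)
      (φ.map_source (mem_chart_source (Cn n) x))).comp (off x hx)
        (contMDiffAt_of_mem_maximalAtlas (offHomeo_mem B hφ) hps)

lemma contMDiffOn_lift : ContMDiffOn 𝓘(ℝ, Cn n) 𝓘(ℝ, Cn n) ∞ (lift B) {B.center}ᶜ := by
  intro x hx
  refine ContMDiffAt.contMDiffWithinAt ?_
  set φ := chartAt (Cn n) x
  have hφ : φ ∈ atlas (Cn n) M := chart_mem_atlas _ _
  have hxs : x ∈ φ.source := mem_chart_source (Cn n) x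
  have h1 : lift B =ᶠ[𝓝 x] fun y => (offHomeo B hφ).symm (φ y) := by
    filter_upwards [φ.open_source.mem_nhds hxs, isOpen_ne.mem_nhds hx] with y hy hyc
    change _ = (offChart B φ).symm (φ y)
    simp only [offChart, PartialEquiv.coe_symm_mk, φ.left_inv hy, lift]
    rw [dif_neg hyc, dif_neg (by rw [φ.left_inv hy]; exact hyc)]
  refine ContMDiffAt.congr_of_eventuallyEq ?_ h1
  refine (contMDiffAt_symm_of_mem_maximalAtlas (offHomeo_mem B hφ) ?_).comp x
    (contMDiffAt_of_mem_maximalAtlas (IsManifold.subset_maximalAtlas hφ) hxs)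
  refine ⟨φ.map_source hxs, ?_⟩
  rw [φ.left_inv hxs]
  exact hx

/-- The blow-down map is a diffeomorphism off the exceptional divisor. -/
def projHomeo : OpenPartialHomeomorph (BlowUp B) M where
  toFun := proj B
  invFun := lift B
  source := proj B ⁻¹' {B.center}ᶜ
  target := {B.center}ᶜ
  map_source' _ h := h
  map_target' x h := by simpa [proj_lift] using h
  left_inv' _ h := lift_proj B h
  right_inv' x _ := proj_lift B x
  open_source := isOpen_compl_singleton.preimage (contMDiff_proj B).continuous
  open_target := isOpen_compl_singleton
  continuousOn_toFun := (contMDiff_proj B).continuous.continuousOn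
  continuousOn_invFun := (contMDiffOn_lift B).continuousOn

/-- Charts of `M` as charts of the blow-up. -/
lemma projHomeo_trans_mem {φ : OpenPartialHomeomorph M (Cn n)}
    (hφ : φ ∈ IsManifold.maximalAtlas 𝓘(ℝ, Cn n) ∞ M) :
    (projHomeo B).trans φ ∈ IsManifold.maximalAtlas 𝓘(ℝ, Cn n) ∞ (BlowUp B) := by
  refine OpenPartialHomeomorph.mem_maximalAtlas_of_contMDiffOn _ ?_ ?_
  · exact (contMDiffOn_of_mem_maximalAtlas hφ).comp (contMDiff_proj B).contMDiffOn
      (fun p hp => hp.2)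
  · exact (contMDiffOn_lift B).comp
      ((contMDiffOn_symm_of_mem_maximalAtlas hφ).mono fun y hy => hy.1) (fun y hy => hy.2)

lemma mfderiv_proj_bijective {p : BlowUp B} (hp : proj B p ≠ B.center) :
    Function.Bijective (mfderiv 𝓘(ℝ, Cn n) 𝓘(ℝ, Cn n) (proj B) p) := by
  have h : (projHomeo B).MDifferentiable 𝓘(ℝ, Cn n) 𝓘(ℝ, Cn n) :=
    ⟨(contMDiff_proj B).contMDiffOn.mdifferentiableOn (by simp),
      (contMDiffOn_lift B).mdifferentiableOn (by simp)⟩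
  exact h.mfderiv_bijective (x := p) hp

lemma contMDiffAt_ballCoord {p : BlowUp B} (hp : proj B p ∈ B.ι.target) :
    ContMDiffAt 𝓘(ℝ, Cn n) 𝓘(ℝ, Cn n) ∞ (ballCoord B) p :=
  (B.smooth_symm.contMDiffAt (B.ι.open_target.mem_nhds hp)).comp p (contMDiff_proj B p)

lemma mfd_ballCoord {p : BlowUp B} (hp : proj B p ∈ B.ι.target) (a : TangentSpace 𝓘(ℝ, Cn n) p) :
    mfd (ballCoord B) p a = mfd B.ι.symm (proj B p)
      (mfderiv 𝓘(ℝ, Cn n) 𝓘(ℝ, Cn n) (proj B) p a) := by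
  have h := mfderiv_comp p
    ((B.smooth_symm.contMDiffAt (B.ι.open_target.mem_nhds hp)).mdifferentiableAt (by simp))
    ((contMDiff_proj B p).mdifferentiableAt (by simp))
  exact DFunLike.congr_fun h a

lemma mfd_ballCoord_affine {j : Fin n} {p : BlowUp B} (hp : p ∈ (affineChart B j).source)
    (a : TangentSpace 𝓘(ℝ, Cn n) p) : mfd (ballCoord B) p a =
      blowDownDeriv j (affineChart B j p) (mfd (affineChart B j) p a) := by
  have hp' : p ∈ (affineHomeo B j).source := hp
  have h1 : ballCoord B =ᶠ[𝓝 p] affineBlowDown j ∘ affineHomeo B j := by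
    filter_upwards [(affineHomeo B j).open_source.mem_nhds hp'] with q hq
    exact (affineBlowDown_affineChart B hq).2.symm
  have h2 := mfderiv_comp p
    ((contDiff_affineBlowDown j).contMDiff.contMDiffAt.mdifferentiableAt (by simp))
    ((contMDiffAt_of_mem_maximalAtlas (affineHomeo_mem B j) hp').mdifferentiableAt (by simp))
  rw [← h1.mfderiv_eq, mfderiv_eq_fderiv, (hasFDerivAt_affineBlowDown j _).fderiv] at h2
  exact DFunLike.congr_fun h2 a

lemma mfd_affineChart_bijective {j : Fin n} {p : BlowUp B} (hp : p ∈ (affineChart B j).source) :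
    Function.Bijective (mfd (affineChart B j) p) :=
  (OpenPartialHomeomorph.mdifferentiable_of_mem_maximalAtlas
    (affineHomeo_mem B j)).mfderiv_bijective (x := p) hp

lemma mfd_ballCoord_bijective {p : BlowUp B} (hp : proj B p ∈ B.ι.target)
    (hp' : proj B p ≠ B.center) : Function.Bijective (mfd (ballCoord B) p) :=
  (OpenPartialHomeomorph.mdifferentiable_of_mem_maximalAtlas
    (projHomeo_trans_mem B B.symm_mem_maximalAtlas)).mfderiv_bijective (x := p) ⟨hp', hp⟩

end BlowUp

/-! ### The blow-up form -/

section Profile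

variable {ρ r δ : ℝ} {β : ℝ → ℝ}

namespace BlowUp.IsProfile

/-- The two prescribed formulas cannot agree anywhere, since `√(ρ² + s²) ≠ s` for `ρ > 0`. So the
inner and the outer interval are disjoint. -/
lemma delta_lt (h : IsProfile ρ r δ β) (hρ : 0 < ρ) : δ < r - δ := by
  have hlt := h.lt
  have hpos := h.pos
  by_contra! hle
  have h1 : ∀ s, 0 ≤ s → Real.sqrt (ρ ^ 2 + s ^ 2) ≠ s := by
    intro s hs h2
    have h3 := Real.sq_sqrt (show 0 ≤ ρ ^ 2 + s ^ 2 by positivity)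
    rw [h2] at h3
    have : 0 < ρ ^ 2 := by positivity
    linarith
  rcases le_total 0 (r - δ) with h0 | h0
  · exact h1 _ h0 ((h.inner _ ⟨h0, hle⟩).symm.trans (h.outer _ ⟨le_rfl, by linarith⟩))
  · exact h1 0 le_rfl ((h.inner _ ⟨le_rfl, hpos.le⟩).symm.trans (h.outer _ ⟨h0, by linarith⟩))

lemma contDiffAt (h : IsProfile ρ r δ β) {s : ℝ} (hs : 0 < s) (hs' : s < r) :
    ContDiffAt ℝ ∞ β s :=
  h.smooth.contDiffAt (Icc_mem_nhds hs hs')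

lemma hasDerivAt (h : IsProfile ρ r δ β) {s : ℝ} (hs : 0 < s) (hs' : s < r) :
    HasDerivAt β (deriv β s) s :=
  ((h.contDiffAt hs hs').differentiableAt (by simp)).hasDerivAt

/-- Positivity is prescribed only up to `r - δ`; beyond that `β` is the identity. -/
lemma deriv_pos (h : IsProfile ρ r δ β) {s : ℝ} (hs : 0 < s) (hs' : s < r) : 0 < deriv β s := by
  rcases le_or_gt s (r - δ) with h1 | h1
  · exact (h.deriv_mem s ⟨hs, h1⟩).1
  · have h2 : β =ᶠ[𝓝 s] id := by
      filter_upwards [Icc_mem_nhds h1 hs'] with t ht using h.outer t ht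
    rw [h2.deriv_eq, deriv_id]
    exact one_pos

lemma strictMonoOn (h : IsProfile ρ r δ β) : StrictMonoOn β (Icc 0 r) := by
  refine strictMonoOn_of_deriv_pos (convex_Icc _ _) h.smooth.continuousOn fun s hs => ?_
  rw [interior_Icc] at hs
  exact h.deriv_pos hs.1 hs.2

lemma apply_pos (h : IsProfile ρ r δ β) {s : ℝ} (hs : 0 < s) (hs' : s < r) :
    0 < β s := by
  have h1 := h.strictMonoOn ⟨le_rfl, (hs.trans hs').le⟩ ⟨hs.le, hs'.le⟩ hs
  rw [h.inner 0 ⟨le_rfl, h.pos.le⟩] at h1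
  exact (Real.sqrt_nonneg _).trans_lt h1

lemma apply_lt (h : IsProfile ρ r δ β) {s : ℝ} (hs : 0 < s) (hs' : s < r) : β s < r := by
  have h1 := h.strictMonoOn ⟨hs.le, hs'.le⟩ ⟨(hs.trans hs').le, le_rfl⟩ hs'
  rwa [h.outer r ⟨by linarith [h.pos], le_rfl⟩] at h1

lemma hasDerivAt_div (h : IsProfile ρ r δ β) {s : ℝ} (hs : 0 < s) (hs' : s < r) :
    HasDerivAt (fun s => β s / s) ((deriv β s * s - β s) / s ^ 2) s := by
  refine ((h.hasDerivAt hs hs').div (hasDerivAt_id s) hs.ne').congr_deriv ?_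
  simp

end BlowUp.IsProfile

/-- The radial map `z ↦ β(|z|) z / |z|`. -/
def radialMap {n : ℕ} (β : ℝ → ℝ) (z : Cn n) : Cn n := (β ‖z‖ / ‖z‖) • z

lemma contDiffAt_radialMap {n : ℕ} (h : BlowUp.IsProfile ρ r δ β) {z : Cn n} (hz : z ≠ 0)
    (hz' : ‖z‖ < r) : ContDiffAt ℝ ∞ (radialMap β) z := by
  have h1 : ContDiffAt ℝ ∞ (fun z : Cn n => ‖z‖) z := contDiffAt_norm ℝ hz
  have h2 : ContDiffAt ℝ ∞ (fun z : Cn n => β ‖z‖) z :=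
    (h.contDiffAt (norm_pos_iff.2 hz) hz').comp z h1
  exact (h2.div h1 (norm_ne_zero_iff.2 hz)).smul contDiffAt_id

lemma norm_radialMap {n : ℕ} (h : BlowUp.IsProfile ρ r δ β) {z : Cn n} (hz : z ≠ 0)
    (hz' : ‖z‖ < r) : ‖radialMap β z‖ = β ‖z‖ := by
  have h0 := norm_pos_iff.2 hz
  have h1 := h.apply_pos h0 hz'
  rw [radialMap, norm_smul, Real.norm_of_nonneg (by positivity)]
  field_simp

/-- The pullback of the standard form by the radial map. -/
def radialForm {n : ℕ} (β : ℝ → ℝ) (z a b : Cn n) : ℝ :=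
  (β ‖z‖ / ‖z‖) ^ 2 * stdForm n ![a, b] + β ‖z‖ / ‖z‖ *
    ((deriv β ‖z‖ * ‖z‖ - β ‖z‖) / ‖z‖ ^ 2 / ‖z‖) * radialPart z a b

lemma stdForm_fderiv_radialMap {n : ℕ} (h : BlowUp.IsProfile ρ r δ β) {z : Cn n}
    (hz : z ≠ 0) (hz' : ‖z‖ < r) (a b : Cn n) :
    stdForm n ![fderiv ℝ (radialMap β) z a, fderiv ℝ (radialMap β) z b] = radialForm β z a b := by
  have h1 : HasFDerivAt (radialMap β) _ z :=
    hasFDerivAt_radial hz (h.hasDerivAt_div (norm_pos_iff.2 hz) hz')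
  rw [h1.fderiv]
  simp only [add_apply, ContinuousLinearMap.smulRight_apply, smul_apply,
    ContinuousLinearMap.id_apply, innerSL_apply_apply, smul_eq_mul]
  rw [stdForm_radial, radialForm]

/-- With `s = |z|` and `q = |⟨z, a⟩|`, the value is `β/s⁴ (β (s²|a|² - q²) + β' s q²)`. Both terms
are nonnegative by the Cauchy-Schwarz inequality and the monotonicity of `β`, and they cannot vanish
together. -/
lemma radialForm_tame {n : ℕ} (h : BlowUp.IsProfile ρ r δ β) {z : Cn n}
    (hz : z ≠ 0) (hz' : ‖z‖ < r) {a : Cn n} (ha : a ≠ 0) :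
    0 < radialForm β z a (Complex.I • a) := by
  rw [radialForm, stdForm_self_I_smul, radialPart_self_I_smul]
  have h0 := norm_pos_iff.2 hz
  have ha0 := norm_pos_iff.2 ha
  have hb := h.apply_pos h0 hz'
  have hd := h.deriv_pos h0 hz'
  set s := ‖z‖
  set q := ‖(inner ℂ z a : ℂ)‖
  have hq : q ^ 2 ≤ s ^ 2 * ‖a‖ ^ 2 := by
    rw [← mul_pow]
    exact pow_le_pow_left₀ (norm_nonneg _) (norm_inner_le_norm z a) 2
  have h1 : (β s / s) ^ 2 * ‖a‖ ^ 2 + β s / s * ((deriv β s * s - β s) / s ^ 2 / s) * q ^ 2 =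
      β s / s ^ 4 * (β s * (s ^ 2 * ‖a‖ ^ 2 - q ^ 2) + deriv β s * s * q ^ 2) := by
    field_simp
    ring
  rw [h1]
  refine mul_pos (by positivity) ?_
  rcases eq_or_ne q 0 with hq0 | hq0
  · rw [hq0]
    have : 0 < β s * (s ^ 2 * ‖a‖ ^ 2) := by positivity
    linarith
  · have h2 : 0 < deriv β s * s * q ^ 2 := by positivity
    have h3 : 0 ≤ β s * (s ^ 2 * ‖a‖ ^ 2 - q ^ 2) := mul_nonneg hb.le (by linarith)
    linarith

/-- In the inner region the radial form is `ω₀ + ρ² ω_FS`. -/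
lemma radialForm_eq_of_lt {n : ℕ} (h : BlowUp.IsProfile ρ r δ β) (hρ : 0 < ρ) {z : Cn n} (hz : z ≠ 0)
    (hz' : ‖z‖ < δ) (a b : Cn n) :
    radialForm β z a b = (stdForm n + ρ ^ 2 • BlowUp.fubiniStudy n z) ![a, b] := by
  have h0 := norm_pos_iff.2 hz
  have hr : ‖z‖ < r := by linarith [h.delta_lt hρ, h.pos]
  rw [← stdForm_fderiv_radialMap h hz hr, ← stdForm_add_fubiniStudy hz, form_comp_pair]
  have h1 : radialMap β =ᶠ[𝓝 z] fun z : Cn n => (Real.sqrt (ρ ^ 2 + ‖z‖ ^ 2) / ‖z‖) • z := by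
    filter_upwards [(isOpen_lt continuous_norm continuous_const).mem_nhds hz'] with y hy
    have hy : ‖y‖ < δ := hy
    rw [radialMap, h.inner _ ⟨norm_nonneg y, hy.le⟩]
  rw [h1.fderiv_eq]

end Profile

lemma TwoForm.congr_point {n : ℕ} {M : Type*} [TopologicalSpace M] [ChartedSpace (Cn n) M]
    (Ω : TwoForm n M) {x y : M} (h : x = y) (a b : Cn n) :
    Ω x ![(a : TangentSpace 𝓘(ℝ, Cn n) x), b] = Ω y ![(a : TangentSpace 𝓘(ℝ, Cn n) y), b] := by
  subst h; rfl

namespace BlowUp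

variable {n : ℕ} {M : Type*} [TopologicalSpace M] [ChartedSpace (Cn n) M] {B : SmoothBall n M}
  [NeZero n] [T2Space M] [IsManifold 𝓘(ℝ, Cn n) ∞ M] {Ω : TwoForm n M} {ρ r δ : ℝ} {β : ℝ → ℝ}

lemma isOpen_ball_image (hr : r ≤ B.radius) : IsOpen (B.ι '' Metric.ball 0 r) :=
  B.ι.isOpen_image_of_subset_source Metric.isOpen_ball
    (by rw [B.source_eq]; exact Metric.ball_subset_ball hr)

lemma isClosed_closedBall_image {s : ℝ} (hs : s < B.radius) :
    IsClosed (B.ι '' Metric.closedBall 0 s) :=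
  ((isCompact_closedBall _ _).image_of_continuousOn (B.ι.continuousOn.mono
    (by rw [B.source_eq]; exact Metric.closedBall_subset_ball hs))).isClosed

lemma mem_ball_image_iff (hr : r ≤ B.radius) {x : M} :
    x ∈ B.ι '' Metric.ball 0 r ↔ x ∈ B.ι.target ∧ ‖B.ι.symm x‖ < r := by
  have hsub : Metric.ball 0 r ⊆ B.ι.source := by
    rw [B.source_eq]; exact Metric.ball_subset_ball hr
  constructor
  · rintro ⟨z, hz, rfl⟩
    rw [B.ι.left_inv (hsub hz)]
    exact ⟨B.ι.map_source (hsub hz), by simpa using hz⟩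
  · rintro ⟨h1, h2⟩
    exact ⟨B.ι.symm x, by simpa using h2, B.ι.right_inv h1⟩

lemma mem_closedBall_image_iff {s : ℝ} (hs : s < B.radius) {x : M} :
    x ∈ B.ι '' Metric.closedBall 0 s ↔ x ∈ B.ι.target ∧ ‖B.ι.symm x‖ ≤ s := by
  have hsub : Metric.closedBall 0 s ⊆ B.ι.source := by
    rw [B.source_eq]; exact Metric.closedBall_subset_ball hs
  constructor
  · rintro ⟨z, hz, rfl⟩
    rw [B.ι.left_inv (hsub hz)]
    exact ⟨B.ι.map_source (hsub hz), by simpa using hz⟩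
  · rintro ⟨h1, h2⟩
    exact ⟨B.ι.symm x, by simpa using h2, B.ι.right_inv h1⟩

lemma center_mem_target : B.center ∈ B.ι.target := B.ι.map_source B.zero_mem

lemma ballCoord_ne_zero {p : BlowUp B} (hp : proj B p ∈ B.ι.target) (hp' : proj B p ≠ B.center) :
    ballCoord B p ≠ 0 := fun h => hp' ((ballCoord_eq_zero_iff B hp).1 h)

/-- In the collar between the radii `r - δ` and `r` the profile is the identity, so both branches of
`stretch` are the blow-down map there. This is why the pieces fit smoothly. -/
lemma stretch_eventuallyEq_outer (h : IsProfile ρ r δ β) (hρ : 0 < ρ) (hr : r ≤ B.radius)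
    {p : BlowUp B} (hp : proj B p ∉ B.ι '' Metric.closedBall 0 (r - δ)) :
    stretch B r β =ᶠ[𝓝 p] proj B := by
  have hδ := h.pos
  have hδr := h.delta_lt hρ
  have hs : r - δ < B.radius := by linarith
  filter_upwards [((isClosed_closedBall_image hs).isOpen_compl.preimage
    (contMDiff_proj B).continuous).mem_nhds hp] with q hq
  have hq : proj B q ∉ B.ι '' Metric.closedBall 0 (r - δ) := hq
  rw [mem_closedBall_image_iff hs] at hq
  by_cases hq' : proj B q ∈ B.ι '' Metric.ball 0 r
  · have h1 := (mem_ball_image_iff hr).1 hq'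
    have h2 : r - δ < ‖B.ι.symm (proj B q)‖ := by
      by_contra! h2
      exact hq ⟨h1.1, h2⟩
    rw [stretch, if_pos hq', h.outer _ ⟨h2.le, h1.2.le⟩, div_self (by linarith), one_smul,
      B.ι.right_inv h1.1]
  · rw [stretch, if_neg hq']

lemma stretch_eventuallyEq_inner (hr : r ≤ B.radius)
    {p : BlowUp B} (hp : proj B p ∈ B.ι '' Metric.ball 0 r) :
    stretch B r β =ᶠ[𝓝 p] fun q => B.ι (radialMap β (ballCoord B q)) := by
  filter_upwards [((isOpen_ball_image hr).preimage (contMDiff_proj B).continuous).mem_nhds hp]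
    with q hq
  exact if_pos hq

lemma radialMap_mem_source (h : IsProfile ρ r δ β) (hr : r ≤ B.radius) {z : Cn n}
    (hz : z ≠ 0) (hz' : ‖z‖ < r) : radialMap β z ∈ B.ι.source := by
  rw [B.source_eq, mem_ball_zero_iff, norm_radialMap h hz hz']
  exact (h.apply_lt (norm_pos_iff.2 hz) hz').trans_le hr

lemma contMDiffAt_stretch (h : IsProfile ρ r δ β) (hρ : 0 < ρ) (hr : r ≤ B.radius)
    {p : BlowUp B} (hp : proj B p ≠ B.center) :
    ContMDiffAt 𝓘(ℝ, Cn n) 𝓘(ℝ, Cn n) ∞ (stretch B r β) p := by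
  by_cases hp' : proj B p ∈ B.ι '' Metric.ball 0 r
  · refine ContMDiffAt.congr_of_eventuallyEq ?_ (stretch_eventuallyEq_inner hr hp')
    have h1 := (mem_ball_image_iff hr).1 hp'
    have h2 := ballCoord_ne_zero h1.1 hp
    have h3 := (B.smooth.contMDiffAt (B.ι.open_source.mem_nhds
      (radialMap_mem_source h hr h2 h1.2)))
    exact h3.comp p ((contDiffAt_radialMap h h2 h1.2).contMDiffAt.comp p
      (contMDiffAt_ballCoord B h1.1))
  · refine (contMDiff_proj B p).congr_of_eventuallyEq (stretch_eventuallyEq_outer h hρ hr ?_)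
    rintro ⟨z, hz, hz'⟩
    refine hp' ⟨z, ?_, hz'⟩
    have hδ := h.pos
    rw [mem_closedBall_zero_iff] at hz
    rw [mem_ball_zero_iff]
    linarith

lemma form_off {p : BlowUp B} (hp : proj B p ≠ B.center) (a b : TangentSpace 𝓘(ℝ, Cn n) p) :
    form B Ω ρ r β p ![a, b] = Ω (stretch B r β p)
      ![mfderiv 𝓘(ℝ, Cn n) 𝓘(ℝ, Cn n) (stretch B r β) p a,
        mfderiv 𝓘(ℝ, Cn n) 𝓘(ℝ, Cn n) (stretch B r β) p b] := by
  obtain ⟨x, hx, rfl⟩ := (proj_ne_center_iff B).1 hp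
  change ((Ω (stretch B r β (off x hx))).compContinuousLinearMap _) ![a, b] = _
  rw [form_comp_pair]

lemma proj_ne_center_of_outer {s : ℝ} (hs : 0 ≤ s) {p : BlowUp B}
    (hp : proj B p ∉ B.ι '' Metric.closedBall 0 s) : proj B p ≠ B.center := by
  intro h
  exact hp ⟨0, by simpa using hs, h.symm⟩

/-- Outside of the ball the form is the pullback of `Ω` by the blow-down map. -/
lemma form_outer (h : IsProfile ρ r δ β) (hρ : 0 < ρ) (hr : r ≤ B.radius)
    {p : BlowUp B} (hp : proj B p ∉ B.ι '' Metric.closedBall 0 (r - δ))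
    (a b : TangentSpace 𝓘(ℝ, Cn n) p) :
    form B Ω ρ r β p ![a, b] = Ω (proj B p)
      ![mfderiv 𝓘(ℝ, Cn n) 𝓘(ℝ, Cn n) (proj B) p a,
        mfderiv 𝓘(ℝ, Cn n) 𝓘(ℝ, Cn n) (proj B) p b] := by
  have h1 := stretch_eventuallyEq_outer h hρ hr hp
  rw [form_off (proj_ne_center_of_outer (by linarith [h.delta_lt hρ, h.pos]) hp)]
  rw [h1.mfderiv_eq]
  exact Ω.congr_point h1.self_of_nhds _ _

/-- In the ball, off the exceptional divisor, the form is given by the radial form. -/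
lemma form_inner (hB : B.IsSymplectic Ω) (h : IsProfile ρ r δ β) (hr : r ≤ B.radius)
    {p : BlowUp B} (hp : proj B p ∈ B.ι '' Metric.ball 0 r) (hp' : proj B p ≠ B.center)
    (a b : TangentSpace 𝓘(ℝ, Cn n) p) :
    form B Ω ρ r β p ![a, b] =
      radialForm β (ballCoord B p) (mfd (ballCoord B) p a) (mfd (ballCoord B) p b) := by
  have h1 := stretch_eventuallyEq_inner (β := β) hr hp
  have h2 := (mem_ball_image_iff hr).1 hp
  have h3 := ballCoord_ne_zero h2.1 hp'
  have h4 := radialMap_mem_source h hr h3 h2.2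
  rw [form_off hp', h1.mfderiv_eq]
  have e1 := mfderiv_comp p
    ((B.smooth.contMDiffAt (B.ι.open_source.mem_nhds h4)).mdifferentiableAt (by simp))
    (((contDiffAt_radialMap h h3 h2.2).contMDiffAt.comp p
      (contMDiffAt_ballCoord B h2.1)).mdifferentiableAt (by simp))
  have e2 := mfderiv_comp p
    ((contDiffAt_radialMap h h3 h2.2).contMDiffAt.mdifferentiableAt (by simp))
    ((contMDiffAt_ballCoord B h2.1).mdifferentiableAt (by simp))
  rw [mfderiv_eq_fderiv] at e2
  have e3 : ∀ a, mfderiv 𝓘(ℝ, Cn n) 𝓘(ℝ, Cn n) (fun q => B.ι (radialMap β (ballCoord B q))) p a =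
      mfderiv 𝓘(ℝ, Cn n) 𝓘(ℝ, Cn n) B.ι (radialMap β (ballCoord B p))
        (fderiv ℝ (radialMap β) (ballCoord B p) (mfd (ballCoord B) p a)) := by
    intro a
    refine (DFunLike.congr_fun e1 a).trans ?_
    exact congrArg _ (DFunLike.congr_fun e2 a)
  rw [← stdForm_fderiv_radialMap h h3 h2.2]
  refine (Ω.congr_point h1.self_of_nhds _ _).trans (Eq.trans ?_ (hB _ h4 _ _))
  exact congrArg₂ (fun a b : Cn n => Ω (B.ι (radialMap β (ballCoord B p)))
    ![(a : TangentSpace 𝓘(ℝ, Cn n) (B.ι (radialMap β (ballCoord B p)))), b]) (e3 a) (e3 b)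

lemma affineChart_transition {i j : Fin n} {p : BlowUp B} (hp : p ∈ (affineChart B i).source) :
    affineChart B j p = affineCoord j (affineChart B i p i) (hat i (affineChart B i p)) ∧
      (p ∈ (affineChart B j).source ↔ hat i (affineChart B i p) j ≠ 0) := by
  cases p with
  | off x hx =>
    have h1 : affineChart B i (off x hx) = affineCoord i 1 (B.ι.symm x) := rfl
    rw [h1, hat_affineCoord i 1 hp.2, affineCoord_same,
      affineCoord_smul j _ _ (inv_ne_zero hp.2), one_mul, mul_inv_cancel₀ hp.2]
    refine ⟨rfl, ?_⟩
    have h2 : off x hx ∈ (affineChart B j).source ↔ B.ι.symm x j ≠ 0 :=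
      ⟨fun h => h.2, fun h => ⟨hp.1, h⟩⟩
    rw [h2]
    simp [hp.2]
  | exc l =>
    have hl : l.rep i ≠ 0 := hp
    have h1 : affineChart B i (exc l) = affineCoord i 0 l.rep := rfl
    rw [h1, hat_affineCoord i 0 hl, affineCoord_same,
      affineCoord_smul j _ _ (inv_ne_zero hl), zero_mul, zero_mul]
    refine ⟨rfl, ?_⟩
    have h2 : exc l ∈ (affineChart B j).source ↔ l.rep j ≠ 0 := Iff.rfl
    rw [h2]
    simp [hl]

/-- Near the exceptional divisor the form is the model form in all affine charts. -/
lemma form_near (hB : B.IsSymplectic Ω) (h : IsProfile ρ r δ β) (hρ : 0 < ρ) (hr : r ≤ B.radius)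
    {j : Fin n} {p : BlowUp B} (hp : p ∈ (affineChart B j).source) (hp' : ‖ballCoord B p‖ < δ)
    (a b : TangentSpace 𝓘(ℝ, Cn n) p) :
    form B Ω ρ r β p ![a, b] = modelForm ρ j (affineChart B j p)
      ![mfd (affineChart B j) p a, mfd (affineChart B j) p b] := by
  have h1 := affineBlowDown_affineChart B hp
  have hδr := h.delta_lt hρ
  have hδ := h.pos
  by_cases hc : proj B p = B.center
  · cases p with
    | off x hx => exact absurd hc hx
    | exc l =>
      set i := lineIndex l with hi
      have hpi : (exc l : BlowUp B) ∈ (affineChart B i).source := (exists_rep_ne_zero l).choose_spec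
      set w := affineChart B j (exc l) with hw
      have hwi : hat j w i ≠ 0 := (affineChart_transition (j := i) hp).2.1 hpi
      -- The form on `E` is defined in the chart of index `i`; `T` is the transition to it from the
      -- chart of index `j`, under which the model form is invariant.
      let T : Cn n → Cn n := fun w => affineCoord i (w j) (hat j w)
      have hcoord : ContDiff ℝ ∞ fun w : Cn n => hat j w i :=
        (contDiff_piLp_apply (p := 2) (i := i)).comp (contDiff_hat j)
      have hU : IsOpen {w : Cn n | hat j w i ≠ 0} :=
        isOpen_ne_fun hcoord.continuous continuous_const
      have hT : ContDiffAt ℝ ∞ T w :=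
        (contDiffOn_affineCoord i (s := fun w : Cn n => w j) (v := hat j)
          (contDiff_piLp_apply 2).contDiffOn (contDiff_hat j).contDiffOn
          (fun w hw => hw)).contDiffAt (hU.mem_nhds hwi)
      have hTd := (hT.differentiableAt (by simp)).hasFDerivAt
      have hcd := ((hcoord.contDiffAt (x := w)).inv hwi).differentiableAt (by simp) |>.hasFDerivAt
      have hps : (exc l : BlowUp B) ∈ (affineHomeo B j).source := hp
      have e1 : affineChart B i =ᶠ[𝓝 (exc l)] T ∘ affineHomeo B j := by
        filter_upwards [(affineHomeo B j).open_source.mem_nhds hps] with q hq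
        exact (affineChart_transition hq).1
      have e2 := mfderiv_comp (exc l : BlowUp B)
        ((hT.contMDiffAt (x := affineHomeo B j (exc l))).mdifferentiableAt (by simp))
        ((contMDiffAt_of_mem_maximalAtlas (affineHomeo_mem B j) hps).mdifferentiableAt (by simp))
      rw [← e1.mfderiv_eq, mfderiv_eq_fderiv] at e2
      have e3 : ∀ a, mfd (affineChart B i) (exc l) a =
          fderiv ℝ T w (mfd (affineChart B j) (exc l) a) := fun a => DFunLike.congr_fun e2 a
      have e4 := modelForm_transition (ρ := ρ) (i := j) (j := i) hTd hcd (inv_ne_zero hwi)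
        (by filter_upwards [hU.mem_nhds hwi] with w hw using affineBlowDown_affineCoord i _ hw)
        (by filter_upwards [hU.mem_nhds hwi] with w hw using hat_affineCoord i _ hw)
        (mfd (affineChart B j) (exc l) a) (mfd (affineChart B j) (exc l) b)
      rw [← e4, ← e3, ← e3]
      have e5 : T w = affineChart B i (exc l) := e1.self_of_nhds.symm
      rw [e5]
      exact form_comp_pair (modelForm ρ i _) (mfd (affineChart B i) (exc l)) a b
  · have h2 := ballCoord_ne_zero h1.1 hc
    have h3 : affineChart B j p j ≠ 0 := by
      intro h0
      rw [← h1.2, Ne, affineBlowDown_eq_zero] at h2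
      exact h2 h0
    rw [form_inner hB h hr ((mem_ball_image_iff hr).2 ⟨h1.1, by
      change ‖ballCoord B p‖ < r
      linarith⟩) hc, radialForm_eq_of_lt h hρ h2 hp', modelForm_eq_of_ne h3, h1.2,
      mfd_ballCoord_affine B hp, mfd_ballCoord_affine B hp]

lemma smooth_closed_form (hΩ : IsSymplecticForm Ω) (hB : B.IsSymplectic Ω)
    (h : IsProfile ρ r δ β) (hρ : 0 < ρ) (hr : r ≤ B.radius) (p : BlowUp B)
    {φ : OpenPartialHomeomorph (BlowUp B) (Cn n)}
    (hφ : φ ∈ IsManifold.maximalAtlas 𝓘(ℝ, Cn n) ∞ (BlowUp B)) (hp : p ∈ φ.source) :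
    ContDiffAt ℝ ∞ ((form B Ω ρ r β).inChart φ) (φ p) ∧
      extDeriv ((form B Ω ρ r β).inChart φ) (φ p) = 0 := by
  by_cases hc : proj B p = B.center
  · have ht : proj B p ∈ B.ι.target := hc ▸ center_mem_target
    obtain ⟨j, hj⟩ := exists_mem_affineChart_source B ht
    have hj' : p ∈ (affineHomeo B j).source := hj
    refine smooth_closed_of_pullback (f := affineHomeo B j) (τ := modelForm ρ j)
      (contMDiffAt_of_mem_maximalAtlas (affineHomeo_mem B j) hj') (contDiffAt_modelForm _ _ _)
      (extDeriv_modelForm _ _ _) ?_ hφ hp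
    have h0 : ‖ballCoord B p‖ < δ := by
      rw [(ballCoord_eq_zero_iff B ht).2 hc, norm_zero]
      exact h.pos
    filter_upwards [(affineHomeo B j).open_source.mem_nhds hj',
      (contMDiffAt_ballCoord B ht).continuousAt.norm.eventually_lt continuousAt_const h0]
      with q hq hq' a b
    exact form_near hB h hρ hr hq hq' a b
  · refine smooth_closed_of_pullback_symplectic hΩ (contMDiffAt_stretch h hρ hr hc) ?_ hφ hp
    filter_upwards [(isOpen_compl_singleton.preimage (contMDiff_proj B).continuous).mem_nhds hc]
      with q hq a b
    exact form_off hq a b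

theorem isSymplecticForm_form (hΩ : IsSymplecticForm Ω) (hB : B.IsSymplectic Ω)
    (h : IsProfile ρ r δ β) (hρ : 0 < ρ) (hr : r ≤ B.radius) :
    IsSymplecticForm (form B Ω ρ r β) where
  smooth φ hφ y hy := by
    have h1 := (smooth_closed_form hΩ hB h hρ hr _ (IsManifold.subset_maximalAtlas hφ)
      (φ.map_target hy)).1
    rw [φ.right_inv hy] at h1
    exact h1.contDiffWithinAt
  closed φ hφ y hy := by
    have h1 := (smooth_closed_form hΩ hB h hρ hr _ (IsManifold.subset_maximalAtlas hφ)
      (φ.map_target hy)).2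
    rwa [φ.right_inv hy] at h1
  nondegenerate p a ha := by
    by_cases hc : proj B p = B.center
    · have ht : proj B p ∈ B.ι.target := hc ▸ center_mem_target
      obtain ⟨j, hj⟩ := exists_mem_affineChart_source B ht
      have h0 : ‖ballCoord B p‖ < δ := by
        rw [(ballCoord_eq_zero_iff B ht).2 hc, norm_zero]
        exact h.pos
      have hbij := mfd_affineChart_bijective B hj
      -- Taming gives nondegeneracy: `b` is the vector corresponding to `i` times the coordinates of
      -- `a`.
      obtain ⟨b, hb⟩ := hbij.2 (Complex.I • mfd (affineChart B j) p a)
      refine ⟨b, fun h1 => ha ?_⟩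
      rw [form_near hB h hρ hr hj h0, hb] at h1
      have h2 := eq_zero_of_modelForm_eq_zero hρ.ne' h1
      exact hbij.1 (h2.trans (map_zero _).symm)
    · by_cases hp : proj B p ∈ B.ι '' Metric.ball 0 r
      · have ht := (mem_ball_image_iff hr).1 hp
        have hbij := mfd_ballCoord_bijective B ht.1 hc
        obtain ⟨b, hb⟩ := hbij.2 (Complex.I • mfd (ballCoord B) p a)
        refine ⟨b, ?_⟩
        rw [form_inner hB h hr hp hc, hb]
        refine (radialForm_tame h (ballCoord_ne_zero ht.1 hc) ht.2 fun h0 => ha ?_).ne'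
        exact hbij.1 (h0.trans (map_zero _).symm)
      · have hp' : proj B p ∉ B.ι '' Metric.closedBall 0 (r - δ) := by
          rintro ⟨z, hz, hz'⟩
          refine hp ⟨z, ?_, hz'⟩
          rw [mem_closedBall_zero_iff] at hz
          rw [mem_ball_zero_iff]
          linarith [h.pos]
        have hbij := mfderiv_proj_bijective B hc
        obtain ⟨b', hb'⟩ := hΩ.nondegenerate (proj B p)
          (mfderiv 𝓘(ℝ, Cn n) 𝓘(ℝ, Cn n) (proj B) p a)
          (fun h0 => ha (hbij.1 (h0.trans (map_zero _).symm)))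
        obtain ⟨b, rfl⟩ := hbij.2 b'
        exact ⟨b, by rwa [form_outer h hρ hr hp']⟩

/-! ### The proper transform -/

/-- A slice chart of `L` composed with `π` is a slice chart of the proper transform, so in both
descriptions the same coordinates must be real. -/
lemma mem_tangentVectors_proper {L : Set M} (hL : IsLagrangian Ω L) (hc : B.center ∉ L)
    {p : BlowUp B} (hp : proj B p ∈ L) (v : TangentSpace 𝓘(ℝ, Cn n) p) :
    v ∈ tangentVectors n (proj B ⁻¹' L) p ↔
      mfderiv 𝓘(ℝ, Cn n) 𝓘(ℝ, Cn n) (proj B) p v ∈ tangentVectors n L (proj B p) := by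
  obtain ⟨φ, hφ, hpφ, hφL⟩ := hL.slice _ hp
  have hpc : proj B p ≠ B.center := fun h => hc (h ▸ hp)
  rw [mem_tangentVectors_iff hφ hφL hpφ hp, mem_tangentVectors_iff (L := proj B ⁻¹' L)
    (projHomeo_trans_mem B hφ) (fun q hq => hφL _ hq.2) ⟨hpc, hpφ⟩ hp]
  have h := mfderiv_comp p ((contMDiffAt_of_mem_maximalAtlas hφ hpφ).mdifferentiableAt (by simp))
    ((contMDiff_proj B p).mdifferentiableAt (by simp))
  have h2 : mfd ((projHomeo B).trans φ) p v =
    mfd φ (proj B p) (mfderiv 𝓘(ℝ, Cn n) 𝓘(ℝ, Cn n) (proj B) p v) := DFunLike.congr_fun h v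
  rw [h2]

theorem isLagrangian_proper {L : Set M} (hL : IsLagrangian Ω L)
    (h : IsProfile ρ r δ β) (hρ : 0 < ρ) (hr : r ≤ B.radius)
    (hLB : Disjoint L (B.ι '' Metric.ball 0 r)) :
    IsLagrangian (form B Ω ρ r β) (proj B ⁻¹' L) where
  isClosed := hL.isClosed.preimage (contMDiff_proj B).continuous
  slice p hp := by
    obtain ⟨φ, hφ, hpφ, hφL⟩ := hL.slice _ hp
    have hpc : proj B p ≠ B.center := by
      intro h0
      exact hLB.le_bot ⟨hp, ⟨0, by simpa using hρ.trans h.lt, h0.symm⟩⟩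
    exact ⟨(projHomeo B).trans φ, projHomeo_trans_mem B hφ, ⟨hpc, hpφ⟩, fun q hq => hφL _ hq.2⟩
  isotropic p hp a ha b hb := by
    have hc : B.center ∉ L := fun h0 =>
      hLB.le_bot ⟨h0, ⟨0, by simpa using hρ.trans h.lt, rfl⟩⟩
    rw [mem_tangentVectors_proper hL hc hp] at ha hb
    have hp' : proj B p ∉ B.ι '' Metric.closedBall 0 (r - δ) := by
      rintro ⟨z, hz, hz'⟩
      refine hLB.le_bot ⟨hp, ⟨z, ?_, hz'⟩⟩
      rw [mem_closedBall_zero_iff] at hz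
      rw [mem_ball_zero_iff]
      linarith [h.pos]
    rw [form_outer h hρ hr hp']
    exact hL.isotropic _ hp _ ha _ hb

end BlowUp

/-! ### Green's theorem on the disc -/

section Green

/-- Polar coordinates. -/
def polarMap (x : ℝ × ℝ) : ℂ := x.1 * Complex.exp (x.2 * Complex.I)

lemma norm_polarMap (x : ℝ × ℝ) : ‖polarMap x‖ = |x.1| := by
  rw [polarMap, norm_mul, Complex.norm_exp_ofReal_mul_I, mul_one, Complex.norm_real,
    Real.norm_eq_abs]

lemma continuous_polarMap : Continuous polarMap := by
  unfold polarMap; fun_prop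

lemma polarMap_mem_closedBall {x : ℝ × ℝ} (hx : x ∈ Icc (0 : ℝ) 1 ×ˢ Icc (-Real.pi) Real.pi) :
    polarMap x ∈ Metric.closedBall (0 : ℂ) 1 := by
  rw [mem_closedBall_zero_iff, norm_polarMap, abs_of_nonneg hx.1.1]
  exact hx.1.2

lemma hasFDerivAt_polarMap (x : ℝ × ℝ) : HasFDerivAt polarMap
    (((ContinuousLinearMap.fst ℝ ℝ ℝ).smulRight (Complex.exp (x.2 * Complex.I))) +
      (ContinuousLinearMap.snd ℝ ℝ ℝ).smulRight (x.1 * (Complex.I * Complex.exp (x.2 * Complex.I))))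
      x := by
  have h1 : HasFDerivAt (fun x : ℝ × ℝ => (x.1 : ℂ))
      (Complex.ofRealCLM.comp (ContinuousLinearMap.fst ℝ ℝ ℝ)) x :=
    Complex.ofRealCLM.hasFDerivAt.comp x hasFDerivAt_fst
  have h2 : HasFDerivAt (fun x : ℝ × ℝ => (x.2 : ℂ))
      (Complex.ofRealCLM.comp (ContinuousLinearMap.snd ℝ ℝ ℝ)) x :=
    Complex.ofRealCLM.hasFDerivAt.comp x hasFDerivAt_snd
  have h3 := h1.mul ((h2.mul_const Complex.I).cexp)
  refine h3.congr_fderiv (ContinuousLinearMap.ext fun v => ?_)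
  simp
  ring

lemma setIntegral_closedBall_eq (G : ℂ → ℝ) :
    ∫ z in Metric.closedBall (0 : ℂ) 1, G z =
      ∫ x in Icc (0 : ℝ) 1 ×ˢ Icc (-Real.pi) Real.pi, x.1 * G (polarMap x) := by
  rw [← integral_indicator Metric.isClosed_closedBall.measurableSet,
    ← Complex.integral_comp_polarCoord_symm,
    show polarCoord.target = Ioi (0 : ℝ) ×ˢ Ioo (-Real.pi) Real.pi from rfl]
  have h1 : ∀ p : ℝ × ℝ, Complex.polarCoord.symm p = polarMap p := by
    intro p
    rw [Complex.polarCoord_symm_apply, polarMap, Complex.exp_mul_I]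
    push_cast
    ring
  have h2 : (Ioi (0 : ℝ) ×ˢ Ioo (-Real.pi) Real.pi) ∩ {p : ℝ × ℝ | p.1 ≤ 1} =
      Ioc (0 : ℝ) 1 ×ˢ Ioo (-Real.pi) Real.pi := by
    ext p
    simp only [mem_inter_iff, mem_prod, mem_Ioi, mem_Ioc, mem_ofPred_eq]
    tauto
  have h3 : ∀ p ∈ Ioi (0 : ℝ) ×ˢ Ioo (-Real.pi) Real.pi,
      p.1 • (Metric.closedBall (0 : ℂ) 1).indicator G (Complex.polarCoord.symm p) =
      {p : ℝ × ℝ | p.1 ≤ 1}.indicator (fun p => p.1 * G (polarMap p)) p := by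
    rintro p ⟨hp, -⟩
    have hp : 0 < p.1 := hp
    by_cases h : p.1 ≤ 1
    · rw [indicator_of_mem (show p ∈ {p : ℝ × ℝ | p.1 ≤ 1} from h), indicator_of_mem, h1, smul_eq_mul]
      rw [h1, mem_closedBall_zero_iff, norm_polarMap, abs_of_pos hp]
      exact h
    · rw [indicator_of_notMem (show p ∉ {p : ℝ × ℝ | p.1 ≤ 1} from h), indicator_of_notMem,
        smul_zero]
      rw [h1, mem_closedBall_zero_iff, norm_polarMap, abs_of_pos hp]
      exact h
  rw [setIntegral_congr_fun (measurableSet_Ioi.prod measurableSet_Ioo) h3,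
    setIntegral_indicator (measurableSet_le measurable_fst measurable_const), h2]
  refine setIntegral_congr_set ?_
  exact Measure.set_prod_ae_eq Ioc_ae_eq_Icc Ioo_ae_eq_Icc

/-- The exterior derivative of a 1-form on `ℂ`. -/
def curl (T : ℂ → ℂ →L[ℝ] ℝ) (z : ℂ) : ℝ := fderiv ℝ T z 1 Complex.I - fderiv ℝ T z Complex.I 1

/-- The antisymmetrisation of `S` is a multiple of the area form, and `(e, ie)` arises from `(1, i)`
by a map of determinant `|e|²`. -/
lemma curl_rotate (S : ℂ →L[ℝ] ℂ →L[ℝ] ℝ) (e : ℂ) :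
    S e (Complex.I * e) - S (Complex.I * e) e = ‖e‖ ^ 2 * (S 1 Complex.I - S Complex.I 1) := by
  have h1 : e = e.re • (1 : ℂ) + e.im • Complex.I := by
    conv_lhs => rw [← Complex.re_add_im e]
    simp
  have h2 : Complex.I * e = (-e.im) • (1 : ℂ) + e.re • Complex.I := by
    conv_lhs => rw [← Complex.re_add_im e]
    simp only [Complex.real_smul, Complex.ofReal_neg]
    ring_nf
    rw [Complex.I_sq]
    ring
  have h3 : ‖e‖ ^ 2 = e.re ^ 2 + e.im ^ 2 := by
    rw [← Complex.normSq_eq_norm_sq, Complex.normSq_apply]; ring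
  have h4 : ∀ c s : ℝ, S (c • (1 : ℂ) + s • Complex.I) ((-s) • (1 : ℂ) + c • Complex.I) -
      S ((-s) • (1 : ℂ) + c • Complex.I) (c • (1 : ℂ) + s • Complex.I) =
      (c ^ 2 + s ^ 2) * (S 1 Complex.I - S Complex.I 1) := by
    intro c s
    simp only [map_add, map_smul, add_apply, smul_apply, smul_eq_mul]
    ring
  rw [h2, h3, ← h4, ← h1]

/-- The divergence theorem on the rectangle of polar coordinates, where `T` has the radial component
`T(e^{iθ})` and the angular component `T(r i e^{iθ})`. It requires differentiability only in the
open rectangle, so `T` need only be continuous up to the boundary circle. -/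
theorem green_disc {T : ℂ → ℂ →L[ℝ] ℝ} {G : ℂ → ℝ}
    (hT : ContinuousOn T (Metric.closedBall 0 1)) (hG : ContinuousOn G (Metric.closedBall 0 1))
    (hd : ∀ z ∈ Metric.ball (0 : ℂ) 1, DifferentiableAt ℝ T z)
    (hc : ∀ z ∈ Metric.ball (0 : ℂ) 1, curl T z = G z) :
    ∫ z in Metric.closedBall (0 : ℂ) 1, G z = ∫ θ in (0 : ℝ)..(2 * Real.pi),
      T (Complex.exp (θ * Complex.I)) (Complex.I * Complex.exp (θ * Complex.I)) := by
  classical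
  set Q : Set (ℝ × ℝ) := Icc (0 : ℝ) 1 ×ˢ Icc (-Real.pi) Real.pi with hQ
  have hpi := Real.pi_pos
  have hQ' : Q = Icc ((0 : ℝ), -Real.pi) (1, Real.pi) := by rw [hQ, Icc_prod_eq]
  set Q₀ : Set (ℝ × ℝ) := Ioo (0 : ℝ) 1 ×ˢ Ioo (-Real.pi) Real.pi with hQ₀
  let E : ℝ × ℝ → ℂ := fun x => Complex.exp (x.2 * Complex.I)
  have hEc : Continuous E := by fun_prop
  have hE' : ∀ x, HasFDerivAt E ((ContinuousLinearMap.snd ℝ ℝ ℝ).smulRight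
      (Complex.I * Complex.exp (x.2 * Complex.I))) x := by
    intro x
    have h2 : HasFDerivAt (fun x : ℝ × ℝ => (x.2 : ℂ))
        (Complex.ofRealCLM.comp (ContinuousLinearMap.snd ℝ ℝ ℝ)) x :=
      Complex.ofRealCLM.hasFDerivAt.comp x hasFDerivAt_snd
    refine ((h2.mul_const Complex.I).cexp).congr_fderiv ?_
    ext <;> simp
    ring
  have hTc : ContinuousOn (fun x => T (polarMap x)) Q :=
    hT.comp continuous_polarMap.continuousOn fun x hx => polarMap_mem_closedBall hx
  let f : ℝ × ℝ → ℝ := fun x => T (polarMap x) (x.1 • (Complex.I * E x))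
  let g : ℝ × ℝ → ℝ := fun x => -T (polarMap x) (E x)
  have hball : ∀ x ∈ Q₀, polarMap x ∈ Metric.ball (0 : ℂ) 1 := by
    intro x hx
    rw [mem_ball_zero_iff, norm_polarMap, abs_of_pos hx.1.1]
    exact hx.1.2
  have hder : ∀ x ∈ Q₀, DifferentiableAt ℝ f x ∧ DifferentiableAt ℝ g x ∧
      fderiv ℝ f x (1, 0) + fderiv ℝ g x (0, 1) = x.1 * G (polarMap x) := by
    intro x hx
    have h1 := (hd _ (hball x hx)).hasFDerivAt.comp x (hasFDerivAt_polarMap x)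
    have h2 : HasFDerivAt (fun x : ℝ × ℝ => x.1 • (Complex.I * E x)) _ x :=
      (hasFDerivAt_fst (𝕜 := ℝ) (p := x)).smul ((hE' x).const_mul Complex.I)
    have h3 : HasFDerivAt f _ x := h1.clm_apply h2
    have h4 : HasFDerivAt g _ x := (h1.clm_apply (hE' x)).neg
    refine ⟨h3.differentiableAt, h4.differentiableAt, ?_⟩
    rw [h3.fderiv, h4.fderiv, ← hc _ (hball x hx), curl]
    have h5 := curl_rotate (fderiv ℝ T (polarMap x)) (E x)
    have h6 : ‖E x‖ = 1 := Complex.norm_exp_ofReal_mul_I _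
    rw [h6, one_pow, one_mul] at h5
    rw [← h5]
    have h7 : (x.1 : ℂ) * (Complex.I * E x) = x.1 • (Complex.I * E x) := by simp
    simp only [add_apply, neg_apply, ContinuousLinearMap.comp_apply, ContinuousLinearMap.flip_apply,
      ContinuousLinearMap.smulRight_apply, smul_apply]
    have h8 : Complex.exp (x.2 * Complex.I) = E x := rfl
    simp only [ContinuousLinearMap.coe_fst', ContinuousLinearMap.coe_snd', zero_smul, one_smul,
      add_zero, zero_add, h8, h7, map_smul, smul_apply, smul_eq_mul, mul_zero, smul_zero]
    ring
  -- Off the open rectangle the derivatives are replaced by values for which the divergence is still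
  -- `r G`; integrability then follows from continuity on the closed rectangle.
  let f' : ℝ × ℝ → ℝ × ℝ →L[ℝ] ℝ := fun x => if x ∈ Q₀ then fderiv ℝ f x else
    (x.1 * G (polarMap x)) • ContinuousLinearMap.fst ℝ ℝ ℝ
  let g' : ℝ × ℝ → ℝ × ℝ →L[ℝ] ℝ := fun x => if x ∈ Q₀ then fderiv ℝ g x else 0
  have hsum : ∀ x, f' x (1, 0) + g' x (0, 1) = x.1 * G (polarMap x) := by
    intro x
    by_cases hx : x ∈ Q₀
    · simp only [f', g', if_pos hx, (hder x hx).2.2]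
    · simp [f', g', if_neg hx]
  have hGc : ContinuousOn (fun x : ℝ × ℝ => x.1 * G (polarMap x)) Q :=
    continuous_fst.continuousOn.mul
      (hG.comp continuous_polarMap.continuousOn fun x hx => polarMap_mem_closedBall hx)
  have key := integral_divergence_prod_Icc_of_hasFDerivAt_of_le f g f' g'
    ((0 : ℝ), -Real.pi) (1, Real.pi) ⟨by simp, by simp; linarith⟩
    (by
      rw [← hQ']
      exact hTc.clm_apply (continuous_fst.smul (continuous_const.mul hEc)).continuousOn)
    (by
      rw [← hQ']
      exact (hTc.clm_apply hEc.continuousOn).neg)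
    (fun x hx => by simpa only [f', if_pos (show x ∈ Q₀ from hx)] using (hder x hx).1.hasFDerivAt)
    (fun x hx => by simpa only [g', if_pos (show x ∈ Q₀ from hx)] using (hder x hx).2.1.hasFDerivAt)
    (by
      simp only [hsum]
      rw [← hQ']
      exact hGc.integrableOn_compact (isCompact_Icc.prod isCompact_Icc))
  simp only [hsum] at key
  rw [← hQ'] at key
  rw [setIntegral_closedBall_eq, key]
  -- The two sides `θ = ±π` are the same radius and cancel, and the side `r = 0` contributes nothing
  -- because of the factor `r`.
  have hg : ∀ x : ℝ, g (x, Real.pi) = g (x, -Real.pi) := by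
    intro x
    simp [g, E, polarMap, Complex.exp_neg]
  have hf0 : ∀ y : ℝ, f (0, y) = 0 := by
    intro y
    simp [f]
  simp only [hg, hf0, sub_self, intervalIntegral.integral_zero, sub_zero, zero_add]
  have hper : Function.Periodic (fun θ : ℝ => T (Complex.exp (θ * Complex.I))
      (Complex.I * Complex.exp (θ * Complex.I))) (2 * Real.pi) := by
    intro θ
    have : Complex.exp ((θ + 2 * Real.pi : ℝ) * Complex.I) = Complex.exp (θ * Complex.I) := by
      push_cast
      rw [add_mul, Complex.exp_add, Complex.exp_two_pi_mul_I, mul_one]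
    simp only [this]
  have h8 := hper.intervalIntegral_add_eq (-Real.pi) 0
  rw [zero_add, show -Real.pi + 2 * Real.pi = Real.pi by ring] at h8
  rw [← h8]
  refine intervalIntegral.integral_congr fun θ _ => ?_
  simp [f, E, polarMap]

end Green

/-! ### Primitives on the disc -/

section Primitives

variable {n : ℕ} {S : Set ℂ} {z : ℂ}

/-- The 1-form `d arg F`. -/
def argForm (F : ℂ → ℂ) (S : Set ℂ) (z : ℂ) : ℂ →L[ℝ] ℝ :=
  Complex.imCLM.comp ((F z)⁻¹ • fderivWithin ℝ F S z)

/-- The pullback by `g` of the 1-form `½ k(|p|) Im ⟨p, dp⟩`. -/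
def connForm (k : ℝ → ℝ) (g : ℂ → Cn n) (S : Set ℂ) (z : ℂ) : ℂ →L[ℝ] ℝ :=
  (2⁻¹ * k ‖g z‖) • Complex.imCLM.comp
    (((innerSL ℂ (g z)).restrictScalars ℝ).comp (fderivWithin ℝ g S z))

lemma argForm_apply (F : ℂ → ℂ) (S : Set ℂ) (z h : ℂ) :
    argForm F S z h = ((F z)⁻¹ * fderivWithin ℝ F S z h).im := rfl

lemma connForm_apply (k : ℝ → ℝ) (g : ℂ → Cn n) (S : Set ℂ) (z h : ℂ) :
    connForm k g S z h = 2⁻¹ * k ‖g z‖ * (inner ℂ (g z) (fderivWithin ℝ g S z h)).im := rfl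

lemma contDiffWithinAt_fderivWithin {E : Type*} [NormedAddCommGroup E] [NormedSpace ℝ E]
    {f : ℂ → E} (hS : UniqueDiffOn ℝ S) (hz : z ∈ S) (hf : ContDiffWithinAt ℝ ∞ f S z) :
    ContDiffWithinAt ℝ ∞ (fderivWithin ℝ f S) S z :=
  hf.fderivWithin_right hS (by simp) hz

lemma contDiffWithinAt_argForm {F : ℂ → ℂ} (hS : UniqueDiffOn ℝ S) (hz : z ∈ S)
    (hF : ContDiffWithinAt ℝ ∞ F S z) (h0 : F z ≠ 0) :
    ContDiffWithinAt ℝ ∞ (argForm F S) S z := by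
  have h1 : ContDiffWithinAt ℝ ∞ (fun z => (F z)⁻¹ • fderivWithin ℝ F S z) S z :=
    (hF.inv h0).smul (contDiffWithinAt_fderivWithin hS hz hF)
  exact ((ContinuousLinearMap.compL ℝ ℂ ℂ ℝ Complex.imCLM).contDiff.contDiffAt).comp_contDiffWithinAt
    z h1

lemma contDiffWithinAt_connForm {k : ℝ → ℝ} {g : ℂ → Cn n} (hS : UniqueDiffOn ℝ S) (hz : z ∈ S)
    (hg : ContDiffWithinAt ℝ ∞ g S z) (h0 : g z ≠ 0) (hk : ContDiffAt ℝ ∞ k ‖g z‖) :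
    ContDiffWithinAt ℝ ∞ (connForm k g S) S z := by
  have h1 : ContDiffWithinAt ℝ ∞ (fun z => ‖g z‖) S z :=
    (contDiffAt_norm ℝ h0).comp_contDiffWithinAt z hg
  have h2 : ContDiffWithinAt ℝ ∞ (fun z => k ‖g z‖) S z := hk.comp_contDiffWithinAt z h1
  have h4 : connForm k g S = fun z => connForm k g S z 1 • Complex.reCLM +
      connForm k g S z Complex.I • Complex.imCLM := by
    funext z
    refine ContinuousLinearMap.ext fun v => ?_
    conv_lhs => rw [← Complex.re_add_im v, show (v.re : ℂ) + v.im * Complex.I =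
      v.re • (1 : ℂ) + v.im • Complex.I by simp, map_add, map_smul, map_smul]
    simp [mul_comm]
  suffices h5 : ∀ h, ContDiffWithinAt ℝ ∞ (fun z => connForm k g S z h) S z by
    rw [h4]
    exact ((h5 _).smul contDiffWithinAt_const).add ((h5 _).smul contDiffWithinAt_const)
  intro h
  have h3 : ContDiffWithinAt ℝ ∞ (fun z => (inner ℂ (g z) (fderivWithin ℝ g S z h) : ℂ)) S z :=
    hg.inner ℂ ((contDiffWithinAt_fderivWithin hS hz hg).clm_apply contDiffWithinAt_const)
  exact (contDiffWithinAt_const.mul h2).mul (Complex.imCLM.contDiff.contDiffAt.comp_contDiffWithinAt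
    z h3)

lemma fderivWithin_eventuallyEq {E : Type*} [NormedAddCommGroup E] [NormedSpace ℝ E]
    (f : ℂ → E) (hS : S ∈ 𝓝 z) : fderivWithin ℝ f S =ᶠ[𝓝 z] fderiv ℝ f := by
  filter_upwards [eventually_mem_nhds_iff.2 hS] with y hy using fderivWithin_of_mem_nhds hy

lemma curl_eq_of_hasFDerivAt {T : ℂ → ℂ →L[ℝ] ℝ} (hT : DifferentiableAt ℝ T z)
    {A B : ℂ →L[ℝ] ℝ} (hA : HasFDerivAt (fun z => T z Complex.I) A z)
    (hB : HasFDerivAt (fun z => T z 1) B z) : curl T z = A 1 - B Complex.I := by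
  have h1 := (hT.hasFDerivAt.clm_apply (hasFDerivAt_const Complex.I z)).unique hA
  have h2 := (hT.hasFDerivAt.clm_apply (hasFDerivAt_const (1 : ℂ) z)).unique hB
  rw [← h1, ← h2, curl]
  simp

lemma curl_congr {T T' : ℂ → ℂ →L[ℝ] ℝ} (h : T =ᶠ[𝓝 z] T') : curl T z = curl T' z := by
  rw [curl, curl, h.fderiv_eq]

lemma curl_sub_smul {T T' : ℂ → ℂ →L[ℝ] ℝ} (c : ℝ) (hT : DifferentiableAt ℝ T z)
    (hT' : DifferentiableAt ℝ T' z) :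
    curl (fun z => T z - c • T' z) z = curl T z - c * curl T' z := by
  have h : HasFDerivAt (fun z => T z - c • T' z) _ z :=
    hT.hasFDerivAt.sub (hT'.hasFDerivAt.const_smul c)
  rw [curl, h.fderiv, curl, curl]
  simp only [sub_apply, smul_apply, smul_eq_mul]
  ring

lemma symm_fderiv_fderiv {E : Type*} [NormedAddCommGroup E] [NormedSpace ℝ E] {f : ℂ → E}
    (hf : ContDiffAt ℝ ∞ f z) (a b : ℂ) :
    fderiv ℝ (fderiv ℝ f) z a b = fderiv ℝ (fderiv ℝ f) z b a :=
  (hf.isSymmSndFDerivAt (by simpa using (WithTop.coe_le_coe.2 le_top : (2 : WithTop ℕ∞) ≤ ∞))) a b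

/-- Differentiating `F⁻¹ dF` gives a product symmetric in the two directions and a second derivative
of `F`, which is symmetric too. -/
lemma curl_argForm {F : ℂ → ℂ} (hS : UniqueDiffOn ℝ S) (hz : S ∈ 𝓝 z)
    (hF : ContDiffWithinAt ℝ ∞ F S z) (h0 : F z ≠ 0) : curl (argForm F S) z = 0 := by
  have hT : DifferentiableAt ℝ (argForm F S) z :=
    ((contDiffWithinAt_argForm hS (mem_of_mem_nhds hz) hF h0).contDiffAt hz).differentiableAt
      (by simp)
  have hFc := hF.contDiffAt hz
  have h1 : HasFDerivAt F (fderiv ℝ F z) z := (hFc.differentiableAt (by simp)).hasFDerivAt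
  have h2 : HasFDerivAt (fderiv ℝ F) (fderiv ℝ (fderiv ℝ F) z) z :=
    ((hFc.fderiv_right (m := ∞) (by simp)).differentiableAt (by simp)).hasFDerivAt
  have hi : HasFDerivAt (fun z => (F z)⁻¹) _ z :=
    ((hasDerivAt_inv h0).hasFDerivAt.restrictScalars ℝ).comp z h1
  have h3 : ∀ h : ℂ, HasFDerivAt (fun z => argForm F S z h) _ z := fun h =>
    (Complex.imCLM.hasFDerivAt.comp z (hi.mul
      (h2.clm_apply (hasFDerivAt_const h z)))).congr_of_eventuallyEq (by
        filter_upwards [fderivWithin_eventuallyEq F hz] with y hy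
        rw [argForm_apply, hy]
        rfl)
  rw [curl_eq_of_hasFDerivAt hT (h3 _) (h3 _)]
  simp
  rw [symm_fderiv_fderiv hFc Complex.I 1]
  ring

/-- The exterior derivative of `½ Im⟨p, dp⟩` is the standard form, and `dk` wedged with it yields
`radialPart`. Two choices matter: `k(s) = (β/s)² - 1` gives `radialForm` minus the standard form,
and `k(s) = ρ²/s²` gives `ρ²` times the Fubini-Study form. -/
lemma curl_connForm {k : ℝ → ℝ} {k' : ℝ} {g : ℂ → Cn n} (hS : UniqueDiffOn ℝ S) (hz : S ∈ 𝓝 z)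
    (hg : ContDiffWithinAt ℝ ∞ g S z) (h0 : g z ≠ 0) (hk : ContDiffAt ℝ ∞ k ‖g z‖)
    (hk' : HasDerivAt k k' ‖g z‖) :
    curl (connForm k g S) z = k ‖g z‖ * stdForm n ![fderiv ℝ g z 1, fderiv ℝ g z Complex.I] +
      2⁻¹ * (k' / ‖g z‖) * radialPart (g z) (fderiv ℝ g z 1) (fderiv ℝ g z Complex.I) := by
  have hT : DifferentiableAt ℝ (connForm k g S) z :=
    ((contDiffWithinAt_connForm hS (mem_of_mem_nhds hz) hg h0 hk).contDiffAt hz).differentiableAt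
      (by simp)
  have hgc := hg.contDiffAt hz
  have h1 : HasFDerivAt g (fderiv ℝ g z) z := (hgc.differentiableAt (by simp)).hasFDerivAt
  have h2 : HasFDerivAt (fderiv ℝ g) (fderiv ℝ (fderiv ℝ g) z) z :=
    ((hgc.fderiv_right (m := ∞) (by simp)).differentiableAt (by simp)).hasFDerivAt
  have hn : HasFDerivAt (fun z => k ‖g z‖) ((k' / ‖g z‖) • (innerSL ℝ (g z)).comp (fderiv ℝ g z)) z := by
    have hn0 : ‖g z‖ ≠ 0 := norm_ne_zero_iff.2 h0
    have h3 : HasFDerivAt (fun z => ‖g z‖) (‖g z‖⁻¹ • (innerSL ℝ (g z)).comp (fderiv ℝ g z)) z := by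
      have h4 := h1.norm_sq.sqrt (by positivity)
      have h5 : (fun z => Real.sqrt (‖g z‖ ^ 2)) = fun z => ‖g z‖ :=
        funext fun z => Real.sqrt_sq (norm_nonneg _)
      rw [h5, Real.sqrt_sq (norm_nonneg _)] at h4
      refine h4.congr_fderiv (ContinuousLinearMap.ext fun v => ?_)
      simp
      field_simp
    refine (hk'.comp_hasFDerivAt z h3).congr_fderiv ?_
    rw [smul_smul, div_eq_mul_inv]
  have h3 : ∀ h : ℂ, HasFDerivAt (fun z => connForm k g S z h) _ z := fun h =>
    ((hn.const_mul 2⁻¹).mul (Complex.imCLM.hasFDerivAt.comp z (h1.inner ℂ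
      (h2.clm_apply (hasFDerivAt_const h z))))).congr_of_eventuallyEq (by
        filter_upwards [fderivWithin_eventuallyEq g hz] with y hy
        rw [connForm_apply, hy]
        rfl)
  rw [curl_eq_of_hasFDerivAt hT (h3 _) (h3 _)]
  simp
  have h4 : ∀ a b : Cn n, (inner ℂ a b : ℂ).im = -(inner ℂ b a : ℂ).im := by
    intro a b
    rw [← inner_conj_symm, Complex.conj_im]
  rw [symm_fderiv_fderiv hgc Complex.I 1, stdForm_apply, real_inner_eq_re, real_inner_eq_re,
    radialPart_eq, h4 (fderiv ℝ g z Complex.I)]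
  ring

end Primitives

/-! ### Smooth discs in coordinates -/

section Discs

lemma uniqueDiffOn_disc : UniqueDiffOn ℝ (Metric.closedBall (0 : ℂ) 1) :=
  uniqueDiffOn_convex (convex_closedBall _ _) ⟨0, by
    rw [interior_closedBall _ one_ne_zero]; simp⟩

variable {n : ℕ} {N : Type*} [TopologicalSpace N] [ChartedSpace (Cn n) N]
  [IsManifold 𝓘(ℝ, Cn n) ∞ N] {u : ℂ → N}

/-- The derivative of a disc. -/
def discDeriv (n : ℕ) {N : Type*} [TopologicalSpace N] [ChartedSpace (Cn n) N] (u : ℂ → N)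
    (z h : ℂ) : TangentSpace 𝓘(ℝ, Cn n) (u z) :=
  mfderivWithin 𝓘(ℝ, ℂ) 𝓘(ℝ, Cn n) u (Metric.closedBall 0 1) z h

lemma contDiffWithinAt_comp_disc {m : ℕ} {f : N → Cn m} {z : ℂ}
    (hu : ContMDiffOn 𝓘(ℝ, ℂ) 𝓘(ℝ, Cn n) ∞ u (Metric.closedBall 0 1))
    (hz : z ∈ Metric.closedBall (0 : ℂ) 1)
    (hf : ContMDiffAt 𝓘(ℝ, Cn n) 𝓘(ℝ, Cn m) ∞ f (u z)) :
    ContDiffWithinAt ℝ ∞ (fun z => f (u z)) (Metric.closedBall 0 1) z :=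
  (hf.comp_contMDiffWithinAt z (hu z hz)).contDiffWithinAt

lemma fderivWithin_comp_disc {f : N → Cn n} {z : ℂ}
    (hu : ContMDiffOn 𝓘(ℝ, ℂ) 𝓘(ℝ, Cn n) ∞ u (Metric.closedBall 0 1))
    (hz : z ∈ Metric.closedBall (0 : ℂ) 1)
    (hf : MDifferentiableAt 𝓘(ℝ, Cn n) 𝓘(ℝ, Cn n) f (u z)) (h : ℂ) :
    fderivWithin ℝ (fun z => f (u z)) (Metric.closedBall 0 1) z h =
      mfd f (u z) (discDeriv n u z h) := by
  have h1 := mfderiv_comp_mfderivWithin z hf ((hu z hz).mdifferentiableWithinAt (by simp))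
    (uniqueDiffOn_disc.uniqueMDiffOn z hz)
  rw [mfderivWithin_eq_fderivWithin] at h1
  exact DFunLike.congr_fun h1 h

lemma discDeriv_comp {M : Type*} [TopologicalSpace M] [ChartedSpace (Cn n) M]
    [IsManifold 𝓘(ℝ, Cn n) ∞ M] {f : N → M} {z : ℂ}
    (hu : ContMDiffOn 𝓘(ℝ, ℂ) 𝓘(ℝ, Cn n) ∞ u (Metric.closedBall 0 1))
    (hz : z ∈ Metric.closedBall (0 : ℂ) 1)
    (hf : MDifferentiableAt 𝓘(ℝ, Cn n) 𝓘(ℝ, Cn n) f (u z)) (h : ℂ) :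
    discDeriv n (fun z => f (u z)) z h =
      mfderiv 𝓘(ℝ, Cn n) 𝓘(ℝ, Cn n) f (u z) (discDeriv n u z h) :=
  DFunLike.congr_fun (mfderiv_comp_mfderivWithin z hf
    ((hu z hz).mdifferentiableWithinAt (by simp)) (uniqueDiffOn_disc.uniqueMDiffOn z hz)) h

/-- The integrand of the symplectic area. -/
def areaDensity (Ω : TwoForm n N) (u : ℂ → N) (z : ℂ) : ℝ :=
  Ω (u z) ![discDeriv n u z 1, discDeriv n u z Complex.I]

lemma symplecticArea_eq (Ω : TwoForm n N) (u : ℂ → N) :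
    symplecticArea Ω u = ∫ z in Metric.closedBall (0 : ℂ) 1, areaDensity Ω u z := rfl

lemma continuousOn_areaDensity {Ω : TwoForm n N} (hΩ : IsSymplecticForm Ω)
    (hu : ContMDiffOn 𝓘(ℝ, ℂ) 𝓘(ℝ, Cn n) ∞ u (Metric.closedBall 0 1)) :
    ContinuousOn (areaDensity Ω u) (Metric.closedBall 0 1) := by
  intro z₀ hz₀
  set ψ := chartAt (Cn n) (u z₀)
  have hψ : ψ ∈ IsManifold.maximalAtlas 𝓘(ℝ, Cn n) ∞ N := IsManifold.chart_mem_maximalAtlas _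
  have h0 : u z₀ ∈ ψ.source := mem_chart_source _ _
  have hsm := contDiffWithinAt_comp_disc hu hz₀ (contMDiffAt_of_mem_maximalAtlas hψ h0)
  have h1 : areaDensity Ω u =ᶠ[𝓝[Metric.closedBall 0 1] z₀] fun z => Ω.inChart ψ (ψ (u z))
      ![fderivWithin ℝ (fun z => ψ (u z)) (Metric.closedBall 0 1) z 1,
        fderivWithin ℝ (fun z => ψ (u z)) (Metric.closedBall 0 1) z Complex.I] := by
    filter_upwards [(hu z₀ hz₀).continuousWithinAt.eventually_mem (ψ.open_source.mem_nhds h0),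
      self_mem_nhdsWithin] with z hz hzD
    have h2 : MDifferentiableAt 𝓘(ℝ, Cn n) 𝓘(ℝ, Cn n) ψ (u z) :=
      (contMDiffAt_of_mem_maximalAtlas hψ hz).mdifferentiableAt (by simp)
    rw [fderivWithin_comp_disc hu hzD h2, fderivWithin_comp_disc hu hzD h2]
    exact Ω.eq_inChart hψ hz _ _
  refine ContinuousWithinAt.congr_of_eventuallyEq ?_ h1 (h1.self_of_nhdsWithin hz₀)
  have h3 := (contDiffWithinAt_fderivWithin uniqueDiffOn_disc hz₀ hsm).continuousWithinAt
  have h4 : ContinuousAt (Ω.inChart ψ) (ψ (u z₀)) :=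
    (hΩ.smooth ψ (chart_mem_atlas _ _)).continuousOn.continuousAt
      (ψ.open_target.mem_nhds (ψ.map_source h0))
  have h5 := ContinuousAt.comp_continuousWithinAt (f := fun z => ψ (u z)) h4
    hsm.continuousWithinAt
  have h6 : ∀ h : ℂ, ContinuousWithinAt (fun z => fderivWithin ℝ (fun z => ψ (u z))
      (Metric.closedBall 0 1) z h) (Metric.closedBall 0 1) z₀ :=
    fun h => h3.clm_apply continuousWithinAt_const
  have h7 : Continuous fun x : (Cn n [⋀^Fin 2]→L[ℝ] ℝ) × Cn n × Cn n => x.1 ![x.2.1, x.2.2] := by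
    have h8 : Continuous fun x : (Cn n [⋀^Fin 2]→L[ℝ] ℝ) × (Fin 2 → Cn n) => x.1 x.2 :=
      ContinuousEval.continuous_eval
    exact h8.comp (continuous_fst.prodMk (continuous_pi fun i => by
      fin_cases i
      · exact continuous_fst.comp continuous_snd
      · exact continuous_snd.comp continuous_snd))
  exact ContinuousAt.comp_continuousWithinAt (f := fun z => (Ω.inChart ψ (ψ (u z)),
    fderivWithin ℝ (fun z => ψ (u z)) (Metric.closedBall 0 1) z 1,
    fderivWithin ℝ (fun z => ψ (u z)) (Metric.closedBall 0 1) z Complex.I)) h7.continuousAt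
    (h5.prodMk ((h6 1).prodMk (h6 Complex.I)))

end Discs

/-! ### The change of the area under the blow-down map -/

section GaugeChange

variable {n : ℕ} {S : Set ℂ} {z : ℂ}

lemma argForm_congr {F G : ℂ → ℂ} (h : F =ᶠ[𝓝[S] z] G) (hz : z ∈ S) :
    argForm F S z = argForm G S z := by
  rw [argForm, argForm, h.fderivWithin_eq_of_mem hz, h.self_of_nhdsWithin hz]

lemma connForm_congr {k : ℝ → ℝ} {g g' : ℂ → Cn n} (h : g =ᶠ[𝓝[S] z] g') (hz : z ∈ S) :
    connForm k g S z = connForm k g' S z := by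
  rw [connForm, connForm, h.fderivWithin_eq_of_mem hz, h.self_of_nhdsWithin hz]

/-- The logarithmic derivative turns products into sums. -/
lemma argForm_pow_mul {q C : ℂ → ℂ} (hS : UniqueDiffOn ℝ S) (hz : z ∈ S)
    (hq : DifferentiableWithinAt ℝ q S z) (hC : DifferentiableWithinAt ℝ C S z) (hq0 : q z ≠ 0)
    (hC0 : C z ≠ 0) (m : ℕ) :
    argForm (fun z => q z ^ m * C z) S z = (m : ℝ) • argForm q S z + argForm C S z := by
  refine ContinuousLinearMap.ext fun h => ?_
  have h1 := ((hq.hasFDerivWithinAt.pow m).mul hC.hasFDerivWithinAt).fderivWithin (hS z hz)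
  rw [argForm_apply]
  erw [h1]
  simp only [add_apply, smul_apply, argForm_apply, smul_eq_mul]
  rw [← Complex.im_ofReal_mul, ← Complex.add_im]
  congr 1
  cases m with
  | zero => simp
  | succ m =>
    simp only [Nat.add_sub_cancel, nsmul_eq_mul]
    push_cast
    field_simp
    ring

/-- In `Im⟨qg, d(qg)⟩ / |qg|²` the term with `dg` keeps its form, since `|q|²` cancels, and the term
with `dq` becomes `Im(q̄ dq)/|q|²`, which is `d arg q`. -/
lemma connForm_smul {c : ℝ} {q : ℂ → ℂ} {g : ℂ → Cn n} (hS : UniqueDiffOn ℝ S) (hz : z ∈ S)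
    (hq : DifferentiableWithinAt ℝ q S z) (hg : DifferentiableWithinAt ℝ g S z) (hq0 : q z ≠ 0)
    (hg0 : g z ≠ 0) :
    connForm (fun s => c / s ^ 2) (fun z => q z • g z) S z =
      (c / 2) • argForm q S z + connForm (fun s => c / s ^ 2) g S z := by
  refine ContinuousLinearMap.ext fun h => ?_
  have hq1 : ‖q z‖ ≠ 0 := norm_ne_zero_iff.2 hq0
  have hg1 : ‖g z‖ ≠ 0 := norm_ne_zero_iff.2 hg0
  have h1 := (hq.hasFDerivWithinAt.smul hg.hasFDerivWithinAt).fderivWithin (hS z hz)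
  rw [connForm_apply]
  erw [h1]
  simp only [add_apply, smul_apply, argForm_apply, connForm_apply, smul_eq_mul,
    ContinuousLinearMap.smulRight_apply, norm_smul]
  have h2 : (inner ℂ (q z • g z)
      (q z • fderivWithin ℝ g S z h + fderivWithin ℝ q S z h • g z) : ℂ) =
      ((‖q z‖ ^ 2 : ℝ) : ℂ) * inner ℂ (g z) (fderivWithin ℝ g S z h) +
      ((‖g z‖ ^ 2 : ℝ) : ℂ) * (starRingEnd ℂ (q z) * fderivWithin ℝ q S z h) := by
    rw [inner_add_right, inner_smul_left, inner_smul_left, inner_smul_right, inner_smul_right,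
      norm_sq_eq_inner, ← Complex.normSq_eq_norm_sq, Complex.normSq_eq_conj_mul_self]
    ring
  have h3 : (q z)⁻¹ * fderivWithin ℝ q S z h =
      (((‖q z‖ ^ 2)⁻¹ : ℝ) : ℂ) * (starRingEnd ℂ (q z) * fderivWithin ℝ q S z h) := by
    rw [Complex.inv_def, Complex.normSq_eq_norm_sq]
    push_cast
    ring
  rw [h2, h3, Complex.add_im, Complex.im_ofReal_mul, Complex.im_ofReal_mul, Complex.im_ofReal_mul]
  field_simp
  ring

/-- The combination `½ c Im⟨g, dg⟩/|g|² - (c / 2m) d arg C` is invariant under `g ↦ q g`,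
`C ↦ q ^ m C`. -/
lemma connForm_sub_argForm_eq {c e : ℝ} {m : ℕ} (he : e * m = c / 2) {q C C' : ℂ → ℂ}
    {g g' : ℂ → Cn n} (hS : UniqueDiffOn ℝ S) (hz : z ∈ S)
    (hq : DifferentiableWithinAt ℝ q S z) (hg : DifferentiableWithinAt ℝ g S z)
    (hC : DifferentiableWithinAt ℝ C S z) (hq0 : q z ≠ 0) (hg0 : g z ≠ 0) (hC0 : C z ≠ 0)
    (hg' : g' =ᶠ[𝓝[S] z] fun z => q z • g z) (hC' : C' =ᶠ[𝓝[S] z] fun z => q z ^ m * C z) :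
    connForm (fun s => c / s ^ 2) g' S z - e • argForm C' S z =
      connForm (fun s => c / s ^ 2) g S z - e • argForm C S z := by
  rw [connForm_congr hg' hz, argForm_congr hC' hz, connForm_smul hS hz hq hg hq0 hg0,
    argForm_pow_mul hS hz hq hC hq0 hC0, smul_add, smul_smul, he]
  abel

end GaugeChange

/-! ### A primitive of the difference of the area forms, smooth across `E`. -/

namespace BlowUp

variable {n : ℕ} {M : Type*} [TopologicalSpace M] [ChartedSpace (Cn n) M] {B : SmoothBall n M}
  [NeZero n] [T2Space M] [IsManifold 𝓘(ℝ, Cn n) ∞ M] {Ω : TwoForm n M} {ρ r δ : ℝ} {β : ℝ → ℝ}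
  {u : ℂ → BlowUp B} {F : ℂ → ℂ} {C : Fin n → ℂ → ℂ} {m : ℕ}

lemma form_ball (hB : B.IsSymplectic Ω) {x : M} (hx : x ∈ B.ι.target)
    (a b : TangentSpace 𝓘(ℝ, Cn n) x) :
    Ω x ![a, b] = stdForm n ![mfd B.ι.symm x a, mfd B.ι.symm x b] := by
  have hmd := OpenPartialHomeomorph.mdifferentiable_of_mem_maximalAtlas B.symm_mem_maximalAtlas
  have h1 : ∀ a : TangentSpace 𝓘(ℝ, Cn n) x,
      mfderiv 𝓘(ℝ, Cn n) 𝓘(ℝ, Cn n) B.ι (B.ι.symm x) (mfd B.ι.symm x a) = a :=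
    fun a => DFunLike.congr_fun (hmd.symm_comp_deriv hx) a
  refine (Ω.congr_point (B.ι.right_inv hx).symm a b).trans
    (Eq.trans ?_ (hB _ (B.ι.map_target hx) _ _))
  exact congrArg₂ (fun a b : Cn n => Ω (B.ι (B.ι.symm x))
    ![(a : TangentSpace 𝓘(ℝ, Cn n) (B.ι (B.ι.symm x))), b]) (h1 a).symm (h1 b).symm

/-- A smooth function `F` on the disc which vanishes exactly where the disc meets the exceptional
divisor, to the order `m`, together with the quotients `C j = F / q_j ^ m` by powers of the local
equations `q_j` of the exceptional divisor. -/
structure IsDivisorFunction (B : SmoothBall n M) (δ : ℝ) (m : ℕ) (u : ℂ → BlowUp B)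
    (F : ℂ → ℂ) (C : Fin n → ℂ → ℂ) : Prop where
  smooth : ∀ z ∈ Metric.closedBall (0 : ℂ) 1, proj B (u z) ≠ B.center →
    ContDiffWithinAt ℝ ∞ F (Metric.closedBall 0 1) z
  ne_zero : ∀ z ∈ Metric.closedBall (0 : ℂ) 1, proj B (u z) ≠ B.center → F z ≠ 0
  local_smooth : ∀ z ∈ Metric.closedBall (0 : ℂ) 1, ∀ j, u z ∈ (affineChart B j).source →
    ‖ballCoord B (u z)‖ < δ → ContDiffWithinAt ℝ ∞ (C j) (Metric.closedBall 0 1) z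
  local_ne_zero : ∀ z ∈ Metric.closedBall (0 : ℂ) 1, ∀ j, u z ∈ (affineChart B j).source →
    ‖ballCoord B (u z)‖ < δ → C j z ≠ 0
  eq_pow_mul : ∀ z ∈ Metric.closedBall (0 : ℂ) 1, ∀ j, u z ∈ (affineChart B j).source →
    ‖ballCoord B (u z)‖ < δ → F z = affineChart B j (u z) j ^ m * C j z
  transition : ∀ z ∈ Metric.closedBall (0 : ℂ) 1, ∀ i j, u z ∈ (affineChart B i).source →
    u z ∈ (affineChart B j).source → ‖ballCoord B (u z)‖ < δ →
    C i z = hat i (affineChart B i (u z)) j ^ m * C j z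

/-- The local primitive near the exceptional divisor. -/
def nearForm (B : SmoothBall n M) (ρ e : ℝ) (u : ℂ → BlowUp B) (C : Fin n → ℂ → ℂ) (j : Fin n)
    (z : ℂ) : ℂ →L[ℝ] ℝ :=
  connForm (fun s => ρ ^ 2 / s ^ 2) (fun z => hat j (affineChart B j (u z)))
    (Metric.closedBall 0 1) z - e • argForm (C j) (Metric.closedBall 0 1) z

open Classical in
/-- A primitive of the difference of the two area forms. -/
def primitive (B : SmoothBall n M) (ρ e r : ℝ) (β : ℝ → ℝ) (u : ℂ → BlowUp B) (F : ℂ → ℂ)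
    (C : Fin n → ℂ → ℂ) (z : ℂ) : ℂ →L[ℝ] ℝ :=
  if h : proj B (u z) = B.center then
    nearForm B ρ e u C (exists_mem_affineChart_source B (h ▸ center_mem_target)).choose z
  else (if proj B (u z) ∈ B.ι '' Metric.ball 0 r then
      connForm (fun s => (β s / s) ^ 2 - 1) (fun z => ballCoord B (u z)) (Metric.closedBall 0 1) z
      else 0) - e • argForm F (Metric.closedBall 0 1) z

section Disc

lemma contDiffWithinAt_affine
    (hu : ContMDiffOn 𝓘(ℝ, ℂ) 𝓘(ℝ, Cn n) ∞ u (Metric.closedBall 0 1)) {z : ℂ}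
    (hz : z ∈ Metric.closedBall (0 : ℂ) 1) {j : Fin n} (hj : u z ∈ (affineChart B j).source) :
    ContDiffWithinAt ℝ ∞ (fun z => affineChart B j (u z)) (Metric.closedBall 0 1) z :=
  contDiffWithinAt_comp_disc hu hz (contMDiffAt_of_mem_maximalAtlas (affineHomeo_mem B j)
    (show u z ∈ (affineHomeo B j).source from hj))

lemma eventually_near
    (hu : ContMDiffOn 𝓘(ℝ, ℂ) 𝓘(ℝ, Cn n) ∞ u (Metric.closedBall 0 1)) {z : ℂ}
    (hz : z ∈ Metric.closedBall (0 : ℂ) 1) {j : Fin n} (hj : u z ∈ (affineChart B j).source)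
    (hδ : ‖ballCoord B (u z)‖ < δ) :
    ∀ᶠ y in 𝓝[Metric.closedBall 0 1] z, y ∈ Metric.closedBall (0 : ℂ) 1 ∧
      u y ∈ (affineChart B j).source ∧ ‖ballCoord B (u y)‖ < δ := by
  have h1 := (contMDiffAt_ballCoord B (affineBlowDown_affineChart B hj).1).continuousAt.norm
  have h2 := ContinuousAt.comp_continuousWithinAt (f := u) h1 (hu z hz).continuousWithinAt
  filter_upwards [self_mem_nhdsWithin, (hu z hz).continuousWithinAt.eventually_mem
    ((affineHomeo B j).open_source.mem_nhds (show u z ∈ (affineHomeo B j).source from hj)),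
    h2.eventually_lt continuousWithinAt_const hδ] with y h3 h4 h5
  exact ⟨h3, h4, h5⟩

lemma contDiffWithinAt_hat
    (hu : ContMDiffOn 𝓘(ℝ, ℂ) 𝓘(ℝ, Cn n) ∞ u (Metric.closedBall 0 1)) {z : ℂ}
    (hz : z ∈ Metric.closedBall (0 : ℂ) 1) {j : Fin n} (hj : u z ∈ (affineChart B j).source) :
    ContDiffWithinAt ℝ ∞ (fun z => hat j (affineChart B j (u z))) (Metric.closedBall 0 1) z :=
  (contDiff_hat j).contDiffAt.comp_contDiffWithinAt z (contDiffWithinAt_affine hu hz hj)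

lemma contDiffWithinAt_nearForm
    (hu : ContMDiffOn 𝓘(ℝ, ℂ) 𝓘(ℝ, Cn n) ∞ u (Metric.closedBall 0 1)) {z : ℂ}
    (hz : z ∈ Metric.closedBall (0 : ℂ) 1) (hF : IsDivisorFunction B δ m u F C) {j : Fin n}
    (hj : u z ∈ (affineChart B j).source) (hδ : ‖ballCoord B (u z)‖ < δ) :
    ContDiffWithinAt ℝ ∞ (connForm (fun s => ρ ^ 2 / s ^ 2)
      (fun z => hat j (affineChart B j (u z))) (Metric.closedBall 0 1)) (Metric.closedBall 0 1) z ∧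
    ContDiffWithinAt ℝ ∞ (argForm (C j) (Metric.closedBall 0 1)) (Metric.closedBall 0 1) z := by
  have h0 := hat_ne_zero j (affineChart B j (u z))
  refine ⟨contDiffWithinAt_connForm uniqueDiffOn_disc hz (contDiffWithinAt_hat hu hz hj) h0
    (contDiffAt_const.div (contDiffAt_id.pow 2) (pow_ne_zero 2 (norm_ne_zero_iff.2 h0))),
    contDiffWithinAt_argForm uniqueDiffOn_disc hz (hF.local_smooth z hz j hj hδ)
      (hF.local_ne_zero z hz j hj hδ)⟩

/-- The homogeneous vectors of two affine charts differ by a nonvanishing factor `q`, and the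
functions `C` by `q ^ m`; the combination is invariant under such a change. So the chart chosen in
`primitive` does not matter. -/
lemma nearForm_eq
    (hu : ContMDiffOn 𝓘(ℝ, ℂ) 𝓘(ℝ, Cn n) ∞ u (Metric.closedBall 0 1)) {z : ℂ}
    (hz : z ∈ Metric.closedBall (0 : ℂ) 1) (hF : IsDivisorFunction B δ m u F C) {e : ℝ} (he : e * m = ρ ^ 2 / 2)
    {i j : Fin n} (hi : u z ∈ (affineChart B i).source) (hj : u z ∈ (affineChart B j).source)
    (hδ : ‖ballCoord B (u z)‖ < δ) : nearForm B ρ e u C i z = nearForm B ρ e u C j z := by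
  have hq0 : hat i (affineChart B i (u z)) j ≠ 0 := (affineChart_transition hi).2.1 hj
  refine connForm_sub_argForm_eq (q := fun z => hat i (affineChart B i (u z)) j) he
    uniqueDiffOn_disc hz ?_ ((contDiffWithinAt_hat hu hz hj).differentiableWithinAt (by simp))
    ((hF.local_smooth z hz j hj hδ).differentiableWithinAt (by simp)) hq0 (hat_ne_zero _ _)
    (hF.local_ne_zero z hz j hj hδ) ?_ ?_
  · exact ((contDiff_piLp_apply (𝕜 := ℝ) (p := 2) (n := ∞) (i := j)).contDiffAt.comp_contDiffWithinAt z
      (contDiffWithinAt_hat hu hz hi)).differentiableWithinAt (by simp)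
  · filter_upwards [eventually_near hu hz hi hδ, eventually_near hu hz hj hδ] with y hyi hyj
    have h1 := affineChart_transition (i := i) (j := j) hyi.2.1
    have h2 := h1.2.1 hyj.2.1
    rw [h1.1, hat_affineCoord j _ h2, smul_smul, mul_inv_cancel₀ h2, one_smul]
  · filter_upwards [eventually_near hu hz hi hδ, eventually_near hu hz hj hδ] with y hyi hyj
    exact hF.transition y hyi.1 i j hyi.2.1 hyj.2.1 hyi.2.2

/-- For small radii `(β/s)² - 1 = ρ²/s²`, and the ball coordinate is `q` times `hat j` with the
equation `q` of `E`, while `F = q ^ m C`. The same invariance removes `q`, and with it the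
singularity along `E`. -/
lemma primitive_near
    (hu : ContMDiffOn 𝓘(ℝ, ℂ) 𝓘(ℝ, Cn n) ∞ u (Metric.closedBall 0 1)) {z : ℂ}
    (hz : z ∈ Metric.closedBall (0 : ℂ) 1) (hF : IsDivisorFunction B δ m u F C) {e : ℝ} (he : e * m = ρ ^ 2 / 2)
    (h : IsProfile ρ r δ β) (hρ : 0 < ρ) (hr : r ≤ B.radius)
    {j : Fin n} (hj : u z ∈ (affineChart B j).source) (hδ : ‖ballCoord B (u z)‖ < δ) :
    primitive B ρ e r β u F C z = nearForm B ρ e u C j z := by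
  by_cases hc : proj B (u z) = B.center
  · rw [primitive, dif_pos hc]
    exact nearForm_eq hu hz hF he (exists_mem_affineChart_source B (hc ▸ center_mem_target)).choose_spec hj hδ
  · have h1 := affineBlowDown_affineChart B hj
    have hδr := h.delta_lt hρ
    have hδ0 := h.pos
    rw [primitive, dif_neg hc, if_pos ((mem_ball_image_iff hr).2 ⟨h1.1, by
      change ‖ballCoord B (u z)‖ < r
      linarith⟩)]
    have hp0 := ballCoord_ne_zero h1.1 hc
    have hn0 := norm_pos_iff.2 hp0
    have h2 : connForm (fun s => (β s / s) ^ 2 - 1) (fun z => ballCoord B (u z))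
        (Metric.closedBall 0 1) z = connForm (fun s => ρ ^ 2 / s ^ 2) (fun z => ballCoord B (u z))
        (Metric.closedBall 0 1) z := by
      rw [connForm, connForm, h.inner _ ⟨hn0.le, hδ.le⟩, div_pow,
        Real.sq_sqrt (by positivity)]
      congr 3
      field_simp
      ring
    rw [h2]
    refine connForm_sub_argForm_eq (q := fun z => affineChart B j (u z) j) he
      uniqueDiffOn_disc hz ?_ ((contDiffWithinAt_hat hu hz hj).differentiableWithinAt (by simp))
      ((hF.local_smooth z hz j hj hδ).differentiableWithinAt (by simp)) ?_ (hat_ne_zero _ _)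
      (hF.local_ne_zero z hz j hj hδ) ?_ ?_
    · exact ((contDiff_piLp_apply (𝕜 := ℝ) (p := 2) (n := ∞) (i := j)).contDiffAt.comp_contDiffWithinAt
        z (contDiffWithinAt_affine hu hz hj)).differentiableWithinAt (by simp)
    · intro h3
      exact hp0 (h1.2.symm.trans (affineBlowDown_eq_zero.2 h3))
    · filter_upwards [eventually_near hu hz hj hδ] with y hy
      exact (affineBlowDown_affineChart B hy.2.1).2.symm
    · filter_upwards [eventually_near hu hz hj hδ] with y hy
      exact hF.eq_pow_mul y hy.1 j hy.2.1 hy.2.2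

end Disc

end BlowUp

/-! ### Exterior derivative of the primitive, and the area formula. -/

namespace BlowUp

variable {n : ℕ} {M : Type*} [TopologicalSpace M] [ChartedSpace (Cn n) M] {B : SmoothBall n M}
  [NeZero n] [T2Space M] [IsManifold 𝓘(ℝ, Cn n) ∞ M] {Ω : TwoForm n M} {ρ r δ : ℝ} {β : ℝ → ℝ}
  {u : ℂ → BlowUp B} {F : ℂ → ℂ} {C : Fin n → ℂ → ℂ} {m : ℕ}

lemma fderiv_comp_disc {f : BlowUp B → Cn n} {z : ℂ}
    (hu : ContMDiffOn 𝓘(ℝ, ℂ) 𝓘(ℝ, Cn n) ∞ u (Metric.closedBall 0 1))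
    (hz : z ∈ Metric.ball (0 : ℂ) 1) (hf : ContMDiffAt 𝓘(ℝ, Cn n) 𝓘(ℝ, Cn n) ∞ f (u z)) (h : ℂ) :
    fderiv ℝ (fun z => f (u z)) z h = mfd f (u z) (discDeriv n u z h) := by
  rw [← fderivWithin_comp_disc hu (Metric.ball_subset_closedBall hz)
    (hf.mdifferentiableAt (by simp)),
    fderivWithin_of_mem_nhds (Metric.closedBall_mem_nhds_of_mem hz)]

lemma areaDensity_proj {z : ℂ}
    (hu : ContMDiffOn 𝓘(ℝ, ℂ) 𝓘(ℝ, Cn n) ∞ u (Metric.closedBall 0 1))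
    (hz : z ∈ Metric.closedBall (0 : ℂ) 1) :
    areaDensity Ω (fun z => proj B (u z)) z = Ω (proj B (u z))
      ![mfderiv 𝓘(ℝ, Cn n) 𝓘(ℝ, Cn n) (proj B) (u z) (discDeriv n u z 1),
        mfderiv 𝓘(ℝ, Cn n) 𝓘(ℝ, Cn n) (proj B) (u z) (discDeriv n u z Complex.I)] := by
  have hp : MDifferentiableAt 𝓘(ℝ, Cn n) 𝓘(ℝ, Cn n) (proj B) (u z) :=
    (contMDiff_proj B).contMDiffAt.mdifferentiableAt (by simp)
  rw [areaDensity, discDeriv_comp hu hz hp, discDeriv_comp hu hz hp]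

lemma areaDensity_proj_ball (hB : B.IsSymplectic Ω) {z : ℂ}
    (hu : ContMDiffOn 𝓘(ℝ, ℂ) 𝓘(ℝ, Cn n) ∞ u (Metric.closedBall 0 1))
    (hz : z ∈ Metric.closedBall (0 : ℂ) 1) (hp : proj B (u z) ∈ B.ι.target) :
    areaDensity Ω (fun z => proj B (u z)) z = stdForm n
      ![mfd (ballCoord B) (u z) (discDeriv n u z 1),
        mfd (ballCoord B) (u z) (discDeriv n u z Complex.I)] := by
  rw [areaDensity_proj hu hz, form_ball hB hp, mfd_ballCoord B hp, mfd_ballCoord B hp]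

lemma curl_connForm_sub {k : ℝ → ℝ} {k' e : ℝ} {g : ℂ → Cn n} {G : ℂ → ℂ} {S : Set ℂ} {z : ℂ}
    (hS : UniqueDiffOn ℝ S) (hz : S ∈ 𝓝 z)
    (hg : ContDiffWithinAt ℝ ∞ g S z) (h0 : g z ≠ 0) (hk : ContDiffAt ℝ ∞ k ‖g z‖)
    (hk' : HasDerivAt k k' ‖g z‖) (hG : ContDiffWithinAt ℝ ∞ G S z) (hG0 : G z ≠ 0) :
    curl (fun z => connForm k g S z - e • argForm G S z) z =
      k ‖g z‖ * stdForm n ![fderiv ℝ g z 1, fderiv ℝ g z Complex.I] +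
      2⁻¹ * (k' / ‖g z‖) * radialPart (g z) (fderiv ℝ g z 1) (fderiv ℝ g z Complex.I) := by
  have hz' := mem_of_mem_nhds hz
  rw [curl_sub_smul e
    (((contDiffWithinAt_connForm hS hz' hg h0 hk).contDiffAt hz).differentiableAt (by simp))
    (((contDiffWithinAt_argForm hS hz' hG hG0).contDiffAt hz).differentiableAt (by simp)),
    curl_argForm hS hz hG hG0, curl_connForm hS hz hg h0 hk hk', mul_zero, sub_zero]

/-- Near `E` both area forms contain the pullback of the standard form by the blow-down map, so
their difference is `ρ²` times the Fubini-Study form pulled back by `hat j`. That is the curl of the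
connection form with `k(s) = ρ²/s²`, and `d arg C` is closed. -/
lemma curl_nearForm (hB : B.IsSymplectic Ω) (h : IsProfile ρ r δ β) (hρ : 0 < ρ)
    (hr : r ≤ B.radius) (hF : IsDivisorFunction B δ m u F C) {e : ℝ}
    (hu : ContMDiffOn 𝓘(ℝ, ℂ) 𝓘(ℝ, Cn n) ∞ u (Metric.closedBall 0 1)) {z : ℂ}
    (hz : z ∈ Metric.ball (0 : ℂ) 1) {j : Fin n} (hj : u z ∈ (affineChart B j).source)
    (hδ : ‖ballCoord B (u z)‖ < δ) :
    curl (nearForm B ρ e u C j) z = areaDensity (form B Ω ρ r β) u z -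
      areaDensity Ω (fun z => proj B (u z)) z := by
  have hz' := Metric.ball_subset_closedBall hz
  have hn := Metric.closedBall_mem_nhds_of_mem hz
  have h0 := hat_ne_zero j (affineChart B j (u z))
  have hn0 : ‖hat j (affineChart B j (u z))‖ ≠ 0 := norm_ne_zero_iff.2 h0
  have hpt := (affineBlowDown_affineChart B hj).1
  have hk' : HasDerivAt (fun s => ρ ^ 2 / s ^ 2)
      (-(2 * ρ ^ 2) / ‖hat j (affineChart B j (u z))‖ ^ 3) ‖hat j (affineChart B j (u z))‖ := by
    refine ((hasDerivAt_const _ (ρ ^ 2)).div (hasDerivAt_pow 2 _) (by positivity)).congr_deriv ?_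
    simp
    field_simp
  have hA : ContMDiffAt 𝓘(ℝ, Cn n) 𝓘(ℝ, Cn n) ∞ (affineChart B j) (u z) :=
    contMDiffAt_of_mem_maximalAtlas (affineHomeo_mem B j)
      (show u z ∈ (affineHomeo B j).source from hj)
  have hder : ∀ x, fderiv ℝ (fun z => hat j (affineChart B j (u z))) z x =
      hatDeriv j (mfd (affineChart B j) (u z) (discDeriv n u z x)) := by
    intro x
    have h1 := (contDiffWithinAt_affine hu hz' hj).contDiffAt hn
    have h2 := (hasFDerivAt_hat j (affineChart B j (u z))).comp z
      (h1.differentiableAt (by simp)).hasFDerivAt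
    rw [← fderiv_comp_disc hu hz hA]
    exact DFunLike.congr_fun h2.fderiv x
  have key := curl_connForm_sub (k := fun s => ρ ^ 2 / s ^ 2) (e := e) uniqueDiffOn_disc hn (contDiffWithinAt_hat hu hz' hj) h0
    (contDiffAt_const.div (contDiffAt_id.pow 2) (by simpa using hn0)) hk'
    (hF.local_smooth z hz' j hj hδ) (hF.local_ne_zero z hz' j hj hδ)
  rw [show nearForm B ρ e u C j = fun z => _ from rfl]
  refine key.trans ?_
  rw [areaDensity, form_near hB h hρ hr hj hδ, areaDensity_proj_ball hB hu hz' hpt,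
    modelForm_apply, mfd_ballCoord_affine B hj, mfd_ballCoord_affine B hj, fubiniStudy_apply h0,
    hder, hder]
  field_simp
  ring

/-- The piecewise definition is smooth because on each of three overlapping regions it agrees
locally with one formula whose curl is known. -/
lemma primitive_local (hB : B.IsSymplectic Ω) (h : IsProfile ρ r δ β) (hρ : 0 < ρ)
    (hr : r ≤ B.radius) (hF : IsDivisorFunction B δ m u F C) {e : ℝ} (he : e * m = ρ ^ 2 / 2)
    (hu : ContMDiffOn 𝓘(ℝ, ℂ) 𝓘(ℝ, Cn n) ∞ u (Metric.closedBall 0 1)) {z : ℂ}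
    (hz : z ∈ Metric.closedBall (0 : ℂ) 1) :
    ∃ T : ℂ → ℂ →L[ℝ] ℝ, primitive B ρ e r β u F C =ᶠ[𝓝[Metric.closedBall 0 1] z] T ∧
      ContDiffWithinAt ℝ ∞ T (Metric.closedBall 0 1) z ∧
      (z ∈ Metric.ball (0 : ℂ) 1 → curl T z = areaDensity (form B Ω ρ r β) u z -
        areaDensity Ω (fun z => proj B (u z)) z) := by
  have hδ := h.pos
  have hδr := h.delta_lt hρ
  have huc : ContinuousWithinAt u (Metric.closedBall 0 1) z := (hu z hz).continuousWithinAt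
  have hvc : ContinuousWithinAt (fun z => proj B (u z)) (Metric.closedBall 0 1) z :=
    (contMDiff_proj B).continuous.continuousAt.comp_continuousWithinAt huc
  by_cases hout : proj B (u z) ∈ B.ι '' Metric.closedBall 0 (r - δ)
  swap
  -- Beyond the radius `r - δ`: the coefficient `(β/s)² - 1` vanishes, both area forms agree, and
  -- only the closed form `d arg F` is left.
  · have hc := proj_ne_center_of_outer (by linarith) hout
    have hA := contDiffWithinAt_argForm uniqueDiffOn_disc hz (hF.smooth z hz hc) (hF.ne_zero z hz hc)
    refine ⟨fun z => 0 - e • argForm F (Metric.closedBall 0 1) z, ?_,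
      contDiffWithinAt_const.sub (hA.const_smul e), ?_⟩
    · filter_upwards [hvc.eventually_mem ((isClosed_closedBall_image
        (show r - δ < B.radius by linarith)).isOpen_compl.mem_nhds hout)] with y hy
      rw [primitive, dif_neg (proj_ne_center_of_outer (by linarith) hy)]
      congr 1
      split_ifs with hb
      · have h1 := (mem_ball_image_iff hr).1 hb
        have h2 : r - δ < ‖ballCoord B (u y)‖ := by
          by_contra! h3
          exact hy ((mem_closedBall_image_iff (by linarith)).2 ⟨h1.1, h3⟩)
        rw [connForm, h.outer _ ⟨h2.le, h1.2.le⟩, div_self (by linarith)]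
        simp
      · rfl
    · intro hzb
      have hn := Metric.closedBall_mem_nhds_of_mem hzb
      rw [curl_sub_smul e (differentiableAt_const _) ((hA.contDiffAt hn).differentiableAt (by simp)),
        curl_argForm uniqueDiffOn_disc hn (hF.smooth z hz hc) (hF.ne_zero z hz hc), areaDensity,
        form_outer h hρ hr hout, areaDensity_proj hu hz]
      simp [curl]
  · obtain ⟨hpt, hle⟩ := (mem_closedBall_image_iff (by linarith)).1 hout
    have hle : ‖ballCoord B (u z)‖ ≤ r - δ := hle
    by_cases hnear : ‖ballCoord B (u z)‖ < δ
    -- Inside the radius `δ`, with points of `E` allowed.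
    · obtain ⟨j, hj⟩ := exists_mem_affineChart_source B hpt
      refine ⟨nearForm B ρ e u C j, ?_, ?_, fun hzb => curl_nearForm hB h hρ hr hF hu hzb hj hnear⟩
      · filter_upwards [eventually_near hu hz hj hnear] with y hy
        exact primitive_near hu hy.1 hF he h hρ hr hy.2.1 hy.2.2
      · have h1 := contDiffWithinAt_nearForm (ρ := ρ) hu hz hF hj hnear
        exact h1.1.sub (h1.2.const_smul e)
    -- Between the radii `δ` and `r - δ` the ball coordinate does not vanish, and the radial formula
    -- applies directly.
    · push Not at hnear
      have hn0 : 0 < ‖ballCoord B (u z)‖ := by linarith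
      have hlt : ‖ballCoord B (u z)‖ < r := by linarith
      have hp0 : ballCoord B (u z) ≠ 0 := norm_pos_iff.1 hn0
      have hc : proj B (u z) ≠ B.center := fun hc => hp0 ((ballCoord_eq_zero_iff B hpt).2 hc)
      have hg : ContDiffWithinAt ℝ ∞ (fun z => ballCoord B (u z)) (Metric.closedBall 0 1) z :=
        contDiffWithinAt_comp_disc hu hz (contMDiffAt_ballCoord B hpt)
      have hk : ContDiffAt ℝ ∞ (fun s => (β s / s) ^ 2 - 1) ‖ballCoord B (u z)‖ :=
        (((h.contDiffAt hn0 hlt).div contDiffAt_id hn0.ne').pow 2).sub contDiffAt_const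
      have hk' : HasDerivAt (fun s => (β s / s) ^ 2 - 1)
          (2 * (β ‖ballCoord B (u z)‖ / ‖ballCoord B (u z)‖) *
            ((deriv β ‖ballCoord B (u z)‖ * ‖ballCoord B (u z)‖ - β ‖ballCoord B (u z)‖) /
              ‖ballCoord B (u z)‖ ^ 2)) ‖ballCoord B (u z)‖ := by
        refine (((h.hasDerivAt_div hn0 hlt).pow 2).sub_const 1).congr_deriv ?_
        norm_num
      have hbr := (mem_ball_image_iff hr).2 ⟨hpt, hlt⟩
      refine ⟨fun z => connForm (fun s => (β s / s) ^ 2 - 1) (fun z => ballCoord B (u z))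
        (Metric.closedBall 0 1) z - e • argForm F (Metric.closedBall 0 1) z, ?_,
        (contDiffWithinAt_connForm uniqueDiffOn_disc hz hg hp0 hk).sub
          ((contDiffWithinAt_argForm uniqueDiffOn_disc hz (hF.smooth z hz hc)
            (hF.ne_zero z hz hc)).const_smul e), ?_⟩
      · filter_upwards [hvc.eventually_mem ((isOpen_ball_image hr).mem_nhds hbr),
          hvc.eventually_mem (isOpen_compl_singleton.mem_nhds hc)] with y hy1 hy2
        rw [primitive, dif_neg (show proj B (u y) ≠ B.center from hy2), if_pos hy1]
      · intro hzb
        have hn := Metric.closedBall_mem_nhds_of_mem hzb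
        rw [curl_connForm_sub uniqueDiffOn_disc hn hg hp0 hk hk' (hF.smooth z hz hc)
          (hF.ne_zero z hz hc), fderiv_comp_disc hu hzb (contMDiffAt_ballCoord B hpt),
          fderiv_comp_disc hu hzb (contMDiffAt_ballCoord B hpt), areaDensity,
          form_inner hB h hr hbr hc, areaDensity_proj_ball hB hu hz hpt, radialForm]
        field_simp
        ring

lemma hasDerivAt_circle {G : ℂ → ℂ} (θ : ℝ)
    (hG : DifferentiableWithinAt ℝ G (Metric.closedBall 0 1) (Complex.exp (θ * Complex.I))) :
    HasDerivAt (fun θ : ℝ => G (Complex.exp (θ * Complex.I)))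
      (fderivWithin ℝ G (Metric.closedBall 0 1) (Complex.exp (θ * Complex.I))
        (Complex.I * Complex.exp (θ * Complex.I))) θ := by
  have h1 : HasDerivAt (fun θ : ℝ => Complex.exp (θ * Complex.I))
      (Complex.I * Complex.exp (θ * Complex.I)) θ := by
    have h2 := ((Complex.ofRealCLM.hasDerivAt (x := θ)).mul_const Complex.I).cexp
    refine h2.congr_deriv ?_
    simp [mul_comm]
  exact hG.hasFDerivWithinAt.comp_hasDerivAt θ h1 (Eventually.of_forall exp_mem_closedBall)

/-- The change of the symplectic area under the blow-down map. -/
theorem symplecticArea_form (hΩ : IsSymplecticForm Ω) (hB : B.IsSymplectic Ω)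
    (h : IsProfile ρ r δ β) (hρ : 0 < ρ)
    (hr : r ≤ B.radius) (hF : IsDivisorFunction B δ m u F C) {e : ℝ} (he : e * m = ρ ^ 2 / 2)
    (hu : ContMDiffOn 𝓘(ℝ, ℂ) 𝓘(ℝ, Cn n) ∞ u (Metric.closedBall 0 1))
    (hub : ∀ z ∈ Metric.sphere (0 : ℂ) 1, proj B (u z) ∉ B.ι '' Metric.ball 0 r)
    {a : ℝ} (ha : HasArgVar (fun θ => F (Complex.exp (θ * Complex.I))) a) :
    symplecticArea (form B Ω ρ r β) u = symplecticArea Ω (fun z => proj B (u z)) - e * a := by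
  have hΩ' := isSymplecticForm_form hΩ hB h hρ hr
  have hv : ContMDiffOn 𝓘(ℝ, ℂ) 𝓘(ℝ, Cn n) ∞ (fun z => proj B (u z)) (Metric.closedBall 0 1) :=
    (contMDiff_proj B).comp_contMDiffOn hu
  have hc1 := continuousOn_areaDensity hΩ' hu
  have hc2 := continuousOn_areaDensity hΩ hv
  have hint : ∀ {G : ℂ → ℝ}, ContinuousOn G (Metric.closedBall 0 1) →
      IntegrableOn G (Metric.closedBall 0 1) :=
    fun hG => hG.integrableOn_compact (isCompact_closedBall _ _)
  have hcenter : ∀ z ∈ Metric.sphere (0 : ℂ) 1, proj B (u z) ≠ B.center := by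
    intro z hz hcz
    exact hub z hz ⟨0, by simpa using hρ.trans h.lt, hcz.symm⟩
  have hgreen := green_disc (T := primitive B ρ e r β u F C)
    (G := fun z => areaDensity (form B Ω ρ r β) u z - areaDensity Ω (fun z => proj B (u z)) z)
    (fun z hz => by
      obtain ⟨T, hT, hTs, -⟩ := primitive_local hB h hρ hr hF he hu hz
      exact hTs.continuousWithinAt.congr_of_eventuallyEq hT (hT.self_of_nhdsWithin hz))
    (hc1.sub hc2)
    (fun z hz => by
      have hn := Metric.closedBall_mem_nhds_of_mem hz
      obtain ⟨T, hT, hTs, -⟩ := primitive_local hB h hρ hr hF he hu (Metric.ball_subset_closedBall hz)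
      rw [nhdsWithin_eq_nhds.2 hn] at hT
      exact ((hTs.contDiffAt hn).differentiableAt (by simp)).congr_of_eventuallyEq hT)
    (fun z hz => by
      have hn := Metric.closedBall_mem_nhds_of_mem hz
      obtain ⟨T, hT, -, hTc⟩ := primitive_local hB h hρ hr hF he hu (Metric.ball_subset_closedBall hz)
      rw [nhdsWithin_eq_nhds.2 hn] at hT
      rw [curl_congr hT, hTc hz])
  rw [integral_sub (hint hc1) (hint hc2)] at hgreen
  rw [symplecticArea_eq, symplecticArea_eq, sub_eq_add_neg, ← sub_eq_iff_eq_add', hgreen]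
  have hF0 : ∀ θ : ℝ, F (Complex.exp (θ * Complex.I)) ≠ 0 := fun θ =>
    hF.ne_zero _ (exp_mem_closedBall θ) (hcenter _ (exp_mem_sphere θ))
  have hFs : ∀ θ : ℝ, ContDiffWithinAt ℝ ∞ F (Metric.closedBall 0 1)
      (Complex.exp (θ * Complex.I)) := fun θ =>
    hF.smooth _ (exp_mem_closedBall θ) (hcenter _ (exp_mem_sphere θ))
  have hF' : Continuous fun θ : ℝ =>
      fderivWithin ℝ F (Metric.closedBall 0 1) (Complex.exp (θ * Complex.I))
        (Complex.I * Complex.exp (θ * Complex.I)) := by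
    have hcirc : Continuous fun θ : ℝ => Complex.exp (θ * Complex.I) := by fun_prop
    refine continuous_iff_continuousAt.2 fun θ => ContinuousAt.clm_apply ?_ (by fun_prop)
    have h1 := (contDiffWithinAt_fderivWithin uniqueDiffOn_disc (exp_mem_closedBall θ)
      (hFs θ)).continuousWithinAt
    exact h1.tendsto.comp (tendsto_nhdsWithin_iff.2
      ⟨hcirc.continuousAt, Eventually.of_forall exp_mem_closedBall⟩)
  have h1 := (HasArgVar.of_hasDerivAt (fun θ => hasDerivAt_circle θ
    ((hFs θ).differentiableWithinAt (by simp))) hF' hF0).unique hF0 ha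
  rw [← h1, ← neg_mul, ← intervalIntegral.integral_const_mul]
  refine intervalIntegral.integral_congr fun θ _ => ?_
  have hs := exp_mem_sphere θ
  -- The boundary lies outside the ball, where the connection term is absent; what is integrated is
  -- `-e d arg F`.
  simp only [primitive, dif_neg (hcenter _ hs), if_neg (hub _ hs)]
  rw [sub_apply, smul_apply, argForm_apply, zero_apply, smul_eq_mul, div_eq_inv_mul]
  ring

end BlowUp

/-! ### Smoothing of continuous gauge functions -/

/-- Continuous nonvanishing local functions with smooth quotients become smooth after
multiplication with one and the same function, whose real part is positive. -/
theorem exists_smoothing_factor {D : Set ℂ} (hD : IsCompact D) {ι : Type*} [Nonempty ι]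
    {U : ι → Set ℂ}
    {c : ι → ℂ → ℂ} (hU : ∀ i, ∀ z ∈ D ∩ U i, U i ∈ 𝓝[D] z) (hcov : ∀ z ∈ D, ∃ i, z ∈ U i)
    (hc : ∀ i, ∀ z ∈ D ∩ U i, ContinuousWithinAt (c i) D z) (h0 : ∀ i, ∀ z ∈ D ∩ U i, c i z ≠ 0)
    (hs : ∀ i j, ∀ z ∈ D, z ∈ U i → z ∈ U j → ContDiffWithinAt ℝ ∞ (fun z => c j z / c i z) D z) :
    ∃ κ : ℂ → ℂ, (∀ z ∈ D, 0 < (κ z).re) ∧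
      ∀ j, ∀ z ∈ D ∩ U j, ContDiffWithinAt ℝ ∞ (fun z => κ z * c j z) D z := by
  choose! i hi using hcov
  -- Near `z` the normalised quotient `c(z)/c(y)` is close to its value `1` at `y = z`.
  have hN : ∀ z ∈ D, ∃ N : Set ℂ, IsOpen N ∧ z ∈ N ∧
      ∀ y ∈ D ∩ N, y ∈ U (i z) ∧ 0 < (c (i z) z / c (i z) y).re := by
    intro z hz
    have hzU : z ∈ D ∩ U (i z) := ⟨hz, hi z hz⟩
    have h1 : ContinuousWithinAt (fun y => (c (i z) z / c (i z) y).re) D z :=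
      Complex.continuous_re.continuousAt.comp_continuousWithinAt
        (continuousWithinAt_const.div (hc _ _ hzU) (h0 _ _ hzU))
    have h2 : (0 : ℝ) < (c (i z) z / c (i z) z).re := by
      rw [div_self (h0 _ _ hzU)]; simp
    have h3 := inter_mem (hU _ _ hzU) (h1.eventually (lt_mem_nhds h2))
    obtain ⟨N, hN, hzN, hsub⟩ := mem_nhdsWithin.1 h3
    exact ⟨N, hN, hzN, fun y hy => hsub ⟨hy.2, hy.1⟩⟩
  choose! N hNo hzN hN using hN
  obtain ⟨t, htD, ht⟩ := hD.elim_nhds_subcover N fun z hz => (hNo z hz).mem_nhds (hzN z hz)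
  obtain ⟨ψ, hψ⟩ := SmoothPartitionOfUnity.exists_isSubordinate 𝓘(ℝ, ℂ) hD.isClosed
    (fun z : t => N z) (fun z => hNo z (htD z z.2)) (by simpa [iUnion_subtype] using ht)
  -- A partition of unity averages the normalised reciprocals. Positivity of the real part survives
  -- averaging, and each summand times `c j` is a constant times a cutoff times a quotient `c j / c
  -- i`, which is smooth by hypothesis.
  refine ⟨fun y => ∑ z : t, ψ z y • (c (i z) z / c (i z) y), fun y hy => ?_, fun j y hy => ?_⟩
  · have hsum : ∑ z : t, ψ z y = 1 := by
      rw [← finsum_eq_sum_of_fintype]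
      exact ψ.sum_eq_one hy
    have hterm : ∀ z : t, 0 < ψ z y → 0 < (c (i z) z / c (i z) y).re := fun z hz =>
      (hN z (htD z z.2) y ⟨hy, hψ z (subset_tsupport _ hz.ne')⟩).2
    rw [Complex.re_sum]
    simp only [Complex.smul_re, smul_eq_mul]
    have hnn : ∀ z ∈ Finset.univ, 0 ≤ ψ z y * (c (i z) z / c (i z) y).re := fun z _ => by
      rcases (ψ.nonneg z y).eq_or_lt with h | h
      · rw [← h, zero_mul]
      · exact mul_nonneg h.le (hterm z h).le
    refine (Finset.sum_nonneg hnn).lt_of_ne fun h => ?_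
    have h1 := (Finset.sum_eq_zero_iff_of_nonneg hnn).1 h.symm
    have h2 : ∀ z, ψ z y = 0 := fun z => by
      by_contra h3
      have h4 := (ψ.nonneg z y).lt_of_ne' h3
      exact (mul_pos h4 (hterm z h4)).ne' (h1 z (Finset.mem_univ _))
    simp [h2] at hsum
  · simp only [Finset.sum_mul]
    refine ContDiffWithinAt.sum fun z _ => ?_
    by_cases hyz : y ∈ tsupport (ψ z)
    · have h1 := hN z (htD z z.2)
      have h2 : ContDiffWithinAt ℝ ∞ (ψ z) D y := (ψ z).contMDiff.contDiff.contDiffWithinAt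
      refine (h2.smul ((hs (i z) j y hy.1 (h1 y ⟨hy.1, hψ z hyz⟩).1 hy.2).const_smul
        (c (i z) z))).congr (fun x _ => ?_) ?_ <;>
      · simp only [Pi.smul_apply', Complex.real_smul, smul_eq_mul]
        ring
    · have h1 : (fun x => ψ z x • (c (i z) z / c (i z) x) * c j x) =ᶠ[𝓝 y] fun _ => 0 := by
        filter_upwards [(isClosed_tsupport (ψ z)).isOpen_compl.mem_nhds hyz] with x hx
        rw [image_eq_zero_of_notMem_tsupport hx, zero_smul, zero_mul]
      exact (contDiffAt_const.congr_of_eventuallyEq h1).contDiffWithinAt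

/-! ### Determinants in the affine charts of the blow-up -/

section Determinants

variable {n : ℕ}

/-- In the standard basis the matrix is `w j` times the identity with the column `j` replaced by
`hat j w`. By Cramer's rule its determinant is `w j ^ (n - 1)` times the entry `1`. This exponent is
the source of the weight in the theorem. -/
lemma det_blowDownDeriv (j : Fin n) (w : Cn n) : (blowDownDeriv j w).det = w j ^ (n - 1) := by
  have h1 : LinearMap.toMatrix (EuclideanSpace.basisFun (Fin n) ℂ).toBasis
      (EuclideanSpace.basisFun (Fin n) ℂ).toBasis (blowDownDeriv j w : Cn n →ₗ[ℂ] Cn n) =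
      Matrix.updateCol (w j • (1 : Matrix (Fin n) (Fin n) ℂ)) j (hat j w) := by
    ext i k
    rw [LinearMap.toMatrix_apply]
    simp only [OrthonormalBasis.coe_toBasis, EuclideanSpace.basisFun_apply,
      ContinuousLinearMap.coe_coe, OrthonormalBasis.coe_toBasis_repr_apply,
      EuclideanSpace.basisFun_repr, blowDownDeriv_apply, PiLp.add_apply, PiLp.smul_apply,
      hatDeriv_apply, smul_eq_mul, Matrix.updateCol_apply, Matrix.smul_apply, Matrix.one_apply]
    by_cases hk : k = j
    · subst hk
      by_cases hi : i = k <;> simp [hi]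
    · by_cases hi : i = j
      · subst hi
        simp [hk, Ne.symm hk]
      · simp [hk, hi, Ne.symm hk]
  rw [ContinuousLinearMap.det, ← LinearMap.det_toMatrix (EuclideanSpace.basisFun (Fin n) ℂ).toBasis,
    h1, ← Matrix.cramer_apply, Matrix.cramer_smul, Matrix.cramer_one]
  simp [hat_same]

lemma hat_add_single (i : Fin n) (w : Cn n) (c : ℂ) :
    hat i (w + EuclideanSpace.single i c) = hat i w := by
  ext k
  by_cases hk : k = i <;> simp [hat, hk]

lemma contDiffAt_affineCoord_hat {i j : Fin n} {w : Cn n} (hw : hat i w j ≠ 0) :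
    ContDiffAt ℝ ∞ (fun w => affineCoord j (w i) (hat i w)) w := by
  have ho : IsOpen {w : Cn n | hat i w j ≠ 0} :=
    isOpen_ne_fun ((contDiff_piLp_apply (𝕜 := ℝ) (n := ∞) (p := 2) (i := j)).continuous.comp
      (contDiff_hat i).continuous) continuous_const
  exact (contDiffOn_affineCoord j (s := fun w : Cn n => w i) (v := hat i)
    (contDiff_piLp_apply 2).contDiffOn (contDiff_hat i).contDiffOn fun x hx => hx).contDiffAt
    (ho.mem_nhds hw)

/-- The transition map intertwines the two blow-down maps. Taking determinants of the derivatives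
gives the formula multiplied by `w i ^ (n - 1)`, which can be cancelled off `E`. -/
lemma cdet_transition_of_ne {i j : Fin n} {w : Cn n} (hw : hat i w j ≠ 0) (hi : w i ≠ 0)
    (Y : Cn n →L[ℝ] Cn n) :
    hat i w j ^ (n - 1) *
      cdet ((fderiv ℝ (fun w => affineCoord j (w i) (hat i w)) w).comp Y) = cdet Y := by
  set T : Cn n → Cn n := fun w => affineCoord j (w i) (hat i w) with hT
  have h1 := (contDiffAt_affineCoord_hat hw).continuousAt
  have hT' := ((contDiffAt_affineCoord_hat hw).differentiableAt (by simp)).hasFDerivAt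
  have ho : ∀ᶠ y in 𝓝 w, hat i y j ≠ 0 :=
    ((contDiff_piLp_apply (𝕜 := ℝ) (n := ∞) (p := 2) (i := j)).continuous.comp
      (contDiff_hat i).continuous).continuousAt.eventually_ne hw
  have h2 : (fun y => affineBlowDown j (T y)) =ᶠ[𝓝 w] affineBlowDown i := by
    filter_upwards [ho] with y hy
    rw [hT, affineBlowDown_affineCoord j _ hy, affineBlowDown]
  have h3 := ((hasFDerivAt_affineBlowDown j (T w)).comp w hT').unique
    ((hasFDerivAt_affineBlowDown i w).congr_of_eventuallyEq h2)
  have h4 := congrArg (fun A => cdet (A.comp Y)) h3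
  simp only [ContinuousLinearMap.comp_assoc, cdet_restrictScalars_comp, det_blowDownDeriv] at h4
  rw [hT, affineCoord_same, mul_pow, mul_assoc] at h4
  exact mul_left_cancel₀ (pow_ne_zero _ hi) h4

/-- The Jacobian of the transition maps between the affine charts. -/
lemma cdet_transition {i j : Fin n} {w : Cn n} (hw : hat i w j ≠ 0) (Y : Cn n →L[ℝ] Cn n) :
    hat i w j ^ (n - 1) *
      cdet ((fderiv ℝ (fun w => affineCoord j (w i) (hat i w)) w).comp Y) = cdet Y := by
  by_cases hi : w i = 0
  swap
  · exact cdet_transition_of_ne hw hi Y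
  -- On `E` the formula follows by continuity along a path leaving `E` in the direction of the
  -- coordinate `i`, on which `hat i` does not depend.
  set p : ℝ → Cn n := fun t => w + EuclideanSpace.single i (t : ℂ) with hp
  have hp0 : p 0 = w := by simp [hp]
  have hpc : Continuous p := by
    have : p = fun t : ℝ => w + t • EuclideanSpace.single i (1 : ℂ) := by
      funext t
      ext k
      by_cases hk : k = i <;> simp [hp, hk]
    rw [this]
    fun_prop
  have hhat : ∀ t, hat i (p t) = hat i w := fun t => hat_add_single i w _
  have hfd : ContinuousAt (fderiv ℝ (fun w : Cn n => affineCoord j (w i) (hat i w))) w :=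
    ((contDiffAt_affineCoord_hat hw).fderiv_right (m := 0) (by simp)).continuousAt
  have h1 : ContinuousAt (fun t => hat i (p t) j ^ (n - 1) *
      cdet ((fderiv ℝ (fun w => affineCoord j (w i) (hat i w)) (p t)).comp Y)) 0 := by
    simp only [hhat]
    refine continuousAt_const.mul (continuous_cdet.continuousAt.comp ?_)
    refine ContinuousAt.clm_comp ?_ continuousAt_const
    exact ContinuousAt.comp (by rw [hp0]; exact hfd) hpc.continuousAt
  have h2 : Tendsto (fun t => hat i (p t) j ^ (n - 1) *
      cdet ((fderiv ℝ (fun w => affineCoord j (w i) (hat i w)) (p t)).comp Y)) (𝓝[≠] 0)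
      (𝓝 (cdet Y)) := by
    refine tendsto_const_nhds.congr' ?_
    filter_upwards [self_mem_nhdsWithin] with t ht
    have ht : t ≠ 0 := ht
    refine (cdet_transition_of_ne (by rw [hhat]; exact hw) ?_ Y).symm
    simp [hp, hi, ht]
  have h3 := tendsto_nhds_unique (h1.tendsto.mono_left nhdsWithin_le_nhds) h2
  rwa [hp0] at h3

end Determinants

/-! ### The Jacobian of the blow-down map in symplectic frames -/

section LinearAlgebra

variable {n : ℕ}

/-- Linear times linear and antilinear times antilinear are the two complex-linear contributions;
`s` scales the second. -/
lemma linPart_comp_partialAnti (P X : Cn n →L[ℝ] Cn n) (s : ℝ) (v : Cn n) :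
    linPart (P.comp (partialAnti X s)) v =
      linPart P (linPart X v) + s • antiPart P (antiPart X v) := by
  simp only [linPart_apply P, antiPart_apply P]
  rw [linPart_apply]
  simp only [ContinuousLinearMap.comp_apply, partialAnti_apply, antiPart_I_smul, map_smul, map_add,
    smul_neg, map_neg, smul_add, smul_sub]
  rw [smul_comm Complex.I s (P (Complex.I • antiPart X v)), smul_comm (2⁻¹ : ℝ) s (P (antiPart X v)),
    smul_comm (2⁻¹ : ℝ) s (Complex.I • P (Complex.I • antiPart X v))]
  abel

lemma cdet_comp_partialAnti_zero (P X : Cn n →L[ℝ] Cn n) :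
    cdet (P.comp (partialAnti X 0)) = cdet P * cdet X := by
  have h : linPart (P.comp (partialAnti X 0)) = (linPart P).comp (linPart X) := by
    refine ContinuousLinearMap.ext fun v => ?_
    rw [linPart_comp_partialAnti, zero_smul, add_zero]
    rfl
  rw [cdet, h, cdet, cdet]
  exact LinearMap.det_comp _ _

/-- For `v` in the kernel, the contraction property applies to the vectors `linPart X v` and
`antiPart X v`, since the second is no longer than the first. It gives `linPart X v = 0`, hence `v =
0`. -/
lemma IsSympl.cdet_comp_partialAnti_ne_zero {P X : Cn n →L[ℝ] Cn n} (hP : IsSympl P)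
    (hX : IsSympl X) {s : ℝ} (hs0 : 0 ≤ s) (hs : s ≤ 1) :
    cdet (P.comp (partialAnti X s)) ≠ 0 := by
  refine _root_.cdet_ne_zero fun v hv => ?_
  rw [linPart_comp_partialAnti] at hv
  have h1 := hX.norm_linPart_sq v
  have h2 : ‖antiPart X v‖ ≤ ‖linPart X v‖ := by
    refine le_of_sq_le_sq ?_ (norm_nonneg _)
    nlinarith [sq_nonneg ‖v‖]
  have h3 := hP.eq_zero_of_linPart_eq hs0 hs h2 (eq_neg_of_add_eq_zero_left hv)
  rw [h3, norm_zero] at h1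
  have h4 : ‖v‖ ^ 2 = 0 := by nlinarith [sq_nonneg ‖v‖, sq_nonneg ‖antiPart X v‖]
  exact norm_eq_zero.1 (pow_eq_zero_iff two_ne_zero |>.1 h4)

lemma IsSympl.isInvertible {A : Cn n →L[ℝ] Cn n} (hA : IsSympl A) : A.IsInvertible := by
  refine ⟨(LinearEquiv.ofInjectiveEndo (A : Cn n →ₗ[ℝ] Cn n) hA.injective).toContinuousLinearEquiv,
    ?_⟩
  ext v : 1
  rfl

lemma IsSympl.inverse {A : Cn n →L[ℝ] Cn n} (hA : IsSympl A) : IsSympl A.inverse := by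
  obtain ⟨e, rfl⟩ := hA.isInvertible
  rw [ContinuousLinearMap.inverse_equiv]
  exact hA.symm

lemma continuousWithinAt_clm_of_apply {X : Type*} [TopologicalSpace X] {f : X → Cn n →L[ℝ] Cn n}
    {S : Set X} {x : X} (h : ∀ a, ContinuousWithinAt (fun x => f x a) S x) :
    ContinuousWithinAt f S x :=
  continuousWithinAt_clm_apply.2 h

lemma IsFrameOn.symm_apply_continuousWithinAt {M : Type*} [TopologicalSpace M]
    [ChartedSpace (Cn n) M] [IsManifold 𝓘(ℝ, Cn n) ∞ M] {X : Type*} [TopologicalSpace X]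
    {w : X → M} {Φ : ∀ x, Cn n ≃L[ℝ] TangentSpace 𝓘(ℝ, Cn n) (w x)} {S : Set X}
    (h : IsFrameOn w Φ S) (hw : ContinuousOn w S) {V : ∀ x, TangentSpace 𝓘(ℝ, Cn n) (w x)} {x₀ : X}
    (hx₀ : x₀ ∈ S)
    (hV : ContinuousWithinAt (fun x => (⟨w x, V x⟩ : TangentBundle 𝓘(ℝ, Cn n) M)) S x₀) :
    ContinuousWithinAt (fun x => (Φ x).symm (V x)) S x₀ := by
  have hp := mem_chart_source (Cn n) (w x₀)
  have h1 := h.coord hw hx₀ hp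
  have h2 := (continuousWithinAt_tcoord_iff (hw x₀ hx₀) hp).1 hV
  have hinv : ∀ x, w x ∈ (chartAt (Cn n) (w x₀)).source →
      ((tcoord n (w x₀) (w x)).comp (Φ x : Cn n →L[ℝ] _)).IsInvertible ∧ (Φ x).symm (V x) =
        ((tcoord n (w x₀) (w x)).comp (Φ x : Cn n →L[ℝ] _)).inverse
          (tcoord n (w x₀) (w x) (V x)) := by
    intro x hx
    obtain ⟨e, he⟩ := isInvertible_tcoord (n := n) hx
    have h3 : (tcoord n (w x₀) (w x)).comp (Φ x : Cn n →L[ℝ] _) =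
        (((Φ x).trans e : Cn n ≃L[ℝ] Cn n) : Cn n →L[ℝ] Cn n) := by
      rw [← he]; rfl
    refine ⟨⟨_, h3.symm⟩, ?_⟩
    rw [h3, ContinuousLinearMap.inverse_equiv, ← he]
    exact congrArg (Φ x).symm (e.symm_apply_apply (V x)).symm
  refine ((continuousWithinAt_inverse h1 (hinv _ hp).1).clm_apply h2).congr_of_eventuallyEq ?_
    (hinv _ hp).2
  filter_upwards [(hw x₀ hx₀).eventually_mem ((chartAt (Cn n) (w x₀)).open_source.mem_nhds hp)]
    with x hx using (hinv x hx).2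

end LinearAlgebra

/-! ### The derivative of the blow-down map read in symplectic frames. -/

namespace BlowUp

variable {n : ℕ} {M : Type*} [TopologicalSpace M] [ChartedSpace (Cn n) M] {B : SmoothBall n M}
  [NeZero n] [T2Space M] [IsManifold 𝓘(ℝ, Cn n) ∞ M] {Ω : TwoForm n M} {ρ r δ : ℝ} {β : ℝ → ℝ}
  {u : ℂ → BlowUp B}

/-- A disc in the blow-up, with symplectic frames along it and along its image. -/
structure IsFramedDisc (B : SmoothBall n M) (Ω : TwoForm n M) (ρ r δ : ℝ) (β : ℝ → ℝ)
    (u : ℂ → BlowUp B) (Φ : ∀ z, Cn n ≃L[ℝ] TangentSpace 𝓘(ℝ, Cn n) (proj B (u z)))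
    (Ψ : ∀ z, Cn n ≃L[ℝ] TangentSpace 𝓘(ℝ, Cn n) (u z)) : Prop where
  symplectic : B.IsSymplectic Ω
  profile : IsProfile ρ r δ β
  pos : 0 < ρ
  le_radius : r ≤ B.radius
  smooth : ContMDiffOn 𝓘(ℝ, ℂ) 𝓘(ℝ, Cn n) ∞ u (Metric.closedBall 0 1)
  frame : IsSymplecticFrameOn Ω (fun z => proj B (u z)) Φ (Metric.closedBall 0 1)
  frame' : IsSymplecticFrameOn (form B Ω ρ r β) u Ψ (Metric.closedBall 0 1)

variable {Φ : ∀ z, Cn n ≃L[ℝ] TangentSpace 𝓘(ℝ, Cn n) (proj B (u z))}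
    {Ψ : ∀ z, Cn n ≃L[ℝ] TangentSpace 𝓘(ℝ, Cn n) (u z)}

/-- The derivative of the blow-down map in the frames. -/
def frameJac (Φ : ∀ z, Cn n ≃L[ℝ] TangentSpace 𝓘(ℝ, Cn n) (proj B (u z)))
    (Ψ : ∀ z, Cn n ≃L[ℝ] TangentSpace 𝓘(ℝ, Cn n) (u z)) (z : ℂ) : Cn n →L[ℝ] Cn n :=
  ((Φ z).symm : _ →L[ℝ] Cn n).comp ((mfderiv 𝓘(ℝ, Cn n) 𝓘(ℝ, Cn n) (proj B) (u z)).comp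
    (Ψ z : Cn n →L[ℝ] _))

/-- The frame of the base in the coordinates of the ball. -/
def ballFrame (Φ : ∀ z, Cn n ≃L[ℝ] TangentSpace 𝓘(ℝ, Cn n) (proj B (u z))) (z : ℂ) :
    Cn n →L[ℝ] Cn n :=
  (mfd B.ι.symm (proj B (u z))).comp (Φ z : Cn n →L[ℝ] _)

/-- The image of the frame of the blow-up in the coordinates of the ball. -/
def ballJac (Ψ : ∀ z, Cn n ≃L[ℝ] TangentSpace 𝓘(ℝ, Cn n) (u z)) (z : ℂ) : Cn n →L[ℝ] Cn n :=
  (mfd (ballCoord B) (u z)).comp (Ψ z : Cn n →L[ℝ] _)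

/-- The frame of the blow-up in an affine chart. -/
def affineFrame (Ψ : ∀ z, Cn n ≃L[ℝ] TangentSpace 𝓘(ℝ, Cn n) (u z)) (j : Fin n) (z : ℂ) :
    Cn n →L[ℝ] Cn n :=
  (mfd (affineChart B j) (u z)).comp (Ψ z : Cn n →L[ℝ] _)

namespace IsFramedDisc

variable {z : ℂ}

lemma continuousWithinAt (hd : IsFramedDisc B Ω ρ r δ β u Φ Ψ)
    (hz : z ∈ Metric.closedBall (0 : ℂ) 1) : ContinuousWithinAt u (Metric.closedBall 0 1) z :=
  (hd.smooth z hz).continuousWithinAt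

lemma continuousWithinAt_proj (hd : IsFramedDisc B Ω ρ r δ β u Φ Ψ)
    (hz : z ∈ Metric.closedBall (0 : ℂ) 1) :
    ContinuousWithinAt (fun z => proj B (u z)) (Metric.closedBall 0 1) z :=
  (contMDiff_proj B).continuous.continuousAt.comp_continuousWithinAt (hd.continuousWithinAt hz)

lemma continuousWithinAt_frameJac (hd : IsFramedDisc B Ω ρ r δ β u Φ Ψ)
    (hz : z ∈ Metric.closedBall (0 : ℂ) 1) :
    ContinuousWithinAt (frameJac Φ Ψ) (Metric.closedBall 0 1) z :=
  continuousWithinAt_clm_of_apply fun a =>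
    hd.frame.isFrameOn.symm_apply_continuousWithinAt
      (fun _ hz => hd.continuousWithinAt_proj hz) hz
      (continuousWithinAt_tangent_map isOpen_univ (contMDiff_proj B).contMDiffOn
        (hd.frame'.isFrameOn a z hz) (hd.continuousWithinAt hz) (mem_univ _))

lemma continuousWithinAt_ballFrame (hd : IsFramedDisc B Ω ρ r δ β u Φ Ψ)
    (hz : z ∈ Metric.closedBall (0 : ℂ) 1) (hp : proj B (u z) ∈ B.ι.target) :
    ContinuousWithinAt (ballFrame Φ) (Metric.closedBall 0 1) z :=
  continuousWithinAt_clm_of_apply fun a =>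
    continuousWithinAt_mfd_apply B.ι.open_target B.smooth_symm (hd.frame.isFrameOn a z hz)
      (hd.continuousWithinAt_proj hz) hp

lemma continuousWithinAt_ballJac (hd : IsFramedDisc B Ω ρ r δ β u Φ Ψ)
    (hz : z ∈ Metric.closedBall (0 : ℂ) 1) (hp : proj B (u z) ∈ B.ι.target) :
    ContinuousWithinAt (ballJac Ψ) (Metric.closedBall 0 1) z :=
  continuousWithinAt_clm_of_apply fun a =>
    continuousWithinAt_mfd_apply (B.ι.open_target.preimage (contMDiff_proj B).continuous)
      (fun _ hp => (contMDiffAt_ballCoord B hp).contMDiffWithinAt) (hd.frame'.isFrameOn a z hz)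
      (hd.continuousWithinAt hz) hp

lemma continuousWithinAt_affineFrame (hd : IsFramedDisc B Ω ρ r δ β u Φ Ψ)
    (hz : z ∈ Metric.closedBall (0 : ℂ) 1) {j : Fin n} (hj : u z ∈ (affineChart B j).source) :
    ContinuousWithinAt (affineFrame Ψ j) (Metric.closedBall 0 1) z :=
  continuousWithinAt_clm_of_apply fun a =>
    continuousWithinAt_mfd_apply (affineHomeo B j).open_source
      (contMDiffOn_of_mem_maximalAtlas (affineHomeo_mem B j)) (hd.frame'.isFrameOn a z hz)
      (hd.continuousWithinAt hz) hj

lemma isSympl_ballFrame (hd : IsFramedDisc B Ω ρ r δ β u Φ Ψ)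
    (hz : z ∈ Metric.closedBall (0 : ℂ) 1) (hp : proj B (u z) ∈ B.ι.target) :
    IsSympl (ballFrame Φ z) := fun a b =>
  (form_ball hd.symplectic hp _ _).symm.trans (hd.frame.form_eq z hz a b)

lemma ballFrame_comp_frameJac (Φ : ∀ z, Cn n ≃L[ℝ] TangentSpace 𝓘(ℝ, Cn n) (proj B (u z)))
    (Ψ : ∀ z, Cn n ≃L[ℝ] TangentSpace 𝓘(ℝ, Cn n) (u z)) (hp : proj B (u z) ∈ B.ι.target) :
    (ballFrame Φ z).comp (frameJac Φ Ψ z) = ballJac Ψ z := by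
  refine ContinuousLinearMap.ext fun a => ?_
  refine Eq.trans ?_ (mfd_ballCoord B hp (Ψ z a)).symm
  exact congrArg (mfd B.ι.symm (proj B (u z))) ((Φ z).apply_symm_apply _)

lemma frameJac_eq (hd : IsFramedDisc B Ω ρ r δ β u Φ Ψ)
    (hz : z ∈ Metric.closedBall (0 : ℂ) 1) (hp : proj B (u z) ∈ B.ι.target) :
    frameJac Φ Ψ z = (ballFrame Φ z).inverse.comp (ballJac Ψ z) := by
  obtain ⟨e, he⟩ := (hd.isSympl_ballFrame hz hp).isInvertible
  rw [← ballFrame_comp_frameJac Φ Ψ hp, ← he, ContinuousLinearMap.inverse_equiv]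
  ext a : 1
  simp

lemma isSympl_frameJac (hd : IsFramedDisc B Ω ρ r δ β u Φ Ψ)
    (hz : z ∈ Metric.closedBall (0 : ℂ) 1)
    (hp : proj B (u z) ∉ B.ι '' Metric.closedBall 0 (r - δ)) : IsSympl (frameJac Φ Ψ z) := by
  intro a b
  rw [← hd.frame.form_eq z hz, ← hd.frame'.form_eq z hz,
    form_outer hd.profile hd.pos hd.le_radius hp]
  simp [frameJac]

/-- In ball coordinates the blow-up form is the pullback of the standard form by the radial map. It
tames `i`, and the frame pulls it back to the standard form. -/
lemma cdet_ballJac_ne_zero (hd : IsFramedDisc B Ω ρ r δ β u Φ Ψ)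
    (hz : z ∈ Metric.closedBall (0 : ℂ) 1) (hp : proj B (u z) ∈ B.ι '' Metric.ball 0 r)
    (hp' : proj B (u z) ≠ B.center) : cdet (ballJac Ψ z) ≠ 0 := by
  have h1 := (mem_ball_image_iff hd.le_radius).1 hp
  have h2 := ballCoord_ne_zero h1.1 hp'
  have h3 : ∀ a b, ((stdForm n).compContinuousLinearMap
      (fderiv ℝ (radialMap β) (ballCoord B (u z)))) ![a, b] =
      radialForm β (ballCoord B (u z)) a b := fun a b => by
    rw [form_comp_pair, stdForm_fderiv_radialMap hd.profile h2 h1.2]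
  refine cdet_ne_zero_of_tame (τ := (stdForm n).compContinuousLinearMap
      (fderiv ℝ (radialMap β) (ballCoord B (u z)))) (fun v => ?_) fun v => ?_
  · rw [h3, ← hd.frame'.form_eq z hz, form_inner hd.symplectic hd.profile hd.le_radius hp hp']
    rfl
  · rw [h3]
    by_cases hv : v = 0
    · rw [hv, ← h3, form_zero_left]
    · exact (radialForm_tame hd.profile h2 h1.2 hv).le

lemma cdet_affineFrame_ne_zero (hd : IsFramedDisc B Ω ρ r δ β u Φ Ψ)
    (hz : z ∈ Metric.closedBall (0 : ℂ) 1) {j : Fin n} (hj : u z ∈ (affineChart B j).source)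
    (hδ : ‖ballCoord B (u z)‖ < δ) : cdet (affineFrame Ψ j z) ≠ 0 := by
  refine cdet_ne_zero_of_tame (τ := modelForm ρ j (affineChart B j (u z))) (fun v => ?_)
    fun v => modelForm_tame _ _ _ _
  rw [← hd.frame'.form_eq z hz, form_near hd.symplectic hd.profile hd.pos hd.le_radius hj hδ]
  rfl

lemma cdet_ballJac_eq (Ψ : ∀ z, Cn n ≃L[ℝ] TangentSpace 𝓘(ℝ, Cn n) (u z)) {j : Fin n}
    (hj : u z ∈ (affineChart B j).source) :
    cdet (ballJac Ψ z) = affineChart B j (u z) j ^ (n - 1) * cdet (affineFrame Ψ j z) := by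
  rw [← det_blowDownDeriv, ← cdet_restrictScalars_comp]
  congr 1
  exact ContinuousLinearMap.ext fun a => mfd_ballCoord_affine B hj (Ψ z a)

lemma cdet_affineFrame_transition (Ψ : ∀ z, Cn n ≃L[ℝ] TangentSpace 𝓘(ℝ, Cn n) (u z))
    {i j : Fin n} (hi : u z ∈ (affineChart B i).source) (hj : u z ∈ (affineChart B j).source) :
    cdet (affineFrame Ψ i z) =
      hat i (affineChart B i (u z)) j ^ (n - 1) * cdet (affineFrame Ψ j z) := by
  have hw := (affineChart_transition hi).2.1 hj
  rw [← cdet_transition hw (affineFrame Ψ i z)]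
  congr 2
  have h1 : (affineChart B j : BlowUp B → Cn n) =ᶠ[𝓝 (u z)]
      (fun w => affineCoord j (w i) (hat i w)) ∘ affineChart B i := by
    filter_upwards [(affineHomeo B i).open_source.mem_nhds
      (show u z ∈ (affineHomeo B i).source from hi)] with p hp
    exact (affineChart_transition hp).1
  have hA : MDifferentiableAt 𝓘(ℝ, Cn n) 𝓘(ℝ, Cn n) (affineChart B i) (u z) :=
    (contMDiffAt_of_mem_maximalAtlas (affineHomeo_mem B i)
      (show u z ∈ (affineHomeo B i).source from hi)).mdifferentiableAt (by simp)
  have hT : MDifferentiableAt 𝓘(ℝ, Cn n) 𝓘(ℝ, Cn n)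
      (fun w : Cn n => affineCoord j (w i) (hat i w)) (affineChart B i (u z)) :=
    ((contDiffAt_affineCoord_hat hw).differentiableAt (by simp)).mdifferentiableAt
  have h2 := h1.mfderiv_eq (I := 𝓘(ℝ, Cn n)) (I' := 𝓘(ℝ, Cn n))
  rw [mfderiv_comp _ hT hA, mfderiv_eq_fderiv] at h2
  refine ContinuousLinearMap.ext fun a => ?_
  exact (DFunLike.congr_fun h2 (Ψ z a)).symm

end IsFramedDisc

end BlowUp

/-! ### The deformed complex determinant and the divisor function. -/

namespace BlowUp

variable {n : ℕ} {M : Type*} [TopologicalSpace M] [ChartedSpace (Cn n) M] {B : SmoothBall n M}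
  [NeZero n] [T2Space M] [IsManifold 𝓘(ℝ, Cn n) ∞ M] {Ω : TwoForm n M} {ρ r δ : ℝ} {β : ℝ → ℝ}
  {u : ℂ → BlowUp B} {Φ : ∀ z, Cn n ≃L[ℝ] TangentSpace 𝓘(ℝ, Cn n) (proj B (u z))}
  {Ψ : ∀ z, Cn n ≃L[ℝ] TangentSpace 𝓘(ℝ, Cn n) (u z)} {z : ℂ}

/-- A cutoff function with the value `0` on `t ≤ r - δ` and `1` on `t ≥ r - δ / 2`. -/
def cutoff (r δ t : ℝ) : ℝ := max 0 (min 1 ((t - (r - δ)) * (2 / δ)))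

lemma continuous_cutoff : Continuous (cutoff r δ) := by unfold cutoff; fun_prop

lemma cutoff_nonneg (t : ℝ) : 0 ≤ cutoff r δ t := le_max_left _ _

lemma cutoff_le_one (t : ℝ) : cutoff r δ t ≤ 1 := max_le zero_le_one (min_le_left _ _)

lemma cutoff_eq_zero (hδ : 0 < δ) {t : ℝ} (ht : t ≤ r - δ) : cutoff r δ t = 0 :=
  max_eq_left ((min_le_right _ _).trans
    (mul_nonpos_of_nonpos_of_nonneg (by linarith) (by positivity)))

lemma cutoff_eq_one (hδ : 0 < δ) {t : ℝ} (ht : r - δ / 2 ≤ t) : cutoff r δ t = 1 := by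
  have h1 : 1 ≤ (t - (r - δ)) * (2 / δ) := by
    rw [mul_div_assoc', le_div_iff₀ hδ]
    linarith
  rw [cutoff, min_eq_left h1, max_eq_right zero_le_one]

open Classical in
/-- A deformation of the complex determinant of the derivative of the blow-down map which vanishes
only on the exceptional divisor. -/
def gauge (r δ : ℝ) (Φ : ∀ z, Cn n ≃L[ℝ] TangentSpace 𝓘(ℝ, Cn n) (proj B (u z)))
    (Ψ : ∀ z, Cn n ≃L[ℝ] TangentSpace 𝓘(ℝ, Cn n) (u z)) (z : ℂ) : ℂ :=
  if proj B (u z) ∈ B.ι '' Metric.ball 0 r then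
    cdet ((ballFrame Φ z).inverse.comp
      (partialAnti (ballJac Ψ z) (cutoff r δ ‖ballCoord B (u z)‖)))
  else cdet (frameJac Φ Ψ z)

/-- The quotient of `gauge` by a power of the equation of the exceptional divisor. -/
def localGauge (Φ : ∀ z, Cn n ≃L[ℝ] TangentSpace 𝓘(ℝ, Cn n) (proj B (u z)))
    (Ψ : ∀ z, Cn n ≃L[ℝ] TangentSpace 𝓘(ℝ, Cn n) (u z)) (j : Fin n) (z : ℂ) : ℂ :=
  cdet (ballFrame Φ z).inverse * cdet (affineFrame Ψ j z)

namespace IsFramedDisc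

lemma continuousWithinAt_inverse_ballFrame (hd : IsFramedDisc B Ω ρ r δ β u Φ Ψ)
    (hz : z ∈ Metric.closedBall (0 : ℂ) 1) (hp : proj B (u z) ∈ B.ι.target) :
    ContinuousWithinAt (fun z => (ballFrame Φ z).inverse) (Metric.closedBall 0 1) z :=
  continuousWithinAt_inverse (hd.continuousWithinAt_ballFrame hz hp)
    (hd.isSympl_ballFrame hz hp).isInvertible

/-- The cutoff reaches `1` already at the radius `r - δ/2`. There the deformed map is the full
derivative `frameJac`, so the two branches agree near the sphere of radius `r`. -/
lemma continuousWithinAt_gauge (hd : IsFramedDisc B Ω ρ r δ β u Φ Ψ)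
    (hz : z ∈ Metric.closedBall (0 : ℂ) 1) :
    ContinuousWithinAt (gauge r δ Φ Ψ) (Metric.closedBall 0 1) z := by
  have hδ := hd.profile.pos
  have hr := hd.le_radius
  by_cases hp : proj B (u z) ∈ B.ι '' Metric.ball 0 r
  · have hpt := ((mem_ball_image_iff hr).1 hp).1
    have h1 : ContinuousWithinAt (fun z => cutoff r δ ‖ballCoord B (u z)‖)
        (Metric.closedBall 0 1) z := by
      have h2 := (contMDiffAt_ballCoord B hpt).continuousAt.norm
      have h3 := ContinuousAt.comp_continuousWithinAt (f := u) h2 (hd.continuousWithinAt hz)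
      have h4 : Continuous (cutoff r δ) := continuous_cutoff
      exact ContinuousAt.comp_continuousWithinAt (g := cutoff r δ) h4.continuousAt h3
    have h2 : ContinuousWithinAt (fun z => partialAnti (ballJac Ψ z)
        (cutoff r δ ‖ballCoord B (u z)‖)) (Metric.closedBall 0 1) z :=
      ContinuousAt.comp_continuousWithinAt
        (g := fun p : (Cn n →L[ℝ] Cn n) × ℝ => partialAnti p.1 p.2)
        (f := fun z => (ballJac Ψ z, cutoff r δ ‖ballCoord B (u z)‖))
        continuous_partialAnti.continuousAt ((hd.continuousWithinAt_ballJac hz hpt).prodMk h1)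
    have h3 := (hd.continuousWithinAt_inverse_ballFrame hz hpt).clm_comp h2
    have h4 := ContinuousAt.comp_continuousWithinAt (g := cdet) continuous_cdet.continuousAt h3
    refine h4.congr_of_eventuallyEq ?_ (if_pos hp)
    filter_upwards [(hd.continuousWithinAt_proj hz).eventually_mem
      ((isOpen_ball_image hr).mem_nhds hp)] with y hy using if_pos hy
  · have hp' : proj B (u z) ∉ B.ι '' Metric.closedBall 0 (r - δ / 2) := fun h =>
      hp (image_mono (Metric.closedBall_subset_ball (by linarith)) h)
    refine (continuous_cdet.continuousAt.comp_continuousWithinAt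
      (hd.continuousWithinAt_frameJac hz)).congr_of_eventuallyEq ?_ (if_neg hp)
    filter_upwards [self_mem_nhdsWithin, (hd.continuousWithinAt_proj hz).eventually_mem
      ((isClosed_closedBall_image (show r - δ / 2 < B.radius by linarith)).isOpen_compl.mem_nhds
        hp')] with y hyD hy
    rw [gauge]
    split_ifs with hb
    · have h1 := (mem_ball_image_iff hr).1 hb
      have h2 : r - δ / 2 ≤ ‖ballCoord B (u y)‖ := by
        by_contra! h3
        exact hy ((mem_closedBall_image_iff (by linarith)).2 ⟨h1.1, h3.le⟩)
      rw [cutoff_eq_one hδ h2, partialAnti_one, ← hd.frameJac_eq hyD h1.1]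
      rfl
    · rfl

/-- Up to the radius `r - δ` the value is a product of two determinants, nonzero by symplecticity
and by tameness. In the collar `ballJac` is itself symplectic, because the blow-up form is there the
pullback of `Ω`, and the deformation meets no zero. Outside, `frameJac` is symplectic. -/
lemma gauge_ne_zero (hd : IsFramedDisc B Ω ρ r δ β u Φ Ψ)
    (hz : z ∈ Metric.closedBall (0 : ℂ) 1) (hc : proj B (u z) ≠ B.center) :
    gauge r δ Φ Ψ z ≠ 0 := by
  have hδ := hd.profile.pos
  have hr := hd.le_radius
  rw [gauge]
  split_ifs with hp
  · have h1 := (mem_ball_image_iff hr).1 hp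
    have hs := hd.isSympl_ballFrame hz h1.1
    rcases le_or_gt ‖ballCoord B (u z)‖ (r - δ) with h2 | h2
    · rw [cutoff_eq_zero hδ h2, cdet_comp_partialAnti_zero]
      exact mul_ne_zero hs.inverse.cdet_ne_zero (hd.cdet_ballJac_ne_zero hz hp hc)
    · refine hs.inverse.cdet_comp_partialAnti_ne_zero ?_ (cutoff_nonneg _) (cutoff_le_one _)
      rw [← ballFrame_comp_frameJac Φ Ψ h1.1]
      refine hs.comp (hd.isSympl_frameJac hz fun h3 => ?_)
      exact h2.not_ge ((mem_closedBall_image_iff (by linarith)).1 h3).2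
  · refine (hd.isSympl_frameJac hz fun h3 => hp ?_).cdet_ne_zero
    exact image_mono (Metric.closedBall_subset_ball (by linarith)) h3

/-- The cutoff vanishes near `E`, where the value is an honest product; the blow-down Jacobian then
splits off the power of the equation of `E`. -/
lemma gauge_near (hd : IsFramedDisc B Ω ρ r δ β u Φ Ψ) {j : Fin n}
    (hj : u z ∈ (affineChart B j).source) (hδ : ‖ballCoord B (u z)‖ < δ) :
    gauge r δ Φ Ψ z = affineChart B j (u z) j ^ (n - 1) * localGauge Φ Ψ j z := by
  have hδr := hd.profile.delta_lt hd.pos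
  have hδ0 := hd.profile.pos
  have hpt := (affineBlowDown_affineChart B hj).1
  rw [gauge, if_pos ((mem_ball_image_iff hd.le_radius).2
    ⟨hpt, lt_trans (show ‖ballCoord B (u z)‖ < δ from hδ) (by linarith)⟩),
    cutoff_eq_zero hδ0 (by linarith), cdet_comp_partialAnti_zero, cdet_ballJac_eq Ψ hj, localGauge]
  ring

lemma localGauge_ne_zero (hd : IsFramedDisc B Ω ρ r δ β u Φ Ψ)
    (hz : z ∈ Metric.closedBall (0 : ℂ) 1) {j : Fin n}
    (hj : u z ∈ (affineChart B j).source) (hδ : ‖ballCoord B (u z)‖ < δ) :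
    localGauge Φ Ψ j z ≠ 0 :=
  mul_ne_zero (hd.isSympl_ballFrame hz (affineBlowDown_affineChart B hj).1).inverse.cdet_ne_zero
    (hd.cdet_affineFrame_ne_zero hz hj hδ)

lemma continuousWithinAt_localGauge (hd : IsFramedDisc B Ω ρ r δ β u Φ Ψ)
    (hz : z ∈ Metric.closedBall (0 : ℂ) 1) {j : Fin n} (hj : u z ∈ (affineChart B j).source) :
    ContinuousWithinAt (localGauge Φ Ψ j) (Metric.closedBall 0 1) z :=
  (continuous_cdet.continuousAt.comp_continuousWithinAt
    (hd.continuousWithinAt_inverse_ballFrame hz (affineBlowDown_affineChart B hj).1)).mul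
  (continuous_cdet.continuousAt.comp_continuousWithinAt (hd.continuousWithinAt_affineFrame hz hj))

lemma localGauge_transition (Φ : ∀ z, Cn n ≃L[ℝ] TangentSpace 𝓘(ℝ, Cn n) (proj B (u z)))
    (Ψ : ∀ z, Cn n ≃L[ℝ] TangentSpace 𝓘(ℝ, Cn n) (u z)) {i j : Fin n}
    (hi : u z ∈ (affineChart B i).source) (hj : u z ∈ (affineChart B j).source) :
    localGauge Φ Ψ i z = hat i (affineChart B i (u z)) j ^ (n - 1) * localGauge Φ Ψ j z := by
  rw [localGauge, cdet_affineFrame_transition Ψ hi hj, localGauge]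
  ring

/-- There are smooth functions which vanish exactly where the disc meets the exceptional divisor,
to the order `n - 1`, and which on the boundary have the argument variation of the complex
determinant of the derivative of the blow-down map. -/
theorem exists_isDivisorFunction (hd : IsFramedDisc B Ω ρ r δ β u Φ Ψ)
    (hub : ∀ z ∈ Metric.sphere (0 : ℂ) 1, proj B (u z) ∉ B.ι '' Metric.ball 0 r) :
    ∃ F C, IsDivisorFunction B δ (n - 1) u F C ∧
      ∀ a, HasArgVar (fun θ => cdet (frameJac Φ Ψ (Complex.exp (θ * Complex.I)))) a →
        HasArgVar (fun θ => F (Complex.exp (θ * Complex.I))) a := by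
  set D := Metric.closedBall (0 : ℂ) 1 with hD
  -- The index `none` stands for the complement of `E`, and `some j` for the part of the chart `j`
  -- near `E`.
  let U : Option (Fin n) → Set ℂ := fun i => i.elim {z | proj B (u z) ≠ B.center}
    fun j => {z | u z ∈ (affineChart B j).source ∧ ‖ballCoord B (u z)‖ < δ}
  let c : Option (Fin n) → ℂ → ℂ := fun i => i.elim (gauge r δ Φ Ψ) fun j => localGauge Φ Ψ j
  have hU : ∀ i, ∀ z ∈ D ∩ U i, U i ∈ 𝓝[D] z := by
    rintro (_ | j) z ⟨hz, hzU⟩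
    · exact (hd.continuousWithinAt_proj hz).eventually_mem (isOpen_compl_singleton.mem_nhds hzU)
    · filter_upwards [eventually_near hd.smooth hz hzU.1 hzU.2] with y hy using hy.2
  have hcov : ∀ z ∈ D, ∃ i, z ∈ U i := by
    intro z hz
    by_cases hp : proj B (u z) = B.center
    · have hpt : proj B (u z) ∈ B.ι.target := hp ▸ center_mem_target
      obtain ⟨j, hj⟩ := exists_mem_affineChart_source B hpt
      refine ⟨some j, hj, ?_⟩
      rw [(ballCoord_eq_zero_iff B hpt).2 hp, norm_zero]
      exact hd.profile.pos
    · exact ⟨none, hp⟩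
  have hc : ∀ i, ∀ z ∈ D ∩ U i, ContinuousWithinAt (c i) D z := by
    rintro (_ | j) z ⟨hz, hzU⟩
    · exact hd.continuousWithinAt_gauge hz
    · exact hd.continuousWithinAt_localGauge hz hzU.1
  have h0 : ∀ i, ∀ z ∈ D ∩ U i, c i z ≠ 0 := by
    rintro (_ | j) z ⟨hz, hzU⟩
    · exact hd.gauge_ne_zero hz hzU
    · exact hd.localGauge_ne_zero hz hzU.1 hzU.2
  have hcoord : ∀ j, ∀ z ∈ D, z ∈ U (some j) →
      ContDiffWithinAt ℝ ∞ (fun z => affineChart B j (u z) j ^ (n - 1)) D z := by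
    intro j z hz hzU
    exact (((contDiff_piLp_apply (𝕜 := ℝ) (p := 2) (n := ∞)
      (i := j)).contDiffAt.comp_contDiffWithinAt z (contDiffWithinAt_affine hd.smooth hz hzU.1))).pow
      (n - 1)
  have hcoord0 : ∀ j, ∀ z ∈ D, z ∈ U none → z ∈ U (some j) → affineChart B j (u z) j ≠ 0 := by
    intro j z hz hz0 hzU h
    have h1 := affineBlowDown_affineChart B hzU.1
    exact ballCoord_ne_zero h1.1 hz0 (h1.2.symm.trans (affineBlowDown_eq_zero.2 h))
  -- The gauge functions themselves are only continuous, as the frames are, but their quotients are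
  -- powers of coordinates of the smooth disc, or inverses of these.
  have hs : ∀ i j, ∀ z ∈ D, z ∈ U i → z ∈ U j → ContDiffWithinAt ℝ ∞ (fun z => c j z / c i z) D z := by
    have hmem : ∀ i j, ∀ z ∈ D, z ∈ U i → z ∈ U j →
        ∀ᶠ y in 𝓝[D] z, y ∈ D ∧ y ∈ U i ∧ y ∈ U j := by
      intro i j z hz hi hj
      filter_upwards [self_mem_nhdsWithin, hU i z ⟨hz, hi⟩, hU j z ⟨hz, hj⟩] with y h1 h2 h3
        using ⟨h1, h2, h3⟩
    have hcongr : ∀ i j (g : ℂ → ℂ), ∀ z ∈ D, z ∈ U i → z ∈ U j → ContDiffWithinAt ℝ ∞ g D z →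
        (∀ y ∈ D, y ∈ U i → y ∈ U j → c j y = g y * c i y) →
        ContDiffWithinAt ℝ ∞ (fun z => c j z / c i z) D z := by
      intro i j g z hz hi hj hg h
      refine hg.congr_of_eventuallyEq ?_ ?_
      · filter_upwards [hmem i j z hz hi hj] with y hy
        rw [h y hy.1 hy.2.1 hy.2.2, mul_div_cancel_right₀ _ (h0 i y ⟨hy.1, hy.2.1⟩)]
      · rw [h z hz hi hj, mul_div_cancel_right₀ _ (h0 i z ⟨hz, hi⟩)]
    rintro (_ | i) (_ | j) z hz hi hj
    · exact hcongr _ _ (fun _ => 1) z hz hi hj contDiffWithinAt_const fun y _ _ _ => (one_mul _).symm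
    · refine hcongr _ _ _ z hz hi hj ((hcoord j z hz hj).inv
        (pow_ne_zero _ (hcoord0 j z hz hi hj))) fun y hy hyi hyj => ?_
      change localGauge Φ Ψ j y = (affineChart B j (u y) j ^ (n - 1))⁻¹ * gauge r δ Φ Ψ y
      rw [hd.gauge_near hyj.1 hyj.2, ← mul_assoc,
        inv_mul_cancel₀ (pow_ne_zero _ (hcoord0 j y hy hyi hyj)), one_mul]
    · exact hcongr _ _ _ z hz hi hj (hcoord i z hz hi) fun y hy hyi hyj =>
        hd.gauge_near hyi.1 hyi.2
    · have hq : ContDiffWithinAt ℝ ∞ (fun z => hat j (affineChart B j (u z)) i ^ (n - 1)) D z :=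
        ((contDiff_piLp_apply (𝕜 := ℝ) (p := 2) (n := ∞)
          (i := i)).contDiffAt.comp_contDiffWithinAt z (contDiffWithinAt_hat hd.smooth hz hj.1)).pow
          (n - 1)
      exact hcongr _ _ _ z hz hi hj hq fun y hy hyi hyj =>
        localGauge_transition Φ Ψ hyj.1 hyi.1
  obtain ⟨κ, hκ, hκs⟩ := exists_smoothing_factor (isCompact_closedBall _ _) hU hcov hc h0 hs
  have hκ0 : ∀ z ∈ D, κ z ≠ 0 := fun z hz h => by
    have := hκ z hz
    simp [h] at this
  have hdiv : IsDivisorFunction B δ (n - 1) u (fun z => κ z * gauge r δ Φ Ψ z)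
      (fun j z => κ z * localGauge Φ Ψ j z) :=
    { smooth := fun z hz hp => hκs none z ⟨hz, hp⟩
      ne_zero := fun z hz hp => mul_ne_zero (hκ0 z hz) (hd.gauge_ne_zero hz hp)
      local_smooth := fun z hz j hj hδ => hκs (some j) z ⟨hz, hj, hδ⟩
      local_ne_zero := fun z hz j hj hδ => mul_ne_zero (hκ0 z hz) (hd.localGauge_ne_zero hz hj hδ)
      eq_pow_mul := fun z hz j hj hδ => by
        rw [hd.gauge_near hj hδ]; ring
      transition := fun z hz i j hi hj hδ => by
        rw [localGauge_transition Φ Ψ hi hj]; ring }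
  refine ⟨_, _, hdiv, fun a ha => ?_⟩
  have hcirc : Continuous fun θ : ℝ => Complex.exp (θ * Complex.I) := by fun_prop
  have hcont : ∀ {Y : Type} [TopologicalSpace Y] {f : ℂ → Y},
      (∀ z ∈ Metric.sphere (0 : ℂ) 1, ContinuousWithinAt f D z) →
      Continuous fun θ : ℝ => f (Complex.exp (θ * Complex.I)) := fun hf =>
    continuous_iff_continuousAt.2 fun θ => (hf _ (exp_mem_sphere θ)).tendsto.comp
      (tendsto_nhdsWithin_iff.2 ⟨hcirc.continuousAt, Eventually.of_forall exp_mem_closedBall⟩)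
  have hcenter : ∀ z ∈ Metric.sphere (0 : ℂ) 1, proj B (u z) ≠ B.center := by
    intro z hz hcz
    exact hub z hz ⟨0, by simpa using hd.pos.trans hd.profile.lt, hcz.symm⟩
  have hg : ∀ z ∈ Metric.sphere (0 : ℂ) 1, gauge r δ Φ Ψ z = cdet (frameJac Φ Ψ z) :=
    fun z hz => if_neg (hub z hz)
  have hne : ∀ θ : ℝ, cdet (frameJac Φ Ψ (Complex.exp (θ * Complex.I))) ≠ 0 := fun θ => by
    rw [← hg _ (exp_mem_sphere θ)]
    exact hd.gauge_ne_zero (exp_mem_closedBall θ) (hcenter _ (exp_mem_sphere θ))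
  have hper : Complex.exp ((2 * Real.pi : ℝ) * Complex.I) = Complex.exp ((0 : ℝ) * Complex.I) := by
    simp
  refine ha.of_re_div_pos
    (hcont (f := fun z => cdet (frameJac Φ Ψ z)) fun z hz =>
      continuous_cdet.continuousAt.comp_continuousWithinAt
        (hd.continuousWithinAt_frameJac (Metric.sphere_subset_closedBall hz)))
    (hcont (f := fun z => κ z * gauge r δ Φ Ψ z) fun z hz =>
      (hdiv.smooth z (Metric.sphere_subset_closedBall hz) (hcenter z hz)).continuousWithinAt)
    hne (fun θ => ?_) (by simp only [hper]) (by simp only [hper])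
  rw [hg _ (exp_mem_sphere θ), mul_div_cancel_right₀ _ (hne θ)]
  exact hκ _ (exp_mem_closedBall θ)

end IsFramedDisc

end BlowUp

/-! ### Comparison of index and area, and the conclusion. -/

namespace BlowUp

variable {n : ℕ} {M : Type*} [TopologicalSpace M] [ChartedSpace (Cn n) M] {B : SmoothBall n M}
  [NeZero n] [T2Space M] [IsManifold 𝓘(ℝ, Cn n) ∞ M] {Ω : TwoForm n M} {ρ r δ : ℝ} {β : ℝ → ℝ}

/-- The change of the Maslov index and of the symplectic area under the blow-down map. -/
theorem maslovIndex_and_area_proper (hn : 2 ≤ n) (hΩ : IsSymplecticForm Ω)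
    (hB : B.IsSymplectic Ω) (h : IsProfile ρ r δ β) (hρ : 0 < ρ) (hr : r ≤ B.radius) {L : Set M}
    (hL : IsLagrangian Ω L) (hLB : Disjoint L (B.ι '' Metric.ball 0 r)) {u : ℂ → BlowUp B}
    (hu : IsSmoothDisc n (proj B ⁻¹' L) u) :
    ∃ a : ℝ,
      Real.pi * maslovIndex (form B Ω ρ r β) (proj B ⁻¹' L) u =
        Real.pi * maslovIndex Ω L (fun z => proj B (u z)) - a ∧
      symplecticArea (form B Ω ρ r β) u =
        symplecticArea Ω (fun z => proj B (u z)) - ρ ^ 2 / (2 * ((n : ℝ) - 1)) * a := by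
  have hΩ' := isSymplecticForm_form hΩ hB h hρ hr
  have hL' := isLagrangian_proper hL h hρ hr hLB
  have huc := hu.smooth.continuousOn
  have hvc : ContinuousOn (fun z => proj B (u z)) (Metric.closedBall 0 1) :=
    (contMDiff_proj B).continuous.comp_continuousOn huc
  have hub : ∀ z ∈ Metric.sphere (0 : ℂ) 1, proj B (u z) ∉ B.ι '' Metric.ball 0 r :=
    fun z hz hz' => disjoint_left.1 hLB (hu.boundary z hz) hz'
  have hc : B.center ∉ L := fun hc =>
    disjoint_left.1 hLB hc ⟨0, by simpa using hρ.trans h.lt, rfl⟩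
  obtain ⟨Φ, hΦ⟩ := exists_isSymplecticFrameOn_disc hΩ hvc
  obtain ⟨Ψ, hΨ⟩ := exists_isSymplecticFrameOn_disc hΩ' huc
  have hd : IsFramedDisc B Ω ρ r δ β u Φ Ψ := ⟨hB, h, hρ, hr, hu.smooth, hΦ, hΨ⟩
  obtain ⟨F, C, hF, hFa⟩ := hd.exists_isDivisorFunction hub
  set A : ℝ → Cn n →L[ℝ] Cn n := fun θ => frameJac Φ Ψ (Complex.exp (θ * Complex.I)) with hA
  have hcirc : Continuous fun θ : ℝ => Complex.exp (θ * Complex.I) := by fun_prop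
  have hAc : Continuous A := continuous_iff_continuousAt.2 fun θ =>
    (hd.continuousWithinAt_frameJac (exp_mem_closedBall θ)).tendsto.comp
      (tendsto_nhdsWithin_iff.2 ⟨hcirc.continuousAt, Eventually.of_forall exp_mem_closedBall⟩)
  -- The boundary of the disc stays outside the ball, where the blow-up form is `π^*Ω`.
  have hAs : ∀ θ, IsSympl (A θ) := fun θ =>
    hd.isSympl_frameJac (exp_mem_closedBall θ) fun h3 => hub _ (exp_mem_sphere θ)
      (image_mono (Metric.closedBall_subset_ball (by linarith [h.pos])) h3)
  obtain ⟨a, ha⟩ := exists_hasArgVar (continuous_cdet.comp hAc) fun θ => (hAs θ).cdet_ne_zero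
  obtain ⟨φ, k, hφ, hφk, hk⟩ := exists_hasMaslovIndex_of_frame hL' huc hu.boundary hΨ
  obtain ⟨φ', k', hφ', hφk', hk'⟩ := exists_hasMaslovIndex_of_frame hL hvc hu.boundary hΦ
  have hcmp := (isLagrangianLoop_boundaryLoop hL' huc hu.boundary hΨ).phase_comparison hAc hAs
    (by simp [hA]) (Λ' := boundaryLoop L (fun z => proj B (u z)) Φ) (fun θ v hv => by
      have h1 := (mem_tangentVectors_proper hL hc (hu.boundary _ (exp_mem_sphere θ)) _).1 hv
      have h2 : Φ (Complex.exp (θ * Complex.I)) (A θ v) = mfderiv 𝓘(ℝ, Cn n) 𝓘(ℝ, Cn n) (proj B)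
          (u (Complex.exp (θ * Complex.I))) (Ψ (Complex.exp (θ * Complex.I)) v) :=
        (Φ (Complex.exp (θ * Complex.I))).apply_symm_apply _
      change Φ (Complex.exp (θ * Complex.I)) (A θ v) ∈ tangentVectors n L _
      rw [h2]
      exact h1) hφ hφ' ha
  refine ⟨a, ?_, ?_⟩
  · rw [hk.maslovIndex_eq hL' huc hu.boundary, hk'.maslovIndex_eq hL hvc hu.boundary]
    rw [hφk, hφk'] at hcmp
    -- The phases give `2πk' = 2πk + 2a`.
    linarith
  · refine symplecticArea_form hΩ hB h hρ hr hF ?_ hu.smooth hub (hFa a ha)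
    have hn' : (2 : ℝ) ≤ n := by exact_mod_cast hn
    have hn1 : (n : ℝ) - 1 ≠ 0 := by linarith
    -- The coefficient `e = ρ²/(2(n-1))` is the one with `e (n-1) = ρ²/2` for the vanishing order `n
    -- - 1`; here `n ≥ 2` is needed.
    rw [Nat.cast_sub (by omega), Nat.cast_one]
    field_simp

theorem isMonotone_proper (hn : 2 ≤ n) (hΩ : IsSymplecticForm Ω)
    (hB : B.IsSymplectic Ω) (h : IsProfile ρ r δ β) (hρ : 0 < ρ) (hr : r ≤ B.radius) {L : Set M}
    {lam : ℝ} (hL : IsMonotoneLagrangian Ω L lam)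
    (hweight : ρ ^ 2 = 2 * ((n : ℝ) - 1) / (lam * Real.pi))
    (hLB : Disjoint L (B.ι '' Metric.ball 0 r)) :
    IsMonotone (form B Ω ρ r β) (proj B ⁻¹' L) lam := by
  obtain ⟨hLag, hlam, hmon⟩ := hL
  refine ⟨hlam, fun u hu => ?_⟩
  obtain ⟨a, h1, h2⟩ := maslovIndex_and_area_proper hn hΩ hB h hρ hr hLag hLB hu
  have h3 := hmon (fun z => proj B (u z))
    ⟨(contMDiff_proj B).comp_contMDiffOn hu.smooth, hu.boundary⟩
  have hpi := Real.pi_pos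
  have hn' : (2 : ℝ) ≤ n := by exact_mod_cast hn
  have hn1 : (n : ℝ) - 1 ≠ 0 := by linarith
  rw [h3] at h1
  refine mul_left_cancel₀ hpi.ne' (h1.trans ?_)
  -- By the choice of `ρ` one has `λρ²/(2(n-1)) = 1/π`, so the corrections of the index and of `λ`
  -- times the area coincide.
  rw [h2, hweight]
  field_simp

/-- A closed set which is disjoint from a closed ball is disjoint from a larger open ball. -/
lemma exists_disjoint_ball {L : Set M} (hL : IsClosed L) (B : SmoothBall n M)
    (hρ : 0 ≤ ρ) (hρB : ρ < B.radius) (havoid : Disjoint L (B.ι '' Metric.closedBall 0 ρ)) :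
    ∃ r, ρ < r ∧ r ≤ B.radius ∧ Disjoint L (B.ι '' Metric.ball 0 r) := by
  have ho : IsOpen (B.ι.source ∩ B.ι ⁻¹' Lᶜ) := B.ι.isOpen_inter_preimage hL.isOpen_compl
  have hK : Metric.closedBall 0 ρ ⊆ B.ι.source ∩ B.ι ⁻¹' Lᶜ := fun z hz =>
    ⟨by rw [B.source_eq]; exact Metric.closedBall_subset_ball hρB hz,
      fun hzL => disjoint_left.1 havoid hzL ⟨z, hz, rfl⟩⟩
  -- The closed ball is compact and lies in the open preimage of the complement of `L`, hence so
  -- does a neighbourhood of it of some uniform width.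
  obtain ⟨ε, hε, hε'⟩ := (isCompact_closedBall (0 : Cn n) ρ).exists_thickening_subset_open ho hK
  rw [thickening_closedBall hε hρ] at hε'
  refine ⟨min B.radius (ε + ρ), lt_min hρB (by linarith), min_le_left _ _,
    disjoint_left.2 ?_⟩
  rintro _ hx ⟨z, hz, rfl⟩
  exact (hε' (Metric.ball_subset_ball (min_le_right _ _) hz)).2 hx

end BlowUp

theorem lemmal {n : ℕ} [NeZero n] (hn : 2 ≤ n)
    {M : Type*} [TopologicalSpace M] [T2Space M] [SecondCountableTopology M]
    [ChartedSpace (Cn n) M] [IsManifold 𝓘(ℝ, Cn n) ∞ M]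
    (Ω : TwoForm n M) (hΩ : IsSymplecticForm Ω)
    (L : Set M) (lam : ℝ) (hL : IsMonotoneLagrangian Ω L lam)
    (ρ : ℝ) (hρ : 0 < ρ) (hweight : ρ ^ 2 = 2 * ((n : ℝ) - 1) / (lam * Real.pi))
    (B : SmoothBall n M) (hB : B.IsSymplectic Ω) (hρB : ρ < B.radius)
    (havoid : Disjoint L (B.ι '' Metric.closedBall 0 ρ)) :
    (∃ r, ρ < r ∧ r ≤ B.radius ∧ Disjoint L (B.ι '' Metric.ball 0 r)) ∧
    ∀ (r δ : ℝ) (β : ℝ → ℝ), r ≤ B.radius → Disjoint L (B.ι '' Metric.ball 0 r) →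
      BlowUp.IsProfile ρ r δ β →
      IsSymplecticForm (BlowUp.form B Ω ρ r β) ∧
      IsMonotoneLagrangian (BlowUp.form B Ω ρ r β) (BlowUp.proj B ⁻¹' L) lam :=
  ⟨BlowUp.exists_disjoint_ball hL.1.isClosed B hρ.le hρB havoid, fun _ _ _ hr hLB h =>
    ⟨BlowUp.isSymplecticForm_form hΩ hB h hρ hr, BlowUp.isLagrangian_proper hL.1 h hρ hr hLB,
      BlowUp.isMonotone_proper hn hΩ hB h hρ hr hL hweight hLB⟩⟩
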